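/- Let $\Omega\subset\mathbb R^3$ be a contractible polyhedral domain with a (finite, simplicial) triangulation $\mathcal T$ with sets of vertices $\mathsf V$, edges $\mathsf E$, faces $\mathsf F$ and tetrahedra $\mathsf K$, and let $k\ge 7$. Fix an orthonormal frame $(t,n_1,n_2)$ with $t$ tangential on each edge $e$ and an orthonormal frame $(t_1,t_2,n)$ with $n$ normal on each face $f$. Put $\mathbf e_0(x)=x$, let $\mathbf e_1,\mathbf e_2,\mathbf e_3$ be the constant unit coordinate fields, and $RT=\operatorname{span}\{\mathbf e_0,\dots,\mathbf e_3\}=\{a+bx\}$. Let $\mathbb S,\mathbb T$ be the symmetric and the traceless $3\times3$ matrices; $\operatorname{curl}$, $\operatorname{div}$, $\operatorname{rot}_f$ act by rows. Write $(\cdot,\cdot)_s$ for the $L^2$ inner product on a simplex $s$, $A/B=\{u\in A:(u,v)_s=0\ \forall v\in B\}$, $\mathcal P_W$ for the $L^2$ projection to $W$, $\lambda_i$ for the barycentric coordinates, $P_d$ for the polynomials of degree $\le d$ ($P_d=0$ for $d<0$), $b_e,b_f,b_K$ for the product of all barycentric coordinates of $e,f,K$. On a face, $E_f v=(v\cdot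 t_1,v\cdot t_2)$, $\mathbb E_f\sigma=(t_a^T\sigma t_b)_{a,b}$, $\nabla_f=(\partial_{t_1},\partial_{t_2})$, $\operatorname{hess}_f=\nabla_f^2$, $\operatorname{rot}_f v=-\partial_{t_1}v_2+\partial_{t_2}v_1$, and $RT(f)=E_f(RT)|_f$. Let $P_d^{(0)}(s)$ be the elements of $P_d(s)$ vanishing at the vertices of $s$, and $P^{(1)}_d(f)$ those vanishing there together with their face gradient. For $K$ with vertices $x_i$ and unit normals $n_i$ of the opposite faces let $$B_K^{\operatorname{curl}}=\sum_i\Big(\prod_{j\ne i}\lambda_j\Big)P^{(0)}_{k-3}(K)\,n_in_i^T+b_KP_{k-4}(K;\mathbb S),\qquad B_K^{\operatorname{div}}=\sum_i\sum_{j<l;\ j,l\neq i}\lambda_j\lambda_l\{p\in P_{k-3}(K):p(x_j)=p(x_l)=0\}\,n_i(x_l-x_j)^T .$$ Consider the following finite element spaces of piecewise polynomials on $\mathcal T$ and their degrees of freedom on each $K\in\mathsf K$ (for all vertices $x$, edges $e$, faces $f$ of $K$ and all $j,j'\in\{1,2\}$). * $U_h=\{u\in C^1(\Omega):u|_K\in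 P_{k+2}$, $u$ is $C^4$ at vertices and $C^2$ on edges$\}$: (4a) $u(x),\partial_1u(x),\partial_2u(x),\partial_3u(x)$; (4b) $D^\alpha u(x)$, $2\le|\alpha|\le4$; (4c) $(\partial_t^2u,\partial_t^2p)_e$, $p\in b_e^5P_{k-8}$; (4d) $(\partial_{n_j}\partial_tu,\partial_tp)_e$, $p\in b_e^4P_{k-7}$; (4e) $(\partial_{n_j}\partial_{n_{j'}}u,p)_e$, $p\in b_e^3P_{k-6}$; (4f) $(\operatorname{hess}_fu,\operatorname{hess}_fp)_f$, $p\in b_f^3P_{k-7}$; (4g) $(\nabla_f\partial_nu,\nabla_fp)_f$, $p\in b_f^2P_{k-5}$; (4h) $(\operatorname{hess}u,\operatorname{hess}p)_K$, $p\in b_K^2P_{k-6}$. * $\Sigma_h=\{\sigma\in H(\operatorname{curl},\Omega;\mathbb S):\sigma|_K\in P_k(K;\mathbb S)$, $\sigma$ is $C^2$ at vertices and $C^0$ on edges$\}$: (5a) $(\sigma t,\mathbf e_i)_e$, $i=0,\dots,3$; (5b) $D^\alpha\sigma(x)$, $|\alpha|\le2$; (5c) $(t^T\sigma t,p)_e$,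 $p\in b_e^3P_{k-6}/P_1$; (5d) $(n_j^T\sigma t,p)_e$, $p\in b_e^3P_{k-6}/P_0$; (5e) $(n_j^T\sigma n_{j'},p)_e$, $p\in b_e^3P_{k-6}$; (5f) $(\mathcal P_W\mathbb E_f\sigma,\mathcal P_W\eta)_f+(\operatorname{rot}_f\mathbb E_f\sigma,\operatorname{rot}_f\eta)_f$ with $W=\operatorname{hess}_f(b_f^3P_{k-7})$, for symmetric $\eta$ with entries in $b_fP^{(0)}_{k-3}(f)$; (5g) $(\mathcal P_WE_f(\sigma n),\mathcal P_Ww)_f+(\operatorname{rot}_fE_f(\sigma n),\operatorname{rot}_fw)_f$ with $W=\nabla_f(b_f^2P_{k-5})$, for $w\in b_fP^{(0)}_{k-3}(f;\mathbb R^2)$; (5h) $(\mathcal P_W\sigma,\mathcal P_W\eta)_K+(\operatorname{curl}\sigma,\operatorname{curl}\eta)_K$ with $W=\operatorname{hess}(b_K^2P_{k-6})$, for $\eta\in B_K^{\operatorname{curl}}$. * $V_h=\{v\in H(\operatorname{div},\Omega;\mathbb T):v|_K\in P_{k-1}(K;\mathbb T)$, $v$ is $C^1$ at vertices$\}$: (6a)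 $(vn,\mathbf e_i)_f$, $i=0,\dots,3$; (6b) $D^\alpha v(x)$, $|\alpha|\le1$; (6c) $(E_f(vn),w)_f$, $w\in P^{(1)}_{k-1}(f;\mathbb R^2)/RT(f)$; (6d) $(n^Tvn,p)_f$, $p\in P^{(1)}_{k-1}(f)/\mathbb R$; (6e) $(\mathcal P_Wv,\mathcal P_W\eta)_K+(\operatorname{div}v,\operatorname{div}\eta)_K$ with $W=\operatorname{curl}B_K^{\operatorname{curl}}$, for $\eta\in B_K^{\operatorname{div}}$. * $Q_h=\{q\in L^2(\Omega;\mathbb R^3):q|_K\in P_{k-2}(K;\mathbb R^3)$, $q$ is $C^0$ at vertices$\}$: (7a) $(q,\mathbf e_i)_K$, $i=0,\dots,3$; (7b) $q(x)$; (7c) $(q,w)_K$, $w\in P^{(0)}_{k-2}(K;\mathbb R^3)/RT$. Let $\tilde\varphi_{x,j}\in U_h$, $\varphi_{e,j}\in\Sigma_h$, $\varphi_{f,j}\in V_h$, $\varphi_{K,j}\in Q_h$ ($x\in\mathsf V$, $e\in\mathsf E$, $f\in\mathsf F$, $K\in\mathsf K$, $j=0,\dots,3$) be the basis functions dual to the first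 sets (4a), (5a), (6a), (7a): the $j$-th degree of freedom of the first set at the given simplex is $1$, and all other degrees of freedom (of the first set and of the remaining sets) are $0$. Then the sequence $$P_1\xrightarrow{\ \subset\ }\operatorname{span}_{x,j}\{\tilde\varphi_{x,j}\}\xrightarrow{\operatorname{hess}}\operatorname{span}_{e,j}\{\varphi_{e,j}\}\xrightarrow{\operatorname{curl}}\operatorname{span}_{f,j}\{\varphi_{f,j}\}\xrightarrow{\operatorname{div}}\operatorname{span}_{K,j}\{\varphi_{K,j}\}\to0$$ is a complex: each map sends its space into the next one (in particular $P_1$ is contained in the first span), and the composition of two successive maps is zero. -/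

import Mathlib

open MeasureTheory

namespace GradGrad

/-! ## Euclidean space, polynomials, differential operators -/

/-- Three-dimensional Euclidean space. -/
abbrev E3 : Type := EuclideanSpace ℝ (Fin 3)

/-- Real polynomials in the coordinates `x₁, x₂, x₃`. -/
abbrev Poly : Type := MvPolynomial (Fin 3) ℝ

/-- Value of a polynomial at a point. -/
noncomputable def ev (p : Poly) (x : E3) : ℝ := MvPolynomial.eval (fun i => x i) p

/-- `p` has total degree at most `d`. The bound is an integer: for `d < 0` only `p = 0` qualifies. -/
def Deg (d : ℤ) (p : Poly) : Prop := ∀ m ∈ p.support, (m.degree : ℤ) ≤ d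

/-- The partial derivative `∂ᵢ`. -/
noncomputable def pd (i : Fin 3) (p : Poly) : Poly := MvPolynomial.pderiv i p

/-- The derivative `D^α` for a multi-index `α`. -/
noncomputable def dAlpha (α : Fin 3 → ℕ) (p : Poly) : Poly :=
  (pd 0)^[α 0] ((pd 1)^[α 1] ((pd 2)^[α 2] p))

/-- The derivative `∂/∂v` along the constant vector `v`. -/
noncomputable def dir (v : E3) (p : Poly) : Poly := ∑ i, MvPolynomial.C (v i) * pd i p

/-- The Hessian of a scalar polynomial. -/
noncomputable def hess (u : Poly) : Matrix (Fin 3) (Fin 3) Poly :=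
  Matrix.of fun i j => pd i (pd j u)

/-- The curl of a matrix field, taken row by row (indices modulo 3). -/
noncomputable def curl (σ : Matrix (Fin 3) (Fin 3) Poly) : Matrix (Fin 3) (Fin 3) Poly :=
  Matrix.of fun i l => pd (l + 1) (σ i (l + 2)) - pd (l + 2) (σ i (l + 1))

/-- The divergence of a matrix field, taken row by row. -/
noncomputable def div (v : Matrix (Fin 3) (Fin 3) Poly) : Fin 3 → Poly :=
  fun i => ∑ j, pd j (v i j)

/-- A constant vector as a polynomial vector field. -/
noncomputable def cvec (v : E3) : Fin 3 → Poly := fun i => MvPolynomial.C (v i)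

/-- The constant matrix `a bᵀ` as a polynomial matrix field. -/
noncomputable def cdyad (a b : E3) : Matrix (Fin 3) (Fin 3) Poly :=
  Matrix.vecMulVec (cvec a) (cvec b)

/-- The polynomial function `aᵀ σ b`, for constant vectors `a`, `b`. -/
noncomputable def comp (a : E3) (σ : Matrix (Fin 3) (Fin 3) Poly) (b : E3) : Poly :=
  ∑ i, ∑ j, MvPolynomial.C (a i) * σ i j * MvPolynomial.C (b j)

/-- The polynomial of degree at most one that represents an affine function. -/
noncomputable def affPoly (f : E3 →ᵃ[ℝ] ℝ) : Poly :=
  MvPolynomial.C (f 0) +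
    ∑ i, MvPolynomial.C (f.linear (EuclideanSpace.single i 1)) * MvPolynomial.X i

/-- `affPoly f` has the values of `f`. -/
theorem ev_affPoly (f : E3 →ᵃ[ℝ] ℝ) (x : E3) : ev (affPoly f) x = f x := by
  have hx : x = ∑ i, x i • EuclideanSpace.single i (1 : ℝ) := by
    ext j
    simp [Fin.sum_univ_three]
    fin_cases j <;> simp
  have h1 : f x = f.linear x + f 0 := by
    have := f.map_vadd 0 x
    simpa using this
  rw [h1]
  conv_rhs => rw [hx]
  simp only [ev, affPoly, map_add, MvPolynomial.eval_C, map_sum, map_mul, MvPolynomial.eval_X,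
    map_smul, smul_eq_mul]
  rw [add_comm]
  congr 1
  exact Finset.sum_congr rfl fun i _ => mul_comm _ _

/-! ## `L²` inner products on simplices

A simplex is given by the finite set `s` of its vertices; integrals over it are taken with respect
to length, area or volume, that is, the Euclidean Hausdorff measure of dimension `#s - 1`. -/

/-- `(p, q)_s` for scalar functions. -/
noncomputable def ipS (s : Finset E3) (p q : Poly) : ℝ :=
  ∫ x in convexHull ℝ (s : Set E3), ev p x * ev q x ∂(Measure.euclideanHausdorffMeasure (s.card - 1))

/-- `(v, w)_s` for vector-valued functions. -/
noncomputable def ipV {ι : Type} [Fintype ι] (s : Finset E3) (v w : ι → Poly) : ℝ :=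
  ∑ i, ipS s (v i) (w i)

/-- `(σ, τ)_s` for matrix-valued functions. -/
noncomputable def ipM {ι : Type} [Fintype ι] (s : Finset E3) (σ τ : Matrix ι ι Poly) : ℝ :=
  ∑ i, ∑ j, ipS s (σ i j) (τ i j)

/-- `w` is an orthogonal projection of `u` to `W` for the bilinear form `ip`. -/
def IsProj {V : Type} [AddCommGroup V] (ip : V → V → ℝ) (W : Set V) (u w : V) : Prop :=
  w ∈ W ∧ ∀ z ∈ W, ip (u - w) z = 0

open Classical in
/-- The orthogonal projection of `u` to `W` for the bilinear form `ip`. (It exists in all uses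
below, where `W` is a finite-dimensional linear space of polynomial functions on a simplex and `ip`
is the `L²` inner product there, and it is unique as a function on that simplex.) -/
noncomputable def proj {V : Type} [AddCommGroup V] (ip : V → V → ℝ) (W : Set V) (u : V) : V :=
  if h : ∃ w, IsProj ip W u w then h.choose else 0

/-! ## Meshes -/

/-- `T` is a (finite, simplicial) triangulation of the polyhedral domain `Ω`. -/
structure IsTriangulation (Ω : Set E3) (T : Geometry.SimplicialComplex ℝ E3) : Prop where
  finite : T.faces.Finite
  pure : ∀ s ∈ T.faces, ∃ K ∈ T.faces, s ⊆ K ∧ K.card = 4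
  domain : Ω = interior T.space

variable {T : Geometry.SimplicialComplex ℝ E3}

/-- The vertices of the mesh. -/
abbrev Vertex (T : Geometry.SimplicialComplex ℝ E3) : Type := {x : E3 // x ∈ T.vertices}

/-- The edges of the mesh, as sets of two vertices. -/
abbrev Edge (T : Geometry.SimplicialComplex ℝ E3) : Type :=
  {s : Finset E3 // s ∈ T.faces ∧ s.card = 2}

/-- The two-dimensional faces of the mesh, as sets of three vertices. -/
abbrev Face (T : Geometry.SimplicialComplex ℝ E3) : Type :=
  {s : Finset E3 // s ∈ T.faces ∧ s.card = 3}

/-- The tetrahedra of the mesh, as sets of four vertices. -/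
abbrev Cell (T : Geometry.SimplicialComplex ℝ E3) : Type :=
  {s : Finset E3 // s ∈ T.faces ∧ s.card = 4}

/-- The four vertices of a tetrahedron as an affine basis. -/
noncomputable def Cell.affineBasis (K : Cell T) : AffineBasis K.1 ℝ E3 where
  toFun := fun v => v.1
  ind' := T.indep K.2.1
  tot' := by
    rw [(T.indep K.2.1).affineSpan_eq_top_iff_card_eq_finrank_add_one]
    simp [K.2.2]

/-- The barycentric coordinate of the tetrahedron `K` with respect to its vertex `v`. On an edge or
a face of `K` which contains `v`, it restricts to the barycentric coordinate of that edge or face. -/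
noncomputable def lam (K : Cell T) (v : K.1) : Poly := affPoly (K.affineBasis.coord v)

open Classical in
/-- The product of the barycentric coordinates of `K` that belong to the vertices in `s`. -/
noncomputable def bub (K : Cell T) (s : Finset E3) : Poly :=
  ∏ v : K.1, if v.1 ∈ s then lam K v else 1

open Classical in
/-- The face of `K` opposite to the vertex `v`. -/
noncomputable def opp (K : Cell T) (v : K.1) : Face T :=
  ⟨K.1.erase v.1, by
    have hc : (K.1.erase v.1).card = 3 := by
      rw [Finset.card_erase_of_mem v.2, K.2.2]
    exact ⟨T.down_closed K.2.1 (Finset.erase_subset _ _)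
      (Finset.card_pos.mp (by rw [hc]; norm_num)), hc⟩⟩

/-- A choice of an orthonormal frame `(t, n₁, n₂)` on each edge, with `t` tangential, and of an
orthonormal frame `(t₁, t₂, n)` on each face, with `n` normal to the face. -/
structure Frame (T : Geometry.SimplicialComplex ℝ E3) where
  edge : Edge T → OrthonormalBasis (Fin 3) ℝ E3
  edge_tangent : ∀ e : Edge T, ∀ a ∈ e.1, ∀ b ∈ e.1, ∃ c : ℝ, b - a = c • edge e 0
  face : Face T → OrthonormalBasis (Fin 3) ℝ E3
  face_normal : ∀ f : Face T, ∀ a ∈ f.1, ∀ b ∈ f.1, inner ℝ (face f 2) (b - a) = 0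

/-- The unit tangential vector `t` of an edge. -/
noncomputable def Frame.te (F : Frame T) (e : Edge T) : E3 := F.edge e 0

/-- The unit normal vectors `n₁`, `n₂` of an edge. -/
noncomputable def Frame.ne (F : Frame T) (e : Edge T) (j : Fin 2) : E3 := F.edge e j.succ

/-- The unit tangential vectors `t₁`, `t₂` of a face. -/
noncomputable def Frame.tf (F : Frame T) (f : Face T) (j : Fin 2) : E3 := F.face f j.castSucc

/-- The unit normal vector `n` of a face. -/
noncomputable def Frame.nf (F : Frame T) (f : Face T) : E3 := F.face f 2

/-! ## Operators on faces -/

/-- `E_f v`, the tangential components of a vector field. -/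
noncomputable def tanV (F : Frame T) (f : Face T) (v : Fin 3 → Poly) : Fin 2 → Poly :=
  fun a => ∑ i, MvPolynomial.C (F.tf f a i) * v i

/-- `𝔼_f σ`, the tangential-tangential components of a matrix field. -/
noncomputable def tanM (F : Frame T) (f : Face T) (σ : Matrix (Fin 3) (Fin 3) Poly) :
    Matrix (Fin 2) (Fin 2) Poly :=
  Matrix.of fun a b => comp (F.tf f a) σ (F.tf f b)

/-- The face gradient. -/
noncomputable def gradF (F : Frame T) (f : Face T) (p : Poly) : Fin 2 → Poly :=
  fun a => dir (F.tf f a) p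

/-- The face Hessian. -/
noncomputable def hessF (F : Frame T) (f : Face T) (p : Poly) : Matrix (Fin 2) (Fin 2) Poly :=
  Matrix.of fun a b => dir (F.tf f a) (dir (F.tf f b) p)

/-- `rot_f v = - ∂v₂/∂t₁ + ∂v₁/∂t₂`. -/
noncomputable def rotF (F : Frame T) (f : Face T) (v : Fin 2 → Poly) : Poly :=
  - dir (F.tf f 0) (v 1) + dir (F.tf f 1) (v 0)

/-- `rot_f` of a matrix field, taken row by row. -/
noncomputable def rotFM (F : Frame T) (f : Face T) (σ : Matrix (Fin 2) (Fin 2) Poly) :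
    Fin 2 → Poly :=
  fun a => rotF F f (σ a)

/-! ## Auxiliary polynomial spaces

Functions on an edge or a face of the tetrahedron `K` are represented by polynomials on `ℝ³`; only
their restrictions to the edge or the face and the tangential derivatives there are ever used. -/

/-- The field `x ↦ x`, followed by the constant fields `e₁, e₂, e₃`: a basis of `RT(K)`. -/
noncomputable def rtBasis : Fin 4 → Fin 3 → Poly :=
  Fin.cons (fun i => MvPolynomial.X i) fun j => cvec (EuclideanSpace.single j 1)

/-- `RT(K) = {a + b x : a ∈ ℝ³, b ∈ ℝ}`. -/
def RT : Set (Fin 3 → Poly) :=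
  {w | ∃ (a : E3) (b : ℝ), w = fun i => MvPolynomial.C (a i) + MvPolynomial.C b * MvPolynomial.X i}

/-- `RT(f)`, the tangential parts on `f` of the fields `a + b x`. -/
def RTf (F : Frame T) (f : Face T) : Set (Fin 2 → Poly) := tanV F f '' RT

/-- `p` vanishes at all points of `s`. -/
def VanishAt (s : Finset E3) (p : Poly) : Prop := ∀ x ∈ s, ev p x = 0

/-- `(∏ λ)^m P_d`, the product being over the vertices in `s`. -/
def bubP (K : Cell T) (s : Finset E3) (m : ℕ) (d : ℤ) : Set Poly :=
  {p | ∃ q, Deg d q ∧ p = bub K s ^ m * q}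

/-- `(λ₀λ₁λ₂) P_d^{(0)}(f)`, where `P_d^{(0)}(f)` are the polynomials of degree at most `d` that
vanish at the vertices of `f`. -/
def bubF0 (K : Cell T) (f : Face T) (d : ℤ) : Set Poly :=
  {p | ∃ q, Deg d q ∧ VanishAt f.1 q ∧ p = bub K f.1 * q}

/-- `P_d^{(1)}(f)`, the polynomials of degree at most `d` that vanish together with their (face)
gradient at the vertices of `f`. -/
def polyF1 (F : Frame T) (f : Face T) (d : ℤ) : Set Poly :=
  {p | Deg d p ∧ VanishAt f.1 p ∧ ∀ a, VanishAt f.1 (gradF F f p a)}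

/-- The bubble space `B_K^{curl;𝕊}`: sums of functions `λ_jλ_lλ_m p nᵢnᵢᵀ` with
`p ∈ P_{k-3}^{(0)}(K)` and of functions `λ₀λ₁λ₂λ₃ Q` with `Q ∈ P_{k-4}(K;𝕊)`. -/
noncomputable def bubCurl (F : Frame T) (k : ℕ) (K : Cell T) :
    Submodule ℝ (Matrix (Fin 3) (Fin 3) Poly) :=
  Submodule.span ℝ
    ({η | ∃ (i : K.1) (p : Poly), Deg ((k : ℤ) - 3) p ∧ VanishAt K.1 p ∧
        η = (bub K (opp K i).1 * p) • cdyad (F.nf (opp K i)) (F.nf (opp K i))} ∪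
     {η | ∃ Q : Matrix (Fin 3) (Fin 3) Poly, Q.IsSymm ∧ (∀ a b, Deg ((k : ℤ) - 4) (Q a b)) ∧
        η = bub K K.1 • Q})

/-- The bubble space `B_K^{div;𝕋}`: sums of functions `λ_jλ_l p nᵢ t_{j,l}ᵀ` with `j, l ≠ i` and
`p ∈ P_{k-3}(K)` vanishing at the vertices `x_j`, `x_l`. -/
noncomputable def bubDiv (F : Frame T) (k : ℕ) (K : Cell T) :
    Submodule ℝ (Matrix (Fin 3) (Fin 3) Poly) :=
  Submodule.span ℝ
    {η | ∃ (i j l : K.1) (p : Poly), j ≠ l ∧ j ≠ i ∧ l ≠ i ∧ Deg ((k : ℤ) - 3) p ∧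
        ev p j.1 = 0 ∧ ev p l.1 = 0 ∧
        η = (lam K j * lam K l * p) • cdyad (F.nf (opp K i)) (l.1 - j.1)}

/-! ## Sobolev spaces -/

/-- Test functions on `Ω`: smooth with compact support in `Ω`. -/
def IsTest (Ω : Set E3) (ψ : E3 → ℝ) : Prop :=
  ContDiff ℝ (⊤ : ℕ∞) ψ ∧ HasCompactSupport ψ ∧ tsupport ψ ⊆ Ω

/-- The partial derivative of a function. -/
noncomputable def fpd (i : Fin 3) (ψ : E3 → ℝ) (x : E3) : ℝ :=
  fderiv ℝ ψ x (EuclideanSpace.single i 1)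

/-- `v` is the row-wise distributional curl of `s` in `Ω`. -/
def IsWeakCurl (Ω : Set E3) (s v : E3 → Matrix (Fin 3) (Fin 3) ℝ) : Prop :=
  ∀ ψ, IsTest Ω ψ → ∀ i l, ∫ x in Ω, v x i l * ψ x =
    - ∫ x in Ω, (s x i (l + 2) * fpd (l + 1) ψ x - s x i (l + 1) * fpd (l + 2) ψ x)

/-- `q` is the row-wise distributional divergence of `s` in `Ω`. -/
def IsWeakDiv (Ω : Set E3) (s : E3 → Matrix (Fin 3) (Fin 3) ℝ) (q : E3 → Fin 3 → ℝ) : Prop :=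
  ∀ ψ, IsTest Ω ψ → ∀ i, ∫ x in Ω, q x i * ψ x = - ∫ x in Ω, ∑ j, s x i j * fpd j ψ x

/-- `L²(Ω; ℝ^{3×3})`. -/
def L2M (Ω : Set E3) (s : E3 → Matrix (Fin 3) (Fin 3) ℝ) : Prop :=
  ∀ i j, MemLp (fun x => s x i j) 2 (volume.restrict Ω)

/-- `H(curl, Ω; 𝕊) = {s ∈ L²(Ω; 𝕊) : curl s ∈ L²(Ω; 𝕋)}`. -/
def HCurlS (Ω : Set E3) (s : E3 → Matrix (Fin 3) (Fin 3) ℝ) : Prop :=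
  L2M Ω s ∧ (∀ᵐ x ∂(volume.restrict Ω), (s x).IsSymm) ∧
    ∃ v, L2M Ω v ∧ (∀ᵐ x ∂(volume.restrict Ω), (v x).trace = 0) ∧ IsWeakCurl Ω s v

/-- `H(div, Ω; 𝕋) = {s ∈ L²(Ω; 𝕋) : div s ∈ L²(Ω; ℝ³)}`. -/
def HDivT (Ω : Set E3) (s : E3 → Matrix (Fin 3) (Fin 3) ℝ) : Prop :=
  L2M Ω s ∧ (∀ᵐ x ∂(volume.restrict Ω), (s x).trace = 0) ∧
    ∃ q : E3 → Fin 3 → ℝ, (∀ i, MemLp (fun x => q x i) 2 (volume.restrict Ω)) ∧ IsWeakDiv Ω s q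

/-! ## Piecewise polynomials and the finite element spaces

A piecewise polynomial function is given by its polynomial on each tetrahedron. -/

/-- Scalar piecewise polynomials. -/
abbrev PwS (T : Geometry.SimplicialComplex ℝ E3) : Type := Cell T → Poly

/-- Vector-valued piecewise polynomials. -/
abbrev PwV (T : Geometry.SimplicialComplex ℝ E3) : Type := Cell T → Fin 3 → Poly

/-- Matrix-valued piecewise polynomials. -/
abbrev PwM (T : Geometry.SimplicialComplex ℝ E3) : Type := Cell T → Matrix (Fin 3) (Fin 3) Poly

/-- The function `s` equals the piecewise polynomial `σ` inside all tetrahedra. -/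
def Represents (s : E3 → Matrix (Fin 3) (Fin 3) ℝ) (σ : PwM T) : Prop :=
  ∀ K : Cell T, ∀ x ∈ interior (convexHull ℝ (K.1 : Set E3)), ∀ i j, s x i j = ev (σ K i j) x

/-- All derivatives of order at most `m` of the piecewise polynomial `u` are single-valued at `x`:
any two tetrahedra that contain the vertices in `s` give the same values. -/
def SameJet (m : ℕ) (s : Finset E3) (x : E3) (u : PwS T) : Prop :=
  ∀ K L : Cell T, s ⊆ K.1 → s ⊆ L.1 → ∀ α : Fin 3 → ℕ, ∑ i, α i ≤ m →
    ev (dAlpha α (u K)) x = ev (dAlpha α (u L)) x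

/-- `u` is `C^m` at each vertex. -/
def SmoothAtVertices (m : ℕ) (u : PwS T) : Prop := ∀ x : Vertex T, SameJet m {x.1} x.1 u

/-- `u` is `C^m` on each edge. -/
def SmoothOnEdges (m : ℕ) (u : PwS T) : Prop :=
  ∀ e : Edge T, ∀ x ∈ convexHull ℝ (e.1 : Set E3), SameJet m e.1 x u

/-- The `H²` conforming finite element space `U_h`. -/
structure MemU (Ω : Set E3) (k : ℕ) (u : PwS T) : Prop where
  deg : ∀ K, Deg ((k : ℤ) + 2) (u K)
  c1 : ∃ g : E3 → ℝ, ContDiffOn ℝ 1 g Ω ∧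
    ∀ K : Cell T, ∀ x ∈ convexHull ℝ (K.1 : Set E3) ∩ Ω, g x = ev (u K) x
  vertex : SmoothAtVertices 4 u
  edge : SmoothOnEdges 2 u

/-- The `H(curl; 𝕊)` conforming finite element space `Σ_h`. -/
structure MemSigma (Ω : Set E3) (k : ℕ) (σ : PwM T) : Prop where
  deg : ∀ K i j, Deg (k : ℤ) (σ K i j)
  symm : ∀ K, (σ K).IsSymm
  hcurl : ∃ s, HCurlS Ω s ∧ Represents s σ
  vertex : ∀ i j, SmoothAtVertices 2 fun K => σ K i j
  edge : ∀ i j, SmoothOnEdges 0 fun K => σ K i j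

/-- The `H(div; 𝕋)` conforming finite element space `V_h`. -/
structure MemV (Ω : Set E3) (k : ℕ) (v : PwM T) : Prop where
  deg : ∀ K i j, Deg ((k : ℤ) - 1) (v K i j)
  traceless : ∀ K, (v K).trace = 0
  hdiv : ∃ s, HDivT Ω s ∧ Represents s v
  vertex : ∀ i j, SmoothAtVertices 1 fun K => v K i j

/-- The `L²` finite element space `Q_h`. -/
structure MemQ (k : ℕ) (q : PwV T) : Prop where
  deg : ∀ K i, Deg ((k : ℤ) - 2) (q K i)
  vertex : ∀ i, SmoothAtVertices 0 fun K => q K i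

/-! ## Degrees of freedom

For each of the four elements: the first set of degrees of freedom on a tetrahedron `K`, and the
statement that all the other degrees of freedom on `K` vanish. -/

/-- First set for `U_h`: the value and the first derivatives at the vertex `x`. -/
noncomputable def dofU (x : Vertex T) (u : Poly) : Fin 4 → ℝ :=
  Fin.cons (ev u x.1) fun i => ev (pd i u) x.1

/-- The other degrees of freedom of `U_h` on `K` vanish. -/
structure RestU (F : Frame T) (k : ℕ) (K : Cell T) (u : Poly) : Prop where
  vertex : ∀ x ∈ K.1, ∀ α : Fin 3 → ℕ, 2 ≤ ∑ i, α i → ∑ i, α i ≤ 4 → ev (dAlpha α u) x = 0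
  edge_tt : ∀ e : Edge T, e.1 ⊆ K.1 → ∀ p ∈ bubP K e.1 5 ((k : ℤ) - 8),
    ipS e.1 (dir (F.te e) (dir (F.te e) u)) (dir (F.te e) (dir (F.te e) p)) = 0
  edge_nt : ∀ e : Edge T, e.1 ⊆ K.1 → ∀ j, ∀ p ∈ bubP K e.1 4 ((k : ℤ) - 7),
    ipS e.1 (dir (F.ne e j) (dir (F.te e) u)) (dir (F.te e) p) = 0
  edge_nn : ∀ e : Edge T, e.1 ⊆ K.1 → ∀ j j', ∀ p ∈ bubP K e.1 3 ((k : ℤ) - 6),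
    ipS e.1 (dir (F.ne e j) (dir (F.ne e j') u)) p = 0
  face_hess : ∀ f : Face T, f.1 ⊆ K.1 → ∀ p ∈ bubP K f.1 3 ((k : ℤ) - 7),
    ipM f.1 (hessF F f u) (hessF F f p) = 0
  face_grad : ∀ f : Face T, f.1 ⊆ K.1 → ∀ p ∈ bubP K f.1 2 ((k : ℤ) - 5),
    ipV f.1 (gradF F f (dir (F.nf f) u)) (gradF F f p) = 0
  cell : ∀ p ∈ bubP K K.1 2 ((k : ℤ) - 6), ipM K.1 (hess u) (hess p) = 0

/-- First set for `Σ_h`: the moments `(σ t, w)_e` for `w` in the basis `x, e₁, e₂, e₃` of `RT`. -/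
noncomputable def dofSigma (F : Frame T) (e : Edge T) (σ : Matrix (Fin 3) (Fin 3) Poly)
    (j : Fin 4) : ℝ :=
  ipV e.1 (σ.mulVec (cvec (F.te e))) (rtBasis j)

/-- The inner product on a face for the tangential-tangential components. -/
noncomputable def harmFM (F : Frame T) (k : ℕ) (K : Cell T) (f : Face T)
    (σ η : Matrix (Fin 2) (Fin 2) Poly) : ℝ :=
  ipM f.1 (proj (ipM f.1) (hessF F f '' bubP K f.1 3 ((k : ℤ) - 7)) σ)
      (proj (ipM f.1) (hessF F f '' bubP K f.1 3 ((k : ℤ) - 7)) η) +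
    ipV f.1 (rotFM F f σ) (rotFM F f η)

/-- The inner product on a face for the normal-tangential components. -/
noncomputable def harmFV (F : Frame T) (k : ℕ) (K : Cell T) (f : Face T)
    (v w : Fin 2 → Poly) : ℝ :=
  ipV f.1 (proj (ipV f.1) (gradF F f '' bubP K f.1 2 ((k : ℤ) - 5)) v)
      (proj (ipV f.1) (gradF F f '' bubP K f.1 2 ((k : ℤ) - 5)) w) +
    ipS f.1 (rotF F f v) (rotF F f w)

/-- The inner product on a tetrahedron for `H(curl; 𝕊)`. -/
noncomputable def harmCurl (k : ℕ) (K : Cell T) (σ η : Matrix (Fin 3) (Fin 3) Poly) : ℝ :=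
  ipM K.1 (proj (ipM K.1) (hess '' bubP K K.1 2 ((k : ℤ) - 6)) σ)
      (proj (ipM K.1) (hess '' bubP K K.1 2 ((k : ℤ) - 6)) η) +
    ipM K.1 (curl σ) (curl η)

/-- The inner product on a tetrahedron for `H(div; 𝕋)`. -/
noncomputable def harmDiv (F : Frame T) (k : ℕ) (K : Cell T)
    (v η : Matrix (Fin 3) (Fin 3) Poly) : ℝ :=
  ipM K.1 (proj (ipM K.1) (curl '' (bubCurl F k K : Set (Matrix (Fin 3) (Fin 3) Poly))) v)
      (proj (ipM K.1) (curl '' (bubCurl F k K : Set (Matrix (Fin 3) (Fin 3) Poly))) η) +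
    ipV K.1 (div v) (div η)

/-- The other degrees of freedom of `Σ_h` on `K` vanish. -/
structure RestSigma (F : Frame T) (k : ℕ) (K : Cell T) (σ : Matrix (Fin 3) (Fin 3) Poly) :
    Prop where
  vertex : ∀ x ∈ K.1, ∀ α : Fin 3 → ℕ, ∑ i, α i ≤ 2 → ∀ i j, ev (dAlpha α (σ i j)) x = 0
  edge_tt : ∀ e : Edge T, e.1 ⊆ K.1 → ∀ p ∈ bubP K e.1 3 ((k : ℤ) - 6),
    (∀ q, Deg 1 q → ipS e.1 p q = 0) → ipS e.1 (comp (F.te e) σ (F.te e)) p = 0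
  edge_nt : ∀ e : Edge T, e.1 ⊆ K.1 → ∀ j, ∀ p ∈ bubP K e.1 3 ((k : ℤ) - 6),
    (∀ q, Deg 0 q → ipS e.1 p q = 0) → ipS e.1 (comp (F.ne e j) σ (F.te e)) p = 0
  edge_nn : ∀ e : Edge T, e.1 ⊆ K.1 → ∀ j j', ∀ p ∈ bubP K e.1 3 ((k : ℤ) - 6),
    ipS e.1 (comp (F.ne e j) σ (F.ne e j')) p = 0
  face_tt : ∀ f : Face T, f.1 ⊆ K.1 → ∀ η : Matrix (Fin 2) (Fin 2) Poly, η.IsSymm →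
    (∀ a b, η a b ∈ bubF0 K f ((k : ℤ) - 3)) → harmFM F k K f (tanM F f σ) η = 0
  face_nt : ∀ f : Face T, f.1 ⊆ K.1 → ∀ w : Fin 2 → Poly,
    (∀ a, w a ∈ bubF0 K f ((k : ℤ) - 3)) →
    harmFV F k K f (tanV F f (σ.mulVec (cvec (F.nf f)))) w = 0
  cell : ∀ η ∈ bubCurl F k K, harmCurl k K σ η = 0

/-- First set for `V_h`: the moments `(v n, w)_f` for `w` in the basis `x, e₁, e₂, e₃` of `RT`. -/
noncomputable def dofV (F : Frame T) (f : Face T) (v : Matrix (Fin 3) (Fin 3) Poly)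
    (j : Fin 4) : ℝ :=
  ipV f.1 (v.mulVec (cvec (F.nf f))) (rtBasis j)

/-- The other degrees of freedom of `V_h` on `K` vanish. -/
structure RestV (F : Frame T) (k : ℕ) (K : Cell T) (v : Matrix (Fin 3) (Fin 3) Poly) :
    Prop where
  vertex : ∀ x ∈ K.1, ∀ α : Fin 3 → ℕ, ∑ i, α i ≤ 1 → ∀ i j, ev (dAlpha α (v i j)) x = 0
  face_nt : ∀ f : Face T, f.1 ⊆ K.1 → ∀ w : Fin 2 → Poly,
    (∀ a, w a ∈ polyF1 F f ((k : ℤ) - 1)) → (∀ r ∈ RTf F f, ipV f.1 w r = 0) →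
    ipV f.1 (tanV F f (v.mulVec (cvec (F.nf f)))) w = 0
  face_nn : ∀ f : Face T, f.1 ⊆ K.1 → ∀ p ∈ polyF1 F f ((k : ℤ) - 1), ipS f.1 p 1 = 0 →
    ipS f.1 (comp (F.nf f) v (F.nf f)) p = 0
  cell : ∀ η ∈ bubDiv F k K, harmDiv F k K v η = 0

/-- First set for `Q_h`: the moments `(q, w)_K` for `w` in the basis `x, e₁, e₂, e₃` of `RT`. -/
noncomputable def dofQ (K : Cell T) (q : Fin 3 → Poly) (j : Fin 4) : ℝ := ipV K.1 q (rtBasis j)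

/-- The other degrees of freedom of `Q_h` on `K` vanish. -/
structure RestQ (k : ℕ) (K : Cell T) (q : Fin 3 → Poly) : Prop where
  vertex : ∀ x ∈ K.1, ∀ i, ev (q i) x = 0
  cell : ∀ w : Fin 3 → Poly, (∀ i, Deg ((k : ℤ) - 2) (w i) ∧ VanishAt K.1 (w i)) →
    (∀ r ∈ RT, ipV K.1 w r = 0) → ipV K.1 q w = 0

/-! ## The dual basis functions -/

open Classical in
/-- `φ x j` are the basis functions of `U_h` dual to the first set of degrees of freedom: on every
tetrahedron, all degrees of freedom of `φ x j` vanish except for the `j`-th one of the first set at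
the vertex `x`, which is one. -/
structure IsBasisU (Ω : Set E3) (F : Frame T) (k : ℕ) (φ : Vertex T → Fin 4 → PwS T) : Prop where
  mem : ∀ x j, MemU Ω k (φ x j)
  dual : ∀ x j (y : Vertex T) i (K : Cell T), y.1 ∈ K.1 →
    dofU y (φ x j K) i = if y = x ∧ i = j then 1 else 0
  rest : ∀ x j K, RestU F k K (φ x j K)

open Classical in
/-- The basis functions of `Σ_h` dual to the first set of degrees of freedom. -/
structure IsBasisSigma (Ω : Set E3) (F : Frame T) (k : ℕ) (φ : Edge T → Fin 4 → PwM T) :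
    Prop where
  mem : ∀ e j, MemSigma Ω k (φ e j)
  dual : ∀ e j (e' : Edge T) i (K : Cell T), e'.1 ⊆ K.1 →
    dofSigma F e' (φ e j K) i = if e' = e ∧ i = j then 1 else 0
  rest : ∀ e j K, RestSigma F k K (φ e j K)

open Classical in
/-- The basis functions of `V_h` dual to the first set of degrees of freedom. -/
structure IsBasisV (Ω : Set E3) (F : Frame T) (k : ℕ) (φ : Face T → Fin 4 → PwM T) :
    Prop where
  mem : ∀ f j, MemV Ω k (φ f j)
  dual : ∀ f j (f' : Face T) i (K : Cell T), f'.1 ⊆ K.1 →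
    dofV F f' (φ f j K) i = if f' = f ∧ i = j then 1 else 0
  rest : ∀ f j K, RestV F k K (φ f j K)

open Classical in
/-- The basis functions of `Q_h` dual to the first set of degrees of freedom. -/
structure IsBasisQ (k : ℕ) (φ : Cell T → Fin 4 → PwV T) : Prop where
  mem : ∀ K j, MemQ k (φ K j)
  dual : ∀ K j (L : Cell T) i, dofQ L (φ K j L) i = if L = K ∧ i = j then 1 else 0
  rest : ∀ K j L, RestQ k L (φ K j L)

/-- The span of a doubly indexed family. -/
def spanOf {ι V : Type} [AddCommGroup V] [Module ℝ V] (φ : ι → Fin 4 → V) : Submodule ℝ V :=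
  Submodule.span ℝ {v | ∃ i j, v = φ i j}

/-- The Hessian of a piecewise polynomial. -/
noncomputable def pwHess (u : PwS T) : PwM T := fun K => hess (u K)

/-- The row-wise curl of a piecewise polynomial. -/
noncomputable def pwCurl (σ : PwM T) : PwM T := fun K => curl (σ K)

/-- The row-wise divergence of a piecewise polynomial. -/
noncomputable def pwDiv (v : PwM T) : PwV T := fun K => div (v K)

end GradGrad

/-! Two successive operators compose to zero by the commutation of partial derivatives (`curl_hess`,
`div_curl`). The substance is that each operator maps one span into the next, although the basis
functions are known only through their degrees of freedom.

The spans have an intrinsic description, `mem_spanOf_iff`: a piecewise polynomial lies in the span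
if and only if all remaining degrees of freedom vanish on every cell and the degrees of freedom of
the first set agree on all cells that share the simplex. One direction needs unisolvence, that is, a
local function is zero once all its degrees of freedom vanish (`RestU.eq_zero`, `RestSigma.eq_zero`,
`RestV.eq_zero`, `RestQ.eq_zero`). Two kinds of local statements are then left.

The degrees of freedom of the first set pass along by calculus: moments of a Hessian on an edge are
end point values of the function and of its gradient (`dofSigma_hess`), and moments of a curl on a
face are edge moments by Stokes' theorem, where symmetry of the field and the form of the `RT`
fields remove the lower order terms (`dofV_curl`). Moments on a cell belong to a single cell, so
there is nothing to match for the divergence.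

The vanishing of the other degrees of freedom also passes along (`RestU.restSigma`,
`RestSigma.restV`, `RestV.restQ`). The interior ones use inner products of the form (P u, P η) + (d
u, d η), where P projects to the image W of the preceding bubbles. On an image of the preceding
operator the second term is zero and the first one is a condition known already. In the other
direction, W lies in the space of bubbles and is killed by d, so testing with η − Pη gives (d u, d
η) = 0 for all bubbles η (`harm_transfer`). It remains that d maps the bubbles onto the test
functions of the next element that are orthogonal to `RT` or to the constants: `exists_rotFM`,
`exists_rotF`, `exists_div`. These are proved by duality in Bernstein form. A functional that kills
all d η is invariant under moves of the multi-index along edges, and discrete rigidity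
(`rigid_triangle`, `rigid_tetrahedron`) forces it to act on the coefficients like integration
against an affine vector field (`moment_eq_zero`), against which the test function is orthogonal.

Unisolvence descends from vertices to edges, faces and cells. At each stage the function is, on the
simplex, itself an admissible test function, because a polynomial with vanishing traces is a bubble
(`exists_mem_bubP`, `mem_bubCurl`, `mem_bubDiv`); testing it with itself leaves the kernel of d on
bubbles, which is W by the Poincaré lemma for polynomials. The delicate case is
`exists_curl_bubble`: a divergence-free bubble has a symmetric potential whose tangential parts on
the four faces are Hessians, and `exists_hess_tangentZero` glues the four scalar potentials so that
subtracting one Hessian turns the potential into a bubble. -/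

namespace GradGrad

variable {T : Geometry.SimplicialComplex ℝ E3}

/-! ## Evaluation, derivatives and degrees of polynomials -/

section basic

@[simp] theorem ev_add (p q : Poly) (x : E3) : ev (p + q) x = ev p x + ev q x := map_add _ _ _
@[simp] theorem ev_sub (p q : Poly) (x : E3) : ev (p - q) x = ev p x - ev q x := map_sub _ _ _
@[simp] theorem ev_neg (p : Poly) (x : E3) : ev (-p) x = -ev p x := map_neg _ _
@[simp] theorem ev_mul (p q : Poly) (x : E3) : ev (p * q) x = ev p x * ev q x := map_mul _ _ _
@[simp] theorem ev_zero (x : E3) : ev 0 x = 0 := map_zero _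
@[simp] theorem ev_one (x : E3) : ev 1 x = 1 := map_one _
@[simp] theorem ev_C (a : ℝ) (x : E3) : ev (MvPolynomial.C a) x = a := MvPolynomial.eval_C _
@[simp] theorem ev_X (i : Fin 3) (x : E3) : ev (MvPolynomial.X i) x = x i := MvPolynomial.eval_X _
@[simp] theorem ev_pow (p : Poly) (n : ℕ) (x : E3) : ev (p ^ n) x = ev p x ^ n := map_pow _ _ _
@[simp] theorem ev_smul (a : ℝ) (p : Poly) (x : E3) : ev (a • p) x = a * ev p x := by
  simp [MvPolynomial.smul_eq_C_mul]
@[simp] theorem ev_sum {ι : Type*} (s : Finset ι) (f : ι → Poly) (x : E3) :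
    ev (∑ i ∈ s, f i) x = ∑ i ∈ s, ev (f i) x := map_sum _ _ _
@[simp] theorem ev_prod {ι : Type*} (s : Finset ι) (f : ι → Poly) (x : E3) :
    ev (∏ i ∈ s, f i) x = ∏ i ∈ s, ev (f i) x := map_prod _ _ _

theorem continuous_ev (p : Poly) : Continuous fun x : E3 => ev p x := by
  have h : Continuous fun x : E3 => (fun i => x i : Fin 3 → ℝ) := by fun_prop
  exact (MvPolynomial.continuous_eval p).comp h

theorem poly_ext {p q : Poly} (h : ∀ x, ev p x = ev q x) : p = q :=
  MvPolynomial.funext fun x => h (WithLp.toLp 2 x)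

@[simp] theorem pd_add (i : Fin 3) (p q : Poly) : pd i (p + q) = pd i p + pd i q := map_add _ _ _
@[simp] theorem pd_sub (i : Fin 3) (p q : Poly) : pd i (p - q) = pd i p - pd i q := map_sub _ _ _
@[simp] theorem pd_zero (i : Fin 3) : pd i 0 = 0 := map_zero _
@[simp] theorem pd_smul (i : Fin 3) (a : ℝ) (p : Poly) : pd i (a • p) = a • pd i p :=
  (MvPolynomial.pderiv i).map_smul a p
@[simp] theorem pd_C (i : Fin 3) (a : ℝ) : pd i (MvPolynomial.C a) = 0 := MvPolynomial.pderiv_C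
@[simp] theorem pd_sum {ι : Type*} (i : Fin 3) (s : Finset ι) (f : ι → Poly) :
    pd i (∑ j ∈ s, f j) = ∑ j ∈ s, pd i (f j) := map_sum _ _ _
theorem pd_mul (i : Fin 3) (p q : Poly) : pd i (p * q) = pd i p * q + p * pd i q :=
  MvPolynomial.pderiv_mul
@[simp] theorem pd_C_mul (i : Fin 3) (a : ℝ) (p : Poly) :
    pd i (MvPolynomial.C a * p) = MvPolynomial.C a * pd i p := MvPolynomial.pderiv_C_mul
theorem pd_X (i j : Fin 3) : pd i (MvPolynomial.X j) = if i = j then 1 else 0 := by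
  classical
  simp only [pd, MvPolynomial.pderiv_X, Pi.single_apply, eq_comm]

/-- The commutator of two derivations is a derivation, hence zero as soon as it kills the variables.
-/
theorem pd_comm (i j : Fin 3) (p : Poly) : pd i (pd j p) = pd j (pd i p) := by
  have h : ⁅MvPolynomial.pderiv (R := ℝ) i, MvPolynomial.pderiv j⁆ = 0 :=
    MvPolynomial.derivation_ext fun l => by
      classical
      rw [Derivation.commutator_apply]
      simp only [MvPolynomial.pderiv_X, Pi.single_apply]
      split_ifs <;> simp
  have := congrArg (fun D => D p) h
  rw [Derivation.commutator_apply] at this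
  exact sub_eq_zero.mp this

@[simp] theorem dir_add (v : E3) (p q : Poly) : dir v (p + q) = dir v p + dir v q := by
  simp [dir, mul_add, Finset.sum_add_distrib]
@[simp] theorem dir_sub (v : E3) (p q : Poly) : dir v (p - q) = dir v p - dir v q := by
  simp [dir, mul_sub, Finset.sum_sub_distrib]
@[simp] theorem dir_zero (v : E3) : dir v 0 = 0 := by simp [dir]
@[simp] theorem dir_C (v : E3) (a : ℝ) : dir v (MvPolynomial.C a) = 0 := by simp [dir]
@[simp] theorem dir_one (v : E3) : dir v 1 = 0 := dir_C v 1
@[simp] theorem dir_smul (v : E3) (a : ℝ) (p : Poly) : dir v (a • p) = a • dir v p := by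
  simp [dir, Finset.smul_sum]
@[simp] theorem dir_sum {ι : Type*} (v : E3) (s : Finset ι) (f : ι → Poly) :
    dir v (∑ j ∈ s, f j) = ∑ j ∈ s, dir v (f j) := by
  simp only [dir, pd_sum, Finset.mul_sum]
  exact Finset.sum_comm
theorem dir_mul (v : E3) (p q : Poly) : dir v (p * q) = dir v p * q + p * dir v q := by
  simp only [dir, pd_mul, Fin.sum_univ_three]; ring
@[simp] theorem dir_C_mul (v : E3) (a : ℝ) (p : Poly) :
    dir v (MvPolynomial.C a * p) = MvPolynomial.C a * dir v p := by
  simp [dir_mul]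
theorem dir_pow_succ (v : E3) (p : Poly) (n : ℕ) :
    dir v (p ^ (n + 1)) = (n + 1 : Poly) * p ^ n * dir v p := by
  induction n with
  | zero => simp
  | succ n ih => rw [pow_succ, dir_mul, ih]; push_cast; ring
theorem dir_comm (v w : E3) (p : Poly) : dir v (dir w p) = dir w (dir v p) := by
  simp only [dir, Fin.sum_univ_three, pd_add, pd_C_mul, pd_comm 1 0, pd_comm 2 0, pd_comm 2 1]
  ring
@[simp] theorem dir_add_vec (v w : E3) (p : Poly) : dir (v + w) p = dir v p + dir w p := by
  simp [dir, add_mul, Finset.sum_add_distrib]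
@[simp] theorem dir_sub_vec (v w : E3) (p : Poly) : dir (v - w) p = dir v p - dir w p := by
  simp [dir, sub_mul, Finset.sum_sub_distrib]
@[simp] theorem dir_zero_vec (p : Poly) : dir 0 p = 0 := by simp [dir]
@[simp] theorem dir_smul_vec (a : ℝ) (v : E3) (p : Poly) :
    dir (a • v) p = MvPolynomial.C a * dir v p := by
  simp [dir, Finset.mul_sum, mul_assoc]
@[simp] theorem dir_single (i : Fin 3) (p : Poly) :
    dir (EuclideanSpace.single i (1 : ℝ)) p = pd i p := by
  simp only [dir, Fin.sum_univ_three, PiLp.single_apply]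
  fin_cases i <;> simp

theorem ev_dir (v : E3) (p : Poly) (x : E3) : ev (dir v p) x = ∑ i, v i * ev (pd i p) x := by
  simp [dir]

/-! ### Degrees -/

theorem deg_zero (d : ℤ) : Deg d 0 := by intro m hm; simp at hm
theorem Deg.mono {d e : ℤ} {p : Poly} (h : Deg d p) (hde : d ≤ e) : Deg e p :=
  fun m hm => (h m hm).trans hde
theorem Deg.add {d : ℤ} {p q : Poly} (hp : Deg d p) (hq : Deg d q) : Deg d (p + q) := by
  classical
  intro m hm
  rcases Finset.mem_union.mp (MvPolynomial.support_add hm) with h | h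
  exacts [hp m h, hq m h]
theorem Deg.neg {d : ℤ} {p : Poly} (hp : Deg d p) : Deg d (-p) := by
  intro m hm
  rw [MvPolynomial.support_neg] at hm
  exact hp m hm
theorem Deg.sub {d : ℤ} {p q : Poly} (hp : Deg d p) (hq : Deg d q) : Deg d (p - q) := by
  rw [sub_eq_add_neg]; exact hp.add hq.neg
theorem Deg.sum {ι : Type*} {d : ℤ} {s : Finset ι} {f : ι → Poly} (h : ∀ i ∈ s, Deg d (f i)) :
    Deg d (∑ i ∈ s, f i) := by
  classical
  induction s using Finset.induction_on with
  | empty => simpa using deg_zero d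
  | insert a s ha ih =>
    rw [Finset.sum_insert ha]
    exact (h a (by simp)).add (ih fun i hi => h i (by simp [hi]))
theorem Deg.mul {d e : ℤ} {p q : Poly} (hp : Deg d p) (hq : Deg e q) : Deg (d + e) (p * q) := by
  classical
  intro m hm
  obtain ⟨a, ha, b, hb, rfl⟩ := Finset.mem_add.mp (MvPolynomial.support_mul _ _ hm)
  have h1 := hp a ha
  have h2 := hq b hb
  simp only [map_add, Nat.cast_add]
  omega
theorem deg_C (a : ℝ) : Deg 0 (MvPolynomial.C a) := by
  classical
  intro m hm
  rw [MvPolynomial.mem_support_iff, MvPolynomial.coeff_C] at hm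
  have : m = 0 := by by_contra h; exact hm (if_neg (Ne.symm h))
  simp [this]
theorem deg_one : Deg 0 (1 : Poly) := deg_C 1
theorem deg_X (i : Fin 3) : Deg 1 (MvPolynomial.X i) := by
  classical
  intro m hm
  rw [MvPolynomial.mem_support_iff, MvPolynomial.coeff_X] at hm
  have : m = Finsupp.single i 1 := by by_contra h; exact hm (if_neg (Ne.symm h))
  simp [this]
theorem Deg.C_mul {d : ℤ} {p : Poly} (a : ℝ) (hp : Deg d p) : Deg d (MvPolynomial.C a * p) := by
  simpa using (deg_C a).mul hp
theorem Deg.smul {d : ℤ} {p : Poly} (a : ℝ) (hp : Deg d p) : Deg d (a • p) := by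
  rw [MvPolynomial.smul_eq_C_mul]; exact hp.C_mul a
theorem Deg.pow {d : ℤ} {p : Poly} (hp : Deg d p) (n : ℕ) : Deg (n * d) (p ^ n) := by
  induction n with
  | zero => simpa using deg_one
  | succ n ih =>
    rw [pow_succ]
    exact (ih.mul hp).mono (by push_cast; linarith)
theorem Deg.prod {ι : Type*} {s : Finset ι} {f : ι → Poly} {d : ι → ℤ}
    (h : ∀ i ∈ s, Deg (d i) (f i)) : Deg (∑ i ∈ s, d i) (∏ i ∈ s, f i) := by
  classical
  induction s using Finset.induction_on with
  | empty => simpa using deg_one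
  | insert a s ha ih =>
    rw [Finset.prod_insert ha, Finset.sum_insert ha]
    exact (h a (by simp)).mul (ih fun i hi => h i (by simp [hi]))
theorem Deg.pd {d : ℤ} {p : Poly} (hp : Deg d p) (i : Fin 3) : Deg (d - 1) (pd i p) := by
  intro m hm
  rw [MvPolynomial.mem_support_iff, GradGrad.pd, MvPolynomial.coeff_pderiv] at hm
  have h := hp (m + Finsupp.single i 1)
    (MvPolynomial.mem_support_iff.mpr fun h => hm (by rw [h, zero_mul]))
  simp only [map_add, Finsupp.degree_single] at h
  push_cast at h
  omega
theorem Deg.dir {d : ℤ} {p : Poly} (hp : Deg d p) (v : E3) : Deg (d - 1) (dir v p) :=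
  Deg.sum fun i _ => (hp.pd i).C_mul _
theorem Deg.eq_zero {d : ℤ} {p : Poly} (hp : Deg d p) (hd : d < 0) : p = 0 := by
  rw [← MvPolynomial.support_eq_empty, Finset.eq_empty_iff_forall_notMem]
  intro m hm
  have := hp m hm
  omega
theorem deg_affPoly (f : E3 →ᵃ[ℝ] ℝ) : Deg 1 (affPoly f) :=
  ((deg_C _).mono (by norm_num)).add (Deg.sum fun i _ => (deg_X i).C_mul _)

/-! ### Vanishing orders -/

/-- All derivatives of `p` of order less than `m` vanish at `x`. -/
def VanishOrd (x : E3) : ℕ → Poly → Prop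
  | 0, _ => True
  | m + 1, p => ev p x = 0 ∧ ∀ i, VanishOrd x m (pd i p)

theorem vanishOrd_zero (x : E3) (m : ℕ) : VanishOrd x m 0 := by
  induction m with
  | zero => trivial
  | succ m ih => exact ⟨ev_zero x, fun i => by rw [pd_zero]; exact ih⟩

theorem VanishOrd.add {x : E3} {m : ℕ} {p q : Poly} (hp : VanishOrd x m p)
    (hq : VanishOrd x m q) : VanishOrd x m (p + q) := by
  induction m generalizing p q with
  | zero => trivial
  | succ m ih =>
    exact ⟨by rw [ev_add, hp.1, hq.1, add_zero], fun i => by rw [pd_add]; exact ih (hp.2 i) (hq.2 i)⟩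

theorem VanishOrd.mono {x : E3} {m n : ℕ} {p : Poly} (hp : VanishOrd x m p) (h : n ≤ m) :
    VanishOrd x n p := by
  induction n generalizing m p with
  | zero => trivial
  | succ n ih =>
    obtain ⟨m, rfl⟩ : ∃ m', m = m' + 1 := ⟨m - 1, by omega⟩
    exact ⟨hp.1, fun i => ih (hp.2 i) (by omega)⟩

/-- Leibniz' rule, by induction on the total order: each derivative lowers the order of one of the
factors only. -/
theorem VanishOrd.mul {x : E3} {m n : ℕ} {p q : Poly} (hp : VanishOrd x m p)
    (hq : VanishOrd x n q) : VanishOrd x (m + n) (p * q) := by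
  induction h : m + n generalizing m n p q with
  | zero => trivial
  | succ N ih =>
    refine ⟨?_, fun i => ?_⟩
    · rw [ev_mul]
      rcases m with _ | m
      · obtain ⟨n, rfl⟩ : ∃ n', n = n' + 1 := ⟨n - 1, by omega⟩
        rw [hq.1, mul_zero]
      · rw [hp.1, zero_mul]
    · rw [pd_mul]
      refine VanishOrd.add ?_ ?_
      · rcases m with _ | m
        · obtain ⟨n, rfl⟩ : ∃ n', n = n' + 1 := ⟨n - 1, by omega⟩
          -- The first factor has no order to lose, so the loss is charged to the second factor
          -- instead.
          have : VanishOrd x 0 (pd i p) := trivial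
          exact ih this (hq.mono (Nat.le_succ n)) (by omega)
        · exact ih (hp.2 i) hq (by omega)
      · rcases n with _ | n
        · obtain ⟨m, rfl⟩ : ∃ m', m = m' + 1 := ⟨m - 1, by omega⟩
          have : VanishOrd x 0 (pd i q) := trivial
          exact ih (hp.mono (Nat.le_succ m)) this (by omega)
        · exact ih hp (hq.2 i) (by omega)

theorem VanishOrd.C_mul {x : E3} {m : ℕ} {p : Poly} (a : ℝ) (hp : VanishOrd x m p) :
    VanishOrd x m (MvPolynomial.C a * p) := by
  have h : VanishOrd x 0 (MvPolynomial.C a) := trivial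
  simpa using h.mul hp

theorem VanishOrd.neg {x : E3} {m : ℕ} {p : Poly} (hp : VanishOrd x m p) :
    VanishOrd x m (-p) := by
  have := hp.C_mul (-1)
  simpa using this

theorem VanishOrd.sub {x : E3} {m : ℕ} {p q : Poly} (hp : VanishOrd x m p)
    (hq : VanishOrd x m q) : VanishOrd x m (p - q) := by
  rw [sub_eq_add_neg]; exact hp.add hq.neg

theorem VanishOrd.sum {ι : Type*} {x : E3} {m : ℕ} {s : Finset ι} {f : ι → Poly}
    (h : ∀ i ∈ s, VanishOrd x m (f i)) : VanishOrd x m (∑ i ∈ s, f i) := by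
  classical
  induction s using Finset.induction_on with
  | empty => simpa using vanishOrd_zero x m
  | insert a s ha ih =>
    rw [Finset.sum_insert ha]
    exact (h a (by simp)).add (ih fun i hi => h i (by simp [hi]))

theorem VanishOrd.pow {x : E3} {m : ℕ} {p : Poly} (hp : VanishOrd x m p) (n : ℕ) :
    VanishOrd x (n * m) (p ^ n) := by
  induction n with
  | zero => simp only [zero_mul]; trivial
  | succ n ih => rw [pow_succ, Nat.succ_mul]; exact ih.mul hp

theorem VanishOrd.dir {x : E3} {m : ℕ} {p : Poly} (hp : VanishOrd x (m + 1) p) (v : E3) :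
    VanishOrd x m (dir v p) :=
  VanishOrd.sum fun i _ => (hp.2 i).C_mul _

theorem pd_iterate_comm (i j : Fin 3) (n : ℕ) (p : Poly) :
    (pd i)^[n] (pd j p) = pd j ((pd i)^[n] p) := by
  have h : Function.Commute (pd i) (pd j) := pd_comm i j
  exact (h.iterate_left n) p

theorem dAlpha_pd (α : Fin 3 → ℕ) (i : Fin 3) (p : Poly) :
    dAlpha α (pd i p) = dAlpha (α + Pi.single i 1) p := by
  fin_cases i
  · simp [dAlpha, pd_iterate_comm, Function.comp]
  · simp [dAlpha, pd_iterate_comm, Function.comp]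
  · simp [dAlpha, pd_iterate_comm, Function.comp]

/-- Translates between the recursive notion, which suits products and inductions, and the
multi-index form in which the vertex degrees of freedom are stated. -/
theorem vanishOrd_iff {x : E3} {m : ℕ} {p : Poly} :
    VanishOrd x (m + 1) p ↔ ∀ α : Fin 3 → ℕ, ∑ i, α i ≤ m → ev (dAlpha α p) x = 0 := by
  induction m generalizing p with
  | zero =>
    constructor
    · intro h α hα
      have : α = 0 := by
        ext i
        have := Finset.single_le_sum (f := α) (fun _ _ => Nat.zero_le _) (Finset.mem_univ i)
        simp only [Pi.zero_apply]; omega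
      rw [this]; exact h.1
    · intro h
      exact ⟨h 0 (by simp), fun i => trivial⟩
  | succ m ih =>
    constructor
    · intro h α hα
      by_cases h0 : ∀ i, α i = 0
      · have : α = 0 := funext h0
        rw [this]; exact h.1
      · push Not at h0
        obtain ⟨i, hi⟩ := h0
        obtain ⟨β, rfl⟩ : ∃ β : Fin 3 → ℕ, α = β + Pi.single i 1 := by
          refine ⟨fun j => α j - (Pi.single i 1 : Fin 3 → ℕ) j, ?_⟩
          ext j
          by_cases hj : j = i
          · subst hj; simp; omega
          · simp [hj]
        rw [← dAlpha_pd]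
        refine ih.mp (h.2 i) β ?_
        simp only [Pi.add_apply, Finset.sum_add_distrib, Finset.sum_pi_single', Finset.mem_univ,
          if_true] at hα
        omega
    · intro h
      refine ⟨h 0 (by simp), fun i => ih.mpr fun α hα => ?_⟩
      rw [dAlpha_pd]
      refine h _ ?_
      simp only [Pi.add_apply, Finset.sum_add_distrib, Finset.sum_pi_single', Finset.mem_univ,
        if_true]
      omega

end basic

/-! ## Barycentric coordinates and the Bernstein form -/

section bernstein

/-- The derivative of the barycentric coordinate of the vertex `v` along `w`. -/
noncomputable def slope (K : Cell T) (w : E3) (v : K.1) : ℝ :=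
  (K.affineBasis.coord v).linear w

theorem ev_lam (K : Cell T) (v : K.1) (x : E3) : ev (lam K v) x = K.affineBasis.coord v x :=
  ev_affPoly _ _

theorem Cell.affineBasis_apply (K : Cell T) (v : K.1) : K.affineBasis v = v.1 := rfl

theorem ev_lam_vertex (K : Cell T) (v w : K.1) :
    ev (lam K v) w.1 = if v = w then 1 else 0 := by
  classical
  rw [ev_lam, ← K.affineBasis_apply w, AffineBasis.coord_apply]

theorem sum_ev_lam (K : Cell T) (x : E3) : ∑ v, ev (lam K v) x = 1 := by
  simp only [ev_lam]
  exact K.affineBasis.sum_coord_apply_eq_one x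

theorem sum_ev_lam_smul (K : Cell T) (x : E3) : ∑ v, ev (lam K v) x • v.1 = x := by
  simp only [ev_lam]
  exact K.affineBasis.linear_combination_coord_eq_self x

theorem sum_lam (K : Cell T) : ∑ v, lam K v = 1 :=
  poly_ext fun x => by rw [ev_sum, sum_ev_lam, ev_one]

theorem X_eq_sum_lam (K : Cell T) (i : Fin 3) :
    (MvPolynomial.X i : Poly) = ∑ v, MvPolynomial.C (v.1 i) * lam K v :=
  poly_ext fun x => by
    conv_lhs => rw [ev_X, ← sum_ev_lam_smul K x]
    simp [mul_comm]

theorem dir_affPoly (f : E3 →ᵃ[ℝ] ℝ) (w : E3) :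
    dir w (affPoly f) = MvPolynomial.C (f.linear w) := by
  have hw : w = ∑ i, w i • EuclideanSpace.single i (1 : ℝ) := by
    ext j
    simp [Fin.sum_univ_three]
    fin_cases j <;> simp
  have hX : ∀ i, dir w (MvPolynomial.X i) = MvPolynomial.C (w i) := by
    intro i
    simp only [dir, pd_X, Fin.sum_univ_three]
    fin_cases i <;> simp
  conv_rhs => rw [hw]
  simp only [affPoly, dir_add, dir_C, dir_sum, dir_C_mul, hX, zero_add, map_sum, map_smul,
    smul_eq_mul, map_mul]
  exact Finset.sum_congr rfl fun i _ => mul_comm _ _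

theorem dir_lam (K : Cell T) (v : K.1) (w : E3) :
    dir w (lam K v) = MvPolynomial.C (slope K w v) := dir_affPoly _ _

theorem deg_lam (K : Cell T) (v : K.1) : Deg 1 (lam K v) := deg_affPoly _

theorem sum_slope (K : Cell T) (w : E3) : ∑ v, slope K w v = 0 := by
  have h := congrArg (dir w) (sum_lam K)
  rw [dir_sum, dir_one] at h
  have := congrArg (fun p => ev p 0) h
  simpa [dir_lam] using this

theorem sum_slope_smul (K : Cell T) (w : E3) : ∑ v, slope K w v • v.1 = w := by
  ext i
  have h := congrArg (fun p => ev (dir w p) 0) (X_eq_sum_lam K i)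
  have hX : dir w (MvPolynomial.X i) = MvPolynomial.C (w i) := by
    simp only [dir, pd_X, Fin.sum_univ_three]
    fin_cases i <;> simp
  simp only [hX, ev_C, dir_sum, dir_C_mul, dir_lam, ev_sum, ev_mul] at h
  simp [h, mul_comm]

open Classical in
theorem slope_sub (K : Cell T) (v a b : K.1) :
    slope K (a.1 - b.1) v = (if v = a then 1 else 0) - (if v = b then 1 else 0) := by
  have h : slope K (a.1 - b.1) v = K.affineBasis.coord v a.1 - K.affineBasis.coord v b.1 := by
    rw [slope, ← vsub_eq_sub a.1 b.1, AffineMap.linearMap_vsub]; rfl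
  rw [h, ← ev_lam, ← ev_lam, ev_lam_vertex, ev_lam_vertex]

@[simp] theorem slope_add (K : Cell T) (v w : E3) (a : K.1) :
    slope K (v + w) a = slope K v a + slope K w a := map_add _ _ _
@[simp] theorem slope_smul (K : Cell T) (r : ℝ) (w : E3) (a : K.1) :
    slope K (r • w) a = r * slope K w a := map_smul _ _ _

/-- A polynomial homomorphism is determined by directional derivatives of the images of the
variables. -/
theorem dir_aeval_lam (K : Cell T) (w : E3) (g : MvPolynomial K.1 ℝ) :
    dir w (MvPolynomial.aeval (lam K) g) =
      ∑ v, MvPolynomial.C (slope K w v) * MvPolynomial.aeval (lam K) (MvPolynomial.pderiv v g) := by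
  classical
  induction g using MvPolynomial.induction_on with
  | C a => simp [MvPolynomial.algHom_C]
  | add p q hp hq => simp only [map_add, dir_add, hp, hq, mul_add, Finset.sum_add_distrib]
  | mul_X p v hp =>
    simp only [map_mul, dir_mul, hp, MvPolynomial.aeval_X, dir_lam, MvPolynomial.pderiv_mul,
      map_add, mul_add, Finset.sum_add_distrib, Finset.sum_mul]
    congr 1
    · exact Finset.sum_congr rfl fun i _ => by ring
    · rw [Finset.sum_eq_single v]
      · simp; ring
      · intro b _ hb
        simp [MvPolynomial.pderiv_X_of_ne (Ne.symm hb)]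
      · simp

/-- The multi-indices with sum `d` that are supported in `s`. -/
noncomputable def idx {ι : Type*} [Fintype ι] (s : Finset ι) (d : ℕ) : Finset (ι → ℕ) := by
  classical exact Finset.piAntidiag s d

theorem mem_idx {ι : Type*} [Fintype ι] {s : Finset ι} {d : ℕ} {α : ι → ℕ} :
    α ∈ idx s d ↔ ∑ v, α v = d ∧ ∀ v, v ∉ s → α v = 0 := by
  classical
  rw [idx, Finset.mem_piAntidiag]
  have h : (∀ i, α i ≠ 0 → i ∈ s) ↔ ∀ v, v ∉ s → α v = 0 :=
    forall_congr' fun v => by rw [not_imp_comm]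
  rw [h]
  refine and_congr_left fun h => ?_
  rw [Finset.sum_subset (Finset.subset_univ s) fun v _ hv => h v hv]

theorem mem_idx_univ {ι : Type*} [Fintype ι] {d : ℕ} {α : ι → ℕ} :
    α ∈ idx Finset.univ d ↔ ∑ v, α v = d := by
  simp [mem_idx]

/-- The multi-index with the single entry one at `v`. -/
noncomputable def unit {ι : Type*} (v : ι) : ι → ℕ := by
  classical exact Pi.single v 1

@[simp] theorem unit_self {ι : Type*} (v : ι) : unit v v = 1 := by
  classical simp [unit]

theorem unit_of_ne {ι : Type*} {v w : ι} (h : w ≠ v) : unit v w = 0 := by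
  classical simp [unit, h]

@[simp] theorem sum_unit {ι : Type*} [Fintype ι] (v : ι) : ∑ w, unit v w = 1 := by
  classical simp [unit]

theorem sum_add_unit {ι : Type*} [Fintype ι] (α : ι → ℕ) (v : ι) :
    ∑ w, (α + unit v) w = ∑ w, α w + 1 := by
  simp [Finset.sum_add_distrib]

theorem sum_smul_unit {ι : Type*} [Fintype ι] (d : ℕ) (v : ι) : ∑ w, (d • unit v) w = d := by
  simp [← Finset.mul_sum]

theorem exists_eq_add_unit {ι : Type*} {α : ι → ℕ} {v : ι} (h : α v ≠ 0) :
    ∃ β, α = β + unit v := by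
  refine ⟨α - unit v, ?_⟩
  ext w
  by_cases hw : w = v
  · subst hw; simp; omega
  · simp [unit_of_ne hw]

/-- The polynomial `∑ c_α X^α / α!`, homogeneous of degree `d`. -/
noncomputable def homPoly {ι : Type*} [Fintype ι] (d : ℕ) (c : (ι → ℕ) → ℝ) :
    MvPolynomial ι ℝ :=
  ∑ α ∈ idx Finset.univ d,
    MvPolynomial.monomial (Finsupp.equivFunOnFinite.symm α) (c α / ∏ v, ((α v).factorial : ℝ))

/-- The polynomial of degree `d` with Bernstein coefficients `c`. -/
noncomputable def bern (K : Cell T) (d : ℕ) (c : (K.1 → ℕ) → ℝ) : Poly :=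
  MvPolynomial.aeval (lam K) (homPoly d c)

theorem coeff_homPoly {ι : Type*} [Fintype ι] (d : ℕ) (c : (ι → ℕ) → ℝ)
    (m : ι →₀ ℕ) : MvPolynomial.coeff m (homPoly d c) =
      if ∑ v, m v = d then c m / ∏ v, ((m v).factorial : ℝ) else 0 := by
  rw [homPoly, MvPolynomial.coeff_sum]
  classical
  simp only [MvPolynomial.coeff_monomial]
  by_cases h : ∑ v, m v = d
  · rw [if_pos h, Finset.sum_eq_single (⇑m)]
    · simp
    · intro b _ hb
      rw [if_neg]
      rintro rfl
      exact hb rfl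
    · intro h'
      exact absurd (mem_idx_univ.mpr h) h'
  · rw [if_neg h]
    refine Finset.sum_eq_zero fun α hα => if_neg ?_
    rintro rfl
    exact h (mem_idx_univ.mp hα)

/-- The factorials in the normalization turn differentiation into a mere shift of the coefficients.
Every finite difference argument below relies on this. -/
theorem pderiv_homPoly {ι : Type*} [Fintype ι] (d : ℕ) (c : (ι → ℕ) → ℝ)
    (v : ι) : MvPolynomial.pderiv v (homPoly (d + 1) c) =
      homPoly d fun β => c (β + unit v) := by
  ext m
  rw [MvPolynomial.coeff_pderiv, coeff_homPoly, coeff_homPoly]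
  classical
  have h2 : (⇑(m + Finsupp.single v 1 : ι →₀ ℕ) : ι → ℕ) = ⇑m + unit v := by
    ext i; simp [unit, Finsupp.single_apply, Pi.single_apply, eq_comm]
  have h1 : ∑ i, (m + Finsupp.single v 1 : ι →₀ ℕ) i = ∑ i, m i + 1 := by
    rw [h2]; simp [Finset.sum_add_distrib]
  have h3 : ∏ i, (((m + Finsupp.single v 1 : ι →₀ ℕ) i).factorial : ℝ) =
      (m v + 1) * ∏ i, ((m i).factorial : ℝ) := by
    rw [← Finset.mul_prod_erase _ _ (Finset.mem_univ v),
      ← Finset.mul_prod_erase _ (fun i => ((m i).factorial : ℝ)) (Finset.mem_univ v), ← mul_assoc]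
    congr 1
    · simp [Nat.factorial_succ]
    · refine Finset.prod_congr rfl fun i hi => ?_
      rw [Finsupp.add_apply, Finsupp.single_apply, if_neg (Finset.ne_of_mem_erase hi).symm, add_zero]
  rw [h1, h3, h2]
  by_cases h : ∑ i, m i = d
  · rw [if_pos (by rw [h]), if_pos h]
    have : (m v + 1 : ℝ) ≠ 0 := by positivity
    field_simp
  · rw [if_neg (by omega), if_neg h, zero_mul]

theorem homPoly_add {ι : Type*} [Fintype ι] (d : ℕ) (c c' : (ι → ℕ) → ℝ) :
    homPoly d (c + c') = homPoly d c + homPoly d c' := by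
  simp [homPoly, add_div, Finset.sum_add_distrib]

theorem homPoly_smul {ι : Type*} [Fintype ι] (d : ℕ) (r : ℝ) (c : (ι → ℕ) → ℝ) :
    homPoly d (r • c) = MvPolynomial.C r * homPoly d c := by
  simp [homPoly, Finset.mul_sum, MvPolynomial.C_mul_monomial, mul_div_assoc]

@[simp] theorem bern_add (K : Cell T) (d : ℕ) (c c' : (K.1 → ℕ) → ℝ) :
    bern K d (c + c') = bern K d c + bern K d c' := by
  rw [bern, homPoly_add, map_add]; rfl

@[simp] theorem bern_smul (K : Cell T) (d : ℕ) (r : ℝ) (c : (K.1 → ℕ) → ℝ) :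
    bern K d (r • c) = MvPolynomial.C r * bern K d c := by
  rw [bern, homPoly_smul, map_mul, ← MvPolynomial.algebraMap_eq, AlgHom.commutes]; rfl

@[simp] theorem bern_zero (K : Cell T) (d : ℕ) : bern K d 0 = 0 := by
  have := bern_smul K d 0 0
  simpa using this

@[simp] theorem bern_sub (K : Cell T) (d : ℕ) (c c' : (K.1 → ℕ) → ℝ) :
    bern K d (c - c') = bern K d c - bern K d c' := by
  have := bern_add K d (c - c') c'
  rw [sub_add_cancel] at this
  rw [this]; ring

theorem bern_sum {ι : Type*} (K : Cell T) (d : ℕ) (s : Finset ι) (c : ι → (K.1 → ℕ) → ℝ) :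
    bern K d (∑ i ∈ s, c i) = ∑ i ∈ s, bern K d (c i) := by
  classical
  induction s using Finset.induction_on with
  | empty => simp
  | insert a s ha ih => rw [Finset.sum_insert ha, Finset.sum_insert ha, bern_add, ih]

theorem bern_congr (K : Cell T) {d : ℕ} {c c' : (K.1 → ℕ) → ℝ}
    (h : ∀ α, ∑ v, α v = d → c α = c' α) : bern K d c = bern K d c' := by
  have : homPoly d c = homPoly d c' :=
    Finset.sum_congr rfl fun α hα => by rw [h α (mem_idx_univ.mp hα)]
  rw [bern, this]; rfl

/-- Chain rule in barycentric coordinates: the slopes of the coordinates weight the shifted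
coefficients. -/
theorem dir_bern (K : Cell T) (w : E3) (d : ℕ) (c : (K.1 → ℕ) → ℝ) :
    dir w (bern K (d + 1) c) =
      bern K d fun β => ∑ v, slope K w v * c (β + unit v) := by
  rw [bern, dir_aeval_lam]
  have : (fun β : K.1 → ℕ => ∑ v, slope K w v * c (β + unit v)) =
      ∑ v, slope K w v • fun β => c (β + unit v) := by
    ext β; simp
  rw [this, bern_sum]
  refine Finset.sum_congr rfl fun v _ => ?_
  rw [bern_smul, pderiv_homPoly]; rfl

theorem bern_eq_sum (K : Cell T) (d : ℕ) (c : (K.1 → ℕ) → ℝ) :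
    bern K d c = ∑ α ∈ idx Finset.univ d,
      MvPolynomial.C (c α / ∏ v, ((α v).factorial : ℝ)) * ∏ v, lam K v ^ α v := by
  rw [bern, homPoly, map_sum]
  refine Finset.sum_congr rfl fun α _ => ?_
  rw [MvPolynomial.aeval_monomial, MvPolynomial.algebraMap_eq, Finsupp.prod_fintype]
  · rfl
  · simp

theorem deg_bern (K : Cell T) (d : ℕ) (c : (K.1 → ℕ) → ℝ) : Deg d (bern K d c) := by
  classical
  rw [bern_eq_sum]
  refine Deg.sum fun α hα => Deg.C_mul _ ?_
  have h : Deg (∑ v, (α v : ℤ) * 1) (∏ v, lam K v ^ α v) :=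
    Deg.prod fun v _ => (deg_lam K v).pow _
  refine h.mono ?_
  have := mem_idx_univ.mp hα
  simp only [mul_one]
  exact_mod_cast this.le

/-- Homogenization: each variable is replaced by its barycentric expansion, and every monomial of
lower degree is multiplied by a power of the sum of the barycentric coordinates, which is one. -/
theorem exists_bern (K : Cell T) {d : ℕ} {p : Poly} (hp : Deg d p) :
    ∃ c, p = bern K d c := by
  obtain ⟨g, hg, hgp⟩ : ∃ g : MvPolynomial K.1 ℝ, g.IsHomogeneous d ∧
      MvPolynomial.aeval (lam K) g = p := by
    let L : Fin 3 → MvPolynomial K.1 ℝ := fun i => ∑ v, MvPolynomial.C (v.1 i) * MvPolynomial.X v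
    let S : MvPolynomial K.1 ℝ := ∑ v, MvPolynomial.X v
    have hL : ∀ i, (L i).IsHomogeneous 1 := fun i =>
      MvPolynomial.IsHomogeneous.sum _ _ _ fun v _ => by
        simpa using (MvPolynomial.isHomogeneous_C K.1 (v.1 i)).mul (MvPolynomial.isHomogeneous_X ℝ v)
    have hS : S.IsHomogeneous 1 :=
      MvPolynomial.IsHomogeneous.sum _ _ _ fun v _ => MvPolynomial.isHomogeneous_X ℝ v
    have eL : ∀ i, MvPolynomial.aeval (lam K) (L i) = (MvPolynomial.X i : Poly) := by
      intro i
      rw [X_eq_sum_lam K i, map_sum]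
      refine Finset.sum_congr rfl fun v _ => ?_
      rw [map_mul, MvPolynomial.aeval_X, ← MvPolynomial.algebraMap_eq, AlgHom.commutes,
        MvPolynomial.algebraMap_eq]
    have eS : MvPolynomial.aeval (lam K) S = (1 : Poly) := by
      rw [map_sum]
      simp only [MvPolynomial.aeval_X, sum_lam]
    refine ⟨∑ m ∈ p.support, MvPolynomial.C (p.coeff m) *
      ((∏ i, L i ^ m i) * S ^ (d - m.degree)), ?_, ?_⟩
    · refine MvPolynomial.IsHomogeneous.sum _ _ _ fun m hm => ?_
      have h1 : (∏ i, L i ^ m i).IsHomogeneous (∑ i, 1 * m i) :=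
        MvPolynomial.IsHomogeneous.prod _ _ _ fun i _ => (hL i).pow _
      have h2 := (MvPolynomial.isHomogeneous_C K.1 (p.coeff m)).mul
        (h1.mul (hS.pow (d - m.degree)))
      convert h2 using 1
      have := hp m hm
      rw [Finsupp.degree_eq_sum] at *
      simp only [one_mul]
      omega
    · conv_rhs => rw [p.as_sum]
      rw [map_sum]
      refine Finset.sum_congr rfl fun m _ => ?_
      rw [map_mul, map_mul, map_pow, eS, one_pow, mul_one, map_prod,
        ← MvPolynomial.algebraMap_eq, AlgHom.commutes, MvPolynomial.algebraMap_eq,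
        MvPolynomial.monomial_eq, Finsupp.prod_fintype _ _ (by simp)]
      simp only [map_pow, eL]
  -- The factorials undo the division in `homPoly`.
  refine ⟨fun α => MvPolynomial.coeff (Finsupp.equivFunOnFinite.symm α) g *
    ∏ v, ((α v).factorial : ℝ), ?_⟩
  rw [← hgp, bern]
  congr 1
  ext m
  rw [coeff_homPoly]
  split_ifs with h
  · have : (∏ v, ((m v).factorial : ℝ)) ≠ 0 := by positivity
    rw [div_eq_mul_inv, mul_assoc, mul_inv_cancel₀ this, mul_one]
    congr 1; ext; rfl
  · refine hg.coeff_eq_zero ?_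
    rw [Finsupp.degree_eq_sum]; exact h

theorem eval_homPoly {ι : Type*} [Fintype ι] (d : ℕ) (c : (ι → ℕ) → ℝ) (w : ι → ℝ) :
    MvPolynomial.eval w (homPoly d c) = ∑ α ∈ idx Finset.univ d,
      c α / (∏ v, ((α v).factorial : ℝ)) * ∏ v, w v ^ α v := by
  rw [homPoly, map_sum]
  refine Finset.sum_congr rfl fun α _ => ?_
  rw [MvPolynomial.eval_monomial, Finsupp.prod_fintype _ _ (by simp)]
  rfl

theorem ev_bern (K : Cell T) (d : ℕ) (c : (K.1 → ℕ) → ℝ) (x : E3) :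
    ev (bern K d c) x = MvPolynomial.eval (fun v => ev (lam K v) x) (homPoly d c) := by
  rw [bern_eq_sum, eval_homPoly, ev_sum]
  simp

/-- The vertices of `K` that belong to `s`. -/
noncomputable def sub (K : Cell T) (s : Finset E3) : Finset K.1 := by
  classical exact Finset.univ.filter fun v => v.1 ∈ s

@[simp] theorem mem_sub {K : Cell T} {s : Finset E3} {v : K.1} : v ∈ sub K s ↔ v.1 ∈ s := by
  classical
  simp [sub]

theorem mem_convexHull_iff (K : Cell T) {s : Finset E3} (hs : s ⊆ K.1) (x : E3) :
    x ∈ convexHull ℝ (s : Set E3) ↔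
      (∀ v, 0 ≤ ev (lam K v) x) ∧ ∀ v : K.1, v.1 ∉ s → ev (lam K v) x = 0 := by
  classical
  constructor
  · intro hx
    have hconv : Convex ℝ {x : E3 | (∀ v, 0 ≤ ev (lam K v) x) ∧
        ∀ v : K.1, v.1 ∉ s → ev (lam K v) x = 0} := by
      intro y hy z hz a b ha hb hab
      have key : ∀ v, ev (lam K v) (a • y + b • z) = a * ev (lam K v) y + b * ev (lam K v) z := by
        intro v
        simp only [ev_lam]
        exact Convex.combo_affine_apply hab
      refine ⟨fun v => ?_, fun v hv => ?_⟩
      · rw [key]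
        exact add_nonneg (mul_nonneg ha (hy.1 v)) (mul_nonneg hb (hz.1 v))
      · rw [key, hy.2 v hv, hz.2 v hv]; ring
    refine convexHull_min ?_ hconv hx
    intro y hy
    have hyK := hs hy
    refine ⟨fun v => ?_, fun v hv => ?_⟩
    · rw [ev_lam_vertex K v ⟨y, hyK⟩]; split_ifs <;> norm_num
    · rw [ev_lam_vertex K v ⟨y, hyK⟩, if_neg]
      rintro rfl
      exact hv hy
  · rintro ⟨h0, h1⟩
    rw [← sum_ev_lam_smul K x]
    have hsub : ∑ v, ev (lam K v) x • v.1 = ∑ v ∈ sub K s, ev (lam K v) x • v.1 := by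
      refine (Finset.sum_subset (Finset.subset_univ _) fun v _ hv => ?_).symm
      rw [h1 v (by simpa using hv), zero_smul]
    have hone : ∑ v ∈ sub K s, ev (lam K v) x = 1 := by
      rw [← sum_ev_lam K x]
      refine Finset.sum_subset (Finset.subset_univ _) fun v _ hv => ?_
      exact h1 v (by simpa using hv)
    rw [hsub]
    refine (convex_convexHull ℝ _).sum_mem (fun v _ => h0 v) hone fun v hv => ?_
    exact subset_convexHull ℝ _ (by simpa using hv)

/-- The points of the simplex `s` at which the barycentric coordinates of its vertices are
positive. -/
def relInt (K : Cell T) (s : Finset E3) : Set E3 :=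
  {x | (∀ v : K.1, v.1 ∈ s → 0 < ev (lam K v) x) ∧ ∀ v : K.1, v.1 ∉ s → ev (lam K v) x = 0}

theorem mem_idx_sub {K : Cell T} {s : Finset E3} {d : ℕ} {α : K.1 → ℕ} :
    α ∈ idx (sub K s) d ↔ ∑ v, α v = d ∧ ∀ v : K.1, v.1 ∉ s → α v = 0 := by
  simp [mem_idx]

theorem relInt_subset {K : Cell T} {s : Finset E3} (hs : s ⊆ K.1) :
    relInt K s ⊆ convexHull ℝ (s : Set E3) := by
  intro x hx
  rw [mem_convexHull_iff K hs]
  refine ⟨fun v => ?_, hx.2⟩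
  by_cases hv : v.1 ∈ s
  · exact (hx.1 v hv).le
  · exact (hx.2 v hv).ge

/-- A point of the open positive orthant, divided by the sum of its entries that belong to `s`,
gives barycentric coordinates of a point of the open simplex. By homogeneity the part of the form
supported in `s` vanishes on the whole orthant, which is a product of infinite sets, so it is the
zero polynomial. -/
theorem coeff_eq_zero_of_relInt (K : Cell T) {s : Finset E3} (hs : s ⊆ K.1) (hne : s.Nonempty)
    {d : ℕ} {c : (K.1 → ℕ) → ℝ} (h : ∀ x ∈ relInt K s, ev (bern K d c) x = 0)
    {α : K.1 → ℕ} (hα : α ∈ idx (sub K s) d) : c α = 0 := by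
  -- Coefficients with an index outside of `s` are not seen on the simplex and have to be discarded
  -- first.
  set c' : (K.1 → ℕ) → ℝ := fun β => if ∀ v, β v ≠ 0 → v ∈ sub K s then c β else 0 with hc'
  have key : homPoly d c' = 0 := by
    refine MvPolynomial.funext_set (fun _ => Set.Ioi (0 : ℝ)) (fun _ => Set.Ioi_infinite 0) ?_
    intro w hw
    rw [map_zero]
    have hw0 : ∀ v, 0 < w v := fun v => hw v trivial
    set t : ℝ := ∑ v ∈ sub K s, w v with ht
    have htpos : 0 < t := by
      obtain ⟨y, hy⟩ := hne
      exact Finset.sum_pos (fun v _ => hw0 v) ⟨⟨y, hs hy⟩, by simpa using hy⟩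
    set u : K.1 → ℝ := fun v => if v ∈ sub K s then w v / t else 0 with hu
    set x : E3 := ∑ v, u v • v.1 with hx
    have hu1 : ∑ v, u v = 1 := by
      rw [hu, ← Finset.sum_filter, Finset.filter_mem_eq_inter, Finset.univ_inter,
        ← Finset.sum_div, div_self htpos.ne']
    have hlam : ∀ v, ev (lam K v) x = u v := by
      intro v
      have hxa : x = Finset.univ.affineCombination ℝ K.affineBasis u := by
        rw [Finset.affineCombination_eq_linear_combination _ _ _ hu1]; rfl
      rw [ev_lam, hxa, K.affineBasis.coord_apply_combination_of_mem (Finset.mem_univ v) hu1]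
    have hxr : x ∈ relInt K s := by
      refine ⟨fun v hv => ?_, fun v hv => ?_⟩
      · rw [hlam, hu]; simp only [mem_sub, hv, if_true]; exact div_pos (hw0 v) htpos
      · rw [hlam, hu]; simp only [mem_sub, hv, if_false]
    have h0 := h x hxr
    rw [ev_bern, eval_homPoly] at h0
    simp only [hlam] at h0
    rw [eval_homPoly]
    have : ∀ β ∈ idx (Finset.univ : Finset K.1) d,
        c' β / (∏ v, ((β v).factorial : ℝ)) * ∏ v, w v ^ β v =
          t ^ d * (c β / (∏ v, ((β v).factorial : ℝ)) * ∏ v, u v ^ β v) := by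
      intro β hβ
      by_cases hb : ∀ v, β v ≠ 0 → v ∈ sub K s
      · have e1 : ∏ v, u v ^ β v = (∏ v, w v ^ β v) / t ^ d := by
          rw [← mem_idx_univ.mp hβ, ← Finset.prod_pow_eq_pow_sum,
            ← Finset.prod_div_distrib]
          refine Finset.prod_congr rfl fun v _ => ?_
          by_cases hv : β v = 0
          · simp [hv]
          · simp only [hu, if_pos (hb v hv), div_pow]
        have htd : t ^ d ≠ 0 := pow_ne_zero _ htpos.ne'
        rw [e1, hc']
        simp only [if_pos hb]
        field_simp
      · have hc0 : c' β = 0 := if_neg hb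
        push Not at hb
        obtain ⟨v, hv, hvs⟩ := hb
        have : ∏ v, u v ^ β v = 0 :=
          Finset.prod_eq_zero (Finset.mem_univ v) (by simp only [hu, if_neg hvs, zero_pow hv])
        rw [this, hc0]; simp
    rw [Finset.sum_congr rfl this, ← Finset.mul_sum, h0, mul_zero]
  obtain ⟨h1, h2⟩ := mem_idx.mp hα
  have hco := congrArg (MvPolynomial.coeff (Finsupp.equivFunOnFinite.symm α)) key
  rw [coeff_homPoly, MvPolynomial.coeff_zero, if_pos] at hco
  · have hf : (∏ v, ((α v).factorial : ℝ)) ≠ 0 := by positivity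
    have h3 : c' α = 0 := by
      rcases div_eq_zero_iff.mp hco with h | h
      · exact h
      · exact absurd h hf
    rw [hc'] at h3
    simp only at h3
    rwa [if_pos fun v hv => by_contra fun h => hv (h2 v h)] at h3
  · exact h1

theorem ev_bern_eq_zero (K : Cell T) {s : Finset E3} {d : ℕ} {c : (K.1 → ℕ) → ℝ}
    (h : ∀ α : K.1 → ℕ, ∑ v, α v = d → (∀ v : K.1, v.1 ∉ s → α v = 0) → c α = 0)
    {x : E3} (hx : ∀ v : K.1, v.1 ∉ s → ev (lam K v) x = 0) : ev (bern K d c) x = 0 := by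
  classical
  rw [ev_bern, eval_homPoly]
  refine Finset.sum_eq_zero fun α hα => ?_
  by_cases hs : ∀ v : K.1, v.1 ∉ s → α v = 0
  · rw [h α (mem_idx_univ.mp hα) hs]; simp
  · push Not at hs
    obtain ⟨v, hv, hv0⟩ := hs
    have : ∏ v, ev (lam K v) x ^ α v = 0 :=
      Finset.prod_eq_zero (Finset.mem_univ v) (by rw [hx v hv, zero_pow hv0])
    rw [this, mul_zero]

/-- A polynomial in Bernstein form vanishes on the simplex `s` if and only if its coefficients
that are supported in `s` vanish. -/
theorem bern_vanish_iff (K : Cell T) {s : Finset E3} (hs : s ⊆ K.1) (hne : s.Nonempty)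
    {d : ℕ} {c : (K.1 → ℕ) → ℝ} :
    (∀ x ∈ convexHull ℝ (s : Set E3), ev (bern K d c) x = 0) ↔
      ∀ α : K.1 → ℕ, ∑ v, α v = d → (∀ v : K.1, v.1 ∉ s → α v = 0) → c α = 0 := by
  classical
  constructor
  · intro h α h1 h2
    exact coeff_eq_zero_of_relInt K hs hne (fun x hx => h x (relInt_subset hs hx))
      (mem_idx_sub.mpr ⟨h1, h2⟩)
  · intro h x hx
    exact ev_bern_eq_zero K h ((mem_convexHull_iff K hs x).mp hx).2

end bernstein

/-! ## Vanishing conditions in terms of Bernstein coefficients -/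

section vanishing

theorem exists_deg (p : Poly) : ∃ d : ℕ, Deg d p := by
  refine ⟨p.support.sup fun m => m.degree, fun m hm => ?_⟩
  exact_mod_cast Finset.le_sup (f := fun m : Fin 3 →₀ ℕ => m.degree) hm

/-- Along an edge vector only two barycentric coordinates vary, so the derivative is a difference of
two shifts. -/
theorem dir_sub_bern (K : Cell T) (a b : K.1) (d : ℕ) (c : (K.1 → ℕ) → ℝ) :
    dir (a.1 - b.1) (bern K (d + 1) c) =
      bern K d fun β => c (β + unit a) - c (β + unit b) := by
  classical
  rw [dir_bern]
  congr 1
  ext β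
  simp only [slope_sub, sub_mul, ite_mul, one_mul, zero_mul, Finset.sum_sub_distrib,
    Finset.sum_ite_eq', Finset.mem_univ, if_true]

theorem slope_sub_eq_zero {K : Cell T} {a b v : K.1} (ha : v ≠ a) (hb : v ≠ b) :
    slope K (a.1 - b.1) v = 0 := by
  rw [slope_sub, if_neg ha, if_neg hb, sub_zero]

/-- The set of points of the plane of `s`. -/
def planeOf (K : Cell T) (s : Finset E3) : Set E3 :=
  {x | ∀ v : K.1, v.1 ∉ s → ev (lam K v) x = 0}

theorem subset_planeOf (K : Cell T) {s : Finset E3} (hs : s ⊆ K.1) {x : E3}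
    (hx : x ∈ convexHull ℝ (s : Set E3)) : x ∈ planeOf K s :=
  ((mem_convexHull_iff K hs x).mp hx).2

theorem vertex_mem_planeOf {K : Cell T} {s : Finset E3} {v : K.1} (hv : v.1 ∈ s) :
    v.1 ∈ planeOf K s := by
  intro w hw
  rw [ev_lam_vertex, if_neg]
  rintro rfl
  exact hw hv

/-- A polynomial that vanishes on a simplex vanishes on its affine hull. -/
theorem vanish_planeOf (K : Cell T) {s : Finset E3} (hs : s ⊆ K.1) (hne : s.Nonempty) {p : Poly}
    (h : ∀ x ∈ relInt K s, ev p x = 0) {x : E3} (hx : x ∈ planeOf K s) : ev p x = 0 := by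
  obtain ⟨d, hd⟩ := exists_deg p
  obtain ⟨c, rfl⟩ := exists_bern K hd
  exact ev_bern_eq_zero K (fun α h1 h2 => coeff_eq_zero_of_relInt K hs hne h
    (mem_idx_sub.mpr ⟨h1, h2⟩)) hx

/-- `w` is a tangential vector of the simplex `s` of `K`. -/
def IsTangent (K : Cell T) (s : Finset E3) (w : E3) : Prop := ∀ v : K.1, v.1 ∉ s → slope K w v = 0

theorem isTangent_sub {K : Cell T} {s : Finset E3} {a b : K.1} (ha : a.1 ∈ s) (hb : b.1 ∈ s) :
    IsTangent K s (a.1 - b.1) := fun _ hv =>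
  slope_sub_eq_zero (fun h => hv (h ▸ ha)) (fun h => hv (h ▸ hb))

/-- A tangential derivative shifts multi-indices only towards vertices of `s`, so it never leaves
the coefficients that vanish. -/
theorem dir_vanish (K : Cell T) {s : Finset E3} (hs : s ⊆ K.1) (hne : s.Nonempty) {p : Poly}
    (h : ∀ x ∈ planeOf K s, ev p x = 0) {w : E3} (hw : IsTangent K s w) :
    ∀ x ∈ planeOf K s, ev (dir w p) x = 0 := by
  intro x hx
  obtain ⟨d, hd⟩ := exists_deg p
  -- The formal degree is raised by one so that the Bernstein form can be differentiated without a
  -- case distinction at degree zero.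
  have hd1 : Deg ((d + 1 : ℕ) : ℤ) p := hd.mono (by push_cast; omega)
  obtain ⟨c, rfl⟩ := exists_bern K hd1
  have hc : ∀ α : K.1 → ℕ, ∑ v, α v = d + 1 → (∀ v : K.1, v.1 ∉ s → α v = 0) → c α = 0 :=
    (bern_vanish_iff K hs hne).mp fun x hx => h x (subset_planeOf K hs hx)
  rw [dir_bern]
  refine ev_bern_eq_zero K (s := s) (fun β h1 h2 => ?_) hx
  refine Finset.sum_eq_zero fun v _ => ?_
  by_cases hv : v.1 ∈ s
  · rw [hc, mul_zero]
    · rw [sum_add_unit, h1]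
    · intro u hu
      rw [Pi.add_apply, h2 u hu, unit_of_ne]
      rintro rfl
      exact hu hv
  · rw [hw v hv, zero_mul]

theorem dir_congr (K : Cell T) {s : Finset E3} (hs : s ⊆ K.1) (hne : s.Nonempty) {p q : Poly}
    (h : ∀ x ∈ planeOf K s, ev p x = ev q x) {w : E3} (hw : IsTangent K s w) :
    ∀ x ∈ planeOf K s, ev (dir w p) x = ev (dir w q) x := by
  intro x hx
  have := dir_vanish K hs hne (p := p - q) (fun x hx => by rw [ev_sub, h x hx, sub_self]) hw x hx
  rw [dir_sub, ev_sub] at this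
  linarith

/-- If moving mass to the index `p` does not change the coefficients, they are determined by the
multi-index concentrated at `p`. -/
theorem eq_of_shift {ι : Type*} [Fintype ι] {p : ι} {P : (ι → ℕ) → Prop} {d : ℕ}
    {c : (ι → ℕ) → ℝ} (hP : ∀ β j, P (β + unit j) → P (β + unit p))
    (hc : ∀ β j, ∑ v, β v + 1 = d → j ≠ p → P (β + unit j) → c (β + unit j) = c (β + unit p))
    {α : ι → ℕ} (hα : ∑ v, α v = d) (hPα : P α) : c α = c (d • unit p) := by
  classical
  -- The induction variable is the mass that is not yet at `p`.
  induction h : d - α p using Nat.strong_induction_on generalizing α with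
  | _ n ih =>
    by_cases hj : ∃ j, j ≠ p ∧ α j ≠ 0
    · obtain ⟨j, hjp, hj⟩ := hj
      obtain ⟨β, rfl⟩ := exists_eq_add_unit hj
      have hs : ∑ v, β v + 1 = d := by
        rw [← hα]; simp [Finset.sum_add_distrib]
      have hle : β p ≤ ∑ v, β v :=
        Finset.single_le_sum (f := β) (fun _ _ => Nat.zero_le _) (Finset.mem_univ p)
      rw [hc β j hs hjp hPα]
      refine ih (d - (β + unit p) p) ?_ ?_ (hP _ _ hPα) rfl
      · rw [← h]; simp only [Pi.add_apply, unit_self, unit_of_ne (Ne.symm hjp)]; omega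
      · rw [← hs]; simp [Finset.sum_add_distrib]
    · push Not at hj
      congr 1
      ext v
      by_cases hv : v = p
      · subst hv
        rw [Finset.sum_eq_single v (fun b _ hb => hj b hb) (by simp)] at hα
        simp [hα]
      · simp [hj v hv, unit_of_ne hv]

theorem ev_bern_vertex (K : Cell T) (d : ℕ) (c : (K.1 → ℕ) → ℝ) (p : K.1)
    (h : ev (bern K d c) p.1 = 0) : c (d • unit p) = 0 := by
  have hs : ({p.1} : Finset E3) ⊆ K.1 := by simp
  refine (bern_vanish_iff K hs (by simp)).mp ?_ _ (sum_smul_unit d p) ?_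
  · intro x hx
    simp only [Finset.coe_singleton, convexHull_singleton, Set.mem_singleton_iff] at hx
    rwa [hx]
  · intro v hv
    have : v ≠ p := fun h => hv (by simp [h])
    simp [unit_of_ne this]

/-- A polynomial whose tangential derivatives vanish on a simplex and which vanishes at a vertex
vanishes on the simplex. -/
theorem vanish_of_dir (K : Cell T) {s : Finset E3} (hs : s ⊆ K.1) {p : K.1} (hp : p.1 ∈ s)
    {q : Poly} (h : ∀ j : K.1, j.1 ∈ s → ∀ x ∈ planeOf K s, ev (dir (j.1 - p.1) q) x = 0)
    (h0 : ev q p.1 = 0) : ∀ x ∈ planeOf K s, ev q x = 0 := by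
  intro x hx
  obtain ⟨d, hd⟩ := exists_deg q
  have hd1 : Deg ((d + 1 : ℕ) : ℤ) q := hd.mono (by push_cast; omega)
  obtain ⟨c, rfl⟩ := exists_bern K hd1
  refine ev_bern_eq_zero K (s := s) (fun α h1 h2 => ?_) hx
  rw [← ev_bern_vertex K _ c p h0]
  refine eq_of_shift (P := fun α => ∀ v : K.1, v.1 ∉ s → α v = 0) ?_ ?_ h1 h2
  · intro β j hβ v hv
    have := hβ v hv
    have hvp : v ≠ p := fun h => hv (h ▸ hp)
    simp only [Pi.add_apply, unit_of_ne hvp] at this ⊢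
    omega
  · intro β j hβd hj hβ
    have hjs : j.1 ∈ s := by
      by_contra hjs
      simpa using hβ j hjs
    have hz := (bern_vanish_iff K hs ⟨_, hp⟩).mp (by
        intro x hx
        rw [← dir_sub_bern K j p d c]
        exact h j hjs x (subset_planeOf K hs hx)) β (by omega) (fun v hv => by
          have := hβ v hv
          simp only [Pi.add_apply] at this
          omega)
    exact sub_eq_zero.mp hz

/-- The derivatives along the edges at `p` vanish to one order less, so by induction the
coefficients near the corner do not change when mass is moved to `p`; at the corner itself the
coefficient is a multiple of the value of the polynomial. -/
theorem coeff_eq_zero_of_vanishOrd (K : Cell T) (p : K.1) {m : ℕ} : ∀ {d : ℕ}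
    {c : (K.1 → ℕ) → ℝ}, VanishOrd p.1 m (bern K d c) →
    ∀ α : K.1 → ℕ, ∑ v, α v = d → d < α p + m → c α = 0 := by
  have hle : ∀ α : K.1 → ℕ, α p ≤ ∑ v, α v := fun α =>
    Finset.single_le_sum (f := α) (fun _ _ => Nat.zero_le _) (Finset.mem_univ p)
  induction m with
  | zero =>
    intro d c _ α hα h
    have := hle α
    omega
  | succ m ih =>
    intro d c hc α hα h
    rcases d with _ | d
    · rw [← ev_bern_vertex K 0 c p hc.1]
      congr 1
      ext v
      have := Finset.sum_eq_zero_iff.mp hα v (Finset.mem_univ v)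
      simp [this]
    · rw [← ev_bern_vertex K (d + 1) c p hc.1]
      refine eq_of_shift (P := fun α => d + 1 < α p + (m + 1)) ?_ ?_ hα h
      · intro β j hβ
        by_cases hjp : j = p
        · subst hjp; exact hβ
        · simp only [Pi.add_apply, unit_of_ne (Ne.symm hjp), unit_self] at hβ ⊢
          omega
      · intro β j hβd hj hβ
        have hz := ih (d := d) (c := fun β => c (β + unit j) - c (β + unit p)) (by
          rw [← dir_sub_bern]
          exact hc.dir _) β (by omega) (by
            simp only [Pi.add_apply, unit_of_ne (Ne.symm hj)] at hβ
            omega)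
        exact sub_eq_zero.mp hz

open Classical in
/-- The part of the coefficients that is supported in the simplex `s`. -/
noncomputable def res (K : Cell T) (s : Finset E3) (c : (K.1 → ℕ) → ℝ) (α : K.1 → ℕ) : ℝ :=
  if ∀ v : K.1, v.1 ∉ s → α v = 0 then c α else 0

theorem res_ne_zero {K : Cell T} {s : Finset E3} {c : (K.1 → ℕ) → ℝ} {α : K.1 → ℕ}
    (h : res K s c α ≠ 0) : (∀ v : K.1, v.1 ∉ s → α v = 0) ∧ c α ≠ 0 := by
  rw [res] at h
  split_ifs at h with h'
  · exact ⟨h', h⟩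
  · exact absurd rfl h

theorem res_of_mem {K : Cell T} {s : Finset E3} {c : (K.1 → ℕ) → ℝ} {α : K.1 → ℕ}
    (h : ∀ v : K.1, v.1 ∉ s → α v = 0) : res K s c α = c α := if_pos h

theorem ev_bern_res (K : Cell T) {s : Finset E3} (d : ℕ) (c : (K.1 → ℕ) → ℝ) {x : E3}
    (hx : x ∈ planeOf K s) : ev (bern K d (res K s c)) x = ev (bern K d c) x := by
  rw [← sub_eq_zero, ← ev_sub, ← bern_sub]
  refine ev_bern_eq_zero K (s := s) (fun α _ h => ?_) hx
  rw [Pi.sub_apply, res_of_mem h, sub_self]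

theorem bub_eq_prod (K : Cell T) {s : Finset E3} : bub K s = ∏ v ∈ sub K s, lam K v := by
  classical
  rw [bub, ← Finset.prod_filter]
  refine Finset.prod_congr ?_ fun _ _ => rfl
  ext v
  simp

theorem card_sub (K : Cell T) {s : Finset E3} (hs : s ⊆ K.1) : (sub K s).card = s.card := by
  refine Finset.card_bij (fun v _ => v.1) (fun v hv => by simpa using hv)
    (fun a _ b _ h => Subtype.ext h) fun b hb => ⟨⟨b, hs hb⟩, by simpa using hb, rfl⟩

theorem deg_bub (K : Cell T) {s : Finset E3} (hs : s ⊆ K.1) : Deg s.card (bub K s) := by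
  rw [bub_eq_prod, ← card_sub K hs]
  have : Deg (∑ _v ∈ sub K s, (1 : ℤ)) (∏ v ∈ sub K s, lam K v) :=
    Deg.prod fun v _ => deg_lam K v
  simpa using this

theorem ev_bub_eq_zero {K : Cell T} {s : Finset E3} {v : K.1} (hv : v.1 ∈ s) {x : E3}
    (hx : ev (lam K v) x = 0) : ev (bub K s) x = 0 := by
  rw [bub_eq_prod, ev_prod]
  exact Finset.prod_eq_zero (by simpa using hv) hx

/-- A polynomial all of whose Bernstein monomials are multiples of `(∏ λ)^m` is such a multiple. -/
theorem bern_eq_bub_mul (K : Cell T) {s : Finset E3} (hs : s ⊆ K.1) (m : ℕ) {d : ℕ}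
    {c : (K.1 → ℕ) → ℝ} (hc : ∀ α, ∑ v, α v = d → c α ≠ 0 → ∀ v : K.1, v.1 ∈ s → m ≤ α v) :
    ∃ q, Deg ((d : ℤ) - m * s.card) q ∧ bern K d c = bub K s ^ m * q ∧
      ∀ j : K.1, (∀ α, ∑ v, α v = d → c α ≠ 0 →
        ∃ v, v ≠ j ∧ (v.1 ∈ s → m < α v) ∧ (v.1 ∉ s → 0 < α v)) → ev q j.1 = 0 := by
  classical
  -- The exponents that remain after the bubble factor has been taken out of each monomial.
  let γ : (K.1 → ℕ) → K.1 → ℕ := fun α v => if v.1 ∈ s then α v - m else α v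
  refine ⟨∑ α ∈ idx Finset.univ d, MvPolynomial.C (c α / ∏ v, ((α v).factorial : ℝ)) *
    ∏ v, lam K v ^ γ α v, ?_, ?_, ?_⟩
  · refine Deg.sum fun α hα => ?_
    by_cases h0 : c α = 0
    · rw [h0]; simpa using deg_zero _
    refine Deg.C_mul _ ?_
    have h : Deg (∑ v, (γ α v : ℤ) * 1) (∏ v, lam K v ^ γ α v) :=
      Deg.prod fun v _ => (deg_lam K v).pow _
    refine h.mono ?_
    have h1 := mem_idx_univ.mp hα
    have h2 : ∀ v, (γ α v : ℤ) * 1 = (α v : ℤ) - if v.1 ∈ s then (m : ℤ) else 0 := by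
      intro v
      simp only [γ]
      split_ifs with hv
      · have := hc α h1 h0 v hv
        push_cast [Nat.cast_sub this]; ring
      · simp
    rw [Finset.sum_congr rfl fun v _ => h2 v, Finset.sum_sub_distrib, ← Finset.sum_filter,
      Finset.sum_const, ← h1, ← card_sub K hs]
    have : (Finset.univ.filter fun v : K.1 => v.1 ∈ s) = sub K s := by ext v; simp
    rw [this]
    simp [mul_comm]
  · rw [bern_eq_sum, Finset.mul_sum]
    refine Finset.sum_congr rfl fun α hα => ?_
    by_cases h0 : c α = 0
    · rw [h0]; simp
    rw [mul_left_comm]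
    congr 1
    rw [bub, ← Finset.prod_pow, ← Finset.prod_mul_distrib]
    refine Finset.prod_congr rfl fun v _ => ?_
    simp only [γ]
    split_ifs with hv
    · rw [← pow_add]
      have := hc α (mem_idx_univ.mp hα) h0 v hv
      congr 1; omega
    · simp
  -- The quotient vanishes at `j` because every remaining monomial still contains a barycentric
  -- coordinate of another vertex.
  · intro j hj
    rw [ev_sum]
    refine Finset.sum_eq_zero fun α hα => ?_
    by_cases h0 : c α = 0
    · rw [h0]; simp
    obtain ⟨v, hvj, h1, h2⟩ := hj α (mem_idx_univ.mp hα) h0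
    rw [ev_mul, ev_prod]
    have : ∏ v, ev (lam K v ^ γ α v) j.1 = 0 := by
      refine Finset.prod_eq_zero (Finset.mem_univ v) ?_
      rw [ev_pow, ev_lam_vertex, if_neg hvj, zero_pow]
      simp only [γ]
      split_ifs with hv
      · have := h1 hv; omega
      · have := h2 hv; omega
    rw [this, mul_zero]

theorem bern_mem_bubP (K : Cell T) {s : Finset E3} (hs : s ⊆ K.1) (m : ℕ) {d : ℕ} {e : ℤ}
    (he : (d : ℤ) - m * s.card ≤ e) {c : (K.1 → ℕ) → ℝ}
    (hc : ∀ α, ∑ v, α v = d → c α ≠ 0 → ∀ v : K.1, v.1 ∈ s → m ≤ α v) :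
    bern K d c ∈ bubP K s m e := by
  obtain ⟨q, h1, h2, -⟩ := bern_eq_bub_mul K hs m hc
  exact ⟨q, h1.mono he, h2⟩

end vanishing

/-! ## The Dirichlet integral -/

section dirichlet

/-- The solid simplex `{y ≥ 0, ∑ y ≤ 1}`. -/
def solid (n : ℕ) : Set (Fin n → ℝ) := {y | (∀ i, 0 ≤ y i) ∧ ∑ i, y i ≤ 1}

theorem isCompact_solid (n : ℕ) : IsCompact (solid n) := by
  refine IsCompact.of_isClosed_subset (isCompact_Icc (a := (0 : Fin n → ℝ)) (b := 1)) ?_ ?_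
  · refine IsClosed.inter ?_ ?_
    · exact isClosed_le (f := fun _ : Fin n → ℝ => (0 : Fin n → ℝ)) continuous_const continuous_id
    · exact isClosed_le (f := fun y : Fin n → ℝ => ∑ i, y i) (by fun_prop) continuous_const
  · intro y hy
    refine ⟨hy.1, fun i => ?_⟩
    exact (Finset.single_le_sum (fun j _ => hy.1 j) (Finset.mem_univ i)).trans hy.2

/-- The integrand of the Dirichlet integral. -/
noncomputable def dirichletFn (n a : ℕ) (β : Fin n → ℕ) (y : Fin n → ℝ) : ℝ :=
  (1 - ∑ i, y i) ^ a / a.factorial * ∏ i, (y i ^ β i / (β i).factorial)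

/-- Euler's beta integral. Integration by parts moves one exponent from `b` to `a`; the boundary
terms vanish, and the factorials absorb all constants. -/
theorem integral_beta (a b : ℕ) (c : ℝ) :
    ∫ t in (0 : ℝ)..c, (c - t) ^ a / a.factorial * (t ^ b / b.factorial) =
      c ^ (a + b + 1) / (a + b + 1).factorial := by
  induction b generalizing a with
  | zero =>
    have h : ∀ t ∈ Set.uIcc 0 c, HasDerivAt
        (fun t : ℝ => -((c - t) ^ (a + 1) / (a + 1).factorial))
        ((c - t) ^ a / a.factorial * (t ^ 0 / (Nat.factorial 0))) t := by
      intro t _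
      have h1 := (((hasDerivAt_id' t).const_sub c).fun_pow (a + 1)).div_const
        ((a + 1).factorial : ℝ)
      refine h1.fun_neg.congr_deriv ?_
      rw [Nat.factorial_succ]
      push_cast
      have : (a.factorial : ℝ) ≠ 0 := by positivity
      have : (a + 1 : ℝ) ≠ 0 := by positivity
      simp
      field_simp
    rw [intervalIntegral.integral_eq_sub_of_hasDerivAt h
      (Continuous.intervalIntegrable (by fun_prop) _ _)]
    simp
  | succ b ih =>
    have h : ∀ t ∈ Set.uIcc 0 c, HasDerivAt
        (fun t : ℝ => -((c - t) ^ (a + 1) / (a + 1).factorial * (t ^ (b + 1) / (b + 1).factorial)))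
        ((c - t) ^ a / a.factorial * (t ^ (b + 1) / (b + 1).factorial) -
          (c - t) ^ (a + 1) / (a + 1).factorial * (t ^ b / b.factorial)) t := by
      intro t _
      have h1 := (((hasDerivAt_id' t).const_sub c).fun_pow (a + 1)).div_const
        ((a + 1).factorial : ℝ)
      have h2 := ((hasDerivAt_id' t).fun_pow (b + 1)).div_const ((b + 1).factorial : ℝ)
      refine (h1.fun_mul h2).fun_neg.congr_deriv ?_
      rw [Nat.factorial_succ, Nat.factorial_succ]
      push_cast
      have : (a.factorial : ℝ) ≠ 0 := by positivity
      have : (b.factorial : ℝ) ≠ 0 := by positivity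
      have : (a + 1 : ℝ) ≠ 0 := by positivity
      have : (b + 1 : ℝ) ≠ 0 := by positivity
      simp
      field_simp
      ring
    have h3 := intervalIntegral.integral_eq_sub_of_hasDerivAt h
      (Continuous.intervalIntegrable (by fun_prop) _ _)
    rw [intervalIntegral.integral_sub (Continuous.intervalIntegrable (by fun_prop) _ _)
      (Continuous.intervalIntegrable (by fun_prop) _ _), ih (a + 1)] at h3
    simp only [sub_self, ne_eq, Nat.add_eq_zero_iff, one_ne_zero, and_false, not_false_eq_true,
      zero_pow, zero_div, zero_mul, mul_zero, neg_zero] at h3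
    rw [sub_eq_zero.mp h3]
    rw [show a + 1 + b + 1 = a + (b + 1) + 1 by ring]

theorem continuous_dirichletFn (n a : ℕ) (β : Fin n → ℕ) : Continuous (dirichletFn n a β) := by
  unfold dirichletFn
  fun_prop

/-- Fubini: integrating out one coordinate is a beta integral, which adds its exponent plus one to
`a`. With this normalization the value depends only on the total exponent, so all Bernstein
coefficients have the same weight in an integral. -/
theorem integral_dirichlet (n a : ℕ) (β : Fin n → ℕ) :
    ∫ y in solid n, dirichletFn n a β y = 1 / ((a + ∑ i, β i + n).factorial : ℝ) := by
  induction n generalizing a with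
  | zero =>
    have h : solid 0 = Set.univ := by ext y; simp [solid]
    rw [h, Measure.restrict_univ, Measure.volume_pi_eq_dirac (x := 0), integral_dirac]
    simp [dirichletFn]
  | succ n ih =>
    have hms : ∀ m, MeasurableSet (solid m) := fun m => (isCompact_solid m).measurableSet
    set e := MeasurableEquiv.piFinSuccAbove (fun _ : Fin (n + 1) => ℝ) 0 with he
    have hmp := volume_preserving_piFinSuccAbove (fun _ : Fin (n + 1) => ℝ) 0
    set G : (Fin (n + 1) → ℝ) → ℝ := (solid (n + 1)).indicator (dirichletFn (n + 1) a β) with hG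
    have hGi : Integrable G := by
      rw [hG, integrable_indicator_iff (hms _)]
      exact (continuous_dirichletFn _ _ _).continuousOn.integrableOn_compact (isCompact_solid _)
    have h1 : ∫ y in solid (n + 1), dirichletFn (n + 1) a β y = ∫ y, G y :=
      (integral_indicator (hms _)).symm
    have h2 : ∫ y, G y = ∫ z : ℝ × (Fin n → ℝ), G (e.symm z) :=
      ((hmp.symm).integral_comp e.symm.measurableEmbedding G).symm
    have hint : Integrable (fun z : ℝ × (Fin n → ℝ) => G (e.symm z)) (volume.prod volume) :=
      ((hmp.symm).integrable_comp_emb e.symm.measurableEmbedding).mpr hGi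
    rw [h1, h2, Measure.volume_eq_prod, integral_prod_symm _ hint]
    have hes : ∀ t y, e.symm (t, y) = (Fin.cons t y : Fin (n + 1) → ℝ) := by
      intro t y
      rw [he]
      ext i
      refine Fin.cases ?_ (fun j => ?_) i <;> simp [MeasurableEquiv.piFinSuccAbove]
    -- For fixed `y` the remaining coordinate runs over `[0, 1 - ∑ y]`, which is empty or degenerate
    -- unless `y` lies in the smaller solid simplex or on its boundary.
    have hin : ∀ y : Fin n → ℝ, ∫ t, G (e.symm (t, y)) =
        (solid n).indicator (dirichletFn n (a + β 0 + 1) fun i => β i.succ) y := by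
      intro y
      have hmem : ∀ t, (Fin.cons t y : Fin (n + 1) → ℝ) ∈ solid (n + 1) ↔
          y ∈ solid n ∧ t ∈ Set.Icc 0 (1 - ∑ i, y i) := by
        intro t
        simp only [solid, Set.mem_ofPred_eq, Fin.forall_fin_succ, Fin.cons_zero, Fin.cons_succ,
          Fin.sum_univ_succ, Set.mem_Icc]
        constructor
        · rintro ⟨⟨h1, h2⟩, h3⟩
          exact ⟨⟨h2, by linarith⟩, h1, by linarith⟩
        · rintro ⟨⟨h1, h2⟩, h3, h4⟩
          exact ⟨⟨h3, h1⟩, by linarith⟩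
      by_cases hy : y ∈ solid n
      · rw [Set.indicator_of_mem hy]
        have hc : 0 ≤ 1 - ∑ i, y i := by linarith [hy.2]
        have : ∀ t, G (e.symm (t, y)) = (Set.Icc 0 (1 - ∑ i, y i)).indicator
            (fun t => ((1 - ∑ i, y i) - t) ^ a / a.factorial * (t ^ β 0 / (β 0).factorial) *
              ∏ i, (y i ^ β i.succ / (β i.succ).factorial)) t := by
          intro t
          rw [hes]
          by_cases ht : t ∈ Set.Icc 0 (1 - ∑ i, y i)
          · rw [hG, Set.indicator_of_mem ((hmem t).mpr ⟨hy, ht⟩), Set.indicator_of_mem ht,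
              dirichletFn, Fin.sum_univ_succ, Fin.prod_univ_succ]
            simp only [Fin.cons_zero, Fin.cons_succ]
            rw [mul_assoc, sub_add_eq_sub_sub_swap]
          · rw [hG, Set.indicator_of_notMem (fun h => ht ((hmem t).mp h).2),
              Set.indicator_of_notMem ht]
        simp only [this]
        rw [integral_indicator measurableSet_Icc, integral_Icc_eq_integral_Ioc,
          ← intervalIntegral.integral_of_le hc, intervalIntegral.integral_mul_const,
          integral_beta, dirichletFn]
      · rw [Set.indicator_of_notMem hy]
        have : ∀ t, G (e.symm (t, y)) = 0 := fun t => by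
          rw [hes]
          exact Set.indicator_of_notMem (fun h => hy ((hmem t).mp h).1) _
        simp [this]
    simp only [hin]
    rw [integral_indicator (hms _), ih]
    congr 3
    rw [Fin.sum_univ_succ]
    ring

end dirichlet

/-! ## Integration over simplices -/

section simplex

open scoped Topology

/-- The parametrization `y ↦ v₀ + ∑ yᵢ (vᵢ - v₀)` of a simplex. -/
noncomputable def param {n : ℕ} (v : Fin (n + 1) → E3) (y : Fin n → ℝ) : E3 :=
  v 0 + ∑ i, y i • (v i.succ - v 0)

theorem continuous_param {n : ℕ} (v : Fin (n + 1) → E3) : Continuous (param v) := by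
  unfold param
  fun_prop

/-- The Hausdorff measure on a parametrized simplex is a multiple of the Lebesgue measure. -/
theorem comap_param {n : ℕ} (v : Fin (n + 1) → E3) (hv : Function.Injective (param v)) :
    ∃ κ : ℝ, 0 < κ ∧ (Measure.euclideanHausdorffMeasure n : Measure E3).comap (param v) =
      ENNReal.ofReal κ • (volume : Measure (Fin n → ℝ)) := by
  let f : EuclideanSpace ℝ (Fin n) →ₗ[ℝ] E3 :=
    { toFun := fun y => ∑ i, y i • (v i.succ - v 0)
      map_add' := fun x y => by simp [add_smul, Finset.sum_add_distrib]
      map_smul' := fun r x => by simp [mul_smul, Finset.smul_sum] }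
  have hp : ∀ y, param v y = v 0 + f (WithLp.toLp 2 y) := fun y => rfl
  have hinj : Function.Injective f := by
    intro x y hxy
    have : param v x.ofLp = param v y.ofLp := by rw [hp, hp]; simp [hxy]
    exact WithLp.ofLp_injective 2 (hv this)
  have hemb := (continuous_param v).measurableEmbedding hv
  -- The factor is the volume of the parallelepiped spanned by the edges at the base vertex. Only
  -- its positivity is used later.
  refine ⟨f.normDet, lt_of_le_of_ne f.normDet_nonneg (Ne.symm ?_), ?_⟩
  · rw [Ne, LinearMap.normDet_eq_zero_iff_ker_ne_bot, not_not]
    exact LinearMap.ker_eq_bot.mpr hinj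
  · refine Measure.ext fun s hs => ?_
    rw [hemb.comap_apply, Measure.smul_apply, smul_eq_mul]
    have himg : param v '' s = (fun x => v 0 + x) '' (f '' (WithLp.toLp 2 '' s)) := by
      rw [Set.image_image, Set.image_image]
      rfl
    have hiso : Isometry (fun x : E3 => v 0 + x) := isometry_add_left _
    rw [himg, hiso.euclideanHausdorffMeasure_image]
    have h := f.euclideanHausdorffMeasure_image_eq_normDet_mul_volume (WithLp.toLp 2 '' s)
    rw [finrank_euclideanSpace_fin] at h
    rw [h]
    congr 1
    have hpre : WithLp.toLp 2 '' s = (MeasurableEquiv.toLp 2 (Fin n → ℝ)).symm ⁻¹' s := by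
      ext x
      constructor
      · rintro ⟨y, hy, rfl⟩; exact hy
      · intro hx; exact ⟨x.ofLp, hx, rfl⟩
    rw [hpre]
    exact (PiLp.volume_preserving_ofLp (Fin n)).measure_preimage hs.nullMeasurableSet

end simplex

/-! ### The inner products on subsimplices of a cell -/

section inner

theorem ev_lam_add (K : Cell T) (w : K.1) (x u : E3) :
    ev (lam K w) (x + u) = ev (lam K w) x + slope K u w := by
  rw [ev_lam, ev_lam, slope, add_comm x u, ← vadd_eq_add u x, AffineMap.map_vadd, vadd_eq_add,
    add_comm]

theorem slope_sum {ι : Type*} (K : Cell T) (t : Finset ι) (u : ι → E3) (w : K.1) :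
    slope K (∑ i ∈ t, u i) w = ∑ i ∈ t, slope K (u i) w := map_sum _ _ _

theorem eq_of_ev_lam {K : Cell T} {x y : E3} (h : ∀ w, ev (lam K w) x = ev (lam K w) y) :
    x = y := by
  rw [← sum_ev_lam_smul K x, ← sum_ev_lam_smul K y]
  simp only [h]

/-- The barycentric coordinates of the points of a parametrized simplex. -/
theorem ev_lam_param (K : Cell T) {n : ℕ} (e : Fin (n + 1) → K.1) (y : Fin n → ℝ) (w : K.1) :
    ev (lam K w) (param (fun i => (e i).1) y) =
      ev (lam K w) (e 0).1 + ∑ i, y i * (ev (lam K w) (e i.succ).1 - ev (lam K w) (e 0).1) := by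
  classical
  rw [param, ev_lam_add, slope_sum]
  congr 1
  refine Finset.sum_congr rfl fun i _ => ?_
  rw [slope_smul, slope_sub, ev_lam_vertex, ev_lam_vertex]

/-- Once the vertices of `s` are numbered, the parameters are the barycentric coordinates of all
vertices but the base one, which receives the complement to one. -/
theorem exists_param (K : Cell T) {s : Finset E3} (hs : s ⊆ K.1) {n : ℕ} (hn : s.card = n + 1) :
    ∃ e : Fin (n + 1) → K.1, Function.Injective e ∧ (∀ w, w.1 ∈ s ↔ ∃ i, e i = w) ∧
      ∀ y : Fin n → ℝ, ev (lam K (e 0)) (param (fun i => (e i).1) y) = 1 - ∑ i, y i ∧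
        (∀ i : Fin n, ev (lam K (e i.succ)) (param (fun i => (e i).1) y) = y i) ∧
        ∀ w : K.1, w.1 ∉ s → ev (lam K w) (param (fun i => (e i).1) y) = 0 := by
  classical
  have hc : (sub K s).card = n + 1 := by rw [card_sub K hs, hn]
  let e' := (sub K s).equivFinOfCardEq hc
  refine ⟨fun i => (e'.symm i).1, fun i j h => e'.symm.injective (Subtype.ext h), fun w => ?_,
    fun y => ⟨?_, fun i => ?_, fun w hw => ?_⟩⟩
  · constructor
    · intro hw
      exact ⟨e' ⟨w, by simpa using hw⟩, by simp⟩
    · rintro ⟨i, rfl⟩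
      exact mem_sub.mp (e'.symm i).2
  · rw [ev_lam_param]
    simp only [ev_lam_vertex, if_true]
    rw [sub_eq_add_neg, ← Finset.sum_neg_distrib]
    congr 1
    refine Finset.sum_congr rfl fun i _ => ?_
    rw [if_neg]
    · ring
    · intro h
      exact (Fin.succ_ne_zero i).symm (e'.symm.injective (Subtype.ext h))
  · rw [ev_lam_param]
    simp only [ev_lam_vertex]
    rw [if_neg, Finset.sum_eq_single i]
    · simp
    · intro j _ hj
      rw [if_neg]
      · ring
      · intro h
        exact hj (Fin.succ_injective _ (e'.symm.injective (Subtype.ext h))).symm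
    · simp
    · intro h
      exact Fin.succ_ne_zero i (e'.symm.injective (Subtype.ext h))
  · rw [ev_lam_param]
    have : ∀ i, ev (lam K w) (e'.symm i).1.1 = 0 := by
      intro i
      rw [ev_lam_vertex, if_neg]
      rintro rfl
      exact hw (mem_sub.mp (e'.symm i).2)
    simp [this]

/-- Parametrization of a simplex together with its measure. -/
theorem restrict_simplex (K : Cell T) {s : Finset E3} (hs : s ⊆ K.1) {n : ℕ}
    (hn : s.card = n + 1) :
    ∃ (e : Fin (n + 1) → K.1) (κ : ℝ), 0 < κ ∧ Function.Injective e ∧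
      (∀ w, w.1 ∈ s ↔ ∃ i, e i = w) ∧
      (∀ y : Fin n → ℝ, ev (lam K (e 0)) (param (fun i => (e i).1) y) = 1 - ∑ i, y i ∧
        (∀ i : Fin n, ev (lam K (e i.succ)) (param (fun i => (e i).1) y) = y i) ∧
        ∀ w : K.1, w.1 ∉ s → ev (lam K w) (param (fun i => (e i).1) y) = 0) ∧
      MeasurableEmbedding (param fun i => (e i).1) ∧
      (Measure.euclideanHausdorffMeasure n : Measure E3).restrict (convexHull ℝ (s : Set E3)) =
        ENNReal.ofReal κ •
          ((volume : Measure (Fin n → ℝ)).restrict (solid n)).map (param fun i => (e i).1) := by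
  obtain ⟨e, hinj, hmem, hlam⟩ := exists_param K hs hn
  set Φ := param fun i => (e i).1 with hΦ
  have hΦi : Function.Injective Φ := by
    intro y z h
    ext i
    rw [← (hlam y).2.1 i, ← (hlam z).2.1 i, h]
  obtain ⟨κ, hκ, hcom⟩ := comap_param (fun i => (e i).1) hΦi
  have hemb := (continuous_param fun i => (e i).1).measurableEmbedding hΦi
  refine ⟨e, κ, hκ, hinj, hmem, hlam, hemb, ?_⟩
  have hpre : Φ ⁻¹' convexHull ℝ (s : Set E3) = solid n := by
    ext y
    rw [Set.mem_preimage, mem_convexHull_iff K hs]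
    constructor
    · rintro ⟨h, -⟩
      refine ⟨fun i => ?_, ?_⟩
      · rw [← (hlam y).2.1 i]; exact h _
      · have := h (e 0)
        rw [(hlam y).1] at this
        linarith
    · intro hy
      refine ⟨fun w => ?_, (hlam y).2.2⟩
      by_cases hw : w.1 ∈ s
      · obtain ⟨i, rfl⟩ := (hmem w).mp hw
        refine Fin.cases ?_ (fun j => ?_) i
        · rw [(hlam y).1]; linarith [hy.2]
        · rw [(hlam y).2.1 j]; exact hy.1 j
      · rw [(hlam y).2.2 w hw]
  have hran : convexHull ℝ (s : Set E3) ⊆ Set.range Φ := by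
    intro x hx
    obtain ⟨-, h2⟩ := (mem_convexHull_iff K hs x).mp hx
    refine ⟨fun i => ev (lam K (e i.succ)) x, eq_of_ev_lam (K := K) fun w => ?_⟩
    by_cases hw : w.1 ∈ s
    · obtain ⟨i, rfl⟩ := (hmem w).mp hw
      refine Fin.cases ?_ (fun j => ?_) i
      · rw [(hlam _).1]
        have hsum : ∑ w, ev (lam K w) x = ∑ i, ev (lam K (e i)) x := by
          classical
          rw [← Finset.sum_image (s := Finset.univ) (g := e) (f := fun w => ev (lam K w) x)
            fun a _ b _ h => hinj h]
          refine (Finset.sum_subset (Finset.subset_univ _) fun w _ hw => h2 w fun hws => hw ?_).symm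
          obtain ⟨i, rfl⟩ := (hmem w).mp hws
          simp
        rw [sum_ev_lam, Fin.sum_univ_succ] at hsum
        linarith
      · rw [(hlam _).2.1 j]
    · rw [(hlam _).2.2 w hw, h2 w hw]
  have hmeas : MeasurableSet (convexHull ℝ (s : Set E3)) :=
    ((Finset.finite_toSet s).isCompact_convexHull ℝ).measurableSet
  have h1 := hemb.map_comap (Measure.euclideanHausdorffMeasure n : Measure E3)
  rw [hcom] at h1
  have h2 := congrArg (fun μ => Measure.restrict μ (convexHull ℝ (s : Set E3))) h1
  simp only at h2
  rw [Measure.restrict_restrict hmeas, Set.inter_eq_left.mpr hran] at h2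
  rw [← h2, Measure.map_smul, Measure.restrict_smul, hemb.restrict_map]
  congr 3

theorem card_pos_eq {s : Finset E3} (hne : s.Nonempty) : s.card = (s.card - 1) + 1 := by
  have := hne.card_pos
  omega

theorem integrableOn_ev (K : Cell T) {s : Finset E3} (hs : s ⊆ K.1) (hne : s.Nonempty) (p : Poly) :
    IntegrableOn (fun x => ev p x) (convexHull ℝ (s : Set E3))
      (Measure.euclideanHausdorffMeasure (s.card - 1)) := by
  obtain ⟨e, κ, hκ, -, -, -, hemb, hμ⟩ := restrict_simplex K hs (card_pos_eq hne)
  rw [IntegrableOn, hμ]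
  refine Integrable.smul_measure ?_ ENNReal.ofReal_ne_top
  rw [hemb.integrable_map_iff]
  exact ((continuous_ev p).comp (continuous_param _)).continuousOn.integrableOn_compact
    (isCompact_solid _)

theorem ipS_eq (s : Finset E3) (p q : Poly) : ipS s p q = ipS s (p * q) 1 := by
  simp [ipS]

theorem ipS_comm (s : Finset E3) (p q : Poly) : ipS s p q = ipS s q p := by
  simp [ipS, mul_comm]

theorem ipS_add_left (K : Cell T) {s : Finset E3} (hs : s ⊆ K.1) (hne : s.Nonempty)
    (p q r : Poly) : ipS s (p + q) r = ipS s p r + ipS s q r := by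
  simp only [ipS]
  rw [← integral_add]
  · simp [add_mul]
  · simpa only [ev_mul] using (integrableOn_ev K hs hne (p * r)).integrable
  · simpa only [ev_mul] using (integrableOn_ev K hs hne (q * r)).integrable

theorem ipS_smul_left (s : Finset E3) (a : ℝ) (p r : Poly) :
    ipS s (a • p) r = a * ipS s p r := by
  simp only [ipS]
  rw [← integral_const_mul]
  simp [mul_assoc]

theorem ipS_self_nonneg (s : Finset E3) (p : Poly) : 0 ≤ ipS s p p :=
  integral_nonneg fun _ => mul_self_nonneg _

theorem ipS_congr (K : Cell T) {s : Finset E3} (hs : s ⊆ K.1) {p p' q q' : Poly}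
    (hp : ∀ x ∈ planeOf K s, ev p x = ev p' x) (hq : ∀ x ∈ planeOf K s, ev q x = ev q' x) :
    ipS s p q = ipS s p' q' := by
  refine setIntegral_congr_fun ((Finset.finite_toSet s).isCompact_convexHull ℝ).measurableSet ?_
  intro x hx
  have := subset_planeOf K hs hx
  simp only [hp x this, hq x this]

/-- The inner product on a simplex is definite. -/
theorem ev_eq_zero_of_ipS_self (K : Cell T) {s : Finset E3} (hs : s ⊆ K.1) (hne : s.Nonempty)
    {p : Poly} (h : ipS s p p = 0) : ∀ x ∈ planeOf K s, ev p x = 0 := by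
  refine fun x hx => vanish_planeOf K hs hne (fun x hx => ?_) hx
  obtain ⟨e, κ, hκ, hinj, hmem, hlam, hemb, hμ⟩ := restrict_simplex K hs (card_pos_eq hne)
  rw [ipS, hμ, integral_smul_measure, hemb.integral_map, smul_eq_mul] at h
  have hκ' : (ENNReal.ofReal κ).toReal ≠ 0 := by rw [ENNReal.toReal_ofReal hκ.le]; exact hκ.ne'
  have h0 := (mul_eq_zero.mp h).resolve_left hκ'
  set g : (Fin (s.card - 1) → ℝ) → ℝ := fun y => ev p (param (fun i => (e i).1) y) with hg
  have hgc : Continuous g := (continuous_ev p).comp (continuous_param _)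
  have hae := (integral_eq_zero_iff_of_nonneg (fun y => mul_self_nonneg (g y))
    ((hgc.mul hgc).continuousOn.integrableOn_compact (isCompact_solid _))).mp h0
  -- On the open simplex a continuous function that is zero almost everywhere is zero at every
  -- point, and `vanish_planeOf` needs no more than that.
  set U : Set (Fin (s.card - 1) → ℝ) := {y | (∀ i, 0 < y i) ∧ ∑ i, y i < 1} with hU
  have hUo : IsOpen U := by
    refine IsOpen.inter ?_ ?_
    · have : {y : Fin (s.card - 1) → ℝ | ∀ i, 0 < y i} = ⋂ i, {y | 0 < y i} := by ext; simp
      change IsOpen {y : Fin (s.card - 1) → ℝ | ∀ i, 0 < y i}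
      rw [this]
      exact isOpen_iInter_of_finite fun i => isOpen_lt continuous_const (continuous_apply i)
    · exact isOpen_lt (f := fun y : Fin (s.card - 1) → ℝ => ∑ i, y i) (by fun_prop)
        continuous_const
  have hUs : U ⊆ solid _ := fun y hy => ⟨fun i => (hy.1 i).le, hy.2.le⟩
  have hz := Measure.eqOn_open_of_ae_eq (ae_restrict_of_ae_restrict_of_subset hUs hae) hUo
    (hgc.mul hgc).continuousOn continuousOn_const
  set y : Fin (s.card - 1) → ℝ := fun i => ev (lam K (e i.succ)) x with hy
  have hsum : ∑ w, ev (lam K w) x = ∑ i, ev (lam K (e i)) x := by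
    classical
    rw [← Finset.sum_image (s := Finset.univ) (g := e) (f := fun w => ev (lam K w) x)
      fun a _ b _ h => hinj h]
    refine (Finset.sum_subset (Finset.subset_univ _) fun w _ hw => hx.2 w fun hws => hw ?_).symm
    obtain ⟨i, rfl⟩ := (hmem w).mp hws
    simp
  rw [sum_ev_lam, Fin.sum_univ_succ] at hsum
  have hpar : param (fun i => (e i).1) y = x := by
    refine eq_of_ev_lam (K := K) fun w => ?_
    by_cases hw : w.1 ∈ s
    · obtain ⟨i, rfl⟩ := (hmem w).mp hw
      refine Fin.cases ?_ (fun j => ?_) i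
      · rw [(hlam _).1]
        linarith
      · rw [(hlam _).2.1 j]
    · rw [(hlam _).2.2 w hw, hx.2 w hw]
  have hyU : y ∈ U := by
    refine ⟨fun i => hx.1 _ ((hmem _).mpr ⟨_, rfl⟩), ?_⟩
    have := hx.1 (e 0) ((hmem _).mpr ⟨_, rfl⟩)
    linarith
  have h3 : g y * g y = 0 := hz hyU
  rw [hg] at h3
  simp only [hpar] at h3
  exact mul_self_eq_zero.mp h3

/-- The mean value of a polynomial is determined by the sum of its Bernstein coefficients. -/
theorem ipS_bern (K : Cell T) {s : Finset E3} (hs : s ⊆ K.1) (hne : s.Nonempty) :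
    ∃ C : ℕ → ℝ, (∀ d, 0 < C d) ∧
      ∀ d c, ipS s (bern K d c) 1 = C d * ∑ α ∈ idx (sub K s) d, c α := by
  classical
  obtain ⟨e, κ, hκ, hinj, hmem, hlam, hemb, hμ⟩ := restrict_simplex K hs (card_pos_eq hne)
  -- The Dirichlet integrals of all normalized monomials of degree `d` coincide, hence a single
  -- constant for each degree.
  refine ⟨fun d => κ * (1 / (d + (s.card - 1)).factorial), fun d => by positivity, fun d c => ?_⟩
  rw [ipS, hμ, integral_smul_measure, hemb.integral_map, smul_eq_mul,
    ENNReal.toReal_ofReal hκ.le, mul_assoc]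
  congr 1
  have hsup : ∀ (f : K.1 → ℕ), (∀ v : K.1, v.1 ∉ s → f v = 0) → ∑ w, f w = ∑ i, f (e i) := by
    intro f hf
    rw [← Finset.sum_image (s := Finset.univ) (g := e) (f := f) fun a _ b _ h => hinj h]
    refine (Finset.sum_subset (Finset.subset_univ _) fun w _ hw => hf w fun hws => hw ?_).symm
    obtain ⟨i, rfl⟩ := (hmem w).mp hws
    simp
  have hval : ∀ y, ev (bern K d c) (param (fun i => (e i).1) y) * ev 1
      (param (fun i => (e i).1) y) = ∑ α ∈ idx (sub K s) d,
        c α * dirichletFn (s.card - 1) (α (e 0)) (fun i => α (e i.succ)) y := by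
    intro y
    rw [ev_one, mul_one, ev_bern, eval_homPoly]
    have hsubset : idx (sub K s) d ⊆ idx Finset.univ d := fun α hα =>
      mem_idx_univ.mpr (mem_idx.mp hα).1
    rw [← Finset.sum_subset hsubset]
    · refine Finset.sum_congr rfl fun α hα => ?_
      have hα0 := (mem_idx_sub.mp hα).2
      have hprod : ∀ f : K.1 → ℝ, (∀ v : K.1, v.1 ∉ s → f v = 1) → ∏ w, f w = ∏ i, f (e i) := by
        intro f hf
        rw [← Finset.prod_image (s := Finset.univ) (g := e) (f := f) fun a _ b _ h => hinj h]
        refine (Finset.prod_subset (Finset.subset_univ _) fun w _ hw => hf w fun hws => hw ?_).symm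
        obtain ⟨i, rfl⟩ := (hmem w).mp hws
        simp
      rw [div_mul_eq_mul_div, mul_div_assoc, ← Finset.prod_div_distrib, dirichletFn]
      congr 1
      rw [hprod _ fun v hv => by simp [hα0 v hv], Fin.prod_univ_succ, (hlam y).1]
      simp only [(hlam y).2.1]
    · intro α hα hα'
      have hαd := mem_idx_univ.mp hα
      have : ∃ v : K.1, v.1 ∉ s ∧ α v ≠ 0 := by
        by_contra hcon
        push Not at hcon
        exact hα' (mem_idx_sub.mpr ⟨hαd, hcon⟩)
      obtain ⟨v, hv, hv0⟩ := this
      have : ∏ v, ev (lam K v) (param (fun i => (e i).1) y) ^ α v = 0 :=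
        Finset.prod_eq_zero (Finset.mem_univ v) (by rw [(hlam y).2.2 v hv, zero_pow hv0])
      rw [this, mul_zero]
  simp only [hval]
  rw [integral_finsetSum _ fun α _ => ?_, Finset.mul_sum]
  · refine Finset.sum_congr rfl fun α hα => ?_
    rw [integral_const_mul, integral_dirichlet, mul_comm]
    congr 3
    obtain ⟨h1, h2⟩ := mem_idx_sub.mp hα
    rw [← h1, hsup α h2, Fin.sum_univ_succ]
  · exact ((continuous_dirichletFn _ _ _).continuousOn.integrableOn_compact
      (isCompact_solid _)).const_mul _

end inner

/-! ### Moments in Bernstein form and Stokes' theorem on edges and triangles -/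

section moments

theorem X_mul_homPoly {ι : Type*} [Fintype ι] (d : ℕ) (c : (ι → ℕ) → ℝ) (j : ι) :
    MvPolynomial.X j * homPoly d c =
      homPoly (d + 1) fun α => α j * c (α - unit j) := by
  classical
  ext m
  rw [MvPolynomial.coeff_X_mul', coeff_homPoly]
  by_cases hj : m j = 0
  · rw [if_neg (by simpa using hj), coeff_homPoly]
    simp [hj]
  · rw [if_pos (by simpa using hj), coeff_homPoly]
    obtain ⟨β, hβ⟩ := exists_eq_add_unit hj
    have h1 : (⇑(m - Finsupp.single j 1 : ι →₀ ℕ) : ι → ℕ) = β := by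
      ext v
      have := congrFun hβ v
      by_cases hv : v = j
      · subst hv; simp at this ⊢; omega
      · simp [Ne.symm hv, this, unit_of_ne hv]
    have h2 : (⇑m : ι → ℕ) - unit j = β := by rw [hβ]; ext v; simp
    have h3 : ∏ i, ((m i).factorial : ℝ) = (β j + 1) * ∏ i, ((β i).factorial : ℝ) := by
      rw [← Finset.mul_prod_erase _ _ (Finset.mem_univ j),
        ← Finset.mul_prod_erase _ (fun i => ((β i).factorial : ℝ)) (Finset.mem_univ j), ← mul_assoc]
      congr 1
      · rw [hβ]; simp [Nat.factorial_succ]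
      · refine Finset.prod_congr rfl fun i hi => ?_
        rw [hβ, Pi.add_apply, unit_of_ne (Finset.ne_of_mem_erase hi), add_zero]
    have h4 : ∑ v, m v = ∑ v, β v + 1 := by
      rw [← sum_add_unit β j, ← hβ]
    rw [h2, h3, h4]
    have h5 : m j = β j + 1 := by rw [hβ]; simp
    simp only [h1, h5, add_left_inj]
    split_ifs
    · have : (β j + 1 : ℝ) ≠ 0 := by positivity
      have : (∏ i, ((β i).factorial : ℝ)) ≠ 0 := by positivity
      push_cast
      field_simp
    · rfl

theorem lam_mul_bern (K : Cell T) (d : ℕ) (c : (K.1 → ℕ) → ℝ) (j : K.1) :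
    lam K j * bern K d c = bern K (d + 1) fun α => α j * c (α - unit j) := by
  rw [bern, bern, ← X_mul_homPoly, map_mul, MvPolynomial.aeval_X]

theorem sum_idx_shift {ι : Type*} [Fintype ι] {s : Finset ι} {j : ι} (hj : j ∈ s) (d : ℕ)
    (c : (ι → ℕ) → ℝ) : ∑ α ∈ (idx s (d + 1)).filter (fun α => α j ≠ 0), c α =
      ∑ β ∈ idx s d, c (β + unit j) := by
  symm
  refine Finset.sum_bij (fun β _ => β + unit j) ?_ ?_ ?_ fun _ _ => rfl
  · intro β hβ
    obtain ⟨h1, h2⟩ := mem_idx.mp hβ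
    rw [Finset.mem_filter, mem_idx, sum_add_unit, h1]
    refine ⟨⟨rfl, fun v hv => ?_⟩, by simp⟩
    rw [Pi.add_apply, h2 v hv, unit_of_ne]
    rintro rfl
    exact hv hj
  · intro β _ β' _ h
    exact add_right_cancel h
  · intro α hα
    rw [Finset.mem_filter, mem_idx] at hα
    obtain ⟨⟨h1, h2⟩, h3⟩ := hα
    obtain ⟨β, rfl⟩ := exists_eq_add_unit h3
    refine ⟨β, mem_idx.mpr ⟨?_, fun v hv => ?_⟩, rfl⟩
    · rw [sum_add_unit] at h1; omega
    · have := h2 v hv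
      simp only [Pi.add_apply] at this
      omega

/-- The shifted multi-indices are those with a positive entry at `j`, and the missing ones live on
the facet opposite to `j`. In a difference of two such sums only facet terms survive: this is the
fundamental theorem of calculus for Bernstein coefficients. -/
theorem sum_idx_add_unit {ι : Type*} [Fintype ι] [DecidableEq ι] {s : Finset ι} {j : ι}
    (hj : j ∈ s) (d : ℕ) (c : (ι → ℕ) → ℝ) : ∑ β ∈ idx s d, c (β + unit j) =
      ∑ α ∈ idx s (d + 1), c α - ∑ α ∈ idx (s.erase j) (d + 1), c α := by
  rw [← sum_idx_shift hj, eq_sub_iff_add_eq,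
    ← Finset.sum_filter_add_sum_filter_not (idx s (d + 1)) (fun α => α j ≠ 0)]
  congr 1
  refine Finset.sum_congr ?_ fun _ _ => rfl
  ext α
  rw [Finset.mem_filter, mem_idx, mem_idx]
  constructor
  · rintro ⟨h1, h2⟩
    refine ⟨⟨h1, fun v hv => h2 v fun h => hv (Finset.mem_of_mem_erase h)⟩, ?_⟩
    simpa using h2 j (by simp)
  · rintro ⟨⟨h1, h2⟩, h3⟩
    refine ⟨h1, fun v hv => ?_⟩
    by_cases hvj : v = j
    · subst hvj; simpa using h3
    · exact h2 v fun h => hv (Finset.mem_erase.mpr ⟨hvj, h⟩)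

theorem eq_unit_of_sum_eq_one {ι : Type*} [Fintype ι] {α : ι → ℕ} (h : ∑ v, α v = 1) :
    ∃ j, α = unit j := by
  obtain ⟨j, -, hj⟩ : ∃ j ∈ Finset.univ, α j ≠ 0 := by
    by_contra hcon
    push Not at hcon
    rw [Finset.sum_eq_zero hcon] at h
    exact zero_ne_one h
  obtain ⟨β, rfl⟩ := exists_eq_add_unit hj
  rw [sum_add_unit] at h
  have h0 : ∑ v, β v = 0 := by omega
  refine ⟨j, ?_⟩
  ext v
  have := Finset.sum_eq_zero_iff.mp h0 v (Finset.mem_univ v)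
  simp [this]

/-- The difference of both sides has degree at most one and vanishes at the vertices, and in degree
one the Bernstein coefficients are vertex values. -/
theorem deg_one_eq (K : Cell T) {q : Poly} (hq : Deg 1 q) :
    q = ∑ j, MvPolynomial.C (ev q j.1) * lam K j := by
  classical
  rw [← sub_eq_zero]
  set r := q - ∑ j, MvPolynomial.C (ev q j.1) * lam K j with hr
  have hrd : Deg ((1 : ℕ) : ℤ) r := hq.sub (Deg.sum fun j _ => (deg_lam K j).C_mul _)
  obtain ⟨c, hc⟩ := exists_bern K hrd
  have hv : ∀ v : K.1, ev r v.1 = 0 := by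
    intro v
    rw [hr, ev_sub, ev_sum]
    simp [ev_lam_vertex]
  rw [hc, ← bern_zero K 1]
  refine bern_congr K fun α hα => ?_
  obtain ⟨j, rfl⟩ := eq_unit_of_sum_eq_one hα
  have := ev_bern_vertex K 1 c j (by rw [← hc]; exact hv j)
  rwa [one_smul] at this

theorem ipS_sum_left (K : Cell T) {s : Finset E3} (hs : s ⊆ K.1) (hne : s.Nonempty)
    {ι : Type*} (t : Finset ι) (p : ι → Poly) (r : Poly) :
    ipS s (∑ i ∈ t, p i) r = ∑ i ∈ t, ipS s (p i) r := by
  classical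
  induction t using Finset.induction_on with
  | empty => simp [ipS]
  | insert a t ha ih =>
    rw [Finset.sum_insert ha, Finset.sum_insert ha, ipS_add_left K hs hne, ih]

/-- Moments of a polynomial in Bernstein form against polynomials of degree one. -/
theorem ipS_bern_affine (K : Cell T) {s : Finset E3} (hs : s ⊆ K.1) (hne : s.Nonempty) :
    ∃ C : ℕ → ℝ, (∀ d, 0 < C d) ∧ ∀ d c q, Deg 1 q → ipS s (bern K d c) q =
      C d * ∑ β ∈ idx (sub K s) d, c β * ∑ j ∈ sub K s, (β j + 1) * ev q j.1 := by
  classical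
  obtain ⟨C, hC, h⟩ := ipS_bern K hs hne
  refine ⟨fun d => C (d + 1), fun d => hC _, fun d c q hq => ?_⟩
  -- The affine factor is expanded in barycentric coordinates; multiplication by one of them shifts
  -- the coefficients and produces the weights `β j + 1`.
  have hb : bern K d c * q = ∑ j, ev q j.1 • bern K (d + 1) fun α => α j * c (α - unit j) := by
    conv_lhs => rw [deg_one_eq K hq]
    rw [Finset.mul_sum]
    refine Finset.sum_congr rfl fun j _ => ?_
    rw [← lam_mul_bern, MvPolynomial.smul_eq_C_mul]
    ring
  rw [ipS_eq, hb, ipS_sum_left K hs hne]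
  have hj : ∀ j, ipS s (ev q j.1 • bern K (d + 1) fun α => α j * c (α - unit j)) 1 =
      if j ∈ sub K s then C (d + 1) * ∑ β ∈ idx (sub K s) d, c β * ((β j + 1) * ev q j.1)
      else 0 := by
    intro j
    rw [ipS_smul_left, h]
    split_ifs with hjs
    · have h1 : ∑ α ∈ idx (sub K s) (d + 1), (α j : ℝ) * c (α - unit j) =
          ∑ α ∈ (idx (sub K s) (d + 1)).filter (fun α => α j ≠ 0), (α j : ℝ) * c (α - unit j) := by
        rw [Finset.sum_filter]
        refine Finset.sum_congr rfl fun α _ => ?_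
        split_ifs with h0
        · rfl
        · rw [not_not.mp h0]; simp
      rw [h1, sum_idx_shift hjs, mul_left_comm, Finset.mul_sum]
      congr 1
      refine Finset.sum_congr rfl fun β _ => ?_
      have : β + unit j - unit j = β := by ext v; simp
      rw [this]
      simp
      ring
    · rw [Finset.sum_eq_zero, mul_zero, mul_zero]
      intro α hα
      rw [(mem_idx.mp hα).2 j hjs]
      simp
  rw [Finset.sum_congr rfl fun j _ => hj j, ← Finset.sum_filter, Finset.filter_mem_eq_inter,
    Finset.univ_inter, ← Finset.mul_sum, Finset.sum_comm]
  simp only [Finset.mul_sum]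

theorem ipS_bern_eq_zero_iff (K : Cell T) {s : Finset E3} (hs : s ⊆ K.1) (hne : s.Nonempty)
    {d : ℕ} {c : (K.1 → ℕ) → ℝ} :
    ipS s (bern K d c) 1 = 0 ↔ ∑ α ∈ idx (sub K s) d, c α = 0 := by
  obtain ⟨C, hC, h⟩ := ipS_bern K hs hne
  rw [h, mul_eq_zero, or_iff_right (hC d).ne']

theorem idx_singleton {ι : Type*} [Fintype ι] (j : ι) (d : ℕ) : idx {j} d = {d • unit j} := by
  ext α
  rw [mem_idx, Finset.mem_singleton]
  constructor
  · rintro ⟨h1, h2⟩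
    rw [Finset.sum_eq_single j (fun v _ hv => h2 v (by simpa using hv)) (by simp)] at h1
    ext v
    by_cases hv : v = j
    · subst hv; simp [h1]
    · simp [h2 v (by simpa using hv), unit_of_ne hv]
  · rintro rfl
    refine ⟨sum_smul_unit d j, fun v hv => ?_⟩
    simp [unit_of_ne (by simpa using hv : v ≠ j)]

/-- The integral over an edge of the derivative of a polynomial that vanishes at the end points. -/
theorem ipS_dir_edge (K : Cell T) {a b : K.1} (hab : a ≠ b) {s : Finset E3}
    (hs : sub K s = {a, b}) (hsK : s ⊆ K.1) {h : Poly} (ha : ev h a.1 = 0) (hb : ev h b.1 = 0) :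
    ipS s (dir (b.1 - a.1) h) 1 = 0 := by
  classical
  have has : a.1 ∈ s := by rw [← mem_sub (K := K), hs]; simp
  obtain ⟨d, hd⟩ := exists_deg h
  have hd1 : Deg ((d + 1 : ℕ) : ℤ) h := hd.mono (by push_cast; omega)
  obtain ⟨c, rfl⟩ := exists_bern K hd1
  rw [dir_sub_bern, ipS_bern_eq_zero_iff K hsK ⟨_, has⟩, Finset.sum_sub_distrib,
    sum_idx_add_unit (by rw [hs]; simp), sum_idx_add_unit (by rw [hs]; simp), hs]
  have e1 : ({a, b} : Finset K.1).erase b = {a} := by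
    ext v; simp only [Finset.mem_erase, Finset.mem_insert, Finset.mem_singleton]
    constructor
    · rintro ⟨h1, h2 | h2⟩
      exacts [h2, absurd h2 h1]
    · rintro rfl; exact ⟨hab, Or.inl rfl⟩
  have e2 : ({a, b} : Finset K.1).erase a = {b} := Finset.erase_insert (by simpa using hab)
  rw [e1, e2, idx_singleton, idx_singleton, Finset.sum_singleton, Finset.sum_singleton,
    ev_bern_vertex K _ c a ha, ev_bern_vertex K _ c b hb]
  ring

/-- Stokes' theorem on a triangle: if the tangential component of a vector field has mean value
zero on all edges then so does its rotation on the triangle. -/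
theorem ipS_rot_triangle (K : Cell T) {a b c : K.1} (hab : a ≠ b) (hac : a ≠ c) (hbc : b ≠ c)
    {s e₁ e₂ e₃ : Finset E3} (hsK : s ⊆ K.1) (h1K : e₁ ⊆ K.1) (h2K : e₂ ⊆ K.1) (h3K : e₃ ⊆ K.1)
    (hs : sub K s = {a, b, c}) (h1 : sub K e₁ = {a, b}) (h2 : sub K e₂ = {a, c})
    (h3 : sub K e₃ = {b, c}) {p q : Poly} (hp : ipS e₁ p 1 = 0) (hq : ipS e₂ q 1 = 0)
    (hpq : ipS e₃ (q - p) 1 = 0) :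
    ipS s (dir (b.1 - a.1) q - dir (c.1 - a.1) p) 1 = 0 := by
  classical
  have has : a.1 ∈ s := by rw [← mem_sub (K := K), hs]; simp
  have ha1 : a.1 ∈ e₁ := by rw [← mem_sub (K := K), h1]; simp
  have ha2 : a.1 ∈ e₂ := by rw [← mem_sub (K := K), h2]; simp
  have hb3 : b.1 ∈ e₃ := by rw [← mem_sub (K := K), h3]; simp
  obtain ⟨d, hd⟩ := exists_deg p
  obtain ⟨d', hd'⟩ := exists_deg q
  -- A common formal degree allows the coefficients of the two polynomials to be subtracted; the
  -- extra one is for the derivative.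
  have hdp : Deg ((d + d' + 1 : ℕ) : ℤ) p := hd.mono (by push_cast; omega)
  have hdq : Deg ((d + d' + 1 : ℕ) : ℤ) q := hd'.mono (by push_cast; omega)
  obtain ⟨x, rfl⟩ := exists_bern K hdp
  obtain ⟨y, rfl⟩ := exists_bern K hdq
  rw [← bern_sub, ipS_bern_eq_zero_iff K h3K ⟨_, hb3⟩, h3] at hpq
  rw [ipS_bern_eq_zero_iff K h1K ⟨_, ha1⟩, h1] at hp
  rw [ipS_bern_eq_zero_iff K h2K ⟨_, ha2⟩, h2] at hq
  have ma : a ∈ sub K s := by rw [hs]; simp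
  have mb : b ∈ sub K s := by rw [hs]; simp
  have mc : c ∈ sub K s := by rw [hs]; simp
  rw [dir_sub_bern, dir_sub_bern, ← bern_sub, ipS_bern_eq_zero_iff K hsK ⟨_, has⟩]
  simp only [Pi.sub_apply, Finset.sum_sub_distrib] at hpq ⊢
  -- The sums over the whole triangle cancel and leave precisely the means over the three edges.
  rw [sum_idx_add_unit ma, sum_idx_add_unit mb, sum_idx_add_unit mc, sum_idx_add_unit ma, hs]
  have e1 : ({a, b, c} : Finset K.1).erase a = {b, c} :=
    Finset.erase_insert (by simp [hab, hac])
  have e2 : ({a, b, c} : Finset K.1).erase b = {a, c} := by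
    rw [Finset.insert_comm]; exact Finset.erase_insert (by simp [hab.symm, hbc])
  have e3 : ({a, b, c} : Finset K.1).erase c = {a, b} := by
    rw [Finset.pair_comm b c, Finset.insert_comm]
    exact Finset.erase_insert (by simp [hac.symm, hbc.symm])
  rw [e1, e2, e3]
  linarith

end moments

/-! ## Orthogonal projections with respect to semidefinite forms -/

section projections

variable {V : Type} [AddCommGroup V] [Module ℝ V]

/-- A positive semidefinite symmetric bilinear form. -/
structure IsIP (ip : V → V → ℝ) : Prop where
  add_left : ∀ u v w, ip (u + v) w = ip u w + ip v w
  smul_left : ∀ (a : ℝ) u w, ip (a • u) w = a * ip u w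
  comm : ∀ u w, ip u w = ip w u
  nonneg : ∀ u, 0 ≤ ip u u

namespace IsIP

variable {ip : V → V → ℝ}

theorem add_right (h : IsIP ip) (u v w : V) : ip u (v + w) = ip u v + ip u w := by
  rw [h.comm, h.add_left, h.comm v, h.comm w]
theorem smul_right (h : IsIP ip) (a : ℝ) (u w : V) : ip u (a • w) = a * ip u w := by
  rw [h.comm, h.smul_left, h.comm]
theorem zero_left (h : IsIP ip) (w : V) : ip 0 w = 0 := by
  have := h.smul_left 0 0 w
  simpa using this
theorem zero_right (h : IsIP ip) (w : V) : ip w 0 = 0 := by rw [h.comm, h.zero_left]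
theorem neg_left (h : IsIP ip) (u w : V) : ip (-u) w = -ip u w := by
  have := h.smul_left (-1) u w
  simpa using this
theorem sub_left (h : IsIP ip) (u v w : V) : ip (u - v) w = ip u w - ip v w := by
  rw [sub_eq_add_neg, h.add_left, h.neg_left, sub_eq_add_neg]
-- The degenerate case of the Cauchy–Schwarz inequality: a nonnegative affine function of `t` has
-- slope zero. Null vectors do occur, because a polynomial on space may vanish on the simplex over
-- which the form integrates.
theorem null (h : IsIP ip) {w : V} (hw : ip w w = 0) (z : V) : ip w z = 0 := by
  by_contra hne
  have key : ∀ t : ℝ, 0 ≤ 2 * t * ip w z + ip z z := by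
    intro t
    have := h.nonneg (t • w + z)
    rw [h.add_left, h.add_right, h.add_right, h.smul_left, h.smul_left, h.smul_right,
      h.smul_right, hw, h.comm z w] at this
    linarith
  -- At this parameter the affine function takes the value minus one.
  have := key (-(ip z z + 1) / (2 * ip w z))
  have h2 : 2 * (-(ip z z + 1) / (2 * ip w z)) * ip w z = -(ip z z + 1) := by
    field_simp
  rw [h2] at this
  linarith

/-- One Gram–Schmidt step for each generator. If the residual of the new generator is null it is
orthogonal to everything, and the coefficient zero serves. -/
theorem exists_proj_span (h : IsIP ip) (t : Finset V) :
    ∀ u, ∃ w ∈ Submodule.span ℝ (t : Set V), ∀ z ∈ Submodule.span ℝ (t : Set V),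
      ip (u - w) z = 0 := by
  classical
  induction t using Finset.induction_on with
  | empty =>
    intro u
    refine ⟨0, Submodule.zero_mem _, fun z hz => ?_⟩
    simp only [Finset.coe_empty, Submodule.span_empty, Submodule.mem_bot] at hz
    rw [hz, h.zero_right]
  | insert a t _ ih =>
    intro u
    obtain ⟨wa, hwa, ha⟩ := ih a
    obtain ⟨wu, hwu, hu⟩ := ih u
    have hle : Submodule.span ℝ (t : Set V) ≤ Submodule.span ℝ ((insert a t : Finset V) : Set V) :=
      Submodule.span_mono (by simp)
    have haS : a ∈ Submodule.span ℝ ((insert a t : Finset V) : Set V) :=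
      Submodule.subset_span (by simp)
    have key : ∃ ρ : ℝ, ip (u - (wu + ρ • (a - wa))) (a - wa) = 0 := by
      by_cases h0 : ip (a - wa) (a - wa) = 0
      · exact ⟨0, by rw [h.comm, h.null h0]⟩
      · refine ⟨ip (u - wu) (a - wa) / ip (a - wa) (a - wa), ?_⟩
        rw [← sub_sub, h.sub_left, h.smul_left, div_mul_cancel₀ _ h0, sub_self]
    obtain ⟨ρ, hρ⟩ := key
    refine ⟨wu + ρ • (a - wa), add_mem (hle hwu) (Submodule.smul_mem _ _
      (sub_mem haS (hle hwa))), fun z hz => ?_⟩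
    have hz' : ∀ z ∈ Submodule.span ℝ (t : Set V), ip (u - (wu + ρ • (a - wa))) z = 0 := by
      intro z hz
      rw [← sub_sub, h.sub_left, h.smul_left, hu z hz, ha z hz, mul_zero, sub_zero]
    rw [Finset.coe_insert] at hz
    obtain ⟨r, z', hz'mem, rfl⟩ := Submodule.mem_span_insert.mp hz
    have : a = (a - wa) + wa := by abel
    rw [h.add_right, h.smul_right, hz' z' hz'mem, add_zero, this, h.add_right, ← this, hρ,
      hz' wa hwa, add_zero, mul_zero]

end IsIP

/-- `W` is (the carrier of) a finite-dimensional linear subspace. -/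
def IsFinSub (W : Set V) : Prop := ∃ S : Submodule ℝ V, Module.Finite ℝ S ∧ (S : Set V) = W

theorem IsFinSub.image {V' : Type} [AddCommGroup V'] [Module ℝ V'] {W : Set V} (hW : IsFinSub W)
    (L : V →ₗ[ℝ] V') : IsFinSub (L '' W) := by
  obtain ⟨S, hS, rfl⟩ := hW
  exact ⟨S.map L, inferInstance, Submodule.map_coe L S⟩

theorem IsFinSub.subset {W : Set V} (hW : IsFinSub W) (S : Submodule ℝ V)
    (h : (S : Set V) ⊆ W) : IsFinSub (S : Set V) := by
  obtain ⟨S', hS', rfl⟩ := hW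
  exact ⟨S, Submodule.finiteDimensional_of_le (S₂ := S') h, rfl⟩

variable {ip : V → V → ℝ}

theorem isProj_proj (h : IsIP ip) {W : Set V} (hW : IsFinSub W) (u : V) :
    IsProj ip W u (proj ip W u) := by
  obtain ⟨S, hS, rfl⟩ := hW
  have hex : ∃ w, IsProj ip (S : Set V) u w := by
    obtain ⟨t, ht⟩ := (Submodule.fg_def.mp (Module.Finite.iff_fg.mp hS))
    obtain ⟨w, hw, hwz⟩ := h.exists_proj_span ht.1.toFinset u
    simp only [Set.Finite.coe_toFinset, ht.2] at hw hwz
    exact ⟨w, hw, hwz⟩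
  rw [proj, dif_pos hex]
  exact hex.choose_spec

/-- The projection of a vector that is orthogonal to the subspace is null. -/
theorem ip_proj_of_orthogonal (h : IsIP ip) {W : Set V} {u : V} (hu : ∀ z ∈ W, ip u z = 0)
    (z : V) : ip (proj ip W u) z = 0 := by
  rw [proj]
  split_ifs with hex
  · obtain ⟨h1, h2⟩ := hex.choose_spec
    refine h.null ?_ z
    have := h2 _ h1
    rw [h.sub_left, hu _ h1] at this
    linarith
  · exact h.zero_left z

theorem ip_proj_left (h : IsIP ip) {W : Set V} (hW : IsFinSub W) (u : V) {z : V} (hz : z ∈ W) :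
    ip (proj ip W u) z = ip u z := by
  have := (isProj_proj h hW u).2 z hz
  rw [h.sub_left] at this
  linarith

theorem ip_proj_proj (h : IsIP ip) {W : Set V} (hW : IsFinSub W) (u η : V) :
    ip (proj ip W u) (proj ip W η) = ip u (proj ip W η) :=
  ip_proj_left h hW u (isProj_proj h hW η).1

/-- The projection is chosen from a predicate that sees the vector only modulo null vectors. Equal
predicates lead to the same choice, so the two projections are literally equal. -/
theorem proj_congr (h : IsIP ip) {W : Set V} {u u' : V} (hu : ip (u - u') (u - u') = 0) :
    proj ip W u = proj ip W u' := by
  have : IsProj ip W u = IsProj ip W u' := by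
    ext w
    refine and_congr_right fun _ => forall₂_congr fun z _ => ?_
    have := h.null hu z
    rw [h.sub_left] at this ⊢
    rw [h.sub_left]
    constructor <;> intro h' <;> linarith
  unfold proj
  rw [this]

/-- A vector that is null for the harmonic inner product is null if it belongs to `W`
as soon as its derivative is null. -/
theorem ip_self_eq_zero_of_harm (h : IsIP ip) {W : Set V} (hW : IsFinSub W) {u : V} {b : ℝ}
    (hb : 0 ≤ b) (h0 : ip (proj ip W u) (proj ip W u) + b = 0)
    (hu : b = 0 → ∃ w ∈ W, ip (u - w) (u - w) = 0) : ip u u = 0 := by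
  have h1 : ip (proj ip W u) (proj ip W u) = 0 := by
    have := h.nonneg (proj ip W u)
    linarith
  obtain ⟨w, hw, huw⟩ := hu (by linarith)
  -- Against `w` the vector may be replaced by its projection, which is null.
  have h2 : ip u w = 0 := by rw [← ip_proj_left h hW u hw, h.null h1]
  have h3 := h.null huw u
  rw [h.sub_left, h.comm w u, h2, sub_zero] at h3
  exact h3

/-- A vector orthogonal to a space of bubbles for the harmonic inner product. -/
theorem harm_transfer (h : IsIP ip) {W : Set V} (hW : IsFinSub W) {B : Set V} {σ : V} {b : V → ℝ}
    (hσ : ∀ η ∈ B, ip (proj ip W σ) (proj ip W η) + b η = 0)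
    (hB : ∀ η ∈ B, ∀ w ∈ W, η - w ∈ B) (hb : ∀ η ∈ B, ∀ w ∈ W, b (η - w) = b η) :
    ∀ η ∈ B, b η = 0 := by
  intro η hη
  obtain ⟨h1, h2⟩ := isProj_proj h hW η
  -- The test vector is `η` minus its projection. Its own projection is null, so only the second
  -- term survives, and subtracting an element of `W` does not change that term.
  have h3 := hσ _ (hB η hη _ h1)
  rw [hb η hη _ h1, h.comm, ip_proj_of_orthogonal h h2, zero_add] at h3
  exact h3

end projections

/-! ### The inner products as semidefinite forms -/

section forms

variable {K : Cell T} {s : Finset E3}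

theorem isIP_ipS (hs : s ⊆ K.1) (hne : s.Nonempty) : IsIP (ipS s) where
  add_left := ipS_add_left K hs hne
  smul_left := ipS_smul_left s
  comm := ipS_comm s
  nonneg := ipS_self_nonneg s

theorem isIP_ipV {ι : Type} [Fintype ι] (hs : s ⊆ K.1) (hne : s.Nonempty) :
    IsIP (ipV s : (ι → Poly) → (ι → Poly) → ℝ) where
  add_left u v w := by
    simp [ipV, (isIP_ipS hs hne).add_left, Finset.sum_add_distrib]
  smul_left a u w := by
    simp [ipV, ipS_smul_left, Finset.mul_sum]
  comm u w := by
    simp only [ipV, ipS_comm s (u _)]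
  nonneg u := Finset.sum_nonneg fun i _ => ipS_self_nonneg s _

theorem isIP_ipM {ι : Type} [Fintype ι] (hs : s ⊆ K.1) (hne : s.Nonempty) :
    IsIP (ipM s : Matrix ι ι Poly → Matrix ι ι Poly → ℝ) where
  add_left u v w := by
    simp [ipM, (isIP_ipS hs hne).add_left, Finset.sum_add_distrib]
  smul_left a u w := by
    simp [ipM, ipS_smul_left, Finset.mul_sum]
  comm u w := by
    simp only [ipM, ipS_comm s (u _ _)]
  nonneg u := Finset.sum_nonneg fun i _ => Finset.sum_nonneg fun j _ => ipS_self_nonneg s _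

theorem ipV_self_eq_zero {ι : Type} [Fintype ι] (hs : s ⊆ K.1) (hne : s.Nonempty) {v : ι → Poly} :
    ipV s v v = 0 ↔ ∀ i, ∀ x ∈ planeOf K s, ev (v i) x = 0 := by
  constructor
  · intro h i
    refine ev_eq_zero_of_ipS_self K hs hne ?_
    exact (Finset.sum_eq_zero_iff_of_nonneg fun i _ => ipS_self_nonneg s (v i)).mp h i
      (Finset.mem_univ i)
  · intro h
    refine Finset.sum_eq_zero fun i _ => ?_
    rw [ipS_congr K hs (p' := 0) (q' := v i) (fun x hx => by rw [h i x hx, ev_zero])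
      fun _ _ => rfl]
    exact (isIP_ipS hs hne).zero_left _

theorem ipM_self_eq_zero {ι : Type} [Fintype ι] (hs : s ⊆ K.1) (hne : s.Nonempty)
    {v : Matrix ι ι Poly} :
    ipM s v v = 0 ↔ ∀ i j, ∀ x ∈ planeOf K s, ev (v i j) x = 0 := by
  have h : ipM s v v = ∑ i, ipV s (v i) (v i) := rfl
  rw [h, Finset.sum_eq_zero_iff_of_nonneg fun i _ => (isIP_ipV hs hne).nonneg (v i)]
  simp only [Finset.mem_univ, forall_const, ipV_self_eq_zero hs hne]

theorem ipV_congr {ι : Type} [Fintype ι] (hs : s ⊆ K.1) {v v' w w' : ι → Poly}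
    (hv : ∀ i, ∀ x ∈ planeOf K s, ev (v i) x = ev (v' i) x)
    (hw : ∀ i, ∀ x ∈ planeOf K s, ev (w i) x = ev (w' i) x) : ipV s v w = ipV s v' w' :=
  Finset.sum_congr rfl fun i _ => ipS_congr K hs (hv i) (hw i)

end forms

/-! ## Finite-dimensional spaces of polynomials -/

section finite

/-- The Bernstein monomials span. Finite dimension is what guarantees that the orthogonal
projections in the degrees of freedom exist. -/
theorem isFinSub_deg (K : Cell T) (d : ℕ) : IsFinSub {p : Poly | Deg d p} := by
  let S : Submodule ℝ Poly :=
    { carrier := {p | Deg d p}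
      add_mem' := Deg.add
      zero_mem' := deg_zero _
      smul_mem' := fun a _ hp => hp.smul a }
  let B : Finset Poly := by
    classical exact (idx (Finset.univ : Finset K.1) d).image fun α => ∏ v, lam K v ^ α v
  have hle : S ≤ Submodule.span ℝ (B : Set Poly) := by
    intro p hp
    obtain ⟨c, rfl⟩ := exists_bern K hp
    rw [bern_eq_sum]
    refine Submodule.sum_mem _ fun α hα => ?_
    rw [← MvPolynomial.smul_eq_C_mul]
    refine Submodule.smul_mem _ _ (Submodule.subset_span ?_)
    simp only [B, Finset.coe_image, Set.mem_image, Finset.mem_coe]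
    exact ⟨α, hα, rfl⟩
  have hfin : Module.Finite ℝ (Submodule.span ℝ (B : Set Poly)) :=
    Module.Finite.span_of_finite ℝ B.finite_toSet
  exact ⟨S, Submodule.finiteDimensional_of_le hle, rfl⟩

theorem isFinSub_deg_int (K : Cell T) (d : ℤ) : IsFinSub {p : Poly | Deg d p} := by
  let S : Submodule ℝ Poly :=
    { carrier := {p | Deg d p}
      add_mem' := Deg.add
      zero_mem' := deg_zero _
      smul_mem' := fun a _ hp => hp.smul a }
  exact (isFinSub_deg K d.toNat).subset S fun p (hp : Deg d p) => hp.mono (Int.self_le_toNat d)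

theorem isFinSub_bubP (K : Cell T) (s : Finset E3) (m : ℕ) (d : ℤ) : IsFinSub (bubP K s m d) := by
  have h : bubP K s m d = LinearMap.mulLeft ℝ (bub K s ^ m) '' {q | Deg d q} := by
    ext p
    constructor
    · rintro ⟨q, hq, rfl⟩; exact ⟨q, hq, rfl⟩
    · rintro ⟨q, hq, rfl⟩; exact ⟨q, hq, rfl⟩
  rw [h]
  exact (isFinSub_deg_int K d).image _

theorem isFinSub_matrix {ι : Type} [Fintype ι] {W : Set Poly} (hW : IsFinSub W) :
    IsFinSub {σ : Matrix ι ι Poly | ∀ i j, σ i j ∈ W} := by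
  obtain ⟨S, hS, rfl⟩ := hW
  let M : Submodule ℝ (Matrix ι ι Poly) :=
    { carrier := {σ | ∀ i j, σ i j ∈ S}
      add_mem' := fun ha hb i j => S.add_mem (ha i j) (hb i j)
      zero_mem' := fun _ _ => S.zero_mem
      smul_mem' := fun a _ hp i j => S.smul_mem a (hp i j) }
  let L : M →ₗ[ℝ] (ι → ι → S) :=
    { toFun := fun σ i j => ⟨σ.1 i j, σ.2 i j⟩
      map_add' := fun _ _ => rfl
      map_smul' := fun _ _ => rfl }
  have hL : Function.Injective L := by
    intro a b hab
    exact Subtype.ext (Matrix.ext fun i j => congrArg Subtype.val (congrFun (congrFun hab i) j))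
  exact ⟨M, Module.Finite.of_injective L hL, rfl⟩

end finite

/-! ## Polynomial potentials -/

section potentials

open MvPolynomial in
/-- The inverse of `x · ∇ + s` for `0 < s`: division of each coefficient by its degree plus `s`. -/
noncomputable def invEuler (s : ℕ) : Poly →ₗ[ℝ] Poly :=
  (basisMonomials (Fin 3) ℝ).constr ℝ fun m => monomial m (1 / ((m.degree : ℝ) + s))

theorem coeff_invEuler (s : ℕ) (p : Poly) (m : Fin 3 →₀ ℕ) :
    MvPolynomial.coeff m (invEuler s p) = MvPolynomial.coeff m p / ((m.degree : ℝ) + s) := by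
  induction p using MvPolynomial.induction_on' with
  | monomial n a =>
    have : MvPolynomial.monomial n a = a • (MvPolynomial.basisMonomials (Fin 3) ℝ n) := by
      rw [MvPolynomial.coe_basisMonomials, MvPolynomial.smul_monomial, smul_eq_mul, mul_one]
    rw [this, map_smul, invEuler, Module.Basis.constr_basis, MvPolynomial.coe_basisMonomials]
    simp only [MvPolynomial.coeff_smul, MvPolynomial.coeff_monomial, smul_eq_mul]
    split_ifs with h
    · subst h; ring
    · simp
  | add p q hp hq => rw [map_add, MvPolynomial.coeff_add, hp, hq, MvPolynomial.coeff_add, add_div]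

theorem Deg.invEuler {d : ℤ} {p : Poly} (hp : Deg d p) (s : ℕ) : Deg d (invEuler s p) := by
  intro m hm
  refine hp m ?_
  rw [MvPolynomial.mem_support_iff, coeff_invEuler] at hm
  rw [MvPolynomial.mem_support_iff]
  exact fun h => hm (by rw [h, zero_div])

/-- Differentiation lowers the degree of a monomial by one, and the larger shift compensates for
that. -/
theorem pd_invEuler (i : Fin 3) (s : ℕ) (p : Poly) :
    pd i (invEuler s p) = invEuler (s + 1) (pd i p) := by
  ext m
  simp only [pd, MvPolynomial.coeff_pderiv, coeff_invEuler, map_add, Finsupp.degree_single]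
  push_cast
  rw [add_right_comm, add_assoc, div_mul_eq_mul_div]

theorem coeff_X_mul_pd (i : Fin 3) (p : Poly) (m : Fin 3 →₀ ℕ) :
    MvPolynomial.coeff m (MvPolynomial.X i * pd i p) = m i * MvPolynomial.coeff m p := by
  rw [MvPolynomial.coeff_X_mul']
  split_ifs with h
  · have h1 : (Finsupp.single i 1 : Fin 3 →₀ ℕ) ≤ m := by
      rw [Finsupp.single_le_iff]
      exact Nat.one_le_iff_ne_zero.mpr (Finsupp.mem_support_iff.mp h)
    have h2 : m i = (m - Finsupp.single i 1 : Fin 3 →₀ ℕ) i + 1 := by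
      have := Finsupp.mem_support_iff.mp h
      simp; omega
    rw [pd, MvPolynomial.coeff_pderiv, tsub_add_cancel_of_le h1, mul_comm]
    congr 1
    conv_rhs => rw [h2]
    push_cast; rfl
  · rw [Finsupp.notMem_support_iff.mp h]; simp

theorem euler_invEuler {s : ℕ} (hs : 0 < s) (p : Poly) :
    ∑ i, MvPolynomial.X i * pd i (invEuler s p) + MvPolynomial.C (s : ℝ) * invEuler s p = p := by
  ext m
  have h : (m.degree : ℝ) = ∑ i, (m i : ℝ) := by
    rw [Finsupp.degree_eq_sum]; push_cast; rfl
  have hpos : 0 < (m.degree : ℝ) + s := by positivity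
  simp only [MvPolynomial.coeff_add, MvPolynomial.coeff_sum, coeff_X_mul_pd,
    MvPolynomial.coeff_C_mul]
  rw [← Finset.sum_mul, ← h, ← add_mul, coeff_invEuler, mul_div_cancel₀ _ hpos.ne']

/-- A curl-free polynomial vector field is a gradient. -/
theorem exists_potential {d : ℤ} {w : Fin 3 → Poly} (hd : ∀ i, Deg d (w i))
    (h : ∀ i j, pd i (w j) = pd j (w i)) :
    ∃ u, Deg (d + 1) u ∧ ∀ i, pd i u = w i := by
  -- The Poincaré homotopy `∫₀¹ x · w(τx) dτ`: integration over `τ` divides a monomial by its degree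
  -- plus one.
  refine ⟨∑ j, MvPolynomial.X j * invEuler 1 (w j), Deg.sum fun j _ => ?_, fun i => ?_⟩
  · rw [add_comm]
    exact (deg_X j).mul ((hd j).invEuler 1)
  · have h1 := euler_invEuler one_pos (w i)
    simp only [Nat.cast_one, map_one, one_mul] at h1
    simp only [pd_sum, pd_mul, pd_X, pd_invEuler, h i, ite_mul, one_mul, zero_mul,
      Finset.sum_add_distrib, Finset.sum_ite_eq, Finset.mem_univ, if_true] at h1 ⊢
    rw [add_comm]; exact h1

/-- A divergence-free polynomial vector field is a curl. -/
theorem exists_vector_potential {d : ℤ} {w : Fin 3 → Poly} (hd : ∀ i, Deg d (w i))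
    (h : ∑ j, pd j (w j) = 0) :
    ∃ z : Fin 3 → Poly, (∀ i, Deg (d + 1) (z i)) ∧
      ∀ l, pd (l + 1) (z (l + 2)) - pd (l + 2) (z (l + 1)) = w l := by
  -- The Poincaré homotopy `∫₀¹ τ w(τx) × x dτ`; the additional factor `τ` changes the divisor to
  -- the degree plus two.
  refine ⟨fun l => invEuler 2 (w (l + 1)) * MvPolynomial.X (l + 2) -
    invEuler 2 (w (l + 2)) * MvPolynomial.X (l + 1), fun l => ?_, fun l => ?_⟩
  · exact (((hd _).invEuler 2).mul (deg_X _)).sub (((hd _).invEuler 2).mul (deg_X _))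
  · have h1 := euler_invEuler two_pos (w l)
    have h2 : ∑ j, pd j (invEuler 2 (w j)) = 0 := by
      simp only [pd_invEuler, ← map_sum, h, map_zero]
    have hC : (MvPolynomial.C ((2 : ℕ) : ℝ) : Poly) = 2 := by
      rw [Nat.cast_ofNat]; exact map_ofNat _ 2
    rw [hC] at h1
    simp only [Fin.sum_univ_three] at h1 h2
    conv_rhs => rw [← h1]
    fin_cases l <;> simp [pd_mul, pd_X] <;>
      first | linear_combination (-MvPolynomial.X 0) * h2 | linear_combination (-MvPolynomial.X 1) * h2 |
        linear_combination (-MvPolynomial.X 2) * h2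

end potentials

/-! ## The Hessian complex for polynomials -/

section complexes

theorem curl_apply (σ : Matrix (Fin 3) (Fin 3) Poly) (i l : Fin 3) :
    curl σ i l = pd (l + 1) (σ i (l + 2)) - pd (l + 2) (σ i (l + 1)) := rfl

theorem hess_apply (u : Poly) (i j : Fin 3) : hess u i j = pd i (pd j u) := rfl

theorem curl_add (σ τ : Matrix (Fin 3) (Fin 3) Poly) : curl (σ + τ) = curl σ + curl τ := by
  ext1 i l; simp only [curl_apply, Matrix.add_apply, pd_add]; ring

theorem curl_sub (σ τ : Matrix (Fin 3) (Fin 3) Poly) : curl (σ - τ) = curl σ - curl τ := by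
  ext1 i l; simp only [curl_apply, Matrix.sub_apply, pd_sub]; ring

theorem curl_smul (a : ℝ) (σ : Matrix (Fin 3) (Fin 3) Poly) : curl (a • σ) = a • curl σ := by
  ext1 i l; simp only [curl_apply, Matrix.smul_apply, pd_smul, smul_sub]

theorem hess_add (u v : Poly) : hess (u + v) = hess u + hess v := by
  ext1 i l; simp only [hess_apply, Matrix.add_apply, pd_add]

theorem hess_sub (u v : Poly) : hess (u - v) = hess u - hess v := by
  ext1 i l; simp only [hess_apply, Matrix.sub_apply, pd_sub]

theorem hess_smul (a : ℝ) (u : Poly) : hess (a • u) = a • hess u := by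
  ext1 i l; simp only [hess_apply, Matrix.smul_apply, pd_smul]

theorem div_apply (v : Matrix (Fin 3) (Fin 3) Poly) (i : Fin 3) : div v i = ∑ j, pd j (v i j) := rfl

theorem div_add (v w : Matrix (Fin 3) (Fin 3) Poly) : div (v + w) = div v + div w := by
  ext1 i; simp only [div_apply, Matrix.add_apply, pd_add, Finset.sum_add_distrib, Pi.add_apply]

theorem div_sub (v w : Matrix (Fin 3) (Fin 3) Poly) : div (v - w) = div v - div w := by
  ext1 i; simp only [div_apply, Matrix.sub_apply, pd_sub, Finset.sum_sub_distrib, Pi.sub_apply]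

theorem div_smul (a : ℝ) (v : Matrix (Fin 3) (Fin 3) Poly) : div (a • v) = a • div v := by
  ext1 i; simp only [div_apply, Matrix.smul_apply, pd_smul, Finset.smul_sum, Pi.smul_apply]

theorem hess_isSymm (u : Poly) : (hess u).IsSymm := Matrix.IsSymm.ext fun i j => pd_comm j i u

theorem curl_hess (u : Poly) : curl (hess u) = 0 := by
  ext1 i l
  simp only [curl_apply, hess_apply, Matrix.zero_apply]
  rw [pd_comm (l + 1) i, pd_comm (l + 2) i, pd_comm (l + 1), sub_self]

theorem div_curl (σ : Matrix (Fin 3) (Fin 3) Poly) : div (curl σ) = 0 := by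
  ext1 i
  simp only [div_apply, curl_apply, Fin.sum_univ_three, pd_sub, Pi.zero_apply]
  simp only [Fin.isValue, zero_add, Fin.reduceAdd]
  rw [pd_comm 1 0, pd_comm 2 0, pd_comm 2 1]
  ring

theorem trace_curl (σ : Matrix (Fin 3) (Fin 3) Poly) (h : σ.IsSymm) : (curl σ).trace = 0 := by
  simp only [Matrix.trace, Matrix.diag, curl_apply, Fin.sum_univ_three]
  simp only [Fin.isValue, zero_add, Fin.reduceAdd]
  rw [h.apply 0 1, h.apply 0 2, h.apply 1 2]
  ring

theorem Deg.hess {d : ℤ} {u : Poly} (hu : Deg d u) (i j : Fin 3) : Deg (d - 2) (hess u i j) := by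
  have := (hu.pd j).pd i
  rwa [sub_sub] at this

theorem Deg.curl {d : ℤ} {σ : Matrix (Fin 3) (Fin 3) Poly} (hσ : ∀ i j, Deg d (σ i j))
    (i j : Fin 3) : Deg (d - 1) (curl σ i j) := ((hσ _ _).pd _).sub ((hσ _ _).pd _)

theorem hess_eq_zero_of_deg {u : Poly} (hu : Deg 1 u) : hess u = 0 := by
  ext1 i j
  exact Deg.eq_zero (hu.hess i j) (by norm_num)

theorem exists_eq_C {p : Poly} (h : ∀ i, pd i p = 0) : ∃ a, p = MvPolynomial.C a := by
  refine ⟨MvPolynomial.coeff 0 p, ?_⟩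
  ext m
  rw [MvPolynomial.coeff_C]
  split_ifs with hm
  · rw [hm]
  · obtain ⟨i, hi⟩ : ∃ i, m i ≠ 0 := by
      by_contra hcon
      push Not at hcon
      exact hm (Finsupp.ext fun i => (hcon i).symm)
    have := coeff_X_mul_pd i p m
    rw [h i, mul_zero, MvPolynomial.coeff_zero] at this
    exact (mul_eq_zero.mp this.symm).resolve_left (by exact_mod_cast hi)

theorem deg_one_of_hess {u : Poly} (hu : hess u = 0) : Deg 1 u := by
  have h1 : ∀ i, ∃ a, pd i u = MvPolynomial.C a := fun i =>
    exists_eq_C fun j => congrFun (congrFun hu j) i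
  choose a ha using h1
  have h2 : ∀ i, pd i (u - ∑ j, MvPolynomial.C (a j) * MvPolynomial.X j) = 0 := by
    intro i
    simp [pd_X, ha]
  obtain ⟨b, hb⟩ := exists_eq_C h2
  rw [sub_eq_iff_eq_add.mp hb]
  exact ((deg_C b).mono zero_le_one).add (Deg.sum fun j _ => (deg_X j).C_mul _)

theorem pd_eq_of_curl {σ : Matrix (Fin 3) (Fin 3) Poly} (h : curl σ = 0) (i a b : Fin 3) :
    pd a (σ i b) = pd b (σ i a) := by
  have h' : ∀ l, pd (l + 1) (σ i (l + 2)) = pd (l + 2) (σ i (l + 1)) := fun l =>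
    sub_eq_zero.mp (congrFun (congrFun h i) l)
  have h0 := h' 0
  have h1 := h' 1
  have h2 := h' 2
  simp only [Fin.isValue, zero_add, Fin.reduceAdd] at h0 h1 h2
  fin_cases a <;> fin_cases b <;> simp [h0, h1, h2]

/-- A curl-free symmetric polynomial matrix field is a Hessian. -/
theorem exists_hess {d : ℤ} {σ : Matrix (Fin 3) (Fin 3) Poly} (hd : ∀ i j, Deg d (σ i j))
    (hs : σ.IsSymm) (h : curl σ = 0) : ∃ u, Deg (d + 2) u ∧ hess u = σ := by
  have h1 : ∀ i, ∃ u, Deg (d + 1) u ∧ ∀ j, pd j u = σ i j := fun i =>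
    exists_potential (hd i) fun a b => pd_eq_of_curl h i a b
  choose w hw1 hw2 using h1
  -- Each row is a gradient, and symmetry of the matrix says that the vector of the row potentials
  -- is curl-free in turn.
  obtain ⟨u, hu1, hu2⟩ := exists_potential hw1 fun i j => by rw [hw2, hw2, hs.apply]
  refine ⟨u, by rwa [add_assoc] at hu1, ?_⟩
  ext1 i j
  rw [hess_apply, hu2, hw2, hs.apply]

/-- A divergence-free traceless polynomial matrix field is the curl of a symmetric one. -/
theorem exists_curl {d : ℤ} {v : Matrix (Fin 3) (Fin 3) Poly} (hd : ∀ i j, Deg d (v i j))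
    (ht : v.trace = 0) (h : div v = 0) :
    ∃ σ : Matrix (Fin 3) (Fin 3) Poly, σ.IsSymm ∧ (∀ i j, Deg (d + 1) (σ i j)) ∧ curl σ = v := by
  have h1 : ∀ i, ∃ z : Fin 3 → Poly, (∀ j, Deg (d + 1) (z j)) ∧
      ∀ l, pd (l + 1) (z (l + 2)) - pd (l + 2) (z (l + 1)) = v i l := fun i =>
    exists_vector_potential (hd i) (congrFun h i)
  choose τ hτd hτ using h1
  -- The row potential `τ` need not be symmetric. The divergence of its skew part, read as a vector
  -- field, is the trace of `v` and hence zero, so the skew part is a curl; subtracting the gradient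
  -- of that potential makes `τ` symmetric and preserves its curl.
  obtain ⟨w, hwd, hw⟩ := exists_vector_potential (d := d + 1)
    (w := fun m => τ (m + 2) (m + 1) - τ (m + 1) (m + 2)) (fun m => (hτd _ _).sub (hτd _ _)) (by
      rw [← ht]
      simp only [Matrix.trace, Matrix.diag, ← hτ, Fin.sum_univ_three, pd_sub]
      simp only [Fin.isValue, zero_add, Fin.reduceAdd]
      ring)
  refine ⟨Matrix.of fun i j => τ i j - pd j (w i), ?_, fun i j => (hτd i j).sub ?_, ?_⟩
  · have h0 := hw 0
    have h1 := hw 1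
    have h2 := hw 2
    simp only [Fin.isValue, zero_add, Fin.reduceAdd] at h0 h1 h2
    ext1 i j
    rw [Matrix.transpose_apply]
    fin_cases i <;> fin_cases j <;> simp only [Matrix.of_apply] <;> simp <;>
      first | linear_combination h0 | linear_combination h1 | linear_combination h2 |
        linear_combination -h0 | linear_combination -h1 | linear_combination -h2
  · have := (hwd i).pd j
    rwa [add_sub_cancel_right] at this
  · ext1 i l
    rw [curl_apply, ← hτ i l]
    simp only [Matrix.of_apply, pd_sub]
    rw [pd_comm (l + 1)]
    ring

end complexes

/-! ## Vanishing along the facets of a simplex -/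

section facets

/-- `p` vanishes on the plane of the simplex `s`. -/
def ZeroOn (K : Cell T) (s : Finset E3) (p : Poly) : Prop := ∀ x ∈ planeOf K s, ev p x = 0

variable {K : Cell T} {s : Finset E3} {p q : Poly}

theorem ZeroOn.add (hp : ZeroOn K s p) (hq : ZeroOn K s q) : ZeroOn K s (p + q) := fun x hx => by
  rw [ev_add, hp x hx, hq x hx, add_zero]
theorem ZeroOn.neg (hp : ZeroOn K s p) : ZeroOn K s (-p) := fun x hx => by
  rw [ev_neg, hp x hx, neg_zero]
theorem ZeroOn.sub (hp : ZeroOn K s p) (hq : ZeroOn K s q) : ZeroOn K s (p - q) := fun x hx => by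
  rw [ev_sub, hp x hx, hq x hx, sub_zero]
theorem ZeroOn.mul_left (hq : ZeroOn K s q) (p : Poly) : ZeroOn K s (p * q) := fun x hx => by
  rw [ev_mul, hq x hx, mul_zero]
theorem ZeroOn.mul_right (hq : ZeroOn K s q) (p : Poly) : ZeroOn K s (q * p) := fun x hx => by
  rw [ev_mul, hq x hx, zero_mul]
theorem ZeroOn.smul (hq : ZeroOn K s q) (a : ℝ) : ZeroOn K s (a • q) := fun x hx => by
  rw [ev_smul, hq x hx, mul_zero]
theorem zeroOn_zero : ZeroOn K s 0 := fun x _ => ev_zero x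
theorem zeroOn_sub_iff : ZeroOn K s (p - q) ↔ ∀ x ∈ planeOf K s, ev p x = ev q x := by
  simp only [ZeroOn, ev_sub, sub_eq_zero]

theorem planeOf_mono {s' : Finset E3} (h : s' ⊆ s) : planeOf K s' ⊆ planeOf K s :=
  fun _ hx v hv => hx v fun hv' => hv (h hv')

theorem ZeroOn.mono {s' : Finset E3} (hp : ZeroOn K s p) (h : s' ⊆ s) : ZeroOn K s' p :=
  fun x hx => hp x (planeOf_mono h hx)

theorem planeOf_cell (K : Cell T) (x : E3) : x ∈ planeOf K K.1 := fun v hv => absurd v.2 hv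

theorem zeroOn_cell : ZeroOn K K.1 p ↔ p = 0 :=
  ⟨fun h => poly_ext fun x => by rw [h x (planeOf_cell K x), ev_zero], fun h => h ▸ zeroOn_zero⟩

theorem isTangent_cell (K : Cell T) (w : E3) : IsTangent K K.1 w := fun v hv => absurd v.2 hv

theorem IsTangent.mono {s' : Finset E3} {w : E3} (hw : IsTangent K s' w) (h : s' ⊆ s) :
    IsTangent K s w := fun v hv => hw v fun hv' => hv (h hv')

theorem zeroOn_singleton {v : K.1} : ZeroOn K {v.1} p ↔ ev p v.1 = 0 := by
  constructor
  · exact fun h => h _ (vertex_mem_planeOf (Finset.mem_singleton_self _))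
  · intro h x hx
    have : x = v.1 := by
      refine eq_of_ev_lam (K := K) fun w => ?_
      by_cases hw : w = v
      · subst hw
        have h1 := sum_ev_lam K x
        rw [Finset.sum_eq_single w (fun b _ hb => hx b fun h =>
          hb (Subtype.ext (Finset.mem_singleton.mp h))) (fun h => absurd (Finset.mem_univ _) h)] at h1
        rw [h1, ev_lam_vertex, if_pos rfl]
      · rw [hx w fun h => hw (Subtype.ext (Finset.mem_singleton.mp h)), ev_lam_vertex, if_neg hw]
    rw [this, h]

/-- The facet of `s` opposite to the vertex `l`. -/
noncomputable def facet (s : Finset E3) (l : E3) : Finset E3 := by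
  classical exact s.erase l

@[simp] theorem mem_facet {l x : E3} : x ∈ facet s l ↔ x ≠ l ∧ x ∈ s := by
  classical simp [facet]

theorem facet_subset (s : Finset E3) (l : E3) : facet s l ⊆ s := fun _ hx => (mem_facet.mp hx).2

theorem card_facet {l : E3} (hl : l ∈ s) : (facet s l).card = s.card - 1 := by
  classical
  rw [facet, Finset.card_erase_of_mem hl]

theorem opp_eq_facet (K : Cell T) (i : K.1) : (opp K i).1 = facet K.1 i.1 := by
  classical
  ext x; simp [opp]

/-- The derivatives of `p` of order less than `m` in the directions of `s` vanish on `s'`. -/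
def VanishAlong (K : Cell T) (s s' : Finset E3) : ℕ → Poly → Prop
  | 0, _ => True
  | m + 1, p => ZeroOn K s' p ∧ ∀ w, IsTangent K s w → VanishAlong K s s' m (dir w p)

theorem VanishOrd.vanishAlong {v : K.1} {m : ℕ} (h : VanishOrd v.1 m p) :
    VanishAlong K s {v.1} m p := by
  induction m generalizing p with
  | zero => trivial
  | succ m ih => exact ⟨zeroOn_singleton.mpr h.1, fun w _ => ih (h.dir w)⟩

/-- The derivative from a vertex `q` of the facet towards `l` vanishes to one order less, so one
unit of mass may be moved from `l` to `q`. Repeating this leads to a multi-index supported in the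
facet, where the polynomial vanishes; hence the induction on the order and, inside, on the entry at
`l`. -/
theorem coeff_eq_zero_of_vanishAlong (hs : s ⊆ K.1) {l : K.1} (hl : l.1 ∈ s)
    (hcard : 2 ≤ s.card) {m : ℕ} : ∀ {d : ℕ} {c : (K.1 → ℕ) → ℝ},
    VanishAlong K s (facet s l.1) m (bern K d c) →
    ∀ α : K.1 → ℕ, ∑ v, α v = d → (∀ v : K.1, v.1 ∉ s → α v = 0) → α l < m → c α = 0 := by
  have hne : (facet s l.1).Nonempty := by
    rw [← Finset.card_pos, card_facet hl]; omega
  obtain ⟨q, hq⟩ := hne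
  have hqs := mem_facet.mp hq
  induction m with
  | zero => intro d c _ α _ _ h; omega
  | succ m ih =>
    intro d c h α
    generalize hr : α l = r
    induction r generalizing α with
    | zero =>
      intro hα hsupp _
      refine (bern_vanish_iff K ((facet_subset s l.1).trans hs) ⟨q, hq⟩).mp (fun x hx =>
        h.1 x (subset_planeOf K ((facet_subset s l.1).trans hs) hx)) α hα fun v hv => ?_
      by_cases hvl : v = l
      · rw [hvl, hr]
      · exact hsupp v fun hvs => hv (mem_facet.mpr ⟨fun h => hvl (Subtype.ext h), hvs⟩)
    | succ r ihr =>
      intro hα hsupp hlt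
      obtain ⟨β, rfl⟩ := exists_eq_add_unit (α := α) (v := l) (by omega)
      rw [sum_add_unit] at hα
      subst hα
      have hβ : β l = r := by simpa using hr
      have hβs : ∀ v : K.1, v.1 ∉ s → β v = 0 := fun v hv => by
        have := hsupp v hv
        simp only [Pi.add_apply] at this
        omega
      let q' : K.1 := ⟨q, hs hqs.2⟩
      have hne : l ≠ q' := fun h => hqs.1 (congrArg Subtype.val h).symm
      have h1 := h.2 _ (isTangent_sub (K := K) (a := l) (b := q') hl hqs.2)
      rw [dir_sub_bern] at h1
      have h2 := ih h1 β rfl hβs (by omega)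
      rw [sub_eq_zero.mp h2]
      refine ihr (β + unit q') (by simp [unit_of_ne hne, hβ]) (by rw [sum_add_unit]) ?_ (by omega)
      intro v hv
      have : v ≠ q' := fun h => hv (h ▸ hqs.2)
      simp [unit_of_ne this, hβs v hv]

/-- A polynomial that vanishes along all facets agrees on `s` with a bubble function. -/
theorem exists_mem_bubP (hs : s ⊆ K.1) (hcard : 2 ≤ s.card) {m d : ℕ} {e : ℤ} (hp : Deg d p)
    (h : ∀ l ∈ s, VanishAlong K s (facet s l) m p) (he : (d : ℤ) - m * s.card ≤ e) :
    ∃ q ∈ bubP K s m e, ∀ x ∈ planeOf K s, ev p x = ev q x := by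
  obtain ⟨c, rfl⟩ := exists_bern K hp
  refine ⟨bern K d (res K s c), bern_mem_bubP K hs m he fun α hα h0 v hv => ?_,
    fun x hx => (ev_bern_res K d c hx).symm⟩
  by_contra hlt
  obtain ⟨h1, h2⟩ := res_ne_zero h0
  exact h2 (coeff_eq_zero_of_vanishAlong hs hv hcard (h v.1 hv) α hα h1 (by omega))

/-- Vanishing on the edges gives one factor of each barycentric coordinate of the face; vanishing to
third order at the vertices makes the quotient vanish there. -/
theorem exists_mem_bubF0 {f : Face T} (hf : f.1 ⊆ K.1) {d : ℕ} (hp : Deg d p)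
    (h : ∀ l ∈ f.1, ZeroOn K (facet f.1 l) p) (hv : ∀ x ∈ f.1, VanishOrd x 3 p) :
    ∃ q ∈ bubF0 K f ((d : ℤ) - 3), ∀ x ∈ planeOf K f.1, ev p x = ev q x := by
  obtain ⟨c, rfl⟩ := exists_bern K hp
  have hge : ∀ α : K.1 → ℕ, ∑ v, α v = d → res K f.1 c α ≠ 0 → ∀ v : K.1, v.1 ∈ f.1 →
      1 ≤ α v := by
    intro α hα h0 v hv
    by_contra hlt
    obtain ⟨h1, h2⟩ := res_ne_zero h0
    exact h2 (coeff_eq_zero_of_vanishAlong (m := 1) hf hv (by rw [f.2.2]; norm_num)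
      ⟨h v.1 hv, fun _ _ => trivial⟩ α hα h1 (by omega))
  obtain ⟨q, hq1, hq2, hq3⟩ := bern_eq_bub_mul K hf 1 hge
  refine ⟨bern K d (res K f.1 c), ⟨q, ?_, ?_, by rw [hq2, pow_one]⟩,
    fun x hx => (ev_bern_res K d c hx).symm⟩
  · rw [f.2.2] at hq1
    simpa using hq1
  · intro x hx
    refine hq3 ⟨x, hf hx⟩ fun α hα h0 => ?_
    obtain ⟨h1, h2⟩ := res_ne_zero h0
    -- Otherwise the two other entries on the face are at most one, so the entry at `x` is at least
    -- `d - 2` and the coefficient is zero by the vanishing order at `x`.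
    by_contra hcon
    push Not at hcon
    refine h2 (coeff_eq_zero_of_vanishOrd K ⟨x, hf hx⟩ (hv x hx) α hα ?_)
    classical
    have hx' : (⟨x, hf hx⟩ : K.1) ∈ sub K f.1 := mem_sub.mpr hx
    have h3 : ∑ v, α v = ∑ v ∈ sub K f.1, α v :=
      (Finset.sum_subset (Finset.subset_univ _) fun v _ hv => h1 v fun h => hv (mem_sub.mpr h)).symm
    have h4 : ∑ v ∈ (sub K f.1).erase ⟨x, hf hx⟩, α v ≤ ∑ v ∈ (sub K f.1).erase ⟨x, hf hx⟩, 1 := by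
      refine Finset.sum_le_sum fun v hv => ?_
      obtain ⟨hvx, hvs⟩ := Finset.mem_erase.mp hv
      by_contra hlt
      exact absurd (h1 v) (by
        have := hcon v hvx (fun _ => by omega)
        intro h5
        rw [h5 this.1] at hlt
        omega)
    rw [Finset.sum_const, smul_eq_mul, mul_one, Finset.card_erase_of_mem hx', card_sub K hf,
      f.2.2] at h4
    rw [← Finset.add_sum_erase _ _ hx', hα] at h3
    omega

/-- A polynomial vanishes on all facets of `s` if it vanishes at a vertex and its derivatives along
the facets vanish there. -/
theorem zeroOn_facets (hs : s ⊆ K.1) (hcard : 3 ≤ s.card) {a : E3} (ha : a ∈ s)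
    (h : ∀ l ∈ s, ∀ w, IsTangent K (facet s l) w → ZeroOn K (facet s l) (dir w p))
    (h0 : ev p a = 0) : ∀ l ∈ s, ZeroOn K (facet s l) p := by
  have key : ∀ l ∈ s, ∀ b ∈ facet s l, ev p b = 0 → ZeroOn K (facet s l) p := by
    intro l hl b hb hb0
    have hsub := (facet_subset s l).trans hs
    exact vanish_of_dir K hsub (p := ⟨b, hsub hb⟩) hb
      (fun j hj => h l hl _ (isTangent_sub (K := K) (b := ⟨b, hsub hb⟩) hj hb)) hb0
  have key' : ∀ l ∈ s, l ≠ a → ZeroOn K (facet s l) p := fun l hl hla =>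
    key l hl a (mem_facet.mpr ⟨hla.symm, ha⟩) h0
  intro l hl
  by_cases hla : l = a
  · subst hla
    classical
    -- The facet opposite to `a` does not contain `a`. The value zero is carried to one of its
    -- vertices through another facet.
    obtain ⟨b, hb⟩ : (s.erase l).Nonempty := by
      rw [← Finset.card_pos, Finset.card_erase_of_mem hl]; omega
    obtain ⟨c, hc⟩ : ((s.erase l).erase b).Nonempty := by
      rw [← Finset.card_pos, Finset.card_erase_of_mem hb, Finset.card_erase_of_mem hl]; omega
    simp only [Finset.mem_erase] at hb hc
    refine key l hl b (mem_facet.mpr hb) (key' c hc.2.2 hc.2.1 b ?_)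
    exact vertex_mem_planeOf (v := ⟨b, hs hb.2⟩) (mem_facet.mpr ⟨hc.1.symm, hb.2⟩)
  · exact key' l hl hla

/-- The Taylor polynomial of degree one. -/
noncomputable def taylor (a : E3) (p : Poly) : Poly :=
  MvPolynomial.C (ev p a) +
    ∑ i, MvPolynomial.C (ev (pd i p) a) * (MvPolynomial.X i - MvPolynomial.C (a i))

theorem deg_taylor (a : E3) (p : Poly) : Deg 1 (taylor a p) :=
  ((deg_C _).mono zero_le_one).add (Deg.sum fun i _ =>
    ((deg_X i).sub ((deg_C _).mono zero_le_one)).C_mul _)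

theorem ev_sub_taylor (a : E3) (p : Poly) : ev (p - taylor a p) a = 0 := by
  simp [taylor]

theorem pd_taylor (a : E3) (p : Poly) (i : Fin 3) :
    pd i (taylor a p) = MvPolynomial.C (ev (pd i p) a) := by
  simp [taylor, pd_X]

theorem ev_dir_sub_taylor (a : E3) (p : Poly) (w : E3) : ev (dir w (p - taylor a p)) a = 0 := by
  simp [ev_dir, pd_taylor]

theorem dir_dir_eq (v w : E3) (p : Poly) :
    dir v (dir w p) = ∑ i, ∑ j, MvPolynomial.C (v i) * (MvPolynomial.C (w j) * hess p i j) := by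
  simp only [dir, pd_sum, pd_C_mul, Finset.mul_sum, hess_apply]

theorem dir_dir_of_deg_one (hp : Deg 1 p) (v w : E3) : dir v (dir w p) = 0 := by
  rw [dir_dir_eq, hess_eq_zero_of_deg hp]; simp

theorem dir_dir_sub_taylor (a : E3) (p : Poly) (v w : E3) :
    dir v (dir w (p - taylor a p)) = dir v (dir w p) := by
  rw [dir_sub, dir_sub, dir_dir_of_deg_one (deg_taylor a p), sub_zero]

/-- If the second derivatives vanish on the facets, the polynomial minus an affine one vanishes
along the facets. -/
theorem vanishAlong_sub_taylor (hs : s ⊆ K.1) (hcard : 3 ≤ s.card) {a : E3} (ha : a ∈ s)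
    (h : ∀ l ∈ s, ∀ v w, IsTangent K (facet s l) v → IsTangent K s w →
      ZeroOn K (facet s l) (dir v (dir w p))) :
    ∀ l ∈ s, VanishAlong K s (facet s l) 2 (p - taylor a p) := by
  have h1 : ∀ w, IsTangent K s w → ∀ l ∈ s, ZeroOn K (facet s l) (dir w (p - taylor a p)) := by
    intro w hw
    refine zeroOn_facets hs hcard ha (fun l hl v hv => ?_) (ev_dir_sub_taylor a p w)
    rw [dir_dir_sub_taylor]
    exact h l hl v w hv hw
  refine fun l hl => ⟨zeroOn_facets hs hcard ha (fun l hl v hv => ?_) (ev_sub_taylor a p) l hl,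
    fun w hw => ⟨h1 w hw l hl, fun _ _ => trivial⟩⟩
  exact h1 v (hv.mono (facet_subset s l)) l hl

end facets

/-! ## Frames -/

section frames

theorem sum_inner_smul (b : OrthonormalBasis (Fin 3) ℝ E3) (w : E3) :
    w = inner ℝ (b 0) w • b 0 + inner ℝ (b 1) w • b 1 + inner ℝ (b 2) w • b 2 := by
  have := b.sum_repr' w
  rw [Fin.sum_univ_three] at this
  exact this.symm

theorem inner_e3 (v w : E3) : inner ℝ v w = v 0 * w 0 + v 1 * w 1 + v 2 * w 2 := by
  simp [PiLp.inner_apply, Fin.sum_univ_three]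
  ring

variable (F : Frame T)

theorem exists_opp (K : Cell T) (f : Face T) (hf : f.1 ⊆ K.1) : ∃ i, f = opp K i := by
  classical
  have h : (K.1 \ f.1).card = 1 := by
    rw [Finset.card_sdiff_of_subset hf, K.2.2, f.2.2]
  obtain ⟨x, hx⟩ := Finset.card_eq_one.mp h
  have hxK : x ∈ K.1 := (Finset.mem_sdiff.mp (hx ▸ Finset.mem_singleton_self x)).1
  refine ⟨⟨x, hxK⟩, Subtype.ext ?_⟩
  ext y
  rw [opp_eq_facet, mem_facet]
  have := congrArg (fun s => y ∈ s) hx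
  simp only [Finset.mem_sdiff, Finset.mem_singleton, eq_iff_iff] at this
  constructor
  · intro hy
    exact ⟨fun h => (this.mpr h).2 hy, hf hy⟩
  · intro hy
    by_contra hcon
    exact hy.1 (this.mp ⟨hy.2, hcon⟩)

theorem opp_subset (K : Cell T) (i : K.1) : (opp K i).1 ⊆ K.1 := by
  rw [opp_eq_facet]; exact facet_subset _ _

theorem mem_opp {K : Cell T} {i : K.1} {x : E3} : x ∈ (opp K i).1 ↔ x ≠ i.1 ∧ x ∈ K.1 := by
  rw [opp_eq_facet, mem_facet]

theorem vertex_mem_opp {K : Cell T} {i v : K.1} : v.1 ∈ (opp K i).1 ↔ v ≠ i := by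
  rw [mem_opp, Subtype.coe_ne_coe]
  simp

theorem mem_planeOf_opp {K : Cell T} {i : K.1} {x : E3} :
    x ∈ planeOf K (opp K i).1 ↔ ev (lam K i) x = 0 := by
  constructor
  · exact fun h => h i (by simp [mem_opp])
  · intro h v hv
    rw [vertex_mem_opp, not_not] at hv
    rwa [hv]

theorem isTangent_opp {K : Cell T} {i : K.1} {w : E3} :
    IsTangent K (opp K i).1 w ↔ slope K w i = 0 := by
  constructor
  · exact fun h => h i (by simp [mem_opp])
  · intro h v hv
    rw [vertex_mem_opp, not_not] at hv
    rwa [hv]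

theorem opp_nonempty (K : Cell T) (i : K.1) : (opp K i).1.Nonempty := by
  rw [← Finset.card_pos, (opp K i).2.2]; norm_num

/-- The derivative of a barycentric coordinate is a multiple of the normal component. -/
theorem exists_height (K : Cell T) (i : K.1) :
    ∃ h : ℝ, h ≠ 0 ∧ ∀ w, h * slope K w i = inner ℝ (F.nf (opp K i)) w := by
  obtain ⟨a, ha⟩ := opp_nonempty K i
  -- When `w` is expanded in edge vectors from the base point `a` of the face, the normal kills
  -- every term except the one that leads to `i`.
  have key : ∀ w, inner ℝ (F.nf (opp K i)) (i.1 - a) * slope K w i =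
      inner ℝ (F.nf (opp K i)) w := by
    intro w
    have h1 : w = ∑ v, slope K w v • (v.1 - a) := by
      simp only [smul_sub, Finset.sum_sub_distrib, ← Finset.sum_smul, sum_slope, zero_smul,
        sub_zero, sum_slope_smul]
    conv_rhs => rw [h1, inner_sum]
    rw [Finset.sum_eq_single i]
    · rw [real_inner_smul_right, mul_comm]
    · intro v _ hv
      rw [real_inner_smul_right, Frame.nf, F.face_normal _ _ ha _ (vertex_mem_opp.mpr hv), mul_zero]
    · intro h; exact absurd (Finset.mem_univ i) h
  refine ⟨_, fun h0 => ?_, key⟩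
  have := key (F.nf (opp K i))
  rw [h0, zero_mul, Frame.nf, real_inner_self_eq_norm_sq, OrthonormalBasis.norm_eq_one] at this
  norm_num at this

/-- Connects the affine notion of tangency, through barycentric slopes, with the Euclidean one,
through the unit normal. -/
theorem isTangent_opp_iff {K : Cell T} {i : K.1} {w : E3} :
    IsTangent K (opp K i).1 w ↔ inner ℝ (F.nf (opp K i)) w = 0 := by
  obtain ⟨h, h0, hw⟩ := exists_height F K i
  rw [isTangent_opp, ← hw w, mul_eq_zero, or_iff_right h0]

theorem isTangent_tf {K : Cell T} {f : Face T} (hf : f.1 ⊆ K.1) (a : Fin 2) :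
    IsTangent K f.1 (F.tf f a) := by
  obtain ⟨i, rfl⟩ := exists_opp K f hf
  rw [isTangent_opp_iff F]
  exact (F.face (opp K i)).orthonormal.2 (by fin_cases a <;> decide)

theorem tangent_eq {K : Cell T} {f : Face T} (hf : f.1 ⊆ K.1) {w : E3} (hw : IsTangent K f.1 w) :
    w = inner ℝ (F.tf f 0) w • F.tf f 0 + inner ℝ (F.tf f 1) w • F.tf f 1 := by
  obtain ⟨i, rfl⟩ := exists_opp K f hf
  have h := (isTangent_opp_iff F).mp hw
  have := sum_inner_smul (F.face (opp K i)) w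
  rw [← Frame.nf, h, zero_smul, add_zero] at this
  exact this

theorem dir_tangent {K : Cell T} {f : Face T} (hf : f.1 ⊆ K.1) {w : E3} (hw : IsTangent K f.1 w)
    (p : Poly) : dir w p = MvPolynomial.C (inner ℝ (F.tf f 0) w) * dir (F.tf f 0) p +
      MvPolynomial.C (inner ℝ (F.tf f 1) w) * dir (F.tf f 1) p := by
  conv_lhs => rw [tangent_eq F hf hw]
  rw [dir_add_vec, dir_smul_vec, dir_smul_vec]

theorem edge_ne_zero (e : Edge T) {a b : E3} (ha : a ∈ e.1) (hb : b ∈ e.1) (hab : a ≠ b) :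
    ∃ μ : ℝ, μ ≠ 0 ∧ F.te e = μ • (b - a) := by
  obtain ⟨c, hc⟩ := F.edge_tangent e a ha b hb
  have hc0 : c ≠ 0 := by
    rintro rfl
    rw [zero_smul, sub_eq_zero] at hc
    exact hab hc.symm
  exact ⟨c⁻¹, inv_ne_zero hc0, by rw [hc, smul_smul, inv_mul_cancel₀ hc0, one_smul]; rfl⟩

/-- The cross product of the two tangents is a unit vector orthogonal to both. The orientation of
the frame is not prescribed, so it equals the normal up to the sign `γ`. -/
theorem exists_cross (f : Face T) : ∃ γ : ℝ, γ * γ = 1 ∧ ∀ l : Fin 3,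
    F.nf f l = γ * (F.tf f 0 (l + 1) * F.tf f 1 (l + 2) - F.tf f 0 (l + 2) * F.tf f 1 (l + 1)) := by
  have hon := (F.face f).orthonormal
  have h00 : inner ℝ (F.tf f 0) (F.tf f 0) = (1 : ℝ) := by
    rw [real_inner_self_eq_norm_sq, Frame.tf, OrthonormalBasis.norm_eq_one]; norm_num
  have h11 : inner ℝ (F.tf f 1) (F.tf f 1) = (1 : ℝ) := by
    rw [real_inner_self_eq_norm_sq, Frame.tf, OrthonormalBasis.norm_eq_one]; norm_num
  have h01 : inner ℝ (F.tf f 0) (F.tf f 1) = (0 : ℝ) := hon.2 (by decide)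
  let c : E3 := WithLp.toLp 2 fun l =>
    F.tf f 0 (l + 1) * F.tf f 1 (l + 2) - F.tf f 0 (l + 2) * F.tf f 1 (l + 1)
  have hc : ∀ l, c l = F.tf f 0 (l + 1) * F.tf f 1 (l + 2) - F.tf f 0 (l + 2) * F.tf f 1 (l + 1) :=
    fun l => rfl
  have hc0 : inner ℝ (F.tf f 0) c = (0 : ℝ) := by
    rw [inner_e3]
    simp only [hc, Fin.isValue, Fin.reduceAdd]
    ring
  have hc1 : inner ℝ (F.tf f 1) c = (0 : ℝ) := by
    rw [inner_e3]
    simp only [hc, Fin.isValue, Fin.reduceAdd]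
    ring
  have hcc : inner ℝ c c = (1 : ℝ) := by
    have : inner ℝ c c = inner ℝ (F.tf f 0) (F.tf f 0) * inner ℝ (F.tf f 1) (F.tf f 1) -
        inner ℝ (F.tf f 0) (F.tf f 1) * inner ℝ (F.tf f 0) (F.tf f 1) := by
      simp only [inner_e3, hc, Fin.isValue, Fin.reduceAdd]
      ring
    rw [this, h00, h11, h01]; norm_num
  have h := sum_inner_smul (F.face f) c
  rw [show F.face f 0 = F.tf f 0 from rfl, show F.face f 1 = F.tf f 1 from rfl, hc0, hc1, zero_smul,
    zero_smul, zero_add, zero_add] at h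
  set γ := inner ℝ (F.face f 2) c with hγ
  have hγγ : γ * γ = 1 := by
    rw [← hcc]
    conv_rhs => rw [h]
    rw [real_inner_smul_left, real_inner_smul_right, real_inner_self_eq_norm_sq,
      OrthonormalBasis.norm_eq_one]
    ring
  refine ⟨γ, hγγ, fun l => ?_⟩
  rw [← hc, h, PiLp.smul_apply, smul_eq_mul, ← mul_assoc, hγγ, one_mul]
  rfl

end frames

/-! ## Components of matrix fields -/

section components

variable (σ τ : Matrix (Fin 3) (Fin 3) Poly) (a b c : E3)

theorem comp_eq (σ : Matrix (Fin 3) (Fin 3) Poly) (a b : E3) :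
    comp a σ b = ∑ i, MvPolynomial.C (a i) * σ.mulVec (cvec b) i := by
  simp only [comp, Matrix.mulVec, dotProduct, cvec, Finset.mul_sum, mul_assoc]

theorem comp_add_left : comp (a + b) σ c = comp a σ c + comp b σ c := by
  simp [comp, add_mul, Finset.sum_add_distrib]
theorem comp_smul_left (r : ℝ) : comp (r • a) σ c = MvPolynomial.C r * comp a σ c := by
  simp [comp, Finset.mul_sum, mul_assoc]
theorem comp_add_right : comp a σ (b + c) = comp a σ b + comp a σ c := by
  simp [comp, mul_add, Finset.sum_add_distrib]
theorem comp_smul_right (r : ℝ) : comp a σ (r • c) = MvPolynomial.C r * comp a σ c := by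
  simp only [comp, Finset.mul_sum, PiLp.smul_apply, smul_eq_mul, map_mul]
  exact Finset.sum_congr rfl fun i _ => Finset.sum_congr rfl fun j _ => by ring
theorem comp_add : comp a (σ + τ) b = comp a σ b + comp a τ b := by
  simp [comp, mul_add, add_mul, Finset.sum_add_distrib]
theorem comp_sub : comp a (σ - τ) b = comp a σ b - comp a τ b := by
  simp [comp, mul_sub, sub_mul, Finset.sum_sub_distrib]
theorem comp_smul (p : Poly) : comp a (p • σ) b = p * comp a σ b := by
  simp only [comp, Finset.mul_sum, Matrix.smul_apply, smul_eq_mul]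
  exact Finset.sum_congr rfl fun i _ => Finset.sum_congr rfl fun j _ => by ring
theorem comp_symm {σ : Matrix (Fin 3) (Fin 3) Poly} (hσ : σ.IsSymm) : comp a σ b = comp b σ a := by
  rw [comp, comp, Finset.sum_comm]
  refine Finset.sum_congr rfl fun i _ => Finset.sum_congr rfl fun j _ => ?_
  rw [hσ.apply]; ring
theorem comp_hess (u : Poly) : comp a (hess u) b = dir a (dir b u) := by
  rw [dir_dir_eq, comp]
  exact Finset.sum_congr rfl fun i _ => Finset.sum_congr rfl fun j _ => by ring
theorem comp_cdyad (n t : E3) :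
    comp a (cdyad n t) b = MvPolynomial.C (inner ℝ a n * inner ℝ t b) := by
  simp only [comp, cdyad, Matrix.vecMulVec_apply, cvec, inner_e3, Fin.sum_univ_three, map_add,
    map_mul]
  ring
theorem Deg.comp {d : ℤ} {σ : Matrix (Fin 3) (Fin 3) Poly} (h : ∀ i j, Deg d (σ i j)) (a b : E3) :
    Deg d (comp a σ b) := by
  refine Deg.sum fun i _ => Deg.sum fun j _ => ?_
  rw [mul_comm]
  exact ((h i j).C_mul _).C_mul _

theorem VanishOrd.comp {x : E3} {m : ℕ} {σ : Matrix (Fin 3) (Fin 3) Poly}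
    (h : ∀ i j, VanishOrd x m (σ i j)) (a b : E3) : VanishOrd x m (comp a σ b) := by
  refine VanishOrd.sum fun i _ => VanishOrd.sum fun j _ => ?_
  rw [mul_comm]
  exact ((h i j).C_mul _).C_mul _

/-- A component is a combination of the components in an orthonormal frame. -/
theorem zeroOn_of_frame {K : Cell T} {s : Finset E3} {σ : Matrix (Fin 3) (Fin 3) Poly}
    (B : OrthonormalBasis (Fin 3) ℝ E3) {b : E3} (h : ∀ i, ZeroOn K s (comp (B i) σ b)) (a : E3) :
    ZeroOn K s (comp a σ b) := by
  rw [sum_inner_smul B a, comp_add_left, comp_add_left, comp_smul_left, comp_smul_left,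
    comp_smul_left]
  exact (((h 0).mul_left _).add ((h 1).mul_left _)).add ((h 2).mul_left _)

theorem zeroOn_of_frame_right {K : Cell T} {s : Finset E3} {σ : Matrix (Fin 3) (Fin 3) Poly}
    (B : OrthonormalBasis (Fin 3) ℝ E3) {a : E3} (h : ∀ i, ZeroOn K s (comp a σ (B i))) (b : E3) :
    ZeroOn K s (comp a σ b) := by
  rw [sum_inner_smul B b, comp_add_right, comp_add_right, comp_smul_right, comp_smul_right,
    comp_smul_right]
  exact (((h 0).mul_left _).add ((h 1).mul_left _)).add ((h 2).mul_left _)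

variable (F : Frame T) (f : Face T)

theorem tanV_mulVec (j : Fin 2) :
    tanV F f (σ.mulVec (cvec b)) j = comp (F.tf f j) σ b := (comp_eq _ _ _).symm

theorem tanM_isSymm {σ : Matrix (Fin 3) (Fin 3) Poly} (hσ : σ.IsSymm) : (tanM F f σ).IsSymm :=
  Matrix.IsSymm.ext fun _ _ => comp_symm _ _ hσ

theorem tanM_hess (u : Poly) : tanM F f (hess u) = hessF F f u := by
  ext1 i j; exact comp_hess _ _ _

theorem tanV_hess (u : Poly) :
    tanV F f ((hess u).mulVec (cvec b)) = gradF F f (dir b u) := by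
  ext1 i
  rw [tanV_mulVec, comp_hess]; rfl

theorem dir_comp (w : E3) : dir w (comp a σ b) =
    ∑ i, ∑ j, MvPolynomial.C (a i) * dir w (σ i j) * MvPolynomial.C (b j) := by
  simp only [comp, dir_sum, dir_mul, dir_C, zero_mul, zero_add, mul_zero, add_zero]

/-- The normal components of the curl are derivatives along the face of the tangential
components. -/
theorem exists_comp_curl : ∃ γ : ℝ, γ ≠ 0 ∧ ∀ σ : Matrix (Fin 3) (Fin 3) Poly, ∀ a,
    comp a (curl σ) (F.nf f) =
      MvPolynomial.C γ * rotF F f (fun j => comp a σ (F.tf f j)) := by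
  obtain ⟨γ, hγ, h⟩ := exists_cross F f
  -- The minus sign comes from the sign convention of `rotF`.
  refine ⟨-γ, by rintro h0; rw [neg_eq_zero.mp h0] at hγ; norm_num at hγ, fun σ a => ?_⟩
  simp only [rotF, dir_comp]
  simp only [comp, curl_apply, dir, Fin.sum_univ_three, h, map_mul, map_sub, map_neg]
  simp only [Fin.isValue, Fin.reduceAdd]
  ring

end components

/-! ## Polynomials on a plane -/

section flat

/-- The coordinates of the orthogonal projection to the plane through `a` with unit normal `n`. -/
noncomputable def flatX (a n : E3) (i : Fin 3) : Poly :=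
  MvPolynomial.X i - MvPolynomial.C (n i) *
    ∑ j, MvPolynomial.C (n j) * (MvPolynomial.X j - MvPolynomial.C (a j))

/-- The composition with the orthogonal projection to the plane through `a` with unit normal `n`. -/
noncomputable def flat (a n : E3) : Poly →ₐ[ℝ] Poly := MvPolynomial.aeval (flatX a n)

theorem deg_flatX (a n : E3) (i : Fin 3) : Deg 1 (flatX a n i) :=
  (deg_X i).sub ((Deg.sum fun j _ =>
    ((deg_X j).sub ((deg_C _).mono zero_le_one)).C_mul _).C_mul _)

theorem Deg.flat {d : ℤ} {p : Poly} (hp : Deg d p) (a n : E3) : Deg d (flat a n p) := by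
  rw [GradGrad.flat, MvPolynomial.aeval_def, MvPolynomial.eval₂_eq']
  refine Deg.sum fun m hm => Deg.C_mul _ ?_
  have h : Deg (∑ i, (m i : ℤ) * 1) (∏ i, flatX a n i ^ m i) :=
    Deg.prod fun i _ => (deg_flatX a n i).pow _
  refine h.mono ?_
  have h2 := hp m hm
  rw [Finsupp.degree_eq_sum] at h2
  push_cast at h2
  simpa using h2

theorem ev_flatX (a n x : E3) (i : Fin 3) :
    ev (flatX a n i) x = (x - (inner ℝ n (x - a) : ℝ) • n) i := by
  simp only [flatX, ev_sub, ev_X, ev_mul, ev_C, ev_add, inner_e3, Fin.sum_univ_three, PiLp.sub_apply,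
    PiLp.smul_apply, smul_eq_mul]
  ring

theorem ev_flat (a n x : E3) (p : Poly) :
    ev (flat a n p) x = ev p (x - (inner ℝ n (x - a) : ℝ) • n) := by
  induction p using MvPolynomial.induction_on with
  | C c => rw [flat, MvPolynomial.algHom_C, MvPolynomial.algebraMap_eq, ev_C, ev_C]
  | add p q hp hq => rw [map_add, ev_add, ev_add, hp, hq]
  | mul_X p i hp => rw [map_mul, ev_mul, ev_mul, hp, ev_X, flat, MvPolynomial.aeval_X, ev_flatX]

theorem dir_X (w : E3) (i : Fin 3) : dir w (MvPolynomial.X i) = MvPolynomial.C (w i) := by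
  simp only [dir, pd_X, Fin.sum_univ_three]
  fin_cases i <;> simp

/-- Chain rule: the derivative of the orthogonal projection removes the normal part of the
direction. -/
theorem dir_flat (a n w : E3) (p : Poly) :
    dir w (flat a n p) = flat a n (dir (w - (inner ℝ n w : ℝ) • n) p) := by
  induction p using MvPolynomial.induction_on with
  | C c => rw [flat, MvPolynomial.algHom_C, MvPolynomial.algebraMap_eq, dir_C, dir_C, map_zero]
  | add p q hp hq => rw [map_add, dir_add, dir_add, map_add, hp, hq]
  | mul_X p i hp =>
    have h : dir w (flat a n (MvPolynomial.X i)) =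
        flat a n (dir (w - (inner ℝ n w : ℝ) • n) (MvPolynomial.X i)) := by
      rw [dir_X, flat, MvPolynomial.aeval_X, MvPolynomial.algHom_C, MvPolynomial.algebraMap_eq,
        flatX, dir_sub, dir_X, dir_C_mul, dir_sum]
      simp only [dir_C_mul, dir_sub, dir_X, dir_C, inner_e3, Fin.sum_univ_three, PiLp.sub_apply,
        PiLp.smul_apply, smul_eq_mul, map_sub, map_mul, map_add]
      ring
    rw [map_mul, dir_mul, dir_mul, map_add, map_mul, map_mul, hp, h]

end flat

/-! ## Potentials on a face -/

section facePotentials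

variable (F : Frame T)

theorem inner_nf_of_mem {K : Cell T} {f : Face T} (hf : f.1 ⊆ K.1) {a x : E3} (ha : a ∈ f.1)
    (hx : x ∈ planeOf K f.1) : inner ℝ (F.nf f) (x - a) = 0 := by
  obtain ⟨i, rfl⟩ := exists_opp K f hf
  obtain ⟨h, -, hw⟩ := exists_height F K i
  have h1 := ev_lam_add K i a (x - a)
  rw [add_sub_cancel, mem_planeOf_opp.mp hx,
    mem_planeOf_opp.mp (vertex_mem_planeOf (v := ⟨a, hf ha⟩) ha), zero_add] at h1
  rw [← hw, ← h1, mul_zero]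

theorem proj_mem_planeOf {K : Cell T} {f : Face T} (hf : f.1 ⊆ K.1) {a : E3} (ha : a ∈ f.1)
    (x : E3) : x - (inner ℝ (F.nf f) (x - a) : ℝ) • F.nf f ∈ planeOf K f.1 := by
  obtain ⟨i, rfl⟩ := exists_opp K f hf
  obtain ⟨h, h0, hw⟩ := exists_height F K i
  have h1 := ev_lam_add K i a (x - (inner ℝ (F.nf (opp K i)) (x - a) : ℝ) • F.nf (opp K i) - a)
  rw [add_sub_cancel, mem_planeOf_opp.mp (vertex_mem_planeOf (v := ⟨a, hf ha⟩) ha), zero_add] at h1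
  rw [mem_planeOf_opp, h1]
  refine (mul_eq_zero.mp (?_ : h * _ = 0)).resolve_left h0
  rw [hw, sub_right_comm, inner_sub_right, real_inner_smul_right, Frame.nf,
    real_inner_self_eq_norm_sq, OrthonormalBasis.norm_eq_one]
  ring

theorem flat_eq_of_mem {K : Cell T} {f : Face T} (hf : f.1 ⊆ K.1) {a x : E3} (ha : a ∈ f.1)
    (hx : x ∈ planeOf K f.1) (p : Poly) : ev (flat a (F.nf f) p) x = ev p x := by
  rw [ev_flat, inner_nf_of_mem F hf ha hx, zero_smul, sub_zero]

/-- The projection maps space into the plane of the face. This turns identities that hold only on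
the face into identities of polynomials, to which the Poincaré lemma applies. -/
theorem flat_eq_zero {K : Cell T} {f : Face T} (hf : f.1 ⊆ K.1) {a : E3} (ha : a ∈ f.1) {p : Poly}
    (hp : ZeroOn K f.1 p) : flat a (F.nf f) p = 0 :=
  poly_ext fun x => by rw [ev_flat, hp _ (proj_mem_planeOf F hf ha x), ev_zero]

theorem inner_nf_tf (f : Face T) (j : Fin 2) : inner ℝ (F.nf f) (F.tf f j) = (0 : ℝ) :=
  (F.face f).orthonormal.2 (by fin_cases j <;> decide)

theorem inner_tf_tf (f : Face T) (i j : Fin 2) :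
    inner ℝ (F.tf f i) (F.tf f j) = (if i = j then 1 else 0 : ℝ) := by
  have := orthonormal_iff_ite.mp (F.face f).orthonormal i.castSucc j.castSucc
  rw [Frame.tf, Frame.tf, this]
  simp

theorem dir_tf_flat (f : Face T) (a : E3) (j : Fin 2) (p : Poly) :
    dir (F.tf f j) (flat a (F.nf f) p) = flat a (F.nf f) (dir (F.tf f j) p) := by
  rw [dir_flat, inner_nf_tf, zero_smul, sub_zero]

theorem dir_nf_flat (f : Face T) (a : E3) (p : Poly) :
    dir (F.nf f) (flat a (F.nf f) p) = 0 := by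
  rw [dir_flat, Frame.nf, real_inner_self_eq_norm_sq, OrthonormalBasis.norm_eq_one]
  simp

/-- The gradient in an orthonormal frame. -/
theorem pd_eq_frame (B : OrthonormalBasis (Fin 3) ℝ E3) (i : Fin 3) (p : Poly) :
    pd i p = MvPolynomial.C (B 0 i) * dir (B 0) p + MvPolynomial.C (B 1 i) * dir (B 1) p +
      MvPolynomial.C (B 2 i) * dir (B 2) p := by
  rw [← dir_single]
  conv_lhs => rw [sum_inner_smul B (EuclideanSpace.single i 1)]
  have h : ∀ j, inner ℝ (B j) (EuclideanSpace.single i (1 : ℝ)) = B j i := by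
    intro j
    rw [inner_e3]
    fin_cases i <;> simp
  rw [dir_add_vec, dir_add_vec, dir_smul_vec, dir_smul_vec, dir_smul_vec, h, h, h]

/-- A vector field on a face whose rotation vanishes is a gradient. -/
theorem exists_gradF {K : Cell T} {f : Face T} (hf : f.1 ⊆ K.1) {a : E3} (ha : a ∈ f.1) {d : ℤ}
    {w : Fin 2 → Poly} (hd : ∀ i, Deg d (w i)) (hw : ZeroOn K f.1 (rotF F f w)) :
    ∃ u, Deg (d + 1) u ∧ gradF F f u = fun j => flat a (F.nf f) (w j) := by
  have h0 : dir (F.tf f 1) (flat a (F.nf f) (w 0)) = dir (F.tf f 0) (flat a (F.nf f) (w 1)) := by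
    have := flat_eq_zero F hf ha hw
    rw [rotF, map_add, map_neg, ← dir_tf_flat, ← dir_tf_flat] at this
    linear_combination this
  have hn : ∀ j, dir (F.nf f) (flat a (F.nf f) (w j)) = 0 := fun j => dir_nf_flat F f a _
  -- The field is extended to space with no normal component and constant in the normal direction;
  -- its spatial curl then vanishes together with its rotation on the face.
  obtain ⟨u, hu1, hu2⟩ := exists_potential (d := d)
    (w := fun i => MvPolynomial.C (F.tf f 0 i) * flat a (F.nf f) (w 0) +
      MvPolynomial.C (F.tf f 1 i) * flat a (F.nf f) (w 1))
    (fun i => (((hd 0).flat _ _).C_mul _).add (((hd 1).flat _ _).C_mul _)) (by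
      intro i j
      have key : ∀ i : Fin 3, ∀ p, pd i p = MvPolynomial.C (F.tf f 0 i) * dir (F.tf f 0) p +
          MvPolynomial.C (F.tf f 1 i) * dir (F.tf f 1) p +
          MvPolynomial.C (F.nf f i) * dir (F.nf f) p := fun i p => pd_eq_frame (F.face f) i p
      rw [key i, key j]
      simp only [dir_add, dir_C_mul, hn, h0]
      ring)
  refine ⟨u, hu1, ?_⟩
  ext1 j
  have h1 : gradF F f u j = MvPolynomial.C (inner ℝ (F.tf f j) (F.tf f 0)) * flat a (F.nf f) (w 0) +
      MvPolynomial.C (inner ℝ (F.tf f j) (F.tf f 1)) * flat a (F.nf f) (w 1) := by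
    simp only [gradF, dir, hu2, inner_e3, Fin.sum_univ_three, map_add, map_mul]
    ring
  rw [h1, inner_tf_tf, inner_tf_tf]
  fin_cases j <;> simp

/-- A symmetric matrix field on a face whose rotation vanishes is a Hessian. -/
theorem exists_hessF {K : Cell T} {f : Face T} (hf : f.1 ⊆ K.1) {d : ℤ}
    {τ : Matrix (Fin 2) (Fin 2) Poly} (hs : τ.IsSymm) (hd : ∀ i j, Deg d (τ i j))
    (hτ : ∀ i, ZeroOn K f.1 (rotFM F f τ i)) :
    ∃ u, Deg (d + 2) u ∧ ∀ i j, ZeroOn K f.1 (hessF F f u i j - τ i j) := by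
  obtain ⟨a, ha⟩ : f.1.Nonempty := by rw [← Finset.card_pos, f.2.2]; norm_num
  have h1 : ∀ i, ∃ u, Deg (d + 1) u ∧ gradF F f u = fun j => flat a (F.nf f) (τ i j) :=
    fun i => exists_gradF F hf ha (hd i) (hτ i)
  choose w hw1 hw2 using h1
  obtain ⟨u, hu1, hu2⟩ := exists_gradF F hf ha (w := w) hw1 (by
    have h01 := congrFun (hw2 0) 1
    have h10 := congrFun (hw2 1) 0
    simp only [gradF] at h01 h10
    rw [rotF, h01, h10, hs.apply 0 1, neg_add_cancel]
    exact zeroOn_zero)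
  refine ⟨u, by rwa [add_assoc] at hu1, fun i j => zeroOn_sub_iff.mpr fun x hx => ?_⟩
  have h2 := congrFun hu2 j
  have h3 := congrFun (hw2 j) i
  simp only [gradF] at h2 h3
  rw [hessF, Matrix.of_apply, h2, dir_tf_flat, h3, flat_eq_of_mem F hf ha hx,
    flat_eq_of_mem F hf ha hx, hs.apply]

end facePotentials

/-! ## Bernstein coefficients of matrix fields -/

section coefficients

/-- The real number `aᵀ C b`. -/
def quad (a : E3) (C : Fin 3 → Fin 3 → ℝ) (b : E3) : ℝ := ∑ i, ∑ j, a i * C i j * b j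

theorem quad_add_right (a b b' : E3) (C : Fin 3 → Fin 3 → ℝ) :
    quad a C (b + b') = quad a C b + quad a C b' := by
  simp [quad, mul_add, Finset.sum_add_distrib]
theorem quad_smul_right (a b : E3) (r : ℝ) (C : Fin 3 → Fin 3 → ℝ) :
    quad a C (r • b) = r * quad a C b := by
  simp only [quad, Finset.mul_sum, PiLp.smul_apply, smul_eq_mul]
  exact Finset.sum_congr rfl fun i _ => Finset.sum_congr rfl fun j _ => by ring
theorem quad_add_left (a a' b : E3) (C : Fin 3 → Fin 3 → ℝ) :
    quad (a + a') C b = quad a C b + quad a' C b := by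
  simp [quad, add_mul, Finset.sum_add_distrib]
theorem quad_smul_left (a b : E3) (r : ℝ) (C : Fin 3 → Fin 3 → ℝ) :
    quad (r • a) C b = r * quad a C b := by
  simp only [quad, Finset.mul_sum, PiLp.smul_apply, smul_eq_mul]
  exact Finset.sum_congr rfl fun i _ => Finset.sum_congr rfl fun j _ => by ring
theorem quad_single (i j : Fin 3) (C : Fin 3 → Fin 3 → ℝ) :
    quad (EuclideanSpace.single i 1) C (EuclideanSpace.single j 1) = C i j := by
  simp only [quad, Fin.sum_univ_three, PiLp.single_apply]
  fin_cases i <;> fin_cases j <;> simp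

theorem bern_injective (K : Cell T) {d : ℕ} {c c' : (K.1 → ℕ) → ℝ} (h : bern K d c = bern K d c')
    {α : K.1 → ℕ} (hα : ∑ v, α v = d) : c α = c' α := by
  have h1 := (bern_vanish_iff K (subset_refl K.1) (c := c - c') (d := d)
    (by rw [← Finset.card_pos, K.2.2]; norm_num)).mp (fun x _ => by
      rw [bern_sub, h, sub_self, ev_zero]) α hα (fun v hv => absurd v.2 hv)
  exact sub_eq_zero.mp h1

theorem comp_bern (K : Cell T) (d : ℕ) (c : Fin 3 → Fin 3 → (K.1 → ℕ) → ℝ) (a b : E3) :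
    comp a (Matrix.of fun i j => bern K d (c i j)) b =
      bern K d fun α => quad a (fun i j => c i j α) b := by
  have h : (fun α => quad a (fun i j => c i j α) b) =
      ∑ i, ∑ j, (a i * b j) • c i j := by
    funext α
    simp only [quad, Finset.sum_apply, Pi.smul_apply, smul_eq_mul]
    exact Finset.sum_congr rfl fun i _ => Finset.sum_congr rfl fun j _ => by ring
  rw [h, bern_sum, comp]
  refine Finset.sum_congr rfl fun i _ => ?_
  rw [bern_sum]
  refine Finset.sum_congr rfl fun j _ => ?_
  rw [bern_smul, map_mul, Matrix.of_apply]
  ring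

theorem zeroOn_bern_iff (K : Cell T) {s : Finset E3} (hs : s ⊆ K.1) (hne : s.Nonempty) {d : ℕ}
    {c : (K.1 → ℕ) → ℝ} : ZeroOn K s (bern K d c) ↔
      ∀ α : K.1 → ℕ, ∑ v, α v = d → (∀ v : K.1, v.1 ∉ s → α v = 0) → c α = 0 := by
  constructor
  · exact fun h => (bern_vanish_iff K hs hne).mp fun x hx => h x (subset_planeOf K hs hx)
  · exact fun h x hx => ev_bern_eq_zero K h hx

theorem zeroOn_bern_opp (K : Cell T) (i : K.1) {d : ℕ} {c : (K.1 → ℕ) → ℝ} :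
    ZeroOn K (opp K i).1 (bern K d c) ↔ ∀ α : K.1 → ℕ, ∑ v, α v = d → α i = 0 → c α = 0 := by
  rw [zeroOn_bern_iff K (opp_subset K i) (opp_nonempty K i)]
  refine forall₂_congr fun α _ => ?_
  have : (∀ v : K.1, v.1 ∉ (opp K i).1 → α v = 0) ↔ α i = 0 := by
    simp only [vertex_mem_opp, not_not, forall_eq]
  rw [this]

theorem exists_third (K : Cell T) (i l : K.1) : ∃ m : K.1, m ≠ i ∧ m ≠ l := by
  classical
  have : ({i, l} : Finset K.1) ≠ Finset.univ := by
    intro h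
    have h1 := congrArg Finset.card h
    rw [Finset.card_univ, Fintype.card_coe, K.2.2] at h1
    have := Finset.card_le_two (a := i) (b := l)
    omega
  obtain ⟨m, -, hm⟩ := Finset.exists_of_ssubset (Finset.ssubset_univ_iff.mpr this)
  simp only [Finset.mem_insert, Finset.mem_singleton, not_or] at hm
  exact ⟨m, hm⟩

/-- A vector is the sum of tangential vectors of two different faces. -/
theorem exists_tangent_add (K : Cell T) {i l : K.1} (hil : i ≠ l) (w : E3) :
    ∃ u v, w = u + v ∧ IsTangent K (opp K i).1 u ∧ IsTangent K (opp K l).1 v := by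
  obtain ⟨m, hmi, hml⟩ := exists_third K i l
  -- The edge from a third vertex `m` to `i` lies in the face opposite to `l`, and its multiple
  -- removes the change of the coordinate of `i`.
  refine ⟨w - slope K w i • (i.1 - m.1), slope K w i • (i.1 - m.1), by abel, ?_, ?_⟩
  · have h1 : slope K w i = slope K (w - slope K w i • (i.1 - m.1)) i +
        slope K (slope K w i • (i.1 - m.1)) i := by
      rw [← slope_add, sub_add_cancel]
    rw [slope_smul, slope_sub, if_pos rfl, if_neg hmi.symm] at h1
    rw [isTangent_opp]
    linarith
  · rw [isTangent_opp, slope_smul, slope_sub, if_neg hil.symm, if_neg hml.symm]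
    simp

end coefficients

/-! ## The bubble functions for the curl -/

section bubCurl

variable (F : Frame T)

/-- The tangential components of a matrix field vanish on the faces of `K`. -/
def TangentZero (K : Cell T) (σ : Matrix (Fin 3) (Fin 3) Poly) : Prop :=
  ∀ i : K.1, ∀ t, IsTangent K (opp K i).1 t → ∀ a, ZeroOn K (opp K i).1 (comp a σ t)

theorem bub_ne_zero (K : Cell T) (s : Finset E3) : bub K s ≠ 0 := by
  rw [bub_eq_prod]
  refine Finset.prod_ne_zero_iff.mpr fun v _ h => ?_
  have := congrArg (fun p => ev p v.1) h
  simp [ev_lam_vertex] at this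

/-- The argument works on each Bernstein coefficient, a symmetric matrix that kills the tangents of
every face on which its monomial survives. With two such faces the tangents span space and the
matrix is zero; with one it is a multiple of the dyad of the normal; with none it is arbitrary, but
then the monomial contains all four coordinates. These are the two kinds of generators. -/
theorem mem_bubCurl {k : ℕ} (hk : 4 ≤ k) {K : Cell T} {σ : Matrix (Fin 3) (Fin 3) Poly}
    (hs : σ.IsSymm) (hd : ∀ i j, Deg (k : ℤ) (σ i j)) (hv : ∀ x ∈ K.1, ∀ i j, VanishOrd x 3 (σ i j))
    (ht : TangentZero K σ) : σ ∈ bubCurl F k K := by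
  classical
  have hc : ∀ i j, ∃ c, σ i j = bern K k c := fun i j => exists_bern K (hd i j)
  choose c hc using hc
  have hσ : σ = Matrix.of fun i j => bern K k (c i j) := by ext1 i j; exact hc i j
  let C : (K.1 → ℕ) → Fin 3 → Fin 3 → ℝ := fun α i j => c i j α
  have hsymm : ∀ α, ∑ v, α v = k → ∀ i j, C α i j = C α j i := fun α hα i j =>
    bern_injective K (by rw [← hc, ← hc, hs.apply]) hα
  have hquad : ∀ α, ∑ v, α v = k → ∀ i : K.1, α i = 0 → ∀ t, IsTangent K (opp K i).1 t →
      ∀ a, quad a (C α) t = 0 := by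
    intro α hα i hi t htt a
    have := ht i t htt a
    rw [hσ, comp_bern] at this
    exact (zeroOn_bern_opp K i).mp this α hα hi
  have hsq : ∀ α, ∑ v, α v = k → ∀ a b, quad a (C α) b = quad b (C α) a := by
    intro α hα a b
    simp only [quad, Fin.sum_univ_three]
    rw [hsymm α hα 1 0, hsymm α hα 2 0, hsymm α hα 2 1]
    ring
  have hzero : ∀ α, ∑ v, α v = k → ∀ i l : K.1, i ≠ l → α i = 0 → α l = 0 → C α = 0 := by
    intro α hα i l hil hi hl
    funext p q
    rw [← quad_single p q (C α)]
    obtain ⟨u, v, huv, hu, hv⟩ := exists_tangent_add K hil (EuclideanSpace.single q 1)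
    rw [huv, quad_add_right, hquad α hα i hi u hu, hquad α hα l hl v hv, add_zero]; rfl
  have hface : ∀ α, ∑ v, α v = k → ∀ i : K.1, α i = 0 → ∀ p q,
      C α p q = quad (F.nf (opp K i)) (C α) (F.nf (opp K i)) *
        (F.nf (opp K i) p * F.nf (opp K i) q) := by
    intro α hα i hi p q
    have hdec : ∀ r : Fin 3, ∃ t, IsTangent K (opp K i).1 t ∧
        EuclideanSpace.single r (1 : ℝ) = t + F.nf (opp K i) r • F.nf (opp K i) := by
      intro r
      refine ⟨EuclideanSpace.single r 1 - F.nf (opp K i) r • F.nf (opp K i), ?_, by abel⟩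
      rw [isTangent_opp_iff F, inner_sub_right, real_inner_smul_right, Frame.nf,
        real_inner_self_eq_norm_sq, OrthonormalBasis.norm_eq_one, inner_e3]
      fin_cases r <;> simp
    obtain ⟨t, ht, hpt⟩ := hdec p
    obtain ⟨t', ht', hqt⟩ := hdec q
    conv_lhs => rw [← quad_single p q (C α)]
    rw [hpt, hqt, quad_add_right, hquad α hα i hi t' ht', zero_add, quad_smul_right, quad_add_left,
      hsq α hα t, hquad α hα i hi t ht, zero_add, quad_smul_left]
    ring
  -- The coefficients of the face monomials, reduced to the normal-normal entry; those of the
  -- interior monomials are collected separately.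
  let cf : K.1 → (K.1 → ℕ) → ℝ := fun i α =>
    if α i = 0 then quad (F.nf (opp K i)) (C α) (F.nf (opp K i)) else 0
  let cK : Fin 3 → Fin 3 → (K.1 → ℕ) → ℝ := fun p q α => if ∀ v, α v ≠ 0 then C α p q else 0
  have hsum : σ = ∑ i, bern K k (cf i) • cdyad (F.nf (opp K i)) (F.nf (opp K i)) +
      Matrix.of fun p q => bern K k (cK p q) := by
    ext1 p q
    have h1 : bern K k (c p q) = bern K k (∑ i, (F.nf (opp K i) p * F.nf (opp K i) q) • cf i +
        cK p q) := by
      refine bern_congr K fun α hα => ?_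
      simp only [Pi.add_apply, Finset.sum_apply, Pi.smul_apply, smul_eq_mul]
      by_cases hall : ∀ v, α v ≠ 0
      · simp only [cK, cf, if_pos hall, hall, if_false, mul_zero, Finset.sum_const_zero, zero_add]
        rfl
      · simp only [cK, if_neg hall, add_zero]
        push Not at hall
        obtain ⟨i, hi⟩ := hall
        rw [Finset.sum_eq_single i]
        · simp only [cf, if_pos hi]
          rw [mul_comm]
          exact hface α hα i hi p q
        · intro l _ hl
          by_cases hl0 : α l = 0
          · simp only [cf, if_pos hl0, hzero α hα l i hl hl0 hi]
            simp [quad]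
          · simp only [cf, if_neg hl0, mul_zero]
        · exact fun h => absurd (Finset.mem_univ i) h
    rw [hc, h1, bern_add, bern_sum, Matrix.add_apply, Matrix.sum_apply, Matrix.of_apply]
    congr 1
    refine Finset.sum_congr rfl fun i _ => ?_
    rw [bern_smul, Matrix.smul_apply, cdyad, Matrix.vecMulVec_apply, cvec, cvec, smul_eq_mul, map_mul]
    ring
  rw [hsum]
  refine add_mem (Submodule.sum_mem _ fun i _ => Submodule.subset_span (Or.inl ?_))
    (Submodule.subset_span (Or.inr ?_))
  · have hpos : ∀ α, ∑ v, α v = k → cf i α ≠ 0 → α i = 0 ∧ ∀ v, v ≠ i → α v ≠ 0 := by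
      intro α hα h0
      have hi : α i = 0 := by
        by_contra h
        exact h0 (if_neg h)
      refine ⟨hi, fun v hvi hv0 => h0 ?_⟩
      simp only [cf, hzero α hα v i hvi hv0 hi]
      simp [quad]
    obtain ⟨q, hq1, hq2, hq3⟩ := bern_eq_bub_mul K (opp_subset K i) 1 (c := cf i) (d := k)
      (fun α hα h0 v hv => Nat.one_le_iff_ne_zero.mpr
        ((hpos α hα h0).2 v (vertex_mem_opp.mp hv)))
    refine ⟨i, q, by rw [(opp K i).2.2] at hq1; simpa using hq1, fun x hx => ?_,
      by rw [hq2, pow_one]⟩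
    refine hq3 ⟨x, hx⟩ fun α hα h0 => ?_
    obtain ⟨hi, hpos⟩ := hpos α hα h0
    by_contra hcon
    push Not at hcon
    have hle : ∀ v : K.1, v ≠ ⟨x, hx⟩ → v ≠ i → α v ≤ 1 := by
      intro v hvx hvi
      by_contra hlt
      have := hcon v hvx fun _ => by omega
      exact this.1 (vertex_mem_opp.mpr hvi)
    have hsumle : ∑ v ∈ Finset.univ.erase (⟨x, hx⟩ : K.1), α v ≤ 3 := by
      calc ∑ v ∈ Finset.univ.erase (⟨x, hx⟩ : K.1), α v
          ≤ ∑ v ∈ Finset.univ.erase (⟨x, hx⟩ : K.1), 1 := by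
            refine Finset.sum_le_sum fun v hv => ?_
            by_cases hvi : v = i
            · rw [hvi, hi]; exact Nat.zero_le 1
            · exact hle v (Finset.ne_of_mem_erase hv) hvi
        _ = 3 := by
            rw [Finset.sum_const, Finset.card_erase_of_mem (Finset.mem_univ _), Finset.card_univ,
              Fintype.card_coe, K.2.2]
            simp
    have htot : α ⟨x, hx⟩ + ∑ v ∈ Finset.univ.erase (⟨x, hx⟩ : K.1), α v = k := by
      rw [← hα]
      exact Finset.add_sum_erase _ _ (Finset.mem_univ _)
    -- At the vertex opposite to the face the total degree would be at most three, which is excluded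
    -- by `4 ≤ k`. At a vertex of the face the entry is at least `k - 2`, and the third order zero
    -- applies.
    by_cases hxi : (⟨x, hx⟩ : K.1) = i
    · rw [hxi, hi] at htot
      rw [hxi] at hsumle
      omega
    · have hsumle2 : ∑ v ∈ Finset.univ.erase (⟨x, hx⟩ : K.1), α v ≤ 2 := by
        rw [← Finset.add_sum_erase _ _ (Finset.mem_erase.mpr ⟨Ne.symm hxi, Finset.mem_univ i⟩), hi,
          zero_add]
        calc ∑ v ∈ (Finset.univ.erase (⟨x, hx⟩ : K.1)).erase i, α v
            ≤ ∑ v ∈ (Finset.univ.erase (⟨x, hx⟩ : K.1)).erase i, 1 :=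
              Finset.sum_le_sum fun v hv => hle v
                (Finset.ne_of_mem_erase (Finset.mem_of_mem_erase hv)) (Finset.ne_of_mem_erase hv)
          _ = 2 := by
              rw [Finset.sum_const, Finset.card_erase_of_mem
                (Finset.mem_erase.mpr ⟨Ne.symm hxi, Finset.mem_univ i⟩),
                Finset.card_erase_of_mem (Finset.mem_univ _), Finset.card_univ,
                Fintype.card_coe, K.2.2]
              simp
      have hC : C α = 0 := by
        funext p q
        refine coeff_eq_zero_of_vanishOrd K ⟨x, hx⟩ (m := 3) (d := k) ?_ α hα (by omega)
        rw [← hc]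
        exact hv x hx p q
      refine h0 ?_
      simp only [cf, hC]
      simp [quad]
  · have hq : ∀ p q, ∃ Q, Deg ((k : ℤ) - 4) Q ∧ bern K k (cK p q) = bub K K.1 * Q := by
      intro p q
      obtain ⟨Q, h1, h2, -⟩ := bern_eq_bub_mul K (subset_refl K.1) 1 (c := cK p q) (d := k)
        (fun α hα h0 v _ => by
          by_contra hlt
          exact h0 (if_neg fun h => h v (by omega)))
      rw [pow_one] at h2
      exact ⟨Q, by rw [K.2.2] at h1; simpa using h1, h2⟩
    choose Q hQ1 hQ2 using hq
    refine ⟨Matrix.of Q, Matrix.IsSymm.ext fun p q => ?_, hQ1, ?_⟩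
    · refine mul_left_cancel₀ (bub_ne_zero K K.1) ?_
      rw [Matrix.of_apply, Matrix.of_apply, ← hQ2, ← hQ2]
      refine bern_congr K fun α hα => ?_
      simp only [cK, hsymm α hα p q]
    · ext1 p q
      exact hQ2 p q

end bubCurl

/-! ## Moments on edges -/

section edgeMoments

variable (F : Frame T) {K : Cell T} {e : Edge T}

theorem edge_vertices (he : e.1 ⊆ K.1) : ∃ a b : K.1, a ≠ b ∧ e.1 = {a.1, b.1} := by
  classical
  obtain ⟨x, y, hxy, h⟩ := Finset.card_eq_two.mp e.2.2
  have hx : x ∈ K.1 := he (h ▸ by simp)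
  have hy : y ∈ K.1 := he (h ▸ by simp)
  exact ⟨⟨x, hx⟩, ⟨y, hy⟩, fun h => hxy (congrArg Subtype.val h), by rw [h]⟩

theorem edge_nonempty (e : Edge T) : e.1.Nonempty := by
  rw [← Finset.card_pos, e.2.2]; norm_num

theorem face_nonempty (f : Face T) : f.1.Nonempty := by
  rw [← Finset.card_pos, f.2.2]; norm_num

theorem cell_nonempty (K : Cell T) : K.1.Nonempty := by
  rw [← Finset.card_pos, K.2.2]; norm_num

theorem facet_pair {a b : E3} (hab : a ≠ b) : facet {a, b} a = {b} ∧ facet {a, b} b = {a} := by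
  constructor <;> ext x <;> simp <;> grind

theorem sum_lam_edge {a b : K.1} (hab : a ≠ b) (hab' : e.1 = {a.1, b.1}) {x : E3}
    (hx : x ∈ planeOf K e.1) (g : K.1 → ℝ) :
    ∑ v, g v * ev (lam K v) x = g a * ev (lam K a) x + g b * ev (lam K b) x := by
  classical
  rw [← Finset.sum_subset (Finset.subset_univ ({a, b} : Finset K.1)), Finset.sum_pair hab]
  intro v _ hv
  rw [hx v, mul_zero]
  intro h
  rw [hab'] at h
  simp only [Finset.mem_insert, Finset.mem_singleton, ← Subtype.ext_iff] at h hv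
  exact hv h

theorem lam_add_lam_edge {a b : K.1} (hab : a ≠ b) (hab' : e.1 = {a.1, b.1}) {x : E3}
    (hx : x ∈ planeOf K e.1) : ev (lam K a) x + ev (lam K b) x = 1 := by
  have := sum_lam_edge hab hab' hx fun _ => 1
  simp only [one_mul] at this
  rw [← this, sum_ev_lam]

theorem deg_one_edge {a b : K.1} (hab : a ≠ b) (hab' : e.1 = {a.1, b.1}) {r : Poly}
    (hr : Deg 1 r) {x : E3} (hx : x ∈ planeOf K e.1) :
    ev r x = ev (ev r a.1 • 1 + (ev r b.1 - ev r a.1) • lam K b) x := by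
  have h1 := sum_lam_edge hab hab' hx fun v => ev r v.1
  have h2 := lam_add_lam_edge hab hab' hx
  have h3 : ev r x = ∑ v : K.1, ev r v.1 * ev (lam K v) x := by
    conv_lhs => rw [deg_one_eq K hr]
    rw [ev_sum]
    exact Finset.sum_congr rfl fun v _ => by rw [ev_mul, ev_C]
  rw [h3, h1]
  simp only [ev_add, ev_smul, ev_one]
  linear_combination ev r a.1 * h2

theorem ipS_comp_left (he : e.1 ⊆ K.1) (σ : Matrix (Fin 3) (Fin 3) Poly) (a b : E3) (r : Poly) :
    ipS e.1 (comp a σ b) r = ∑ i, a i * ipS e.1 (σ.mulVec (cvec b) i) r := by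
  rw [comp_eq, ipS_sum_left K he (edge_nonempty e)]
  refine Finset.sum_congr rfl fun i _ => ?_
  rw [← MvPolynomial.smul_eq_C_mul, ipS_smul_left]

theorem dofSigma_succ (he : e.1 ⊆ K.1) (σ : Matrix (Fin 3) (Fin 3) Poly) (j : Fin 3) :
    dofSigma F e σ j.succ = ipS e.1 (σ.mulVec (cvec (F.te e)) j) 1 := by
  have h := isIP_ipS he (edge_nonempty e)
  have h1 : ∀ i : Fin 3, ipS e.1 (σ.mulVec (cvec (F.te e)) i) (rtBasis j.succ i) =
      (if i = j then 1 else 0) * ipS e.1 (σ.mulVec (cvec (F.te e)) i) 1 := by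
    intro i
    rw [← h.smul_right]
    congr 1
    rw [MvPolynomial.smul_eq_C_mul, mul_one]
    simp only [rtBasis, Fin.cons_succ, cvec, PiLp.single_apply]
  rw [dofSigma, ipV, Finset.sum_congr rfl fun i _ => h1 i]
  simp

/-- On the edge the position vector is `a + λ_b (b - a)`. -/
theorem dofSigma_zero (he : e.1 ⊆ K.1) {a b : K.1} (hab : a ≠ b) (hab' : e.1 = {a.1, b.1})
    (σ : Matrix (Fin 3) (Fin 3) Poly) :
    dofSigma F e σ 0 = ipS e.1 (comp a.1 σ (F.te e)) 1 +
      ipS e.1 (comp (b.1 - a.1) σ (F.te e)) (lam K b) := by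
  have h := isIP_ipS he (edge_nonempty e)
  rw [dofSigma, ipV, ipS_comp_left he, ipS_comp_left he, ← Finset.sum_add_distrib]
  refine Finset.sum_congr rfl fun i _ => ?_
  rw [← h.smul_right, ← h.smul_right, ← h.add_right]
  refine ipS_congr K he (fun _ _ => rfl) fun x hx => ?_
  rw [show rtBasis 0 i = MvPolynomial.X i from rfl, deg_one_edge hab hab' (deg_X i) hx]
  simp

/-- The constant fields give the means of `σ t`, and the position field adds the first moment of its
tangential part. These are exactly the moments left out by the orthogonality conditions in
`RestSigma.edge_tt` and `RestSigma.edge_nt`. -/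
theorem dofSigma_eq_zero_iff (he : e.1 ⊆ K.1) (σ : Matrix (Fin 3) (Fin 3) Poly) :
    (∀ j, dofSigma F e σ j = 0) ↔ (∀ c, ipS e.1 (comp c σ (F.te e)) 1 = 0) ∧
      ∀ r, Deg 1 r → ipS e.1 (comp (F.te e) σ (F.te e)) r = 0 := by
  obtain ⟨a, b, hab, hab'⟩ := edge_vertices he
  have h := isIP_ipS he (edge_nonempty e)
  obtain ⟨μ, hμ, ht⟩ := edge_ne_zero F e (a := a.1) (b := b.1) (by rw [hab']; simp)
    (by rw [hab']; simp) (fun h => hab (Subtype.ext h))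
  have hcomp : ipS e.1 (comp (F.te e) σ (F.te e)) (lam K b) =
      μ * ipS e.1 (comp (b.1 - a.1) σ (F.te e)) (lam K b) := by
    conv_lhs => rw [ht, comp_smul_left, ← ht, ← MvPolynomial.smul_eq_C_mul, ipS_smul_left]
  constructor
  · intro hd
    have h1 : ∀ c, ipS e.1 (comp c σ (F.te e)) 1 = 0 := by
      intro c
      rw [ipS_comp_left he]
      refine Finset.sum_eq_zero fun i _ => ?_
      rw [← dofSigma_succ F he, hd, mul_zero]
    refine ⟨h1, fun r hr => ?_⟩
    have h2 := hd 0
    rw [dofSigma_zero F he hab hab', h1, zero_add] at h2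
    rw [ipS_congr K he (fun _ _ => rfl) fun x hx => deg_one_edge hab hab' hr hx, h.add_right,
      h.smul_right, h.smul_right, h1, hcomp, h2]
    ring
  · rintro ⟨h1, h2⟩ j
    refine Fin.cases ?_ (fun j => ?_) j
    · have h3 := h2 _ (deg_lam K b)
      rw [hcomp] at h3
      rw [dofSigma_zero F he hab hab', h1, (mul_eq_zero.mp h3).resolve_left hμ, add_zero]
    · rw [dofSigma_succ F he]
      have h3 := h1 (EuclideanSpace.single j 1)
      rw [ipS_comp_left he, Finset.sum_eq_single j] at h3
      · simpa using h3
      · intro i _ hij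
        simp [hij]
      · exact fun h => absurd (Finset.mem_univ _) h

theorem edge_mem_bubP (he : e.1 ⊆ K.1) {d m : ℕ} {p : Poly} (hd : Deg d p)
    (hv : ∀ x ∈ K.1, VanishOrd x m p) {n : ℤ} (hn : (d : ℤ) - m * 2 ≤ n) :
    ∃ q ∈ bubP K e.1 m n, ∀ x ∈ planeOf K e.1, ev p x = ev q x := by
  obtain ⟨a, b, hab, hab'⟩ := edge_vertices he
  have hab1 : a.1 ≠ b.1 := fun h => hab (Subtype.ext h)
  refine exists_mem_bubP he (by rw [e.2.2]) hd (fun l hl => ?_) (by rw [e.2.2]; exact_mod_cast hn)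
  rw [hab'] at hl ⊢
  simp only [Finset.mem_insert, Finset.mem_singleton] at hl
  rcases hl with rfl | rfl
  · rw [(facet_pair hab1).1]
    exact (hv _ b.2).vanishAlong
  · rw [(facet_pair hab1).2]
    exact (hv _ a.2).vanishAlong

theorem zeroOn_of_orthogonal {s : Finset E3} (hs : s ⊆ K.1) (hne : s.Nonempty) {p q : Poly}
    (h : ∀ x ∈ planeOf K s, ev p x = ev q x) (h0 : ipS s p q = 0) : ZeroOn K s p := by
  refine ev_eq_zero_of_ipS_self K hs hne ?_
  rw [← h0]
  exact ipS_congr K hs (fun _ _ => rfl) h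

end edgeMoments

/-! ## Unisolvence of the `H(curl)` element -/

section unisolvenceSigma

variable (F : Frame T) {k : ℕ} {K : Cell T} {σ : Matrix (Fin 3) (Fin 3) Poly}

theorem RestSigma.vanishOrd (hr : RestSigma F k K σ) {x : E3} (hx : x ∈ K.1) (i j : Fin 3) :
    VanishOrd x 3 (σ i j) := vanishOrd_iff.mpr fun α hα => hr.vertex x hx α hα i j

/-- The third order zeros at the end points place each component, restricted to the edge, in the
test space, and the degrees of freedom of the first set provide the orthogonality to affine or
constant functions. So every component may be tested with itself. -/
theorem RestSigma.zeroOn_edge (hr : RestSigma F k K σ) (hs : σ.IsSymm)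
    (hd : ∀ i j, Deg (k : ℤ) (σ i j)) {e : Edge T} (he : e.1 ⊆ K.1)
    (h0 : ∀ j, dofSigma F e σ j = 0) (a b : E3) : ZeroOn K e.1 (comp a σ b) := by
  obtain ⟨h1, h2⟩ := (dofSigma_eq_zero_iff F he σ).mp h0
  have hne := edge_nonempty e
  have key : ∀ a b, ∃ q ∈ bubP K e.1 3 ((k : ℤ) - 6),
      ∀ x ∈ planeOf K e.1, ev (comp a σ b) x = ev q x := fun a b =>
    edge_mem_bubP he (Deg.comp hd a b) (fun x hx => VanishOrd.comp (hr.vanishOrd F hx) a b)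
      (by push_cast; omega)
  have htt : ZeroOn K e.1 (comp (F.te e) σ (F.te e)) := by
    obtain ⟨q, hq, hq'⟩ := key (F.te e) (F.te e)
    refine zeroOn_of_orthogonal he hne hq' (hr.edge_tt e he q hq fun r hr => ?_)
    rw [ipS_congr K he (fun x hx => (hq' x hx).symm) fun _ _ => rfl]
    exact h2 r hr
  have hnt : ∀ j, ZeroOn K e.1 (comp (F.ne e j) σ (F.te e)) := by
    intro j
    obtain ⟨q, hq, hq'⟩ := key (F.ne e j) (F.te e)
    refine zeroOn_of_orthogonal he hne hq' (hr.edge_nt e he j q hq fun r hr => ?_)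
    rw [ipS_congr K he (fun x hx => (hq' x hx).symm) fun _ _ => rfl]
    obtain ⟨c, rfl⟩ : ∃ c, r = MvPolynomial.C c :=
      exists_eq_C fun i => (hr.pd i).eq_zero (by norm_num)
    rw [← mul_one (MvPolynomial.C c), ← MvPolynomial.smul_eq_C_mul,
      (isIP_ipS he hne).smul_right, h1, mul_zero]
  have hnn : ∀ j j', ZeroOn K e.1 (comp (F.ne e j) σ (F.ne e j')) := by
    intro j j'
    obtain ⟨q, hq, hq'⟩ := key (F.ne e j) (F.ne e j')
    exact zeroOn_of_orthogonal he hne hq' (hr.edge_nn e he j j' q hq)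
  have hB : ∀ i j, ZeroOn K e.1 (comp (F.edge e i) σ (F.edge e j)) := by
    intro i j
    obtain rfl | ⟨i, rfl⟩ := Fin.eq_zero_or_eq_succ i
    · obtain rfl | ⟨j, rfl⟩ := Fin.eq_zero_or_eq_succ j
      · exact htt
      · rw [comp_symm _ _ hs]
        exact hnt j
    · obtain rfl | ⟨j, rfl⟩ := Fin.eq_zero_or_eq_succ j
      · exact hnt i
      · exact hnn i j
  exact zeroOn_of_frame (F.edge e) (fun i => zeroOn_of_frame_right (F.edge e) (hB i) b) a

/-- Bubbles are produced as polynomials on space that agree with a given trace only on the face; the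
form does not distinguish them. -/
theorem harmFM_congr {f : Face T} (hf : f.1 ⊆ K.1) {τ η η' : Matrix (Fin 2) (Fin 2) Poly}
    (h : ∀ i j, ZeroOn K f.1 (η i j - η' i j)) : harmFM F k K f τ η = harmFM F k K f τ η' := by
  have hip := isIP_ipM (ι := Fin 2) hf (face_nonempty f)
  rw [harmFM, harmFM, proj_congr hip (u := η) (u' := η')
    ((ipM_self_eq_zero hf (face_nonempty f)).mpr h)]
  refine congrArg₂ (· + ·) rfl ?_
  refine ipV_congr hf (fun _ _ _ => rfl) fun i x hx => ?_
  have h1 := dir_congr K hf (face_nonempty f) (zeroOn_sub_iff.mp (h i 1)) (isTangent_tf F hf 0) x hx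
  have h2 := dir_congr K hf (face_nonempty f) (zeroOn_sub_iff.mp (h i 0)) (isTangent_tf F hf 1) x hx
  rw [rotFM, rotFM, rotF, rotF, ev_add, ev_add, ev_neg, ev_neg, h1, h2]

theorem harmFV_congr {f : Face T} (hf : f.1 ⊆ K.1) {τ η η' : Fin 2 → Poly}
    (h : ∀ i, ZeroOn K f.1 (η i - η' i)) : harmFV F k K f τ η = harmFV F k K f τ η' := by
  have hip := isIP_ipV (ι := Fin 2) hf (face_nonempty f)
  rw [harmFV, harmFV, proj_congr hip (u := η) (u' := η')
    ((ipV_self_eq_zero hf (face_nonempty f)).mpr h)]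
  refine congrArg₂ (· + ·) rfl ?_
  refine ipS_congr K hf (fun _ _ => rfl) fun x hx => ?_
  have h1 := dir_congr K hf (face_nonempty f) (zeroOn_sub_iff.mp (h 1)) (isTangent_tf F hf 0) x hx
  have h2 := dir_congr K hf (face_nonempty f) (zeroOn_sub_iff.mp (h 0)) (isTangent_tf F hf 1) x hx
  rw [rotF, rotF, ev_add, ev_add, ev_neg, ev_neg, h1, h2]

/-- The Hessian on a face as a linear map. -/
noncomputable def hessFL (f : Face T) : Poly →ₗ[ℝ] Matrix (Fin 2) (Fin 2) Poly where
  toFun := hessF F f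
  map_add' p q := by ext1 i j; simp [hessF]
  map_smul' a p := by ext1 i j; simp [hessF]

/-- The gradient on a face as a linear map. -/
noncomputable def gradFL (f : Face T) : Poly →ₗ[ℝ] (Fin 2 → Poly) where
  toFun := gradF F f
  map_add' p q := by ext1 i; simp [gradF]
  map_smul' a p := by ext1 i; simp [gradF]

/-- The Hessian as a linear map. -/
noncomputable def hessL : Poly →ₗ[ℝ] Matrix (Fin 3) (Fin 3) Poly where
  toFun := hess
  map_add' := hess_add
  map_smul' := hess_smul

/-- The curl as a linear map. -/
noncomputable def curlL : Matrix (Fin 3) (Fin 3) Poly →ₗ[ℝ] Matrix (Fin 3) (Fin 3) Poly where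
  toFun := curl
  map_add' := curl_add
  map_smul' := curl_smul

theorem isFinSub_hessF (f : Face T) (n : ℤ) : IsFinSub (hessF F f '' bubP K f.1 3 n) :=
  (isFinSub_bubP K f.1 3 n).image (hessFL F f)
theorem isFinSub_gradF (f : Face T) (n : ℤ) : IsFinSub (gradF F f '' bubP K f.1 2 n) :=
  (isFinSub_bubP K f.1 2 n).image (gradFL F f)
theorem isFinSub_hess (n : ℤ) : IsFinSub (hess '' bubP K K.1 2 n) :=
  (isFinSub_bubP K K.1 2 n).image hessL

/-- A rotation-free symmetric matrix field on a face that vanishes on the edges is the Hessian of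
a bubble function. -/
theorem exists_hessF_bubP {f : Face T} (hf : f.1 ⊆ K.1) {τ : Matrix (Fin 2) (Fin 2) Poly}
    (hs : τ.IsSymm) (hd : ∀ i j, Deg (k : ℤ) (τ i j))
    (he : ∀ l ∈ f.1, ∀ i j, ZeroOn K (facet f.1 l) (τ i j))
    (hτ : ∀ i, ZeroOn K f.1 (rotFM F f τ i)) :
    ∃ w ∈ bubP K f.1 3 ((k : ℤ) - 7), ∀ i j, ZeroOn K f.1 (τ i j - hessF F f w i j) := by
  obtain ⟨u, hu1, hu2⟩ := exists_hessF F hf hs hd hτ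
  obtain ⟨a, ha⟩ := face_nonempty f
  have hdd : ∀ l ∈ f.1, ∀ v w, IsTangent K f.1 v → IsTangent K f.1 w →
      ZeroOn K (facet f.1 l) (dir v (dir w u)) := by
    intro l hl v w hv hw
    have h1 : ∀ i j, ZeroOn K (facet f.1 l) (dir (F.tf f i) (dir (F.tf f j) u)) := by
      intro i j
      have := ((hu2 i j).mono (facet_subset f.1 l)).add (he l hl i j)
      rwa [sub_add_cancel] at this
    rw [dir_tangent F hf hv, dir_tangent F hf hw]
    simp only [dir_add, dir_C_mul]
    exact ((((h1 0 0).mul_left _).add ((h1 0 1).mul_left _)).mul_left _).add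
      ((((h1 1 0).mul_left _).add ((h1 1 1).mul_left _)).mul_left _)
  have h2 := vanishAlong_sub_taylor hf (by rw [f.2.2]) ha
    (fun l hl v w hv hw => hdd l hl v w (hv.mono (facet_subset f.1 l)) hw)
  -- The Taylor polynomial removes value and gradient on the boundary, and the second derivatives
  -- vanish there because the matrix field does.
  have h3 : ∀ l ∈ f.1, VanishAlong K f.1 (facet f.1 l) 3 (u - taylor a u) := fun l hl =>
    ⟨(h2 l hl).1, fun w hw => ⟨((h2 l hl).2 w hw).1, fun v hv => ⟨by
      rw [dir_dir_sub_taylor]; exact hdd l hl v w hv hw, fun _ _ => trivial⟩⟩⟩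
  have hdeg : Deg ((k + 2 : ℕ) : ℤ) (u - taylor a u) := by
    push_cast
    exact hu1.sub ((deg_taylor a u).mono (by omega))
  -- The cube of the face bubble has degree nine, which leaves `k + 2 - 9`.
  obtain ⟨q, hq, hq'⟩ := exists_mem_bubP hf (by rw [f.2.2]; norm_num) (e := (k : ℤ) - 7) hdeg h3
    (by rw [f.2.2]; push_cast; omega)
  refine ⟨q, hq, fun i j => zeroOn_sub_iff.mpr fun x hx => ?_⟩
  have hne := face_nonempty f
  rw [← zeroOn_sub_iff.mp (hu2 i j) x hx, hessF, hessF, Matrix.of_apply, Matrix.of_apply,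
    ← dir_dir_sub_taylor a u]
  exact dir_congr K hf hne (dir_congr K hf hne hq' (isTangent_tf F hf j)) (isTangent_tf F hf i) x hx

/-- A rotation-free vector field on a face that vanishes on the edges is the gradient of a bubble
function. -/
theorem exists_gradF_bubP {f : Face T} (hf : f.1 ⊆ K.1) {w : Fin 2 → Poly}
    (hd : ∀ i, Deg (k : ℤ) (w i)) (he : ∀ l ∈ f.1, ∀ i, ZeroOn K (facet f.1 l) (w i))
    (hw : ZeroOn K f.1 (rotF F f w)) :
    ∃ p ∈ bubP K f.1 2 ((k : ℤ) - 5), ∀ i, ZeroOn K f.1 (w i - gradF F f p i) := by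
  obtain ⟨a, ha⟩ := face_nonempty f
  obtain ⟨u, hu1, hu2⟩ := exists_gradF F hf ha hd hw
  have hu2' : ∀ j, ∀ x ∈ planeOf K f.1, ev (dir (F.tf f j) u) x = ev (w j) x := by
    intro j x hx
    have := congrFun hu2 j
    simp only [gradF] at this
    rw [this, flat_eq_of_mem F hf ha hx]
  have hdir : ∀ l ∈ f.1, ∀ v, IsTangent K f.1 v →
      ZeroOn K (facet f.1 l) (dir v (u - MvPolynomial.C (ev u a))) := by
    intro l hl v hv
    have h1 : ∀ j, ZeroOn K (facet f.1 l) (dir (F.tf f j) u) := fun j x hx => by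
      rw [hu2' j x (planeOf_mono (facet_subset f.1 l) hx), he l hl j x hx]
    rw [dir_sub, dir_C, sub_zero, dir_tangent F hf hv]
    exact ((h1 0).mul_left _).add ((h1 1).mul_left _)
  have h3 : ∀ l ∈ f.1, VanishAlong K f.1 (facet f.1 l) 2 (u - MvPolynomial.C (ev u a)) :=
    fun l hl => ⟨zeroOn_facets hf (by rw [f.2.2]) ha
      (fun l hl v hv => hdir l hl v (hv.mono (facet_subset f.1 l))) (by simp) l hl,
      fun v hv => ⟨hdir l hl v hv, fun _ _ => trivial⟩⟩
  have hdeg : Deg ((k + 1 : ℕ) : ℤ) (u - MvPolynomial.C (ev u a)) := by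
    push_cast
    exact hu1.sub ((deg_C _).mono (by omega))
  -- Here a square of degree six is taken out of degree `k + 1`.
  obtain ⟨q, hq, hq'⟩ := exists_mem_bubP hf (by rw [f.2.2]; norm_num) (e := (k : ℤ) - 5) hdeg h3
    (by rw [f.2.2]; push_cast; omega)
  refine ⟨q, hq, fun i => zeroOn_sub_iff.mpr fun x hx => ?_⟩
  rw [← hu2' i x hx, gradF, ← dir_congr K hf (face_nonempty f) hq' (isTangent_tf F hf i) x hx, dir_sub,
    dir_C, sub_zero]

/-- After the edges are settled, the tangential part is itself an admissible bubble on the face.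
Tested with itself it has zero rotation, so it is the Hessian of a bubble and belongs to the space
onto which its projection vanishes. -/
theorem RestSigma.tanM_zero (hr : RestSigma F k K σ) (hs : σ.IsSymm)
    (hd : ∀ i j, Deg (k : ℤ) (σ i j)) {f : Face T} (hf : f.1 ⊆ K.1)
    (he : ∀ l ∈ f.1, ∀ a b, ZeroOn K (facet f.1 l) (comp a σ b)) (i j : Fin 2) :
    ZeroOn K f.1 (tanM F f σ i j) := by
  have hne := face_nonempty f
  have hip := isIP_ipM (ι := Fin 2) hf hne
  have h1 : ∀ i j, ∃ η ∈ bubF0 K f ((k : ℤ) - 3), ∀ x ∈ planeOf K f.1,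
      ev (tanM F f σ i j) x = ev η x := fun i j =>
    exists_mem_bubF0 hf (Deg.comp hd _ _) (fun l hl => he l hl _ _)
      fun x hx => VanishOrd.comp (hr.vanishOrd F (hf hx)) _ _
  choose η hη hη' using h1
  -- The bubbles were chosen entry by entry; using one choice for each unordered pair makes the test
  -- matrix symmetric.
  have h2 := hr.face_tt f hf (Matrix.of fun i j => η (min i j) (max i j))
    (Matrix.IsSymm.ext fun i j => by simp only [Matrix.of_apply, min_comm, max_comm])
    (fun i j => hη _ _)
  rw [← harmFM_congr F (η := tanM F f σ) hf] at h2
  · have h3 := ip_self_eq_zero_of_harm hip (isFinSub_hessF F f _)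
      ((isIP_ipV hf hne).nonneg _) h2 (fun h0 => by
        obtain ⟨w, hw, hw'⟩ := exists_hessF_bubP F hf (tanM_isSymm F f hs)
          (fun i j => Deg.comp hd _ _) (fun l hl i j => he l hl _ _)
          ((ipV_self_eq_zero hf hne).mp h0)
        exact ⟨_, ⟨w, hw, rfl⟩, (ipM_self_eq_zero hf hne).mpr hw'⟩)
    exact (ipM_self_eq_zero hf hne).mp h3 i j
  · intro i j
    refine zeroOn_sub_iff.mpr fun x hx => ?_
    rw [Matrix.of_apply, ← hη' _ _ x hx]
    rcases le_total i j with h | h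
    · rw [min_eq_left h, max_eq_right h]
    · rw [min_eq_right h, max_eq_left h, (tanM_isSymm F f hs).apply]

theorem RestSigma.tanV_zero (hr : RestSigma F k K σ)
    (hd : ∀ i j, Deg (k : ℤ) (σ i j)) {f : Face T} (hf : f.1 ⊆ K.1)
    (he : ∀ l ∈ f.1, ∀ a b, ZeroOn K (facet f.1 l) (comp a σ b)) (i : Fin 2) :
    ZeroOn K f.1 (comp (F.tf f i) σ (F.nf f)) := by
  have hne := face_nonempty f
  have hip := isIP_ipV (ι := Fin 2) hf hne
  have hc : tanV F f (σ.mulVec (cvec (F.nf f))) = fun i => comp (F.tf f i) σ (F.nf f) :=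
    funext fun i => tanV_mulVec _ _ _ _ _
  have h1 : ∀ i, ∃ η ∈ bubF0 K f ((k : ℤ) - 3), ∀ x ∈ planeOf K f.1,
      ev (comp (F.tf f i) σ (F.nf f)) x = ev η x := fun i =>
    exists_mem_bubF0 hf (Deg.comp hd _ _) (fun l hl => he l hl _ _)
      fun x hx => VanishOrd.comp (hr.vanishOrd F (hf hx)) _ _
  choose η hη hη' using h1
  have h2 := hr.face_nt f hf η hη
  rw [hc, ← harmFV_congr F (η := fun i => comp (F.tf f i) σ (F.nf f)) hf
    fun i => zeroOn_sub_iff.mpr (hη' i)] at h2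
  have h3 := ip_self_eq_zero_of_harm hip (isFinSub_gradF F f _)
    ((isIP_ipS hf hne).nonneg _) h2 (fun h0 => by
      obtain ⟨w, hw, hw'⟩ := exists_gradF_bubP F hf (fun i => Deg.comp hd _ _)
        (fun l hl i => he l hl _ _) (ev_eq_zero_of_ipS_self K hf hne h0)
      exact ⟨_, ⟨w, hw, rfl⟩, (ipV_self_eq_zero hf hne).mpr hw'⟩)
  exact (ipV_self_eq_zero hf hne).mp h3 i

theorem tangentZero_of_faces (hs : σ.IsSymm)
    (htt : ∀ f : Face T, f.1 ⊆ K.1 → ∀ i j, ZeroOn K f.1 (tanM F f σ i j))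
    (hnt : ∀ f : Face T, f.1 ⊆ K.1 → ∀ i, ZeroOn K f.1 (comp (F.tf f i) σ (F.nf f))) :
    TangentZero K σ := by
  intro i t ht a
  have hf := opp_subset K i
  rw [tangent_eq F hf ht, comp_add_right, comp_smul_right, comp_smul_right]
  have key : ∀ j, ZeroOn K (opp K i).1 (comp a σ (F.tf (opp K i) j)) := by
    intro j
    refine zeroOn_of_frame (F.face (opp K i)) (fun l => ?_) a
    fin_cases l
    · exact htt _ hf 0 j
    · exact htt _ hf 1 j
    · rw [comp_symm _ _ hs]
      exact hnt _ hf j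
  exact ((key 0).mul_left _).add ((key 1).mul_left _)

/-- A Hessian whose tangential components vanish on the faces is the Hessian of a bubble
function. -/
theorem exists_hess_bubP {u : Poly} (hu : Deg ((k : ℤ) + 2) u) (ht : TangentZero K (hess u)) :
    ∃ w ∈ bubP K K.1 2 ((k : ℤ) - 6), hess w = hess u := by
  obtain ⟨a, ha⟩ := cell_nonempty K
  have h2 := vanishAlong_sub_taylor (K := K) (p := u) (subset_refl K.1)
    (by rw [K.2.2]; norm_num) ha (fun l hl v w hv hw => by
      have := ht ⟨l, hl⟩ v (by rw [opp_eq_facet]; exact hv) w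
      rwa [comp_hess, dir_comm, opp_eq_facet] at this)
  have hdeg : Deg ((k + 2 : ℕ) : ℤ) (u - taylor a u) := by
    push_cast
    exact hu.sub ((deg_taylor a u).mono (by omega))
  -- The square of the cell bubble has degree eight, which leaves `k + 2 - 8`.
  obtain ⟨q, hq, hq'⟩ := exists_mem_bubP (subset_refl K.1) (by rw [K.2.2]; norm_num)
    (e := (k : ℤ) - 6) hdeg h2 (by rw [K.2.2]; push_cast; omega)
  refine ⟨q, hq, ?_⟩
  rw [← poly_ext fun x => hq' x (planeOf_cell K x), hess_sub,
    hess_eq_zero_of_deg (deg_taylor a u), sub_zero]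

/-- The field vanishes on the edges, its tangential components vanish on the faces, and so it is a
bubble that may be tested with itself. Its curl is then zero, which makes it the Hessian of a
bubble, and its projection to such Hessians is zero as well. -/
theorem RestSigma.eq_zero (hk : 4 ≤ k) (hr : RestSigma F k K σ) (hs : σ.IsSymm)
    (hd : ∀ i j, Deg (k : ℤ) (σ i j))
    (h0 : ∀ e : Edge T, e.1 ⊆ K.1 → ∀ j, dofSigma F e σ j = 0) : σ = 0 := by
  have hne := cell_nonempty K
  have hip := isIP_ipM (ι := Fin 3) (subset_refl K.1) hne
  have hedge : ∀ f : Face T, f.1 ⊆ K.1 → ∀ l ∈ f.1, ∀ a b,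
      ZeroOn K (facet f.1 l) (comp a σ b) := by
    intro f hf l hl a b
    have hc : (facet f.1 l).card = 2 := by rw [card_facet hl, f.2.2]
    let e : Edge T := ⟨facet f.1 l, T.down_closed f.2.1 (facet_subset _ _)
      (Finset.card_pos.mp (by rw [hc]; norm_num)), hc⟩
    have he : e.1 ⊆ K.1 := (facet_subset _ _).trans hf
    exact hr.zeroOn_edge F hs hd he (h0 e he) a b
  have ht : TangentZero K σ := tangentZero_of_faces F hs
    (fun f hf i j => hr.tanM_zero F hs hd hf (hedge f hf) i j)
    (fun f hf i => hr.tanV_zero F hd hf (hedge f hf) i)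
  have hmem : σ ∈ bubCurl F k K := mem_bubCurl F hk hs hd (fun x hx => hr.vanishOrd F hx) ht
  have h2 := hr.cell σ hmem
  have h3 := ip_self_eq_zero_of_harm hip (isFinSub_hess _) (hip.nonneg _) h2 (fun h0 => by
    have hcurl : curl σ = 0 := by
      ext1 i j
      exact zeroOn_cell.mp ((ipM_self_eq_zero (subset_refl K.1) hne).mp h0 i j)
    obtain ⟨u, hu1, hu2⟩ := exists_hess hd hs hcurl
    obtain ⟨w, hw1, hw2⟩ := exists_hess_bubP hu1 (hu2 ▸ ht)
    refine ⟨_, ⟨w, hw1, rfl⟩, ?_⟩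
    rw [hw2, hu2, sub_self, hip.zero_left])
  ext1 i j
  exact zeroOn_cell.mp ((ipM_self_eq_zero (subset_refl K.1) hne).mp h3 i j)

end unisolvenceSigma

/-! ## Antiderivatives on edges -/

section antiderivatives

variable {K : Cell T} {e : Edge T}

theorem sub_edge {a b : K.1} (hab' : e.1 = {a.1, b.1}) [DecidableEq K.1] :
    sub K e.1 = {a, b} := by
  ext v
  simp [hab']

/-- The coefficients of the antiderivative are partial sums of the given ones along the edge. It
vanishes at `a` since the empty sum is zero, and at `b` since zero mean says that the total sum is
zero. -/
theorem exists_antiderivative (he : e.1 ⊆ K.1) {a b : K.1} (hab : a ≠ b)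
    (hab' : e.1 = {a.1, b.1}) {d : ℕ} {p : Poly} (hd : Deg d p) (h0 : ipS e.1 p 1 = 0) :
    ∃ q, Deg ((d + 1 : ℕ) : ℤ) q ∧ (∀ x ∈ planeOf K e.1, ev (dir (b.1 - a.1) q) x = ev p x) ∧
      ev q a.1 = 0 ∧ ev q b.1 = 0 := by
  classical
  obtain ⟨c, rfl⟩ := exists_bern K hd
  have hsupp : ∀ v : K.1, v.1 ∉ e.1 ↔ v ≠ a ∧ v ≠ b := by
    intro v
    simp [hab']
  let pt : ℕ → K.1 → ℕ := fun m => m • unit b + (d - m) • unit a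
  have hpt : ∀ β : K.1 → ℕ, ∑ v, β v = d → (∀ v : K.1, v.1 ∉ e.1 → β v = 0) → β = pt (β b) := by
    intro β hβ hs
    have hsum : β a + β b = d := by
      rw [← hβ, ← Finset.sum_pair hab (f := β)]
      refine Finset.sum_subset (Finset.subset_univ _) fun v _ hv => hs v ?_
      rw [hsupp]
      simpa using hv
    funext v
    by_cases hva : v = a
    · subst hva
      simp only [pt, Pi.add_apply, Pi.smul_apply, unit_self, unit_of_ne hab, smul_eq_mul]
      omega
    by_cases hvb : v = b
    · subst hvb
      simp only [pt, Pi.add_apply, Pi.smul_apply, unit_self, unit_of_ne hva, smul_eq_mul]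
      omega
    rw [hs v ((hsupp v).mpr ⟨hva, hvb⟩)]
    simp [pt, unit_of_ne hva, unit_of_ne hvb]
  let c' : (K.1 → ℕ) → ℝ := fun α => ∑ m ∈ Finset.range (α b), c (pt m)
  have htot : ∑ m ∈ Finset.range (d + 1), c (pt m) = 0 := by
    obtain ⟨C, hC, hC'⟩ := ipS_bern K he (edge_nonempty e)
    rw [hC', mul_eq_zero, or_iff_right (hC d).ne'] at h0
    rw [← h0]
    have hptb : ∀ m, pt m b = m := fun m => by simp [pt, unit_of_ne hab.symm]
    refine Finset.sum_bij (fun m _ => pt m) (fun m hm => ?_) (fun m _ n _ h => ?_)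
      (fun β hβ => ?_) fun _ _ => rfl
    · have := Finset.mem_range.mp hm
      rw [mem_idx_sub]
      refine ⟨?_, fun v hv => ?_⟩
      · simp only [pt, Pi.add_apply, Finset.sum_add_distrib, sum_smul_unit]
        omega
      · obtain ⟨h1, h2⟩ := (hsupp v).mp hv
        simp [pt, unit_of_ne h1, unit_of_ne h2]
    · rw [← hptb m, ← hptb n, h]
    · obtain ⟨h1, h2⟩ := mem_idx_sub.mp hβ
      refine ⟨β b, ?_, (hpt β h1 h2).symm⟩
      have := Finset.single_le_sum (f := β) (fun _ _ => Nat.zero_le _) (Finset.mem_univ b)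
      rw [Finset.mem_range]; omega
  have hvert : ∀ v : K.1, c' ((d + 1) • unit v) = 0 → ev (bern K (d + 1) c') v.1 = 0 := by
    intro v hv
    refine ev_bern_eq_zero K (s := {v.1}) (fun α h1 h2 => ?_) fun w hw => ?_
    · have : α = (d + 1) • unit v := by
        have h3 : ∀ w, w ≠ v → α w = 0 := fun w hw =>
          h2 w fun h => hw (Subtype.ext (Finset.mem_singleton.mp h))
        rw [Finset.sum_eq_single v (fun w _ hw => h3 w hw)
          fun h => absurd (Finset.mem_univ _) h] at h1
        funext w
        by_cases hw : w = v
        · subst hw; simp [h1]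
        · simp [h3 w hw, unit_of_ne hw]
      rw [this, hv]
    · rw [ev_lam_vertex, if_neg fun h => hw (by rw [h]; simp)]
  refine ⟨bern K (d + 1) c', deg_bern K _ _, fun x hx => ?_, hvert a ?_, hvert b ?_⟩
  · rw [dir_sub_bern, ← sub_eq_zero, ← ev_sub, ← bern_sub]
    refine ev_bern_eq_zero K (fun β h1 h2 => ?_) hx
    have hβ := hpt β h1 h2
    simp only [Pi.sub_apply, c', Pi.add_apply, unit_self, unit_of_ne hab.symm, add_zero,
      Finset.sum_range_succ, ← hβ]
    ring
  · simp [c', unit_of_ne hab.symm]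
  · simp only [c', Pi.smul_apply, unit_self, smul_eq_mul, mul_one]
    exact htot

theorem VanishAlong.zeroOn {s s' : Finset E3} {m : ℕ} {p : Poly}
    (h : VanishAlong K s s' (m + 1) p) : ZeroOn K s' p := h.1

/-- `VanishAlong` depends only on the values on the plane of `s`. -/
theorem VanishAlong.congr {s s' : Finset E3} (hs : s ⊆ K.1) (hne : s.Nonempty) (hs' : s' ⊆ s)
    {m : ℕ} {p q : Poly} (h : VanishAlong K s s' m p)
    (hpq : ∀ x ∈ planeOf K s, ev p x = ev q x) : VanishAlong K s s' m q := by
  induction m generalizing p q with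
  | zero => trivial
  | succ m ih =>
    refine ⟨fun x hx => ?_, fun w hw => ih (h.2 w hw) (dir_congr K hs hne hpq hw)⟩
    rw [← hpq x (planeOf_mono hs' hx)]
    exact h.1 x hx

theorem vanishOrd_bubP_edge {m : ℕ} {n : ℤ} {p : Poly} (hp : p ∈ bubP K e.1 m n) {v : K.1}
    (he : e.1 ⊆ K.1) : VanishOrd v.1 m p := by
  obtain ⟨q, -, rfl⟩ := hp
  obtain ⟨w, hw, hwv⟩ : ∃ w : K.1, w.1 ∈ e.1 ∧ w ≠ v := by
    obtain ⟨a, b, hab, hab'⟩ := edge_vertices he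
    by_cases h : a = v
    · exact ⟨b, by simp [hab'], fun h' => hab (h.trans h'.symm)⟩
    · exact ⟨a, by simp [hab'], h⟩
  have h1 : VanishOrd v.1 1 (bub K e.1) :=
    ⟨ev_bub_eq_zero hw (by rw [ev_lam_vertex, if_neg hwv]), fun _ => trivial⟩
  have h2 := (h1.pow m).mul (n := 0) (q := q) trivial
  simpa using h2

/-- The tangential vectors of an edge. -/
theorem edge_tangent_eq {a b : K.1} (hab : a ≠ b) (hab' : e.1 = {a.1, b.1}) {w : E3}
    (hw : IsTangent K e.1 w) : w = slope K w b • (b.1 - a.1) := by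
  classical
  have h0 : ∀ v, v ∉ ({a, b} : Finset K.1) → slope K w v = 0 := fun v hv => hw v (by
    rw [hab']
    simpa [← Subtype.ext_iff] using hv)
  have h1 := sum_slope_smul K w
  have h2 := sum_slope K w
  rw [← Finset.sum_subset (Finset.subset_univ {a, b}) fun v _ hv => by rw [h0 v hv, zero_smul],
    Finset.sum_pair hab] at h1
  rw [← Finset.sum_subset (Finset.subset_univ {a, b}) fun v _ hv => h0 v hv,
    Finset.sum_pair hab] at h2
  have h3 : slope K w a = -slope K w b := by linarith
  conv_lhs => rw [← h1, h3]
  rw [smul_sub, neg_smul]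
  abel

/-- The antiderivative of a function with mean value zero that vanishes at the end points. -/
theorem exists_antiderivative_bubP (he : e.1 ⊆ K.1) {a b : K.1} (hab : a ≠ b)
    (hab' : e.1 = {a.1, b.1}) {d m : ℕ} {p : Poly} (hd : Deg d p)
    (hv : ∀ v : K.1, v.1 ∈ e.1 → VanishAlong K e.1 {v.1} m p) (h0 : ipS e.1 p 1 = 0) :
    ∃ q, Deg ((d + 1 : ℕ) : ℤ) q ∧ (∀ x ∈ planeOf K e.1, ev (dir (b.1 - a.1) q) x = ev p x) ∧
      ∀ v : K.1, v.1 ∈ e.1 → VanishAlong K e.1 {v.1} (m + 1) q := by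
  obtain ⟨q, hq, hq1, hq2, hq3⟩ := exists_antiderivative he hab hab' hd h0
  refine ⟨q, hq, hq1, fun v hv' => ⟨zeroOn_singleton.mpr ?_, fun w hw => ?_⟩⟩
  · rw [hab', Finset.mem_insert, Finset.mem_singleton, ← Subtype.ext_iff, ← Subtype.ext_iff] at hv'
    rcases hv' with rfl | rfl
    · exact hq2
    · exact hq3
  · rw [edge_tangent_eq hab hab' hw, dir_smul_vec, ← MvPolynomial.smul_eq_C_mul]
    have hsmul : ∀ (m : ℕ) (r : ℝ) (p : Poly), VanishAlong K e.1 {v.1} m p →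
        VanishAlong K e.1 {v.1} m (r • p) := by
      intro m r
      induction m with
      | zero => exact fun _ _ => trivial
      | succ m ih => exact fun p h => ⟨h.1.smul r, fun w hw => by
          rw [dir_smul]; exact ih _ (h.2 w hw)⟩
    refine hsmul m _ _ ((hv v hv').congr he (edge_nonempty e) ?_ fun x hx => (hq1 x hx).symm)
    simpa using hv'

theorem mem_bubP_edge (he : e.1 ⊆ K.1) {d m : ℕ} {q : Poly} (hd : Deg d q)
    (hv : ∀ v : K.1, v.1 ∈ e.1 → VanishAlong K e.1 {v.1} m q) {n : ℤ}
    (hn : (d : ℤ) - m * 2 ≤ n) :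
    ∃ q' ∈ bubP K e.1 m n, ∀ x ∈ planeOf K e.1, ev q x = ev q' x := by
  obtain ⟨a, b, hab, hab'⟩ := edge_vertices he
  have hab1 : a.1 ≠ b.1 := fun h => hab (Subtype.ext h)
  refine exists_mem_bubP he (by rw [e.2.2]) hd (fun l hl => ?_) (by rw [e.2.2]; exact_mod_cast hn)
  rw [hab', Finset.mem_insert, Finset.mem_singleton] at hl
  rcases hl with rfl | rfl
  · have := hv b (by simp [hab'])
    rw [← (facet_pair hab1).1, ← hab'] at this
    exact this
  · have := hv a (by simp [hab'])
    rw [← (facet_pair hab1).2, ← hab'] at this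
    exact this

theorem deg_of_mem_bubP_edge (he : e.1 ⊆ K.1) {m : ℕ} {n : ℤ} {p : Poly}
    (hp : p ∈ bubP K e.1 m n) : Deg (m * 2 + n) p := by
  obtain ⟨q, hq, rfl⟩ := hp
  have := ((deg_bub K he).pow m).mul hq
  rwa [e.2.2] at this

theorem isTangent_te (F : Frame T) (he : e.1 ⊆ K.1) : IsTangent K e.1 (F.te e) := by
  obtain ⟨a, b, hab, hab'⟩ := edge_vertices he
  obtain ⟨μ, -, ht⟩ := edge_ne_zero F e (a := a.1) (b := b.1) (by rw [hab']; simp)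
    (by rw [hab']; simp) (fun h => hab (Subtype.ext h))
  rw [ht]
  intro v hv
  rw [slope_smul, isTangent_sub (s := e.1) (by rw [hab']; simp) (by rw [hab']; simp) v hv, mul_zero]

theorem exists_antiderivative_te (F : Frame T) (he : e.1 ⊆ K.1) {d m : ℕ} {p : Poly} (hd : Deg d p)
    (hv : ∀ v : K.1, v.1 ∈ e.1 → VanishAlong K e.1 {v.1} m p) (h0 : ipS e.1 p 1 = 0) :
    ∃ q, Deg ((d + 1 : ℕ) : ℤ) q ∧ (∀ x ∈ planeOf K e.1, ev (dir (F.te e) q) x = ev p x) ∧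
      ∀ v : K.1, v.1 ∈ e.1 → VanishAlong K e.1 {v.1} (m + 1) q := by
  obtain ⟨a, b, hab, hab'⟩ := edge_vertices he
  obtain ⟨μ, hμ, ht⟩ := edge_ne_zero F e (a := a.1) (b := b.1) (by rw [hab']; simp)
    (by rw [hab']; simp) (fun h => hab (Subtype.ext h))
  have hsmul : ∀ (v : K.1) (m : ℕ) (r : ℝ) (p : Poly), VanishAlong K e.1 {v.1} m p →
      VanishAlong K e.1 {v.1} m (r • p) := by
    intro v m r
    induction m with
    | zero => exact fun _ _ => trivial
    | succ m ih => exact fun p h => ⟨h.1.smul r, fun w hw => by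
        rw [dir_smul]; exact ih _ (h.2 w hw)⟩
  obtain ⟨q, hq, hq1, hq2⟩ := exists_antiderivative_bubP he hab hab' (hd.smul μ⁻¹) (m := m)
    (fun v hv' => hsmul v m _ p (hv v hv')) (by rw [ipS_smul_left, h0, mul_zero])
  refine ⟨q, hq, fun x hx => ?_, hq2⟩
  rw [ht, dir_smul_vec, ev_mul, ev_C, hq1 x hx, ev_smul, mul_inv_cancel_left₀ hμ]

theorem ipS_dir_te (F : Frame T) (he : e.1 ⊆ K.1) {g : Poly} (hg : ∀ x ∈ e.1, ev g x = 0) :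
    ipS e.1 (dir (F.te e) g) 1 = 0 := by
  classical
  obtain ⟨a, b, hab, hab'⟩ := edge_vertices he
  have ha : a.1 ∈ e.1 := by rw [hab']; simp
  have hb : b.1 ∈ e.1 := by rw [hab']; simp
  obtain ⟨μ, hμ, ht⟩ := edge_ne_zero F e ha hb (fun h => hab (Subtype.ext h))
  rw [ht, dir_smul_vec, ← MvPolynomial.smul_eq_C_mul, ipS_smul_left,
    ipS_dir_edge K hab (sub_edge hab') he (hg _ ha) (hg _ hb), mul_zero]

/-- Integration by parts on an edge against a polynomial of degree at most one. -/
theorem ipS_dir_te_affine (F : Frame T) (he : e.1 ⊆ K.1) {g r : Poly}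
    (hg : ∀ x ∈ e.1, ev g x = 0) (hr : Deg 1 r) :
    ∃ c : ℝ, ipS e.1 (dir (F.te e) g) r = -(c * ipS e.1 g 1) ∧ dir (F.te e) r = MvPolynomial.C c := by
  have h := isIP_ipS he (edge_nonempty e)
  obtain ⟨c, hc⟩ : ∃ c, dir (F.te e) r = MvPolynomial.C c :=
    exists_eq_C fun i => ((hr.dir (F.te e)).pd i).eq_zero (by norm_num)
  refine ⟨c, ?_, hc⟩
  have h1 := ipS_dir_te F he (g := g * r) fun x hx => by rw [ev_mul, hg x hx, zero_mul]
  rw [dir_mul, h.add_left, hc, ← ipS_eq, mul_comm g, ← MvPolynomial.smul_eq_C_mul,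
    ipS_smul_left] at h1
  linarith

/-- Integration by parts against a barycentric coordinate, whose tangential derivative is a nonzero
constant. -/
theorem ipS_eq_zero_of_moments (F : Frame T) (he : e.1 ⊆ K.1) {q : Poly}
    (hq : ∀ x ∈ e.1, ev q x = 0) (h : ∀ r, Deg 1 r → ipS e.1 (dir (F.te e) q) r = 0) :
    ipS e.1 q 1 = 0 := by
  obtain ⟨a, b, hab, hab'⟩ := edge_vertices he
  obtain ⟨c, hc1, hc2⟩ := ipS_dir_te_affine F he hq (deg_lam K b)
  rw [h _ (deg_lam K b)] at hc1
  have hc : c ≠ 0 := by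
    rintro rfl
    obtain ⟨μ, hμ, ht⟩ := edge_ne_zero F e (a := a.1) (b := b.1) (by rw [hab']; simp)
      (by rw [hab']; simp) (fun h => hab (Subtype.ext h))
    rw [dir_lam, ht, slope_smul, slope_sub, if_pos rfl, if_neg hab.symm] at hc2
    have := congrArg (fun p => ev p 0) hc2
    simp at this
    exact hμ this
  exact (mul_eq_zero.mp (neg_eq_zero.mp hc1.symm)).resolve_left hc

end antiderivatives

/-! ## Hessians of functions with vanishing degrees of freedom -/

section restU

variable (F : Frame T) {k : ℕ} {K : Cell T} {u : Poly}

theorem rotF_gradF (f : Face T) (p : Poly) : rotF F f (gradF F f p) = 0 := by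
  rw [rotF, gradF, gradF, dir_comm, neg_add_cancel]

theorem rotFM_hessF (f : Face T) (p : Poly) : rotFM F f (hessF F f p) = 0 := by
  ext1 i
  have h : hessF F f p i = gradF F f (dir (F.tf f i) p) := by
    ext1 j
    rw [hessF, Matrix.of_apply, gradF, dir_comm]
  rw [rotFM, h, rotF_gradF]; rfl

/-- Orthogonality to affine functions lets the test function be integrated twice with zero boundary
values, so it is the second tangential derivative of a bubble of order five, which is a test
function for the scalar element. -/
theorem RestU.edge_tt_hess (hr : RestU F k K u) {e : Edge T} (he : e.1 ⊆ K.1)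
    {p : Poly} (hp : p ∈ bubP K e.1 3 ((k : ℤ) - 6)) (hp1 : ∀ q, Deg 1 q → ipS e.1 p q = 0) :
    ipS e.1 (comp (F.te e) (hess u) (F.te e)) p = 0 := by
  have hne := edge_nonempty e
  have h := isIP_ipS he hne
  have hdp : Deg k p := (deg_of_mem_bubP_edge he hp).mono (by push_cast; omega)
  obtain ⟨q, hq1, hq2, hq3⟩ := exists_antiderivative_te F he (d := k) (m := 3) hdp
    (fun v _ => (vanishOrd_bubP_edge hp he).vanishAlong) (hp1 1 (deg_one.mono zero_le_one))
  have hqv : ∀ x ∈ e.1, ev q x = 0 := fun x hx => by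
    have h1 : ZeroOn K {x} q := (hq3 ⟨x, he hx⟩ hx).zeroOn
    exact h1 x (vertex_mem_planeOf (v := ⟨x, he hx⟩) (Finset.mem_singleton_self x))
  have hq0 : ipS e.1 q 1 = 0 := ipS_eq_zero_of_moments F he hqv fun r hr => by
    rw [ipS_congr K he hq2 fun _ _ => rfl, hp1 r hr]
  obtain ⟨s, hs1, hs2, hs3⟩ := exists_antiderivative_te F he (d := k + 1) (m := 4) hq1 hq3 hq0
  -- Two integrations raise the degree to `k + 2` and the vanishing order from three to five; `b_e ^
  -- 5` has degree ten.
  obtain ⟨s', hs', hss'⟩ := mem_bubP_edge he (d := k + 2) (m := 5) hs1 hs3 (n := (k : ℤ) - 8) (by push_cast; omega)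
  rw [comp_hess, ← hr.edge_tt e he s' hs']
  refine ipS_congr K he (fun _ _ => rfl) fun x hx => ?_
  have ht := isTangent_te F he
  rw [← dir_congr K he hne (dir_congr K he hne hss' ht) ht x hx,
    dir_congr K he hne hs2 ht x hx, hq2 x hx]

/-- Orthogonality to constants allows one integration, which raises the order of the bubble from
three to four. -/
theorem RestU.edge_nt_hess (hr : RestU F k K u) {e : Edge T} (he : e.1 ⊆ K.1)
    (j : Fin 2) {p : Poly} (hp : p ∈ bubP K e.1 3 ((k : ℤ) - 6))
    (hp1 : ∀ q, Deg 0 q → ipS e.1 p q = 0) :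
    ipS e.1 (comp (F.ne e j) (hess u) (F.te e)) p = 0 := by
  have hne := edge_nonempty e
  have hdp : Deg k p := (deg_of_mem_bubP_edge he hp).mono (by push_cast; omega)
  obtain ⟨q, hq1, hq2, hq3⟩ := exists_antiderivative_te F he (d := k) (m := 3) hdp
    (fun v _ => (vanishOrd_bubP_edge hp he).vanishAlong) (hp1 1 deg_one)
  obtain ⟨s, hs, hqs⟩ := mem_bubP_edge he hq1 hq3 (n := (k : ℤ) - 7) (by push_cast; omega)
  rw [comp_hess, ← hr.edge_nt e he j s hs]
  refine ipS_congr K he (fun _ _ => rfl) fun x hx => ?_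
  rw [← dir_congr K he hne hqs (isTangent_te F he) x hx, hq2 x hx]

/-- A face Hessian has no rotation, so only the projection term is left, and it vanishes because the
face Hessian is orthogonal to the space of projection. -/
theorem RestU.face_tt_hess (hr : RestU F k K u) {f : Face T} (hf : f.1 ⊆ K.1)
    (η : Matrix (Fin 2) (Fin 2) Poly) : harmFM F k K f (tanM F f (hess u)) η = 0 := by
  have hip := isIP_ipM (ι := Fin 2) hf (face_nonempty f)
  rw [harmFM, tanM_hess, rotFM_hessF, (isIP_ipV hf (face_nonempty f)).zero_left, add_zero]
  refine ip_proj_of_orthogonal hip ?_ _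
  rintro _ ⟨p, hp, rfl⟩
  exact hr.face_hess f hf p hp

theorem RestU.face_nt_hess (hr : RestU F k K u) {f : Face T} (hf : f.1 ⊆ K.1)
    (w : Fin 2 → Poly) : harmFV F k K f (tanV F f ((hess u).mulVec (cvec (F.nf f)))) w = 0 := by
  have hip := isIP_ipV (ι := Fin 2) hf (face_nonempty f)
  rw [harmFV, tanV_hess, rotF_gradF, (isIP_ipS hf (face_nonempty f)).zero_left, add_zero]
  refine ip_proj_of_orthogonal hip ?_ _
  rintro _ ⟨p, hp, rfl⟩
  exact hr.face_grad f hf p hp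

theorem RestU.cell_hess (hr : RestU F k K u) (η : Matrix (Fin 3) (Fin 3) Poly) :
    harmCurl k K (hess u) η = 0 := by
  have hip := isIP_ipM (ι := Fin 3) (subset_refl K.1) (cell_nonempty K)
  rw [harmCurl, curl_hess, hip.zero_left, add_zero]
  refine ip_proj_of_orthogonal hip ?_ _
  rintro _ ⟨p, hp, rfl⟩
  exact hr.cell p hp

theorem RestU.restSigma (hr : RestU F k K u) : RestSigma F k K (hess u) where
  vertex x hx α hα i j := by
    rw [hess_apply, dAlpha_pd, dAlpha_pd]
    refine hr.vertex x hx _ ?_ ?_ <;>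
    · simp only [Pi.add_apply, Finset.sum_add_distrib, Finset.sum_pi_single', Finset.mem_univ,
        if_true]
      omega
  edge_tt e he p hp hp1 := hr.edge_tt_hess F he hp hp1
  edge_nt e he j p hp hp1 := hr.edge_nt_hess F he j hp hp1
  edge_nn e he j j' p hp := by
    rw [comp_hess]
    exact hr.edge_nn e he j j' p hp
  face_tt f hf η _ _ := hr.face_tt_hess F hf η
  face_nt f hf w _ := hr.face_nt_hess F hf w
  cell η _ := hr.cell_hess F η

/-- The mean of `∂_t ∂_c u` is the difference of `∂_c u` at the end points. The first moment of
`∂_t² u` becomes, after integration by parts, a difference of values of `u`. Both are degrees of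
freedom at the vertices of the edge. -/
theorem dofSigma_hess {e : Edge T} (he : e.1 ⊆ K.1)
    (hu : ∀ x : Vertex T, x.1 ∈ e.1 → dofU x u = 0) (j : Fin 4) : dofSigma F e (hess u) j = 0 := by
  have hvert : ∀ x ∈ e.1, x ∈ T.vertices := fun x hx =>
    T.down_closed e.2.1 (Finset.singleton_subset_iff.mpr hx) (Finset.singleton_nonempty x)
  have h0 : ∀ x ∈ e.1, ev u x = 0 := fun x hx => by
    have := congrFun (hu ⟨x, hvert x hx⟩ hx) 0
    exact this
  have h1 : ∀ x ∈ e.1, ∀ c, ev (dir c u) x = 0 := fun x hx c => by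
    rw [ev_dir]
    refine Finset.sum_eq_zero fun i _ => ?_
    have := congrFun (hu ⟨x, hvert x hx⟩ hx) i.succ
    have h2 : ev (pd i u) x = 0 := this
    rw [h2, mul_zero]
  refine (dofSigma_eq_zero_iff F he _).mpr ⟨fun c => ?_, fun r hr => ?_⟩ j
  · rw [comp_hess, dir_comm]
    exact ipS_dir_te F he fun x hx => h1 x hx c
  · rw [comp_hess]
    obtain ⟨c, hc, -⟩ := ipS_dir_te_affine F he (g := dir (F.te e) u) (fun x hx => h1 x hx _) hr
    rw [hc, ipS_dir_te F he h0, mul_zero, neg_zero]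

/-- Unisolvence is inherited from the next element: the Hessian has all degrees of freedom zero, so
the function is affine, and it vanishes at the vertices. -/
theorem RestU.eq_zero (hk : 7 ≤ k) (hr : RestU F k K u) (hd : Deg ((k : ℤ) + 2) u)
    (hu : ∀ x : Vertex T, x.1 ∈ K.1 → dofU x u = 0) : u = 0 := by
  have h := (hr.restSigma F).eq_zero F (by omega) (hess_isSymm u) (fun i j => by
    have := hd.hess i j
    rwa [add_sub_cancel_right] at this) fun e he j =>
      dofSigma_hess F he (fun x hx => hu x (he hx)) j
  rw [deg_one_eq K (deg_one_of_hess h)]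
  refine Finset.sum_eq_zero fun v _ => ?_
  have hv : v.1 ∈ T.vertices :=
    T.down_closed K.2.1 (Finset.singleton_subset_iff.mpr v.2) (Finset.singleton_nonempty v.1)
  have : ev u v.1 = 0 := congrFun (hu ⟨v.1, hv⟩ v.2) 0
  rw [this, map_zero, zero_mul]

end restU

/-! ## Stokes' theorem on a face -/

section stokes

variable (F : Frame T) {K : Cell T} {f : Face T} {σ : Matrix (Fin 3) (Fin 3) Poly}

theorem mulVec_cvec_add (σ : Matrix (Fin 3) (Fin 3) Poly) (a b : E3) (i : Fin 3) :
    σ.mulVec (cvec (a + b)) i = σ.mulVec (cvec a) i + σ.mulVec (cvec b) i := by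
  simp [Matrix.mulVec, dotProduct, cvec, mul_add, Finset.sum_add_distrib]

theorem mulVec_cvec_smul (σ : Matrix (Fin 3) (Fin 3) Poly) (r : ℝ) (a : E3) (i : Fin 3) :
    σ.mulVec (cvec (r • a)) i = MvPolynomial.C r * σ.mulVec (cvec a) i := by
  simp only [Matrix.mulVec, dotProduct, cvec, PiLp.smul_apply, smul_eq_mul, map_mul, Finset.mul_sum]
  exact Finset.sum_congr rfl fun j _ => by ring

theorem mulVec_cvec_eq_comp (σ : Matrix (Fin 3) (Fin 3) Poly) (a : E3) (i : Fin 3) :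
    σ.mulVec (cvec a) i = comp (EuclideanSpace.single i 1) σ a := by
  rw [comp_eq]
  simp only [Fin.sum_univ_three, PiLp.single_apply]
  fin_cases i <;> simp

/-- The derivative of an `RT` field is a multiple of the identity. This is the property that makes
these fields the right weights in Stokes' theorem for symmetric matrices. -/
theorem dir_rtBasis (j : Fin 4) : ∃ β : ℝ, ∀ w i,
    dir w (rtBasis j i) = MvPolynomial.C β * MvPolynomial.C (w i) := by
  refine Fin.cases ⟨1, fun w i => ?_⟩ (fun j => ⟨0, fun w i => ?_⟩) j
  · rw [show rtBasis 0 i = MvPolynomial.X i from rfl, dir_X, map_one, one_mul]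
  · rw [show rtBasis j.succ i = MvPolynomial.C _ from rfl, dir_C, map_zero, zero_mul]

/-- The tangential component along `t` of `σ r`, for the `j`-th basis field `r`. -/
noncomputable def rtComp (σ : Matrix (Fin 3) (Fin 3) Poly) (j : Fin 4) (t : E3) : Poly :=
  ∑ i, rtBasis j i * σ.mulVec (cvec t) i

theorem rtComp_add (σ : Matrix (Fin 3) (Fin 3) Poly) (j : Fin 4) (a b : E3) :
    rtComp σ j (a + b) = rtComp σ j a + rtComp σ j b := by
  simp only [rtComp, mulVec_cvec_add, mul_add, Finset.sum_add_distrib]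

theorem rtComp_smul (σ : Matrix (Fin 3) (Fin 3) Poly) (j : Fin 4) (r : ℝ) (a : E3) :
    rtComp σ j (r • a) = MvPolynomial.C r * rtComp σ j a := by
  simp only [rtComp, mulVec_cvec_smul, Finset.mul_sum]
  exact Finset.sum_congr rfl fun i _ => by ring

theorem rtComp_sub (σ : Matrix (Fin 3) (Fin 3) Poly) (j : Fin 4) (a b : E3) :
    rtComp σ j (a - b) = rtComp σ j a - rtComp σ j b := by
  have h : rtComp σ j (a + (-1 : ℝ) • b) = rtComp σ j a + MvPolynomial.C (-1) * rtComp σ j b := by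
    rw [rtComp_add, rtComp_smul]
  rw [neg_one_smul, ← sub_eq_add_neg] at h
  rw [h, map_neg, map_one]
  ring

theorem dofSigma_eq_rtComp {e : Edge T} (he : e.1 ⊆ K.1) (σ : Matrix (Fin 3) (Fin 3) Poly)
    (j : Fin 4) : dofSigma F e σ j = ipS e.1 (rtComp σ j (F.te e)) 1 := by
  rw [rtComp, ipS_sum_left K he (edge_nonempty e), dofSigma, ipV]
  refine Finset.sum_congr rfl fun i _ => ?_
  rw [ipS_eq, mul_comm]

/-- The product rule yields the wanted curl term and a multiple of `t₁ᵀ σ t₂ - t₂ᵀ σ t₁`, which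
vanishes by symmetry. -/
theorem dofV_curl_eq (hf : f.1 ⊆ K.1) (hs : σ.IsSymm) (j : Fin 4) : ∃ γ : ℝ,
    dofV F f (curl σ) j = γ * ipS f.1 (dir (F.tf f 0) (rtComp σ j (F.tf f 1)) -
      dir (F.tf f 1) (rtComp σ j (F.tf f 0))) 1 := by
  obtain ⟨γ, -, hγ⟩ := exists_comp_curl F f
  obtain ⟨β, hβ⟩ := dir_rtBasis j
  refine ⟨-γ, ?_⟩
  have h1 : dofV F f (curl σ) j =
      ipS f.1 (∑ i, rtBasis j i * (curl σ).mulVec (cvec (F.nf f)) i) 1 := by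
    rw [ipS_sum_left K hf (face_nonempty f), dofV, ipV]
    refine Finset.sum_congr rfl fun i _ => ?_
    rw [ipS_eq, mul_comm]
  rw [h1, ← ipS_smul_left]
  congr 1
  have hsym : ∑ i, MvPolynomial.C (F.tf f 0 i) * σ.mulVec (cvec (F.tf f 1)) i =
      ∑ i, MvPolynomial.C (F.tf f 1 i) * σ.mulVec (cvec (F.tf f 0)) i := by
    rw [← comp_eq, ← comp_eq, comp_symm _ _ hs]
  rw [MvPolynomial.smul_eq_C_mul, map_neg]
  simp only [rtComp, dir_sum, dir_mul, hβ, Finset.sum_add_distrib, mulVec_cvec_eq_comp, hγ, rotF]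
  simp only [← mulVec_cvec_eq_comp]
  simp only [Fin.sum_univ_three] at hsym ⊢
  linear_combination MvPolynomial.C γ * MvPolynomial.C β * hsym

theorem face_vertices (hf : f.1 ⊆ K.1) :
    ∃ a b c : K.1, a ≠ b ∧ a ≠ c ∧ b ≠ c ∧ f.1 = {a.1, b.1, c.1} := by
  classical
  obtain ⟨x, y, z, hxy, hxz, hyz, h⟩ := Finset.card_eq_three.mp f.2.2
  have hx : x ∈ K.1 := hf (h ▸ by simp)
  have hy : y ∈ K.1 := hf (h ▸ by simp)
  have hz : z ∈ K.1 := hf (h ▸ by simp)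
  exact ⟨⟨x, hx⟩, ⟨y, hy⟩, ⟨z, hz⟩, fun h => hxy (congrArg Subtype.val h),
    fun h => hxz (congrArg Subtype.val h), fun h => hyz (congrArg Subtype.val h), by rw [h]⟩

theorem tangent_face_eq {a b c : K.1} (hab : a ≠ b) (hac : a ≠ c) (hbc : b ≠ c)
    (hf' : f.1 = {a.1, b.1, c.1}) {w : E3} (hw : IsTangent K f.1 w) :
    w = slope K w b • (b.1 - a.1) + slope K w c • (c.1 - a.1) := by
  classical
  have h0 : ∀ v, v ∉ ({a, b, c} : Finset K.1) → slope K w v = 0 := fun v hv => hw v (by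
    rw [hf']
    simpa [← Subtype.ext_iff] using hv)
  have h1 := sum_slope_smul K w
  have h2 := sum_slope K w
  have hn1 : a ∉ ({b, c} : Finset K.1) := by simp [hab, hac]
  have hn2 : b ∉ ({c} : Finset K.1) := by simp [hbc]
  rw [← Finset.sum_subset (Finset.subset_univ {a, b, c}) fun v _ hv => by rw [h0 v hv, zero_smul],
    Finset.sum_insert hn1, Finset.sum_insert hn2, Finset.sum_singleton] at h1
  rw [← Finset.sum_subset (Finset.subset_univ {a, b, c}) fun v _ hv => h0 v hv,
    Finset.sum_insert hn1, Finset.sum_insert hn2, Finset.sum_singleton] at h2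
  have h3 : slope K w a = -slope K w b - slope K w c := by linarith
  conv_lhs => rw [← h1, h3]
  module

/-- Stokes' theorem on the triangle for the tangential field `rᵀ σ` with `r` an `RT` field: its edge
means are the edge degrees of freedom up to nonzero factors. -/
theorem dofV_curl (hf : f.1 ⊆ K.1) (hs : σ.IsSymm) (j : Fin 4)
    (h : ∀ e : Edge T, e.1 ⊆ f.1 → dofSigma F e σ j = 0) : dofV F f (curl σ) j = 0 := by
  classical
  obtain ⟨γ, hγ⟩ := dofV_curl_eq F hf hs j
  obtain ⟨a, b, c, hab, hac, hbc, hf'⟩ := face_vertices hf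
  have haf : a.1 ∈ f.1 := by rw [hf']; simp
  have hbf : b.1 ∈ f.1 := by rw [hf']; simp
  have hcf : c.1 ∈ f.1 := by rw [hf']; simp
  have key : ∀ p q : K.1, p ≠ q → p.1 ∈ f.1 → q.1 ∈ f.1 →
      ipS {p.1, q.1} (rtComp σ j (q.1 - p.1)) 1 = 0 := by
    intro p q hpq hp hq
    have hpq' : p.1 ≠ q.1 := fun h => hpq (Subtype.ext h)
    have hc : ({p.1, q.1} : Finset E3).card = 2 := Finset.card_pair hpq'
    have hsub : ({p.1, q.1} : Finset E3) ⊆ f.1 := by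
      intro x hx
      rw [Finset.mem_insert, Finset.mem_singleton] at hx
      rcases hx with rfl | rfl
      exacts [hp, hq]
    let e : Edge T := ⟨{p.1, q.1}, T.down_closed f.2.1 hsub ⟨p.1, by simp⟩, hc⟩
    have h1 := h e hsub
    rw [dofSigma_eq_rtComp F (K := K) (hsub.trans hf)] at h1
    obtain ⟨μ, hμ, ht⟩ := edge_ne_zero F e (a := p.1) (b := q.1) (by simp [e]) (by simp [e]) hpq'
    rw [ht, rtComp_smul, ← MvPolynomial.smul_eq_C_mul, ipS_smul_left] at h1
    exact (mul_eq_zero.mp h1).resolve_left hμ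
  have hsubK : ∀ p q : K.1, ({p.1, q.1} : Finset E3) ⊆ K.1 := by
    intro p q x hx
    rw [Finset.mem_insert, Finset.mem_singleton] at hx
    rcases hx with rfl | rfl
    exacts [p.2, q.2]
  have hsub2 : ∀ p q : K.1, sub K {p.1, q.1} = {p, q} := by
    intro p q; ext v; simp
  have hst := ipS_rot_triangle K hab hac hbc hf (hsubK a b) (hsubK a c) (hsubK b c)
    (by ext v; simp [hf']) (hsub2 a b) (hsub2 a c) (hsub2 b c)
    (key a b hab haf hbf) (key a c hac haf hcf) (by
      rw [← rtComp_sub, sub_sub_sub_cancel_right]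
      exact key b c hbc hbf hcf)
  have h0 := tangent_face_eq hab hac hbc hf' (isTangent_tf F hf 0)
  have h1 := tangent_face_eq hab hac hbc hf' (isTangent_tf F hf 1)
  set s0b := slope K (F.tf f 0) b
  set s0c := slope K (F.tf f 0) c
  set s1b := slope K (F.tf f 1) b
  set s1c := slope K (F.tf f 1) c
  -- The rotation is an alternating expression in the two directions, so passing from the frame to
  -- the edge vectors multiplies it by a determinant.
  have hfin : dir (F.tf f 0) (rtComp σ j (F.tf f 1)) - dir (F.tf f 1) (rtComp σ j (F.tf f 0)) =
      (s0b * s1c - s0c * s1b) • (dir (b.1 - a.1) (rtComp σ j (c.1 - a.1)) -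
        dir (c.1 - a.1) (rtComp σ j (b.1 - a.1))) := by
    rw [h0, h1]
    simp only [rtComp_add, rtComp_smul, dir_add_vec, dir_smul_vec, dir_add, dir_C_mul,
      MvPolynomial.smul_eq_C_mul, map_sub, map_mul]
    ring
  rw [hγ, hfin, ipS_smul_left, hst, mul_zero, mul_zero]

end stokes

/-! ## Discrete rigidity -/

section rigidity

theorem eq_affine_of_step {Q : ℕ → ℝ} {t : ℝ} {a n : ℕ}
    (h : ∀ m, a ≤ m → m + 1 ≤ n → Q (m + 1) - Q m = t) :
    ∀ m, a ≤ m → m ≤ n → Q m = Q a - t * a + t * m := by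
  intro m hm
  induction m, hm using Nat.le_induction with
  | base => intro _; ring
  | succ m hm ih =>
    intro hn
    have h1 := h m hm hn
    have h2 := ih (by omega)
    push_cast
    linarith

/-- A discrete additive functional equation. Moving one unit between two arguments shows that the
increments of the functions coincide, so all three are affine with one slope. Arguments stop at `N -
2` because the two others are at least one. -/
theorem cauchy_three {Q₀ Q₁ Q₂ : ℕ → ℝ} {N : ℕ} (hN : 4 ≤ N)
    (h : ∀ a b c, 1 ≤ a → 1 ≤ b → 1 ≤ c → a + b + c = N → Q₀ a + Q₁ b + Q₂ c = 0) :
    ∃ c₀ c₁ c₂ t : ℝ, c₀ + c₁ + c₂ + t * N = 0 ∧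
      ∀ m, 1 ≤ m → m + 2 ≤ N → Q₀ m = c₀ + t * m ∧ Q₁ m = c₁ + t * m ∧ Q₂ m = c₂ + t * m := by
  have h01 : ∀ a b, 1 ≤ a → 1 ≤ b → a + b + 2 ≤ N → Q₀ (a + 1) - Q₀ a = Q₁ (b + 1) - Q₁ b := by
    intro a b ha hb hab
    have h1 := h (a + 1) b (N - 1 - a - b) (by omega) hb (by omega) (by omega)
    have h2 := h a (b + 1) (N - 1 - a - b) ha (by omega) (by omega) (by omega)
    linarith
  have h02 : ∀ a c, 1 ≤ a → 1 ≤ c → a + c + 2 ≤ N → Q₀ (a + 1) - Q₀ a = Q₂ (c + 1) - Q₂ c := by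
    intro a c ha hc hac
    have h1 := h (a + 1) (N - 1 - a - c) c (by omega) (by omega) hc (by omega)
    have h2 := h a (N - 1 - a - c) (c + 1) ha (by omega) (by omega) (by omega)
    linarith
  obtain ⟨t, ht⟩ : ∃ t, t = Q₀ 2 - Q₀ 1 := ⟨_, rfl⟩
  have e1 := eq_affine_of_step (Q := Q₁) (t := t) (a := 1) (n := N - 2) fun m hm hn => by
    rw [ht]; exact (h01 1 m le_rfl hm (by omega)).symm
  have e2 := eq_affine_of_step (Q := Q₂) (t := t) (a := 1) (n := N - 2) fun m hm hn => by
    rw [ht]; exact (h02 1 m le_rfl hm (by omega)).symm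
  have e0 := eq_affine_of_step (Q := Q₀) (t := t) (a := 1) (n := N - 2) fun m hm hn => by
    rw [h01 m 1 hm le_rfl (by omega), ht]; exact (h01 1 1 le_rfl le_rfl (by omega)).symm
  refine ⟨_, _, _, t, ?_, fun m h1 h2 => ⟨e0 m h1 (by omega), e1 m h1 (by omega),
    e2 m h1 (by omega)⟩⟩
  have := h 1 1 (N - 2) le_rfl le_rfl (by omega) (by omega)
  rw [e2 (N - 2) (by omega) le_rfl, Nat.cast_sub (by omega : 2 ≤ N)] at this
  push_cast at this ⊢
  linarith

/-- Functions on the multi-indices of a triangle that are invariant under moves along the lines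
parallel to the edges. -/
theorem rigid_triangle {q₀ q₁ q₂ : ℕ → ℕ → ℕ → ℝ} {N : ℕ} (hN : 4 ≤ N)
    (hsum : ∀ x y z, x + y + z = N → q₀ x y z + q₁ x y z + q₂ x y z = 0)
    (h₀ : ∀ x y z, x + y + z + 1 = N → 1 ≤ x → x + 2 ≤ N → y + 3 ≤ N → z + 3 ≤ N →
      q₀ x (y + 1) z = q₀ x y (z + 1))
    (h₁ : ∀ x y z, x + y + z + 1 = N → 1 ≤ y → y + 2 ≤ N → x + 3 ≤ N → z + 3 ≤ N →
      q₁ (x + 1) y z = q₁ x y (z + 1))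
    (h₂ : ∀ x y z, x + y + z + 1 = N → 1 ≤ z → z + 2 ≤ N → x + 3 ≤ N → y + 3 ≤ N →
      q₂ (x + 1) y z = q₂ x (y + 1) z) :
    ∃ c₀ c₁ c₂ t : ℝ, ∀ x y z, x + y + z = N → x + 2 ≤ N → y + 2 ≤ N → z + 2 ≤ N →
      q₀ x y z = c₀ + t * x ∧ q₁ x y z = c₁ + t * y ∧ q₂ x y z = c₂ + t * z := by
  have m₀ : ∀ n x y z, x + y + z + n = N → 1 ≤ x → x + 2 ≤ N → y + n + 2 ≤ N → z + n + 2 ≤ N →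
      q₀ x (y + n) z = q₀ x y (z + n) := by
    intro n
    induction n with
    | zero => intros; rfl
    | succ n ih =>
      intro x y z h hx hx' hy hz
      rw [show y + (n + 1) = (y + n) + 1 by ring, h₀ x (y + n) z (by omega) hx hx' (by omega)
        (by omega), ih x y (z + 1) (by omega) hx hx' (by omega) (by omega)]
      congr 1; ring
  have m₁ : ∀ n x y z, x + y + z + n = N → 1 ≤ y → y + 2 ≤ N → x + n + 2 ≤ N → z + n + 2 ≤ N →
      q₁ (x + n) y z = q₁ x y (z + n) := by
    intro n
    induction n with
    | zero => intros; rfl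
    | succ n ih =>
      intro x y z h hy hy' hx hz
      rw [show x + (n + 1) = (x + n) + 1 by ring, h₁ (x + n) y z (by omega) hy hy' (by omega)
        (by omega), ih x y (z + 1) (by omega) hy hy' (by omega) (by omega)]
      congr 1; ring
  have m₂ : ∀ n x y z, x + y + z + n = N → 1 ≤ z → z + 2 ≤ N → x + n + 2 ≤ N → y + n + 2 ≤ N →
      q₂ (x + n) y z = q₂ x (y + n) z := by
    intro n
    induction n with
    | zero => intros; rfl
    | succ n ih =>
      intro x y z h hz hz' hx hy
      rw [show x + (n + 1) = (x + n) + 1 by ring, h₂ (x + n) y z (by omega) hz hz' (by omega)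
        (by omega), ih x (y + 1) z (by omega) hz hz' (by omega) (by omega)]
      congr 1; ring
  -- Moves parallel to the opposite edge show that this component depends on its own index only; a
  -- normal form with last index one is fixed.
  have u₀ : ∀ x y z, x + y + z = N → 1 ≤ x → x + 2 ≤ N → y + 2 ≤ N → z + 2 ≤ N →
      q₀ x y z = q₀ x (N - x - 1) 1 := by
    intro x y z h hx hx' hy hz
    rcases Nat.eq_zero_or_pos z with rfl | hz0
    · have := m₀ 1 x (N - x - 1) 0 (by omega) hx hx' (by omega) (by omega)
      rw [show N - x - 1 + 1 = y by omega] at this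
      exact this
    · obtain ⟨n, rfl⟩ : ∃ n, z = 1 + n := ⟨z - 1, by omega⟩
      rw [← m₀ n x y 1 (by omega) hx hx' (by omega) (by omega)]
      congr 1; omega
  have u₁ : ∀ x y z, x + y + z = N → 1 ≤ y → y + 2 ≤ N → x + 2 ≤ N → z + 2 ≤ N →
      q₁ x y z = q₁ (N - y - 1) y 1 := by
    intro x y z h hy hy' hx hz
    rcases Nat.eq_zero_or_pos z with rfl | hz0
    · have := m₁ 1 (N - y - 1) y 0 (by omega) hy hy' (by omega) (by omega)
      rw [show N - y - 1 + 1 = x by omega] at this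
      exact this
    · obtain ⟨n, rfl⟩ : ∃ n, z = 1 + n := ⟨z - 1, by omega⟩
      rw [← m₁ n x y 1 (by omega) hy hy' (by omega) (by omega)]
      congr 1; omega
  have u₂ : ∀ x y z, x + y + z = N → 1 ≤ z → z + 2 ≤ N → x + 2 ≤ N → y + 2 ≤ N →
      q₂ x y z = q₂ (N - z - 1) 1 z := by
    intro x y z h hz hz' hx hy
    rcases Nat.eq_zero_or_pos y with rfl | hy0
    · have := m₂ 1 (N - z - 1) 0 z (by omega) hz hz' (by omega) (by omega)
      rw [show N - z - 1 + 1 = x by omega] at this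
      exact this
    · obtain ⟨n, rfl⟩ : ∃ n, y = 1 + n := ⟨y - 1, by omega⟩
      rw [← m₂ n x 1 z (by omega) hz hz' (by omega) (by omega)]
      congr 1; omega
  obtain ⟨c₀, c₁, c₂, t, hc, hQ⟩ := cauchy_three (Q₀ := fun x => q₀ x (N - x - 1) 1)
    (Q₁ := fun y => q₁ (N - y - 1) y 1) (Q₂ := fun z => q₂ (N - z - 1) 1 z) hN (by
      intro a b c ha hb hc habc
      have := hsum a b c habc
      rw [u₀ a b c habc ha (by omega) (by omega) (by omega),
        u₁ a b c habc hb (by omega) (by omega) (by omega),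
        u₂ a b c habc hc (by omega) (by omega) (by omega)] at this
      exact this)
  refine ⟨c₀, c₁, c₂, t, fun x y z h hx hy hz => ?_⟩
  have v₀ : 1 ≤ x → q₀ x y z = c₀ + t * x := fun h1 => by
    rw [u₀ x y z h h1 hx hy hz]; exact (hQ x h1 hx).1
  have v₁ : 1 ≤ y → q₁ x y z = c₁ + t * y := fun h1 => by
    rw [u₁ x y z h h1 hy hx hz]; exact (hQ y h1 hy).2.1
  have v₂ : 1 ≤ z → q₂ x y z = c₂ + t * z := fun h1 => by
    rw [u₂ x y z h h1 hz hx hy]; exact (hQ z h1 hz).2.2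
  have hs := hsum x y z h
  have hN' : (x : ℝ) + y + z = N := by exact_mod_cast h
  rw [← hN'] at hc
  -- For a zero index the moves say nothing, and the value is recovered from the relation that the
  -- three components sum to zero.
  rcases Nat.eq_zero_or_pos x with rfl | hx0
  · have e1 := v₁ (by omega)
    have e2 := v₂ (by omega)
    refine ⟨?_, e1, e2⟩
    push_cast at hc ⊢
    linarith
  rcases Nat.eq_zero_or_pos y with rfl | hy0
  · have e0 := v₀ (by omega)
    have e2 := v₂ (by omega)
    refine ⟨e0, ?_, e2⟩
    push_cast at hc ⊢
    linarith
  rcases Nat.eq_zero_or_pos z with rfl | hz0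
  · have e0 := v₀ (by omega)
    have e1 := v₁ (by omega)
    refine ⟨e0, e1, ?_⟩
    push_cast at hc ⊢
    linarith
  · exact ⟨v₀ hx0, v₁ hy0, v₂ hz0⟩

end rigidity

/-! ## Functionals on Bernstein polynomials -/

open Classical in
/-- A Bernstein basis polynomial, scaled by the reciprocal of a multinomial coefficient. -/
noncomputable def bmon (K : Cell T) (d : ℕ) (α : K.1 → ℕ) : Poly :=
  bern K d fun β => if β = α then 1 else 0

theorem bern_eq_sum_bmon (K : Cell T) (d : ℕ) (c : (K.1 → ℕ) → ℝ) :
    bern K d c = ∑ α ∈ idx Finset.univ d, c α • bmon K d α := by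
  classical
  simp only [bmon, MvPolynomial.smul_eq_C_mul, ← bern_smul, ← bern_sum]
  refine bern_congr K fun α hα => ?_
  rw [Finset.sum_apply, Finset.sum_eq_single α]
  · simp
  · intro β _ hβ
    simp [hβ.symm]
  · exact fun h => absurd (mem_idx_univ.mpr hα) h

theorem map_bern_res (K : Cell T) (s : Finset E3) (d : ℕ) (c : (K.1 → ℕ) → ℝ)
    (L : Poly →ₗ[ℝ] ℝ) :
    L (bern K d (res K s c)) = ∑ α ∈ idx (sub K s) d, c α * L (bmon K d α) := by
  rw [bern_eq_sum_bmon, map_sum, ← Finset.sum_subset (s₁ := idx (sub K s) d)]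
  · refine Finset.sum_congr rfl fun α hα => ?_
    rw [map_smul, smul_eq_mul, res_of_mem (mem_idx_sub.mp hα).2]
  · exact fun α hα => mem_idx_univ.mpr (mem_idx_sub.mp hα).1
  · intro α hα hα'
    rw [map_smul, smul_eq_mul]
    by_contra h
    have := (res_ne_zero (left_ne_zero_of_mul h)).1
    exact hα' (mem_idx_sub.mpr ⟨mem_idx_univ.mp hα, this⟩)

/-- The derivative along an edge has two terms, so a functional that annihilates it takes equal
values on two neighbouring multi-indices. This is the source of the invariances in the rigidity
lemmas. -/
theorem dir_bmon (K : Cell T) (a b : K.1) (d : ℕ) (γ : K.1 → ℕ) :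
    dir (a.1 - b.1) (bmon K (d + 1) (γ + unit a + unit b)) =
      bmon K d (γ + unit b) - bmon K d (γ + unit a) := by
  rw [bmon, dir_sub_bern, bmon, bmon, ← bern_sub]
  refine bern_congr K fun β _ => ?_
  have h1 : β + unit a = γ + unit a + unit b ↔ β = γ + unit b := by
    rw [add_right_comm, add_left_inj]
  have h2 : β + unit b = γ + unit a + unit b ↔ β = γ + unit a := by rw [add_left_inj]
  simp only [Pi.sub_apply, h1, h2]

/-- An affine vector field, tested with a constant vector. -/
noncomputable def affComp (v A : E3) (t : ℝ) : Poly :=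
  ∑ i, MvPolynomial.C (v i) * (MvPolynomial.C (A i) + MvPolynomial.C t * MvPolynomial.X i)

theorem deg_affComp (v A : E3) (t : ℝ) : Deg 1 (affComp v A t) :=
  Deg.sum fun i _ => (((deg_C _).mono (by norm_num)).add ((deg_X i).C_mul _)).C_mul _

theorem ev_affComp (v A : E3) (t : ℝ) (x : E3) :
    ev (affComp v A t) x = inner ℝ v (A + t • x) := by
  simp [affComp, inner_e3, Fin.sum_univ_three]

theorem ev_bern_vertex_sub {K : Cell T} {N : ℕ} {c : (K.1 → ℕ) → ℝ} {p j : K.1}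
    (h0 : ev (bern K (N + 1) c) p.1 = 0)
    (h1 : ev (dir (j.1 - p.1) (bern K (N + 1) c)) p.1 = 0) : c (N • unit p + unit j) = 0 := by
  have h2 := ev_bern_vertex K (N + 1) c p h0
  rw [dir_sub_bern] at h1
  have h3 := ev_bern_vertex K N _ p h1
  rw [← succ_nsmul, h2, sub_zero] at h3
  exact h3

/-- If the functionals `L a` act on the coefficients like an affine vector field, and if the vector
field `(bern N (c a))ₐ` is orthogonal to the affine vector fields, then it is annihilated. -/
theorem moment_eq_zero (K : Cell T) {s : Finset E3} (hs : s ⊆ K.1) (hne : s.Nonempty)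
    {ι : Type} [Fintype ι] {τ : ι → E3} (hτ : Orthonormal ℝ τ) (ht : ∀ a, IsTangent K s (τ a))
    {N : ℕ} {c : ι → (K.1 → ℕ) → ℝ} (L : ι → Poly →ₗ[ℝ] ℝ) (e : K.1 → ℝ) (t : ℝ)
    (hL : ∀ β ∈ idx (sub K s) N, (∃ a, c a β ≠ 0) → ∀ m ∈ sub K s,
      ∑ b, slope K (τ b) m * L b (bmon K N β) = e m + t * β m)
    (horth : ∀ A r, ∑ a, ipS s (bern K N (c a)) (affComp (τ a) A r) = 0) :
    ∑ a, L a (bern K N (res K s (c a))) = 0 := by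
  -- The hypothesis gives the pairings of `L` with the gradients of the barycentric coordinates;
  -- expanding the frame vectors in the vertices recovers `L` from them.
  have hval : ∀ β ∈ idx (sub K s) N, (∃ a, c a β ≠ 0) → ∀ a, L a (bmon K N β) =
      inner ℝ (τ a) (∑ m ∈ sub K s, (e m + t * β m) • m.1) := by
    intro β hβ hc a
    have h1 : ∑ m ∈ sub K s, (e m + t * β m) • m.1 = ∑ b, L b (bmon K N β) • τ b := by
      rw [Finset.sum_congr rfl fun m hm => by rw [← hL β hβ hc m hm]]
      simp only [Finset.sum_smul]
      rw [Finset.sum_comm]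
      refine Finset.sum_congr rfl fun b _ => ?_
      conv_rhs => rw [← sum_slope_smul K (τ b), Finset.smul_sum]
      rw [← Finset.sum_subset (Finset.subset_univ (sub K s))]
      · exact Finset.sum_congr rfl fun m _ => by rw [smul_smul, mul_comm]
      · intro m _ hm
        rw [ht b m (fun h => hm (mem_sub.mpr h)), zero_smul, smul_zero]
    rw [h1, hτ.inner_right_fintype]
  obtain ⟨C, hC, hip⟩ := ipS_bern_affine K hs hne
  set n : ℝ := (s.card : ℝ) + N with hn
  have hn0 : n ≠ 0 := by
    have : 0 < s.card := Finset.card_pos.mpr hne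
    positivity
  -- The weights `β j + 1` of the affine moments add up to `n`. With this constant part the weighted
  -- sum of the affine field at the vertices is exactly `∑ (e m + t β m) xₘ`.
  have h2 := horth (n⁻¹ • ∑ m ∈ sub K s, (e m - t) • m.1) t
  simp only [map_bern_res]
  simp only [hip N _ _ (deg_affComp _ _ _), ← Finset.mul_sum] at h2
  rw [mul_eq_zero, or_iff_right (hC N).ne'] at h2
  rw [← h2]
  refine Finset.sum_congr rfl fun a _ => Finset.sum_congr rfl fun β hβ => ?_
  by_cases hc : c a β = 0
  · rw [hc, zero_mul, zero_mul]
  rw [hval β hβ ⟨a, hc⟩]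
  congr 1
  simp only [ev_affComp, ← inner_smul_right, ← inner_sum]
  congr 1
  have h3 : ∑ j ∈ sub K s, ((β j : ℝ) + 1) = n := by
    rw [Finset.sum_add_distrib, Finset.sum_const, card_sub K hs, hn, nsmul_one, add_comm]
    congr 1
    have h4 := (mem_idx_sub.mp hβ).1
    rw [← h4, ← Nat.cast_sum]
    congr 1
    refine Finset.sum_subset (Finset.subset_univ _) fun v _ hv => ?_
    exact (mem_idx_sub.mp hβ).2 v fun h => hv (mem_sub.mpr h)
  simp only [smul_add, Finset.sum_add_distrib (s := sub K s)]
  rw [← Finset.sum_smul, h3, smul_inv_smul₀ hn0, ← Finset.sum_add_distrib]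
  refine Finset.sum_congr rfl fun m _ => ?_
  rw [smul_smul, ← add_smul]
  congr 1
  ring

/-! ## Surjectivity of the face rotation on bubbles -/

section rotSurjective

variable (F : Frame T) {K : Cell T} {f : Face T} {k : ℕ}

theorem add_mem_bubF0 {d : ℤ} {p q : Poly} (hp : p ∈ bubF0 K f d) (hq : q ∈ bubF0 K f d) :
    p + q ∈ bubF0 K f d := by
  obtain ⟨p', hp, hp0, rfl⟩ := hp
  obtain ⟨q', hq, hq0, rfl⟩ := hq
  exact ⟨p' + q', hp.add hq, fun x hx => by rw [ev_add, hp0 x hx, hq0 x hx, add_zero],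
    (mul_add _ _ _).symm⟩

theorem C_mul_mem_bubF0 {d : ℤ} {p : Poly} (r : ℝ) (hp : p ∈ bubF0 K f d) :
    MvPolynomial.C r * p ∈ bubF0 K f d := by
  obtain ⟨p', hp, hp0, rfl⟩ := hp
  exact ⟨MvPolynomial.C r * p', hp.C_mul r, fun x hx => by rw [ev_mul, hp0 x hx, mul_zero],
    by ring⟩

theorem zero_mem_bubF0 {d : ℤ} : (0 : Poly) ∈ bubF0 K f d :=
  ⟨0, deg_zero _, fun x _ => ev_zero x, (mul_zero _).symm⟩

/-- Interior Bernstein polynomials with bounded exponents are face bubbles. -/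
theorem bmon_mem_bubF0 (hf : f.1 ⊆ K.1) {α : K.1 → ℕ} (hsum : ∑ v, α v = k)
    (hpos : ∀ v : K.1, v.1 ∈ f.1 → 1 ≤ α v) (h0 : ∀ v : K.1, v.1 ∉ f.1 → α v = 0)
    (hbd : ∀ v, α v + 3 ≤ k) : bmon K k α ∈ bubF0 K f ((k : ℤ) - 3) := by
  classical
  obtain ⟨q, hq, hb, hv⟩ := bern_eq_bub_mul K hf 1 (d := k)
    (c := fun β => if β = α then 1 else 0) (by
      intro β _ hβ v hv
      rw [ne_eq, ite_eq_right_iff, not_forall] at hβ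
      rw [hβ.1]; exact hpos v hv)
  refine ⟨q, hq.mono (by rw [f.2.2]; norm_num), fun x hx => ?_, by rw [bmon, hb, pow_one]⟩
  refine hv ⟨x, hf hx⟩ fun β hβs hβ => ?_
  rw [ne_eq, ite_eq_right_iff, not_forall] at hβ
  rw [hβ.1]
  -- If the quotient did not vanish at `x`, the two other entries would be at most one and the entry
  -- at `x` at least `k - 2`.
  by_contra hcon
  push Not at hcon
  obtain ⟨a, b, c, hab, hac, hbc, hfv⟩ := face_vertices hf
  have hS : ∑ v, α v = α a + α b + α c := by
    rw [← Finset.sum_subset (Finset.subset_univ ({a, b, c} : Finset K.1)),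
      Finset.sum_insert (by simp [hab, hac]), Finset.sum_pair hbc, add_assoc]
    intro v _ hv
    refine h0 v fun h => hv ?_
    rw [hfv] at h
    simpa [← Subtype.ext_iff] using h
  have key : ∀ v : K.1, v.1 ∈ f.1 → v ≠ ⟨x, hf hx⟩ → α v ≤ 1 := by
    intro v hv hvx
    by_contra h
    exact absurd (hcon v hvx fun _ => by omega).1 (by simpa using hv)
  have hm : ∀ v : K.1, v = a ∨ v = b ∨ v = c → v.1 ∈ f.1 := by
    rintro v (rfl | rfl | rfl) <;> simp [hfv]
  have ha := key a (hm a (by simp))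
  have hb := key b (hm b (by simp))
  have hc := key c (hm c (by simp))
  have := hbd a
  have := hbd b
  have := hbd c
  have hx' : (⟨x, hf hx⟩ : K.1) = a ∨ (⟨x, hf hx⟩ : K.1) = b ∨ (⟨x, hf hx⟩ : K.1) = c := by
    rw [hfv] at hx
    simp only [Finset.mem_insert, Finset.mem_singleton] at hx
    exact hx.imp Subtype.ext (Or.imp Subtype.ext Subtype.ext)
  rcases hx' with h | h | h <;> rw [h] at ha hb hc
  · have := hb hab.symm; have := hc hac.symm; omega
  · have := ha hab; have := hc hbc.symm; omega
  · have := ha hac; have := hb hbc; omega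

/-- Coefficients of functions in `P^{(1)}(f)`. -/
theorem le_of_polyF1 {N : ℕ} {c : (K.1 → ℕ) → ℝ} (hf : f.1 ⊆ K.1)
    (hp : bern K (N + 1) c ∈ polyF1 F f (N + 1 : ℕ)) {β : K.1 → ℕ}
    (hβ : β ∈ idx (sub K f.1) (N + 1)) (hc : c β ≠ 0) (v : K.1) : β v + 2 ≤ N + 1 := by
  classical
  rw [mem_idx_sub] at hβ
  by_cases hv : v.1 ∈ f.1
  swap
  · rw [hβ.2 v hv]
    by_contra h
    have hN : N = 0 := by omega
    subst hN
    obtain ⟨j, rfl⟩ := eq_unit_of_sum_eq_one hβ.1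
    have hj : j.1 ∈ f.1 := by
      by_contra h
      have := hβ.2 j h
      simp at this
    refine hc ?_
    have := ev_bern_vertex K 1 c j (hp.2.1 j.1 hj)
    rwa [one_smul] at this
  by_contra h
  have hle : β v ≤ N + 1 := hβ.1 ▸ Finset.single_le_sum (fun _ _ => Nat.zero_le _)
    (Finset.mem_univ v)
  -- So near the corner `v` the coefficient is determined by the value and the gradient at `v`.
  have hj : ∃ j : K.1, j.1 ∈ f.1 ∧ β = N • unit v + unit j := by
    rcases Nat.lt_or_ge (β v) (N + 1) with h1 | h1
    · have hsum : ∑ w, β w = β v + ∑ w ∈ Finset.univ.erase v, β w :=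
        (Finset.add_sum_erase _ _ (Finset.mem_univ v)).symm
      obtain ⟨j, hj⟩ := eq_unit_of_sum_eq_one (α := fun w => β w - N * unit v w) (by
        rw [← Finset.add_sum_erase _ _ (Finset.mem_univ v)]
        have : ∑ w ∈ Finset.univ.erase v, (β w - N * unit v w) = ∑ w ∈ Finset.univ.erase v, β w :=
          Finset.sum_congr rfl fun w hw => by
            rw [unit_of_ne (Finset.ne_of_mem_erase hw)]; simp
        rw [this, unit_self]
        omega)
      have hβ' : β = N • unit v + unit j := by
        ext w
        have := congrFun hj w
        simp only [Pi.add_apply, Pi.smul_apply, smul_eq_mul]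
        by_cases hw : w = v
        · subst hw
          rw [unit_self] at this ⊢
          omega
        · rw [unit_of_ne hw] at this ⊢
          omega
      refine ⟨j, ?_, hβ'⟩
      by_contra hjf
      have := hβ.2 j hjf
      rw [hβ'] at this
      simp at this
    · refine ⟨v, hv, ?_⟩
      rw [← succ_nsmul]
      have hsum : ∑ w, β w = β v + ∑ w ∈ Finset.univ.erase v, β w :=
        (Finset.add_sum_erase _ _ (Finset.mem_univ v)).symm
      have h0 : ∑ w ∈ Finset.univ.erase v, β w = 0 := by omega
      rw [Finset.sum_eq_zero_iff] at h0
      ext w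
      by_cases hw : w = v
      · subst hw
        simp; omega
      · simp [unit_of_ne hw, h0 w (Finset.mem_erase.mpr ⟨hw, Finset.mem_univ _⟩)]
  obtain ⟨j, hj, rfl⟩ := hj
  refine hc (ev_bern_vertex_sub (hp.2.1 v.1 hv) ?_)
  rw [dir_tangent F hf (isTangent_sub hj hv), ev_add, ev_mul, ev_mul]
  have h0 := hp.2.2 0 v.1 hv
  have h1 := hp.2.2 1 v.1 hv
  rw [gradF] at h0 h1
  rw [h0, h1, mul_zero, mul_zero, add_zero]

end rotSurjective

/-! ### Duality and rigidity on a triangle -/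

section rotSurjective

variable (F : Frame T) {K : Cell T} {f : Face T} {k : ℕ}

theorem sum_sub_triangle {a b c : K.1} (hab : a ≠ b) (hac : a ≠ c) (hbc : b ≠ c)
    (hf : f.1 = {a.1, b.1, c.1}) {M : Type*} [AddCommMonoid M] (g : K.1 → M) :
    ∑ m ∈ sub K f.1, g m = g a + g b + g c := by
  classical
  have : sub K f.1 = {a, b, c} := by ext v; simp [hf]
  rw [this, Finset.sum_insert (by simp [hab, hac]), Finset.sum_pair hbc, add_assoc]

theorem eq_triangle {a b c : K.1} (hab : a ≠ b) (hac : a ≠ c) (hbc : b ≠ c)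
    (hf : f.1 = {a.1, b.1, c.1}) {β : K.1 → ℕ} (hβ : ∀ v : K.1, v.1 ∉ f.1 → β v = 0) :
    β = β a • unit a + β b • unit b + β c • unit c := by
  classical
  ext v
  simp only [Pi.add_apply, Pi.smul_apply, smul_eq_mul]
  by_cases h1 : v = a
  · subst h1; simp [unit_of_ne hab, unit_of_ne hac]
  by_cases h2 : v = b
  · subst h2; simp [unit_of_ne hab.symm, unit_of_ne hbc]
  by_cases h3 : v = c
  · subst h3; simp [unit_of_ne hac.symm, unit_of_ne hbc.symm]
  rw [unit_of_ne h1, unit_of_ne h2, unit_of_ne h3, hβ v (by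
    rw [hf]; simp [h1, h2, h3])]
  rfl

/-- Transfers `rigid_triangle` to multi-indices on the vertices of the face. The bound on the
entries costs nothing: by `le_of_polyF1` the functions to be tested have no other coefficients. -/
theorem face_rigid (hf : f.1 ⊆ K.1) {N : ℕ} (hN : 4 ≤ N) (p : K.1 → (K.1 → ℕ) → ℝ)
    (hsum : ∀ β ∈ idx (sub K f.1) N, ∑ m ∈ sub K f.1, p m β = 0)
    (hstep : ∀ l i j : K.1, l ≠ i → l ≠ j → i ≠ j → f.1 = {l.1, i.1, j.1} → ∀ γ : K.1 → ℕ,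
      ∑ v, (γ + unit i + unit j) v = N + 1 → (∀ v : K.1, v.1 ∉ f.1 → (γ + unit i + unit j) v = 0) →
      (∀ v : K.1, v.1 ∈ f.1 → 1 ≤ (γ + unit i + unit j) v) →
      (∀ v, (γ + unit i + unit j) v + 2 ≤ N) → p l (γ + unit i) = p l (γ + unit j)) :
    ∃ (e : K.1 → ℝ) (t : ℝ), ∀ β ∈ idx (sub K f.1) N, (∀ v, β v + 2 ≤ N) →
      ∀ m ∈ sub K f.1, p m β = e m + t * β m := by
  classical
  obtain ⟨a, b, c, hab, hac, hbc, hfv⟩ := face_vertices hf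
  let τ : ℕ → ℕ → ℕ → K.1 → ℕ := fun x y z => x • unit a + y • unit b + z • unit c
  have ta : ∀ x y z, τ x y z a = x := by
    intro x y z; simp [τ, unit_of_ne hab, unit_of_ne hac]
  have tb : ∀ x y z, τ x y z b = y := by
    intro x y z; simp [τ, unit_of_ne hab.symm, unit_of_ne hbc]
  have tc : ∀ x y z, τ x y z c = z := by
    intro x y z; simp [τ, unit_of_ne hac.symm, unit_of_ne hbc.symm]
  have hmem : ∀ v : K.1, v.1 ∈ f.1 ↔ v = a ∨ v = b ∨ v = c := by
    intro v; rw [hfv]; simp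
  have t0 : ∀ x y z (v : K.1), v.1 ∉ f.1 → τ x y z v = 0 := by
    intro x y z v hv
    rw [hmem] at hv
    push Not at hv
    simp [τ, unit_of_ne hv.1, unit_of_ne hv.2.1, unit_of_ne hv.2.2]
  have ts : ∀ x y z, ∑ v, τ x y z v = x + y + z := by
    intro x y z
    simp only [τ, Pi.add_apply, Pi.smul_apply, smul_eq_mul, Finset.sum_add_distrib,
      ← Finset.mul_sum, sum_unit, mul_one]
  have ua : ∀ x y z, τ x y z + unit a = τ (x + 1) y z := by
    intro x y z; simp only [τ, succ_nsmul]; abel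
  have ub : ∀ x y z, τ x y z + unit b = τ x (y + 1) z := by
    intro x y z; simp only [τ, succ_nsmul]; abel
  have uc : ∀ x y z, τ x y z + unit c = τ x y (z + 1) := by
    intro x y z; simp only [τ, succ_nsmul]; abel
  have hpos : ∀ x y z, 1 ≤ x → 1 ≤ y → 1 ≤ z → ∀ v : K.1, v.1 ∈ f.1 → 1 ≤ τ x y z v := by
    intro x y z hx hy hz v hv
    rcases (hmem v).mp hv with rfl | rfl | rfl
    exacts [by rwa [ta], by rwa [tb], by rwa [tc]]
  have hbd : ∀ x y z, x + 2 ≤ N → y + 2 ≤ N → z + 2 ≤ N → ∀ v : K.1, τ x y z v + 2 ≤ N := by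
    intro x y z hx hy hz v
    by_cases hv : v.1 ∈ f.1
    · rcases (hmem v).mp hv with rfl | rfl | rfl
      exacts [by rwa [ta], by rwa [tb], by rwa [tc]]
    · rw [t0 x y z v hv]; omega
  obtain ⟨c₀, c₁, c₂, t, h⟩ := rigid_triangle (N := N) hN
    (q₀ := fun x y z => p a (τ x y z)) (q₁ := fun x y z => p b (τ x y z))
    (q₂ := fun x y z => p c (τ x y z))
    (fun x y z hxyz => by
      rw [← hsum (τ x y z) (mem_idx_sub.mpr ⟨(ts x y z).trans hxyz, t0 x y z⟩),
        sum_sub_triangle hab hac hbc hfv])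
    (fun x y z hs hx hx' hy hz => by
      have := hstep a b c hab hac hbc hfv (τ x y z)
      simp only [ub, uc] at this
      exact this (by rw [ts]; omega) (t0 _ _ _) (hpos _ _ _ hx (by omega) (by omega))
        (hbd _ _ _ (by omega) (by omega) (by omega)))
    (fun x y z hs hx hx' hy hz => by
      have := hstep b a c hab.symm hbc hac (by rw [hfv]; exact Finset.insert_comm _ _ _) (τ x y z)
      simp only [ua, uc] at this
      exact this (by rw [ts]; omega) (t0 _ _ _) (hpos _ _ _ (by omega) hx (by omega))
        (hbd _ _ _ (by omega) (by omega) (by omega)))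
    (fun x y z hs hx hx' hy hz => by
      have := hstep c a b hac.symm hbc.symm hab (by
        rw [hfv]; ext v; simp only [Finset.mem_insert, Finset.mem_singleton]; tauto) (τ x y z)
      simp only [ua, ub] at this
      exact this (by rw [ts]; omega) (t0 _ _ _) (hpos _ _ _ (by omega) (by omega) hx)
        (hbd _ _ _ (by omega) (by omega) (by omega)))
  refine ⟨fun m => if m = a then c₀ else if m = b then c₁ else c₂, t, fun β hβ hb m hm => ?_⟩
  rw [mem_idx_sub] at hβ
  have hβe := eq_triangle hab hac hbc hfv hβ.2
  have hs : β a + β b + β c = N := by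
    rw [← hβ.1]
    conv_rhs => rw [hβe]
    exact (ts _ _ _).symm
  obtain ⟨h1, h2, h3⟩ := h (β a) (β b) (β c) hs (hb a) (hb b) (hb c)
  change p a (β a • unit a + β b • unit b + β c • unit c) = _ at h1
  change p b (β a • unit a + β b • unit b + β c • unit c) = _ at h2
  change p c (β a • unit a + β b • unit b + β c • unit c) = _ at h3
  rw [← hβe] at h1 h2 h3
  rcases (hmem m).mp (mem_sub.mp hm) with rfl | rfl | rfl
  · simpa using h1
  · simpa [hab.symm] using h2
  · simpa [hac.symm, hbc.symm] using h3

theorem smul_sub_of_slope {l i j : K.1} (hij : i ≠ j) (hfv : f.1 = {l.1, i.1, j.1}) {w : E3}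
    (hw : IsTangent K f.1 w) (hl : slope K w l = 0) : w = slope K w i • (i.1 - j.1) := by
  classical
  have h0 : ∀ v, v ≠ i → v ≠ j → slope K w v = 0 := by
    intro v hi hj
    by_cases hv : v = l
    · rw [hv, hl]
    · exact hw v (by rw [hfv]; simp [hi, hj, hv])
  have key : ∀ {M : Type} [AddCommMonoid M] [Module ℝ M] (g : K.1 → M),
      ∑ v, slope K w v • g v = slope K w i • g i + slope K w j • g j := by
    intro M _ _ g
    rw [← Finset.sum_subset (Finset.subset_univ ({i, j} : Finset K.1)), Finset.sum_pair hij]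
    intro v _ hv
    simp only [Finset.mem_insert, Finset.mem_singleton, not_or] at hv
    rw [h0 v hv.1 hv.2, zero_smul]
  have h1 := key fun _ => (1 : ℝ)
  have h2 := key fun v => v.1
  simp only [smul_eq_mul, mul_one] at h1
  rw [sum_slope] at h1
  rw [sum_slope_smul] at h2
  rw [show slope K w j = -slope K w i by linarith] at h2
  conv_lhs => rw [h2]
  rw [neg_smul, smul_sub, sub_eq_add_neg]

theorem orthonormal_tf (f : Face T) : Orthonormal ℝ (F.tf f) :=
  (F.face f).orthonormal.comp _ (Fin.castSucc_injective 2)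

theorem exists_tf_slope_ne (hf : f.1 ⊆ K.1) {l i : K.1} (hli : l ≠ i) (hl : l.1 ∈ f.1)
    (hi : i.1 ∈ f.1) : slope K (F.tf f 0) l ≠ 0 ∨ slope K (F.tf f 1) l ≠ 0 := by
  by_contra! h
  have h1 := congrArg (fun w => slope K w l) (tangent_eq F hf (isTangent_sub hl hi))
  simp only [slope_add, slope_smul, h.1, h.2, mul_zero, add_zero] at h1
  rw [slope_sub] at h1
  simp [hli] at h1

/-- Matrix-valued face bubbles have arbitrary row-wise rotations orthogonal to `RT(f)`. -/
theorem exists_rotFM (hk : 7 ≤ k) (hf : f.1 ⊆ K.1) {w : Fin 2 → Poly}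
    (hw : ∀ a, w a ∈ polyF1 F f ((k : ℤ) - 1)) (horth : ∀ r ∈ RTf F f, ipV f.1 w r = 0) :
    ∃ η : Matrix (Fin 2) (Fin 2) Poly, η.IsSymm ∧ (∀ a b, η a b ∈ bubF0 K f ((k : ℤ) - 3)) ∧
      ∀ a, ZeroOn K f.1 (w a - rotFM F f η a) := by
  classical
  obtain ⟨N, rfl⟩ : ∃ N, k = N + 2 := ⟨k - 2, by omega⟩
  let S : Submodule ℝ (Fin 2 → Poly) :=
    { carrier := {w | ∃ η : Matrix (Fin 2) (Fin 2) Poly, η.IsSymm ∧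
        (∀ a b, η a b ∈ bubF0 K f (((N + 2 : ℕ) : ℤ) - 3)) ∧
        ∀ a, ZeroOn K f.1 (w a - rotFM F f η a)}
      zero_mem' := ⟨0, rfl, fun _ _ => zero_mem_bubF0, fun a => by
        simp [rotFM, rotF, zeroOn_zero]⟩
      add_mem' := by
        rintro v w ⟨η, hη, hb, hz⟩ ⟨η', hη', hb', hz'⟩
        refine ⟨η + η', hη.add hη', fun a b => add_mem_bubF0 (hb a b) (hb' a b), fun a => ?_⟩
        convert (hz a).add (hz' a) using 1
        have h1 : ∀ b, (η + η') a b = η a b + η' a b := fun _ => rfl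
        simp only [rotFM, rotF, Pi.add_apply, h1, dir_add]
        ring
      smul_mem' := by
        rintro r w ⟨η, hη, hb, hz⟩
        refine ⟨r • η, hη.smul r, fun a b => ?_, fun a => ?_⟩
        · rw [Matrix.smul_apply, MvPolynomial.smul_eq_C_mul]
          exact C_mul_mem_bubF0 r (hb a b)
        · convert (hz a).mul_left (MvPolynomial.C r) using 1
          have h1 : ∀ b, (r • η) a b = MvPolynomial.C r * η a b := fun _ =>
            MvPolynomial.smul_eq_C_mul _ _
          simp only [rotFM, rotF, Pi.smul_apply, h1, MvPolynomial.smul_eq_C_mul, dir_C_mul]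
          ring }
  change w ∈ S
  by_contra hwS
  obtain ⟨ℓ, hℓw, hℓ⟩ := Submodule.exists_le_ker_of_notMem hwS
  let L : Fin 2 → Poly →ₗ[ℝ] ℝ := fun a => ℓ ∘ₗ LinearMap.single ℝ (fun _ => Poly) a
  have hL : ∀ v : Fin 2 → Poly, ℓ v = ∑ a, L a (v a) := by
    intro v
    conv_lhs => rw [← Finset.univ_sum_single v]
    rw [map_sum]
    rfl
  have hker : ∀ v ∈ S, ∑ a, L a (v a) = 0 := fun v hv => by
    rw [← hL]; exact hℓ hv
  have hdeg : ∀ a, Deg ((N + 1 : ℕ) : ℤ) (w a) := fun a => by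
    have := (hw a).1
    push_cast at this ⊢
    convert this using 1; ring_nf
  choose c hc using fun a => exists_bern K (hdeg a)
  -- Rigidity is applied to the pairings of the functional with the tangential gradients of the
  -- barycentric coordinates; they sum to zero because the coordinates sum to one.
  obtain ⟨e, t, het⟩ := face_rigid hf (N := N + 1) (by omega)
    (fun m β => ∑ b, slope K (F.tf f b) m * L b (bmon K (N + 1) β))
    (by
      intro β _
      rw [Finset.sum_comm]
      refine Finset.sum_eq_zero fun b _ => ?_
      rw [← Finset.sum_mul, Finset.sum_subset (Finset.subset_univ _)
        (fun v _ hv => isTangent_tf F hf b v fun h => hv (mem_sub.mpr h)), sum_slope, zero_mul])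
    (by
      intro l i j hli hlj hij hfv γ hs h0 hpos hbd
      set E := bmon K (N + 2) (γ + unit i + unit j) with hE
      have hEb : E ∈ bubF0 K f (((N + 2 : ℕ) : ℤ) - 3) :=
        bmon_mem_bubF0 hf hs hpos h0 fun v => by have := hbd v; omega
      -- The test field is `s sᵀ E` with `s` the tangential gradient of the coordinate of `l`. It is
      -- symmetric, and its rotation differentiates `E` along `s` turned by a right angle, which is
      -- parallel to the edge from `j` to `i`.
      set s : Fin 2 → ℝ := fun a => slope K (F.tf f a) l with hsdef
      have hmi : i.1 ∈ f.1 := by rw [hfv]; simp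
      have hml : l.1 ∈ f.1 := by rw [hfv]; simp
      have hτ := smul_sub_of_slope hij hfv (w := s 0 • F.tf f 1 - s 1 • F.tf f 0)
        (by
          intro v hv
          rw [sub_eq_add_neg, ← neg_smul, slope_add, slope_smul, slope_smul,
            isTangent_tf F hf 0 v hv, isTangent_tf F hf 1 v hv]
          ring)
        (by
          rw [sub_eq_add_neg, ← neg_smul, slope_add, slope_smul, slope_smul]
          simp only [hsdef]; ring)
      set κ := slope K (s 0 • F.tf f 1 - s 1 • F.tf f 0) i
      have hκ : κ ≠ 0 := by
        intro h
        rw [h, zero_smul] at hτ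
        have h1 : inner ℝ (F.tf f 1) (s 0 • F.tf f 1 - s 1 • F.tf f 0) = 0 := by
          rw [hτ, inner_zero_right]
        have h2 : inner ℝ (F.tf f 0) (s 0 • F.tf f 1 - s 1 • F.tf f 0) = 0 := by
          rw [hτ, inner_zero_right]
        simp only [inner_sub_right, inner_smul_right, inner_tf_tf, if_true, one_ne_zero,
          zero_ne_one, if_false, mul_one, mul_zero, sub_zero, zero_sub, neg_eq_zero] at h1 h2
        rcases exists_tf_slope_ne F hf hli hml hmi with h3 | h3
        · exact h3 h1
        · exact h3 h2
      have hrot : ∀ a, rotFM F f (Matrix.of fun a b => MvPolynomial.C (s a * s b) * E) a =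
          MvPolynomial.C (s a * κ) * (bmon K (N + 1) (γ + unit j) - bmon K (N + 1) (γ + unit i)) := by
        intro a
        have h1 : dir (s 0 • F.tf f 1 - s 1 • F.tf f 0) E =
            MvPolynomial.C κ * (bmon K (N + 1) (γ + unit j) - bmon K (N + 1) (γ + unit i)) := by
          rw [hτ, dir_smul_vec, hE, dir_bmon]
        rw [dir_sub_vec, dir_smul_vec, dir_smul_vec] at h1
        rw [MvPolynomial.C_mul, mul_assoc, ← h1]
        simp only [rotFM, rotF, Matrix.of_apply, dir_C_mul]
        simp only [MvPolynomial.C_mul]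
        ring
      have h1 := hker (rotFM F f (Matrix.of fun a b => MvPolynomial.C (s a * s b) * E))
        ⟨Matrix.of fun a b => MvPolynomial.C (s a * s b) * E,
          Matrix.IsSymm.ext fun a b => by simp only [Matrix.of_apply, mul_comm (s a)],
          fun a b => C_mul_mem_bubF0 _ hEb, fun a => by rw [sub_self]; exact zeroOn_zero⟩
      simp only [hrot] at h1
      simp only [← MvPolynomial.smul_eq_C_mul, map_smul, map_sub, smul_eq_mul] at h1
      have h2 : κ * (∑ b, s b * L b (bmon K (N + 1) (γ + unit j)) -
          ∑ b, s b * L b (bmon K (N + 1) (γ + unit i))) = 0 := by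
        rw [← h1, ← Finset.sum_sub_distrib, Finset.mul_sum]
        exact Finset.sum_congr rfl fun b _ => by ring
      rw [mul_eq_zero, or_iff_right hκ, sub_eq_zero] at h2
      exact h2.symm)
  have hfin := moment_eq_zero K hf (face_nonempty f) (orthonormal_tf F f) (isTangent_tf F hf)
    (c := c) L e t
    (by
      rintro β hβ ⟨a, ha⟩ m hm
      refine het β hβ (fun v => ?_) m hm
      refine le_of_polyF1 F hf (c := c a) ?_ hβ ha v
      rw [← hc a]
      convert hw a using 1
      push_cast; ring)
    (by
      intro A r
      rw [← horth (tanV F f fun i => MvPolynomial.C (A i) + MvPolynomial.C r * MvPolynomial.X i)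
        ⟨_, ⟨A, r, rfl⟩, rfl⟩]
      simp only [← hc]
      rfl)
  refine hℓw ?_
  rw [hL, ← hfin, ← sub_eq_zero, ← Finset.sum_sub_distrib]
  simp only [← map_sub]
  -- Dropping the coefficients outside of the face changes `w` by a field that vanishes on the face;
  -- such a field is in the subspace with the zero bubble.
  refine hker (fun a => w a - bern K (N + 1) (res K f.1 (c a))) ⟨0, rfl, fun _ _ =>
    zero_mem_bubF0, fun a x hx => ?_⟩
  have : rotFM F f 0 a = 0 := by simp [rotFM, rotF]
  rw [this, sub_zero, ev_sub, ev_bern_res K _ _ hx, ← hc, sub_self]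

/-- Vector-valued face bubbles have arbitrary rotations with vanishing mean. -/
theorem exists_rotF (hk : 7 ≤ k) (hf : f.1 ⊆ K.1) {p : Poly}
    (hp : p ∈ polyF1 F f ((k : ℤ) - 1)) (horth : ipS f.1 p 1 = 0) :
    ∃ w : Fin 2 → Poly, (∀ a, w a ∈ bubF0 K f ((k : ℤ) - 3)) ∧
      ZeroOn K f.1 (p - rotF F f w) := by
  classical
  obtain ⟨N, rfl⟩ : ∃ N, k = N + 2 := ⟨k - 2, by omega⟩
  let S : Submodule ℝ Poly :=
    { carrier := {p | ∃ w : Fin 2 → Poly, (∀ a, w a ∈ bubF0 K f (((N + 2 : ℕ) : ℤ) - 3)) ∧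
        ZeroOn K f.1 (p - rotF F f w)}
      zero_mem' := ⟨0, fun _ => zero_mem_bubF0, by simp [rotF, zeroOn_zero]⟩
      add_mem' := by
        rintro v w ⟨η, hb, hz⟩ ⟨η', hb', hz'⟩
        refine ⟨η + η', fun a => add_mem_bubF0 (hb a) (hb' a), ?_⟩
        convert hz.add hz' using 1
        simp only [rotF, Pi.add_apply, dir_add]
        ring
      smul_mem' := by
        rintro r w ⟨η, hb, hz⟩
        refine ⟨r • η, fun a => ?_, ?_⟩
        · rw [Pi.smul_apply, MvPolynomial.smul_eq_C_mul]
          exact C_mul_mem_bubF0 r (hb a)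
        · convert hz.mul_left (MvPolynomial.C r) using 1
          simp only [rotF, Pi.smul_apply, MvPolynomial.smul_eq_C_mul, dir_C_mul]
          ring }
  change p ∈ S
  by_contra hpS
  obtain ⟨L, hLp, hL⟩ := Submodule.exists_le_ker_of_notMem hpS
  obtain ⟨c, hc⟩ := exists_bern K (d := N + 1) (p := p) (by
    have := hp.1
    push_cast at this ⊢
    convert this using 1; ring_nf)
  have hstep : ∀ l i j : K.1, l ≠ i → l ≠ j → i ≠ j → f.1 = {l.1, i.1, j.1} → ∀ γ : K.1 → ℕ,
      ∑ v, (γ + unit i + unit j) v = N + 1 + 1 →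
      (∀ v : K.1, v.1 ∉ f.1 → (γ + unit i + unit j) v = 0) →
      (∀ v : K.1, v.1 ∈ f.1 → 1 ≤ (γ + unit i + unit j) v) →
      (∀ v, (γ + unit i + unit j) v + 2 ≤ N + 1) →
      L (bmon K (N + 1) (γ + unit i)) = L (bmon K (N + 1) (γ + unit j)) := by
    intro l i j hli hlj hij hfv γ hs h0 hpos hbd
    have hEb : bmon K (N + 2) (γ + unit i + unit j) ∈ bubF0 K f (((N + 2 : ℕ) : ℤ) - 3) :=
      bmon_mem_bubF0 hf hs hpos h0 fun v => by have := hbd v; omega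
    have hd := dir_tangent F hf (w := i.1 - j.1) (isTangent_sub (by rw [hfv]; simp)
      (by rw [hfv]; simp)) (bmon K (N + 2) (γ + unit i + unit j))
    rw [dir_bmon] at hd
    have h1 := hL (x := bmon K (N + 1) (γ + unit j) - bmon K (N + 1) (γ + unit i))
      -- The edge vector turned by a right angle: the rotation of this field is the derivative of
      -- the bubble along the edge, up to cancellation with the first term.
      ⟨![MvPolynomial.C (inner ℝ (F.tf f 1) (i.1 - j.1)) * bmon K (N + 2) (γ + unit i + unit j),
        MvPolynomial.C (-inner ℝ (F.tf f 0) (i.1 - j.1)) * bmon K (N + 2) (γ + unit i + unit j)],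
        fun a => by
          fin_cases a
          exacts [C_mul_mem_bubF0 _ hEb, C_mul_mem_bubF0 _ hEb], by
        rw [hd]
        convert zeroOn_zero using 1
        simp only [rotF, Matrix.cons_val_zero, Matrix.cons_val_one, dir_C_mul]
        simp only [MvPolynomial.C_neg]
        ring⟩
    rw [LinearMap.mem_ker, map_sub, sub_eq_zero] at h1
    exact h1.symm
  obtain ⟨a, b, d, hab, had, hbd, hfv⟩ := face_vertices hf
  obtain ⟨e, t, het⟩ := face_rigid hf (N := N + 1) (by omega)
    -- A single functional is fed into the rigidity lemma three times; the weights `1, 1, -2` make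
    -- the three components sum to zero.
    (fun m β => (if m = d then -2 else 1) * L (bmon K (N + 1) β))
    (by
      intro β _
      rw [sum_sub_triangle hab had hbd hfv, if_neg had, if_neg hbd, if_pos rfl]
      ring)
    (by
      intro l i j hli hlj hij hfv γ hs h0 hpos hbd
      simp only [hstep l i j hli hlj hij hfv γ hs h0 hpos hbd])
  have hma : a ∈ sub K f.1 := mem_sub.mpr (by rw [hfv]; simp)
  have hmb : b ∈ sub K f.1 := mem_sub.mpr (by rw [hfv]; simp)
  have hmd : d ∈ sub K f.1 := mem_sub.mpr (by rw [hfv]; simp)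
  -- The components of `a` and `b` are the same function, and interchanging the entries one and two
  -- forces the slope to be zero. So the functional is a multiple of the mean value.
  have ht : t = 0 := by
    have key : ∀ x y z : ℕ, x + y + z = N + 1 → x + 2 ≤ N + 1 → y + 2 ≤ N + 1 → z + 2 ≤ N + 1 →
        e a + t * x = e b + t * y := by
      intro x y z hs hx hy hz
      have hβa : (x • unit a + y • unit b + z • unit d) a = x := by
        simp [unit_of_ne hab, unit_of_ne had]
      have hβb : (x • unit a + y • unit b + z • unit d) b = y := by
        simp [unit_of_ne hab.symm, unit_of_ne hbd]
      have hβd : (x • unit a + y • unit b + z • unit d) d = z := by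
        simp [unit_of_ne had.symm, unit_of_ne hbd.symm]
      have hβ0 : ∀ v : K.1, v.1 ∉ f.1 → (x • unit a + y • unit b + z • unit d) v = 0 := by
        intro v hv
        rw [hfv] at hv
        simp only [Finset.mem_insert, Finset.mem_singleton, ← Subtype.ext_iff, not_or] at hv
        simp [unit_of_ne hv.1, unit_of_ne hv.2.1, unit_of_ne hv.2.2]
      have h := het (x • unit a + y • unit b + z • unit d) (mem_idx_sub.mpr ⟨by
        simp only [Pi.add_apply, Pi.smul_apply, smul_eq_mul, Finset.sum_add_distrib,
          ← Finset.mul_sum, sum_unit, mul_one, hs], hβ0⟩) (by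
          intro v
          by_cases hv : v.1 ∈ f.1
          · rw [hfv] at hv
            simp only [Finset.mem_insert, Finset.mem_singleton, ← Subtype.ext_iff] at hv
            rcases hv with rfl | rfl | rfl
            exacts [by rwa [hβa], by rwa [hβb], by rwa [hβd]]
          · rw [hβ0 v hv]; omega)
      have h1 := h a hma
      have h2 := h b hmb
      rw [hβa, if_neg had] at h1
      rw [hβb, if_neg hbd] at h2
      rw [← h1, ← h2]
    have h1 := key 1 2 (N - 2) (by omega) (by omega) (by omega) (by omega)
    have h2 := key 2 1 (N - 2) (by omega) (by omega) (by omega) (by omega)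
    push_cast at h1 h2
    linarith
  refine hLp ?_
  have h1 : L p = L (bern K (N + 1) (res K f.1 c)) := by
    rw [← sub_eq_zero, ← map_sub]
    refine hL ⟨0, fun _ => zero_mem_bubF0, fun x hx => ?_⟩
    have : rotF F f 0 = 0 := by simp [rotF]
    rw [this, sub_zero, ev_sub, ev_bern_res K _ _ hx, ← hc, sub_self]
  rw [h1, map_bern_res]
  rw [hc, ipS_bern_eq_zero_iff K hf (face_nonempty f)] at horth
  rw [← mul_zero (e a), ← horth, Finset.mul_sum]
  refine Finset.sum_congr rfl fun β hβ => ?_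
  by_cases hcβ : c β = 0
  · rw [hcβ, zero_mul, mul_zero]
  have := het β hβ (fun v => le_of_polyF1 F hf (c := c) (by
    rw [← hc]; convert hp using 1; push_cast; ring) hβ hcβ v) a hma
  rw [if_neg had, one_mul, ht, zero_mul, add_zero] at this
  rw [this, mul_comm]

end rotSurjective

/-! ## Rigidity on a tetrahedron -/

/-- Unit moves connect all admissible triples of sum `n`. The bounds exclude only the corners, which
occur when `n = N`, and the path to the normal form `(n - 1, 0, 1)` avoids them. -/
theorem const_of_step {f : ℕ → ℕ → ℕ → ℝ} {n N : ℕ} (hn : n ≤ N)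
    (h1 : ∀ a b c, a + b + c + 1 = n → a + 2 ≤ N → b + 2 ≤ N → c + 1 ≤ N →
      f (a + 1) b c = f a (b + 1) c)
    (h2 : ∀ a b c, a + b + c + 1 = n → a + 2 ≤ N → c + 2 ≤ N → b + 1 ≤ N →
      f (a + 1) b c = f a b (c + 1))
    (h3 : ∀ a b c, a + b + c + 1 = n → b + 2 ≤ N → c + 2 ≤ N → a + 1 ≤ N →
      f a (b + 1) c = f a b (c + 1)) {a b c : ℕ} (hs : a + b + c = n) (ha : a + 1 ≤ N)
    (hb : b + 1 ≤ N) (hc : c + 1 ≤ N) : 0 < n → f a b c = f (n - 1) 0 1 := by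
  intro hn0
  have s1 : ∀ b a c, a + b + c = n → 1 ≤ c → f a b c = f (a + b) 0 c := by
    intro b
    induction b with
    | zero => intros; rfl
    | succ b ih =>
      intro a c hs hc
      rw [← h1 a b c (by omega) (by omega) (by omega) (by omega), ih (a + 1) c (by omega) hc]
      congr 1; ring
  have s2 : ∀ c, c + 1 ≤ n → c + 2 ≤ N → f (n - (c + 1)) 0 (c + 1) = f (n - 1) 0 1 := by
    intro c
    induction c with
    | zero => intros; rfl
    | succ c ih =>
      intro hc hc'
      rw [← ih (by omega) (by omega), ← h2 (n - (c + 1 + 1)) 0 (c + 1) (by omega) (by omega) (by omega)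
        (by omega)]
      congr 1; omega
  have s3 : ∀ a b c, a + b + c = n → 1 ≤ c → c + 1 ≤ N → f a b c = f (n - 1) 0 1 := by
    intro a b c hs hc hc'
    rw [s1 b a c hs hc, ← s2 (c - 1) (by omega) (by omega), show c - 1 + 1 = c by omega]
    congr 1; omega
  rcases Nat.eq_zero_or_pos c with rfl | hc'
  · rcases Nat.eq_zero_or_pos a with rfl | ha'
    · obtain ⟨b, rfl⟩ : ∃ b', b = b' + 1 := ⟨b - 1, by omega⟩
      rw [h3 0 b 0 (by omega) (by omega) (by omega) (by omega)]
      exact s3 _ _ _ (by omega) (by omega) (by omega)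
    · obtain ⟨a, rfl⟩ : ∃ a', a = a' + 1 := ⟨a - 1, by omega⟩
      rw [h2 a b 0 (by omega) (by omega) (by omega) (by omega)]
      exact s3 _ _ _ (by omega) (by omega) (by omega)
  · exact s3 a b c hs hc' hc

theorem exists_three {ι : Type*} [Fintype ι] (hι : Fintype.card ι = 4) (m : ι) :
    ∃ i j l : ι, m ≠ i ∧ m ≠ j ∧ m ≠ l ∧ i ≠ j ∧ i ≠ l ∧ j ≠ l ∧
      ∀ v, v = m ∨ v = i ∨ v = j ∨ v = l := by
  classical
  have h : (Finset.univ.erase m : Finset ι).card = 3 := by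
    rw [Finset.card_erase_of_mem (Finset.mem_univ m), Finset.card_univ, hι]
  obtain ⟨i, j, l, hij, hil, hjl, h⟩ := Finset.card_eq_three.mp h
  have hm : ∀ v, v ∈ ({i, j, l} : Finset ι) ↔ v ≠ m := by
    intro v; rw [← h]; simp
  refine ⟨i, j, l, fun h => (hm i).mp (by simp) h.symm, fun h => (hm j).mp (by simp) h.symm,
    fun h => (hm l).mp (by simp) h.symm, hij, hil, hjl, fun v => ?_⟩
  by_cases hv : v = m
  · exact Or.inl hv
  · have := (hm v).mpr hv
    simp only [Finset.mem_insert, Finset.mem_singleton] at this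
    exact Or.inr this

/-- With the entry at `m` fixed, the remaining mass moves freely among the three other vertices. -/
theorem eq_of_mass {ι : Type*} [Fintype ι] (hι : Fintype.card ι = 4) {N : ℕ} (m : ι)
    {q : (ι → ℕ) → ℝ}
    (hstep : ∀ i j, m ≠ i → m ≠ j → i ≠ j → ∀ γ : ι → ℕ, ∑ v, γ v + 1 = N →
      γ i + 2 ≤ N → γ j + 2 ≤ N → (∀ v, γ v + 1 ≤ N) → q (γ + unit i) = q (γ + unit j)) :
    ∃ g : ℕ → ℝ, ∀ β : ι → ℕ, ∑ v, β v = N → (∀ v, β v + 1 ≤ N) → q β = g (β m) := by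
  classical
  obtain ⟨i, j, l, hmi, hmj, hml, hij, hil, hjl, hall⟩ := exists_three hι m
  let τ : ℕ → ℕ → ℕ → ℕ → ι → ℕ := fun x a b c =>
    x • unit m + a • unit i + b • unit j + c • unit l
  have tm : ∀ x a b c, τ x a b c m = x := by
    intro x a b c; simp [τ, unit_of_ne hmi, unit_of_ne hmj, unit_of_ne hml]
  have ti : ∀ x a b c, τ x a b c i = a := by
    intro x a b c; simp [τ, unit_of_ne hmi.symm, unit_of_ne hij, unit_of_ne hil]
  have tj : ∀ x a b c, τ x a b c j = b := by
    intro x a b c; simp [τ, unit_of_ne hmj.symm, unit_of_ne hij.symm, unit_of_ne hjl]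
  have tl : ∀ x a b c, τ x a b c l = c := by
    intro x a b c; simp [τ, unit_of_ne hml.symm, unit_of_ne hil.symm, unit_of_ne hjl.symm]
  have ts : ∀ x a b c, ∑ v, τ x a b c v = x + a + b + c := by
    intro x a b c
    simp only [τ, Pi.add_apply, Pi.smul_apply, smul_eq_mul, Finset.sum_add_distrib,
      ← Finset.mul_sum, sum_unit, mul_one]
  have ui : ∀ x a b c, τ x a b c + unit i = τ x (a + 1) b c := by
    intros; simp only [τ, succ_nsmul]; abel
  have uj : ∀ x a b c, τ x a b c + unit j = τ x a (b + 1) c := by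
    intros; simp only [τ, succ_nsmul]; abel
  have ul : ∀ x a b c, τ x a b c + unit l = τ x a b (c + 1) := by
    intros; simp only [τ, succ_nsmul]; abel
  have tall : ∀ x a b c, x + 1 ≤ N → a + 1 ≤ N → b + 1 ≤ N → c + 1 ≤ N → ∀ v,
      τ x a b c v + 1 ≤ N := by
    intro x a b c hx ha hb hc v
    rcases hall v with rfl | rfl | rfl | rfl
    exacts [by rwa [tm], by rwa [ti], by rwa [tj], by rwa [tl]]
  refine ⟨fun x => q (τ x (N - x - 1) 0 1), fun β hs hb => ?_⟩
  have hβ : β = τ (β m) (β i) (β j) (β l) := by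
    ext v
    rcases hall v with rfl | rfl | rfl | rfl
    exacts [(tm _ _ _ _).symm, (ti _ _ _ _).symm, (tj _ _ _ _).symm, (tl _ _ _ _).symm]
  have hs' : β m + β i + β j + β l = N := by
    rw [← hs]
    conv_rhs => rw [hβ]
    exact (ts _ _ _ _).symm
  have hm := hb m
  conv_lhs => rw [hβ]
  refine const_of_step (f := fun a b c => q (τ (β m) a b c)) (n := N - β m) (N := N) (by omega)
    (fun a b c h ha hb hc => ?_) (fun a b c h ha hc hb => ?_) (fun a b c h hb hc ha => ?_)
    (by omega) (hb i) (hb j) (hb l) (by omega)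
  · have := hstep i j hmi hmj hij (τ (β m) a b c) (by rw [ts]; omega) (by rwa [ti]) (by rwa [tj])
      (tall _ _ _ _ hm (by omega) (by omega) hc)
    rwa [ui, uj] at this
  · have := hstep i l hmi hml hil (τ (β m) a b c) (by rw [ts]; omega) (by rwa [ti]) (by rwa [tl])
      (tall _ _ _ _ hm (by omega) (by omega) (by omega))
    rwa [ui, ul] at this
  · have := hstep j l hmj hml hjl (τ (β m) a b c) (by rw [ts]; omega) (by rwa [tj]) (by rwa [tl])
      (tall _ _ _ _ hm (by omega) (by omega) (by omega))
    rwa [uj, ul] at this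

/-- By `eq_of_mass` each component is a function of its own entry. Moving one unit from one vertex
to another in the zero sum relation equates the increments of two components, so all are affine with
a common slope. -/
theorem rigid_tetrahedron {ι : Type*} [Fintype ι] (hι : Fintype.card ι = 4) {N : ℕ} (hN : 2 ≤ N)
    {q : ι → (ι → ℕ) → ℝ} (hsum : ∀ β : ι → ℕ, ∑ v, β v = N → ∑ m, q m β = 0)
    (hstep : ∀ m i j, m ≠ i → m ≠ j → i ≠ j → ∀ γ : ι → ℕ, ∑ v, γ v + 1 = N →
      γ i + 2 ≤ N → γ j + 2 ≤ N → (∀ v, γ v + 1 ≤ N) → q m (γ + unit i) = q m (γ + unit j)) :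
    ∃ (e : ι → ℝ) (t : ℝ), ∀ β : ι → ℕ, ∑ v, β v = N → (∀ v, β v + 1 ≤ N) →
      ∀ m, q m β = e m + t * β m := by
  classical
  choose g hg using fun m => eq_of_mass hι m (hstep m)
  have hD : ∀ m m', m ≠ m' → ∀ a b, a + 2 ≤ N → b + 2 ≤ N → a + b + 1 ≤ N →
      g m (a + 1) - g m a = g m' (b + 1) - g m' b := by
    intro m m' hmm a b ha hb hab
    obtain ⟨i, j, l, hmi, hmj, hml, hij, hil, hjl, hall⟩ := exists_three hι m
    obtain ⟨l, hlm, hlm'⟩ : ∃ l, l ≠ m ∧ l ≠ m' := by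
      by_cases h : i = m'
      · exact ⟨j, hmj.symm, fun h' => hij (h.trans h'.symm)⟩
      · exact ⟨i, hmi.symm, h⟩
    -- The rest of the mass is parked at a third vertex, where it is the same before and after the
    -- move and cancels.
    set γ : ι → ℕ := a • unit m + b • unit m' + (N - 1 - a - b) • unit l with hγ
    have γm : γ m = a := by simp [hγ, unit_of_ne hmm, unit_of_ne hlm.symm]
    have γm' : γ m' = b := by simp [hγ, unit_of_ne hmm.symm, unit_of_ne hlm'.symm]
    have γl : γ l = N - 1 - a - b := by simp [hγ, unit_of_ne hlm, unit_of_ne hlm']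
    have γ0 : ∀ v, v ≠ m → v ≠ m' → v ≠ l → γ v = 0 := by
      intro v h1 h2 h3; simp [hγ, unit_of_ne h1, unit_of_ne h2, unit_of_ne h3]
    have γs : ∑ v, γ v + 1 = N := by
      simp only [hγ, Pi.add_apply, Pi.smul_apply, smul_eq_mul, Finset.sum_add_distrib,
        ← Finset.mul_sum, sum_unit, mul_one]
      omega
    have γb : ∀ v, γ v + 1 ≤ N := by
      intro v
      by_cases h1 : v = m
      · subst h1; omega
      by_cases h2 : v = m'
      · subst h2; omega
      by_cases h3 : v = l
      · subst h3; omega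
      · rw [γ0 v h1 h2 h3]; omega
    have key : ∀ u, u = m ∨ u = m' → ∑ v, g v ((γ + unit u) v) = 0 := by
      intro u hu
      have h1 : ∑ v, (γ + unit u) v = N := by rw [sum_add_unit, γs]
      rw [← hsum _ h1]
      refine Finset.sum_congr rfl fun v _ => (hg v _ h1 fun w => ?_).symm
      rw [Pi.add_apply]
      by_cases hw : w = u
      · subst hw
        rw [unit_self]
        rcases hu with rfl | rfl <;> omega
      · rw [unit_of_ne hw]
        exact γb w
    have h1 := key m (Or.inl rfl)
    have h2 := key m' (Or.inr rfl)
    have h3 : ∑ v, (g v ((γ + unit m) v) - g v ((γ + unit m') v)) = 0 := by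
      rw [Finset.sum_sub_distrib, h1, h2, sub_zero]
    rw [← Finset.sum_subset (Finset.subset_univ ({m, m'} : Finset ι)), Finset.sum_pair hmm] at h3
    · simp only [Pi.add_apply, unit_self, unit_of_ne hmm, unit_of_ne hmm.symm, γm, γm',
        add_zero] at h3
      linarith
    · intro v _ hv
      simp only [Finset.mem_insert, Finset.mem_singleton, not_or] at hv
      simp only [Pi.add_apply, unit_of_ne hv.1, unit_of_ne hv.2, sub_self]
  have hne : Nonempty ι := Fintype.card_pos_iff.mp (by omega)
  obtain ⟨m₀⟩ := hne
  obtain ⟨m₁, -, -, h01, -⟩ := exists_three hι m₀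
  refine ⟨fun m => g m 0, g m₀ 1 - g m₀ 0, fun β hs hb m => ?_⟩
  have hstep' : ∀ x, x + 2 ≤ N → g m (x + 1) - g m x = g m₀ 1 - g m₀ 0 := by
    intro x hx
    by_cases h : m = m₀
    · subst h
      rw [hD m m₁ h01 x 0 hx (by omega) (by omega), ← hD m m₁ h01 0 0 (by omega) (by omega)
        (by omega)]
    · rw [hD m m₀ h x 0 hx (by omega) (by omega)]
  have hlin : ∀ x, x + 1 ≤ N → g m x = g m 0 + (g m₀ 1 - g m₀ 0) * x := by
    intro x
    induction x with
    | zero => intro _; simp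
    | succ x ih =>
      intro hx
      have h1 := ih (by omega)
      have h2 := hstep' x (by omega)
      push_cast
      linarith
  rw [hg m β hs hb]
  exact hlin _ (hb m)

/-! ## Surjectivity of the divergence on bubbles -/

/-- The divergence as a linear map. -/
noncomputable def divL : Matrix (Fin 3) (Fin 3) Poly →ₗ[ℝ] (Fin 3 → Poly) where
  toFun := div
  map_add' := div_add
  map_smul' := div_smul

section divSurjective

variable (F : Frame T) {K : Cell T} {k : ℕ}

theorem div_smul_cdyad (E : Poly) (a b : E3) :
    div (E • cdyad a b) = fun i => MvPolynomial.C (a i) * dir b E := by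
  funext i
  simp only [div, cdyad, Matrix.smul_apply, Matrix.vecMulVec_apply, cvec, smul_eq_mul, dir,
    Finset.mul_sum]
  refine Finset.sum_congr rfl fun j _ => ?_
  rw [show E * (MvPolynomial.C (a i) * MvPolynomial.C (b j)) =
    MvPolynomial.C (a i) * (MvPolynomial.C (b j) * E) by ring]
  simp only [pd_mul, pd_C]
  ring

theorem bub_pair {i j : K.1} (hij : i ≠ j) : bub K {i.1, j.1} = lam K i * lam K j := by
  classical
  have : sub K {i.1, j.1} = {i, j} := by ext v; simp
  rw [bub_eq_prod, this, Finset.prod_pair hij]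

theorem pair_subset (i j : K.1) : ({i.1, j.1} : Finset E3) ⊆ K.1 := by
  intro x hx
  rw [Finset.mem_insert, Finset.mem_singleton] at hx
  rcases hx with rfl | rfl
  exacts [i.2, j.2]

/-- Since no exponent exceeds `k - 3`, the monomial divided by the coordinates of `i` and `j` is not
a pure power of either of them, so it vanishes at both vertices. -/
theorem bmon_smul_mem_bubDiv (hk : 3 ≤ k) {m i j : K.1} (hmi : m ≠ i) (hmj : m ≠ j) (hij : i ≠ j)
    {α : K.1 → ℕ} (hsum : ∑ v, α v + 1 = k) (hi : 1 ≤ α i) (hj : 1 ≤ α j)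
    (hbd : ∀ v, α v + 3 ≤ k) :
    bmon K (k - 1) α • cdyad (F.nf (opp K m)) (i.1 - j.1) ∈ bubDiv F k K := by
  classical
  obtain ⟨q, hq, hb, hv⟩ := bern_eq_bub_mul K (pair_subset i j) 1 (d := k - 1)
    (c := fun β => if β = α then 1 else 0) (by
      intro β _ hβ v hv
      rw [ne_eq, ite_eq_right_iff, not_forall] at hβ
      rw [hβ.1]
      simp only [Finset.mem_insert, Finset.mem_singleton, ← Subtype.ext_iff] at hv
      rcases hv with rfl | rfl
      exacts [hi, hj])
  have hij' : i.1 ≠ j.1 := fun h => hij (Subtype.ext h)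
  rw [Finset.card_pair hij'] at hq
  rw [bub_pair hij, pow_one] at hb
  have hvan : ∀ p o : K.1, p ≠ o → (∀ v : K.1, v.1 ∈ ({i.1, j.1} : Finset E3) ↔ v = p ∨ v = o) →
      1 ≤ α o → ev q p.1 = 0 := by
    intro p o hpo hmem ho
    refine hv p fun β _ hβ => ?_
    rw [ne_eq, ite_eq_right_iff, not_forall] at hβ
    rw [hβ.1]
    by_contra hcon
    push Not at hcon
    have h1 : α o ≤ 1 := by
      by_contra h
      exact (hcon o hpo.symm fun _ => by omega).1 ((hmem o).mpr (Or.inr rfl))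
    have h2 : ∀ v, v ≠ p → v ≠ o → α v = 0 := by
      intro v hvp hvo
      have hv : v.1 ∉ ({i.1, j.1} : Finset E3) := fun h => by
        rcases (hmem v).mp h with h | h
        exacts [hvp h, hvo h]
      have := (hcon v hvp fun h => absurd h hv).2
      omega
    have h3 : ∑ v, α v = α p + α o := by
      rw [← Finset.sum_subset (Finset.subset_univ ({p, o} : Finset K.1)), Finset.sum_pair hpo]
      intro v _ hv
      simp only [Finset.mem_insert, Finset.mem_singleton, not_or] at hv
      exact h2 v hv.1 hv.2
    have := hbd p
    omega
  refine Submodule.subset_span ⟨m, j, i, q, hij.symm, hmj.symm, hmi.symm, hq.mono (by push_cast; omega),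
    hvan j i hij.symm (fun v => ?_) hi, hvan i j hij (fun v => ?_) hj, ?_⟩
  · simp only [Finset.mem_insert, Finset.mem_singleton, ← Subtype.ext_iff]
    exact or_comm
  · simp only [Finset.mem_insert, Finset.mem_singleton, ← Subtype.ext_iff]
  · rw [bmon, hb, mul_comm (lam K i)]

theorem affComp_single (a : Fin 3) (A : E3) (r : ℝ) : affComp (EuclideanSpace.single a 1) A r =
    MvPolynomial.C (A a) + MvPolynomial.C r * MvPolynomial.X a := by
  simp only [affComp, PiLp.single_apply]
  rw [Finset.sum_eq_single a (fun b _ hb => by simp [hb]) (by simp)]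
  simp

/-- The bubbles have arbitrary divergences orthogonal to `RT`. -/
theorem exists_div (hk : 7 ≤ k) {w : Fin 3 → Poly} (hd : ∀ i, Deg ((k : ℤ) - 2) (w i))
    (hv : ∀ i, VanishAt K.1 (w i)) (horth : ∀ r ∈ RT, ipV K.1 w r = 0) :
    ∃ η ∈ bubDiv F k K, div η = w := by
  classical
  obtain ⟨N, rfl⟩ : ∃ N, k = N + 2 := ⟨k - 2, by omega⟩
  change w ∈ (bubDiv F (N + 2) K).map divL
  by_contra hwS
  obtain ⟨ℓ, hℓw, hℓ⟩ := Submodule.exists_le_ker_of_notMem hwS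
  let L : Fin 3 → Poly →ₗ[ℝ] ℝ := fun a => ℓ ∘ₗ LinearMap.single ℝ (fun _ => Poly) a
  have hL : ∀ v : Fin 3 → Poly, ℓ v = ∑ a, L a (v a) := by
    intro v
    conv_lhs => rw [← Finset.univ_sum_single v]
    rw [map_sum]
    rfl
  have hker : ∀ η ∈ bubDiv F (N + 2) K, ∑ a, L a (div η a) = 0 := fun η hη => by
    rw [← hL]; exact hℓ ⟨η, hη, rfl⟩
  choose c hc using fun a => exists_bern K (d := N) (p := w a) (by
    have := hd a
    push_cast at this
    rwa [add_sub_cancel_right] at this)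
  have hcard : Fintype.card K.1 = 4 := by rw [Fintype.card_coe, K.2.2]
  obtain ⟨e, t, het⟩ := rigid_tetrahedron hcard (N := N) (by omega)
    (q := fun m β => ∑ b, slope K (EuclideanSpace.single b 1) m * L b (bmon K N β))
    (by
      intro β _
      rw [Finset.sum_comm]
      refine Finset.sum_eq_zero fun b _ => ?_
      rw [← Finset.sum_mul, sum_slope, zero_mul])
    (by
      -- The functional is tested with monomials times the normal of the face opposite to `m` and
      -- the edge vector from `j` to `i`. The normal is a multiple of the gradient of the coordinate
      -- of `m`, so this is an invariance of the component `m`.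
      intro m i j hmi hmj hij γ hs hi hj hb
      have hmem := bmon_smul_mem_bubDiv F (k := N + 2) (by omega) hmi hmj hij
        (α := γ + unit i + unit j) (by rw [sum_add_unit, sum_add_unit]; omega)
        (by simp only [Pi.add_apply, unit_self]; omega) (by simp) (fun v => by
          simp only [Pi.add_apply]
          by_cases h1 : v = i
          · subst h1; rw [unit_self, unit_of_ne hij]; omega
          by_cases h2 : v = j
          · subst h2; rw [unit_self, unit_of_ne hij.symm]; omega
          · rw [unit_of_ne h1, unit_of_ne h2]; have := hb v; omega)
      have h1 := hker _ hmem
      obtain ⟨h, h0, hsl⟩ := exists_height F K m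
      have hn : ∀ a, F.nf (opp K m) a = h * slope K (EuclideanSpace.single a 1) m := by
        intro a
        rw [hsl, EuclideanSpace.inner_single_right]
        simp
      simp only [div_smul_cdyad, show N + 2 - 1 = N + 1 from rfl, dir_bmon] at h1
      simp only [← MvPolynomial.smul_eq_C_mul, map_smul, map_sub, smul_eq_mul, hn] at h1
      have h2 : h * (∑ b, slope K (EuclideanSpace.single b 1) m * L b (bmon K N (γ + unit j)) -
          ∑ b, slope K (EuclideanSpace.single b 1) m * L b (bmon K N (γ + unit i))) = 0 := by
        rw [← h1, ← Finset.sum_sub_distrib, Finset.mul_sum]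
        exact Finset.sum_congr rfl fun b _ => by ring
      rw [mul_eq_zero, or_iff_right h0, sub_eq_zero] at h2
      exact h2.symm)
  have hτ : Orthonormal ℝ fun a : Fin 3 => (EuclideanSpace.single a 1 : E3) :=
    EuclideanSpace.orthonormal_single
  have hfin := moment_eq_zero K subset_rfl (cell_nonempty K) hτ (fun _ => isTangent_cell _ _)
    (c := c) L e t
    (by
      rintro β hβ ⟨a, ha⟩ m hm
      rw [mem_idx_sub] at hβ
      refine het β hβ.1 (fun v => ?_) m
      -- The multi-indices not reached by the rigidity lemma are the corners, where the coefficients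
      -- are vertex values of `w` and thus zero.
      by_contra h
      have hv' : β = N • unit v := by
        have hsum : ∑ w, β w = β v + ∑ w ∈ Finset.univ.erase v, β w :=
          (Finset.add_sum_erase _ _ (Finset.mem_univ v)).symm
        have hβs := hβ.1
        have h0 : ∑ w ∈ Finset.univ.erase v, β w = 0 := by omega
        rw [Finset.sum_eq_zero_iff] at h0
        ext w
        by_cases hw : w = v
        · subst hw
          simp; omega
        · simp [unit_of_ne hw, h0 w (Finset.mem_erase.mpr ⟨hw, Finset.mem_univ _⟩)]
      rw [hv'] at ha
      refine ha (ev_bern_vertex K N (c a) v ?_)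
      rw [← hc a]
      exact hv a v.1 v.2)
    (by
      intro A r
      rw [← horth (fun i => MvPolynomial.C (A i) + MvPolynomial.C r * MvPolynomial.X i)
        ⟨A, r, rfl⟩]
      simp only [affComp_single, ← hc]
      rfl)
  refine hℓw ?_
  rw [hL, ← hfin]
  refine Finset.sum_congr rfl fun a _ => ?_
  congr 1
  rw [hc a]
  refine bern_congr K fun α _ => (res_of_mem fun v hv => absurd v.2 hv).symm

end divSurjective

/-! ## Derivatives of bubbles -/

theorem VanishOrd.prod {ι : Type*} {x : E3} {t : Finset ι} {g : ι → Poly}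
    (h : ∀ u ∈ t, ev (g u) x = 0) : VanishOrd x t.card (∏ u ∈ t, g u) := by
  classical
  induction t using Finset.induction_on with
  | empty => trivial
  | insert a t ha ih =>
    rw [Finset.prod_insert ha, Finset.card_insert_of_notMem ha, add_comm]
    exact VanishOrd.mul (m := 1) ⟨h a (Finset.mem_insert_self _ _), fun _ => trivial⟩
      (ih fun u hu => h u (Finset.mem_insert_of_mem hu))

/-- At a vertex all factors but at most one vanish. -/
theorem vanishOrd_bub {K : Cell T} {s : Finset E3} (hs : s ⊆ K.1) (v : K.1) :
    VanishOrd v.1 (s.card - 1) (bub K s) := by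
  classical
  have key : ∀ t : Finset K.1, v ∉ t → VanishOrd v.1 t.card (∏ u ∈ t, lam K u) := fun t hv =>
    VanishOrd.prod fun u hu => by
      rw [ev_lam_vertex, if_neg fun h : u = v => hv (h ▸ hu)]
  rw [bub_eq_prod, ← card_sub K hs]
  by_cases hv : v ∈ sub K s
  · rw [← Finset.mul_prod_erase _ _ hv, ← Finset.card_erase_of_mem hv]
    have := VanishOrd.mul (m := 0) (p := lam K v) trivial (key _ (Finset.notMem_erase v (sub K s)))
    rwa [zero_add] at this
  · exact (key _ hv).mono (Nat.sub_le _ _)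

theorem dir_bub_pow (K : Cell T) (s : Finset E3) (m : ℕ) (q : Poly) (w : E3) :
    dir w (bub K s ^ (m + 1) * q) =
      bub K s ^ m * ((m + 1 : ℕ) • (dir w (bub K s) * q) + bub K s * dir w q) := by
  rw [dir_mul, dir_pow_succ, nsmul_eq_mul]
  push_cast
  ring

theorem deg_dir_bub_pow {K : Cell T} {s : Finset E3} (hs : s ⊆ K.1) (m : ℕ) {q : Poly} {d : ℤ}
    (hq : Deg d q) (w : E3) :
    Deg (d + s.card - 1) ((m + 1 : ℕ) • (dir w (bub K s) * q) + bub K s * dir w q) := by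
  have hb := deg_bub K hs
  rw [nsmul_eq_mul, ← map_natCast (MvPolynomial.C : ℝ →+* Poly)]
  exact ((((hb.dir w).mul hq).C_mul _).mono (by linarith)).add
    ((hb.mul (hq.dir w)).mono (by linarith))

/-- One bubble factor survives the derivative, and the cofactor vanishes at the vertices because the
face bubble has double zeros there. Thus gradients of bubbles are admissible test functions, as
`harm_transfer` requires. -/
theorem dir_bub_sq_mem_bubF0 {K : Cell T} {f : Face T} (hf : f.1 ⊆ K.1) {q : Poly} {d e : ℤ}
    (hq : Deg d q) (he : d + 2 ≤ e) (w : E3) : dir w (bub K f.1 ^ 2 * q) ∈ bubF0 K f e := by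
  refine ⟨_, (deg_dir_bub_pow hf 1 hq w).mono ?_, fun x hx => ?_, by
    rw [dir_bub_pow, pow_one]⟩
  · rw [f.2.2]; push_cast; linarith
  · have h := vanishOrd_bub hf ⟨x, hf hx⟩
    rw [f.2.2] at h
    have h1 := (h.dir (m := 1) w).1
    have h2 := h.1
    rw [nsmul_eq_mul, ev_add, ev_mul, ev_mul, ev_mul, h1, h2]
    ring

theorem dir_dir_bub_cube_mem_bubF0 {K : Cell T} {f : Face T} (hf : f.1 ⊆ K.1) {q : Poly} {d e : ℤ}
    (hq : Deg d q) (he : d + 4 ≤ e) (v w : E3) :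
    dir v (dir w (bub K f.1 ^ 3 * q)) ∈ bubF0 K f e := by
  rw [dir_bub_pow]
  refine dir_bub_sq_mem_bubF0 hf (deg_dir_bub_pow hf 2 hq w) ?_ v
  rw [f.2.2]; push_cast; linarith

/-- Hessians of interior bubbles are bubbles for `H(curl)`. -/
theorem hess_mem_bubCurl (F : Frame T) {k : ℕ} (hk : 4 ≤ k) {K : Cell T} {p : Poly}
    (hp : p ∈ bubP K K.1 2 ((k : ℤ) - 6)) : hess p ∈ bubCurl F k K := by
  obtain ⟨q, hq, rfl⟩ := hp
  have hb := deg_bub K subset_rfl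
  rw [K.2.2] at hb
  refine mem_bubCurl F hk (hess_isSymm _) (fun i j => ?_) (fun x hx i j => ?_) fun i t ht a => ?_
  · exact (Deg.hess ((hb.pow 2).mul hq) i j).mono (by push_cast; linarith)
  · have h := vanishOrd_bub subset_rfl (⟨x, hx⟩ : K.1)
    rw [K.2.2] at h
    have h1 : VanishOrd x (2 * 3 + 0) (bub K K.1 ^ 2 * q) := (h.pow 2).mul trivial
    have h2 : VanishOrd x 4 (hess (bub K K.1 ^ 2 * q) i j) := (h1.2 j).2 i
    exact h2.mono (by norm_num)
  · rw [comp_hess, dir_comm]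
    refine dir_vanish K (opp_subset K i) (opp_nonempty K i) (fun x hx => ?_) ht
    rw [dir_bub_pow, ev_mul, pow_one, ev_bub_eq_zero i.2 (mem_planeOf_opp.mp hx), zero_mul]

/-! ## The curl and the degrees of freedom -/

section curlRest

variable (F : Frame T) {K : Cell T} {k : ℕ} {σ : Matrix (Fin 3) (Fin 3) Poly}

theorem sub_mem_bubF0 {f : Face T} {d : ℤ} {p q : Poly} (hp : p ∈ bubF0 K f d)
    (hq : q ∈ bubF0 K f d) : p - q ∈ bubF0 K f d := by
  have := add_mem_bubF0 hp (C_mul_mem_bubF0 (-1) hq)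
  rwa [MvPolynomial.C_neg, MvPolynomial.C_1, neg_one_mul, ← sub_eq_add_neg] at this

theorem rotF_sub (f : Face T) (v w : Fin 2 → Poly) :
    rotF F f (v - w) = rotF F f v - rotF F f w := by
  simp only [rotF, Pi.sub_apply, dir_sub]; ring

/-- The projection term is removed by `harm_transfer`: face Hessians of bubbles are admissible test
matrices and have no rotation. -/
theorem RestSigma.ipV_rotFM (hr : RestSigma F k K σ) {f : Face T} (hf : f.1 ⊆ K.1)
    {η : Matrix (Fin 2) (Fin 2) Poly} (hη : η.IsSymm)
    (hb : ∀ a b, η a b ∈ bubF0 K f ((k : ℤ) - 3)) :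
    ipV f.1 (rotFM F f (tanM F f σ)) (rotFM F f η) = 0 := by
  refine harm_transfer (isIP_ipM hf (face_nonempty f))
    (isFinSub_hessF (K := K) F f ((k : ℤ) - 7)) (σ := tanM F f σ)
    (B := {η | η.IsSymm ∧ ∀ a b, η a b ∈ bubF0 K f ((k : ℤ) - 3)})
    (b := fun η => ipV f.1 (rotFM F f (tanM F f σ)) (rotFM F f η))
    (fun η hη => hr.face_tt f hf η hη.1 hη.2) ?_ ?_ η ⟨hη, hb⟩
  · rintro η ⟨hη, hb⟩ _ ⟨_, ⟨q, hq, rfl⟩, rfl⟩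
    refine ⟨hη.sub (Matrix.IsSymm.ext fun a b => dir_comm _ _ _), fun a b => ?_⟩
    exact sub_mem_bubF0 (hb a b) (dir_dir_bub_cube_mem_bubF0 hf hq (by linarith) _ _)
  · rintro η - _ ⟨p, -, rfl⟩
    have : rotFM F f (η - hessF F f p) = rotFM F f η := by
      funext a
      have h1 := congrFun (rotFM_hessF F f p) a
      rw [rotFM] at h1
      rw [rotFM, rotFM]
      exact (rotF_sub F f _ _).trans (by rw [h1]; simp)
    simp only [this]

theorem RestSigma.ipS_rotF (hr : RestSigma F k K σ) {f : Face T} (hf : f.1 ⊆ K.1)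
    {w : Fin 2 → Poly} (hb : ∀ a, w a ∈ bubF0 K f ((k : ℤ) - 3)) :
    ipS f.1 (rotF F f (tanV F f (σ.mulVec (cvec (F.nf f))))) (rotF F f w) = 0 := by
  refine harm_transfer (isIP_ipV hf (face_nonempty f))
    (isFinSub_gradF (K := K) F f ((k : ℤ) - 5)) (σ := tanV F f (σ.mulVec (cvec (F.nf f))))
    (B := {w | ∀ a, w a ∈ bubF0 K f ((k : ℤ) - 3)})
    (b := fun w => ipS f.1 (rotF F f (tanV F f (σ.mulVec (cvec (F.nf f))))) (rotF F f w))
    (fun w hw => hr.face_nt f hf w hw) ?_ ?_ w hb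
  · rintro η hb _ ⟨_, ⟨q, hq, rfl⟩, rfl⟩ a
    exact sub_mem_bubF0 (hb a) (dir_bub_sq_mem_bubF0 hf hq (by linarith) _)
  · rintro η - _ ⟨p, -, rfl⟩
    have : rotF F f (η - gradF F f p) = rotF F f η := by
      rw [rotF_sub, rotF_gradF, sub_zero]
    simp only [this]

/-- The same removal of the projection term on the cell, with Hessians of interior bubbles. -/
theorem RestSigma.ipM_curl (hk : 4 ≤ k) (hr : RestSigma F k K σ)
    {η : Matrix (Fin 3) (Fin 3) Poly} (hη : η ∈ bubCurl F k K) :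
    ipM K.1 (curl σ) (curl η) = 0 := by
  refine harm_transfer (isIP_ipM subset_rfl (cell_nonempty K)) (isFinSub_hess ((k : ℤ) - 6))
    (σ := σ) (B := bubCurl F k K) (b := fun η => ipM K.1 (curl σ) (curl η))
    (fun η hη => hr.cell η hη) ?_ ?_ η hη
  · rintro η hη _ ⟨p, hp, rfl⟩
    exact Submodule.sub_mem _ hη (hess_mem_bubCurl F hk hp)
  · rintro η - _ ⟨p, -, rfl⟩
    simp only [curl_sub, curl_hess, sub_zero]

theorem RestSigma.vertex_curl (hr : RestSigma F k K σ) : ∀ x ∈ K.1, ∀ α : Fin 3 → ℕ,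
    ∑ i, α i ≤ 1 → ∀ i j, ev (dAlpha α (curl σ i j)) x = 0 := by
  intro x hx α hα i j
  refine (vanishOrd_iff (m := 1)).mp ?_ α hα
  rw [curl_apply]
  exact ((hr.vanishOrd F hx _ _).2 _).sub ((hr.vanishOrd F hx _ _).2 _)

/-- The tangential part of `(curl σ) n` is, up to sign, the rotation of the tangential part of `σ`,
and by `exists_rotFM` the test function is the rotation of a bubble. -/
theorem RestSigma.face_nt_curl (hk : 7 ≤ k) (hr : RestSigma F k K σ) {f : Face T}
    (hf : f.1 ⊆ K.1) {w : Fin 2 → Poly} (hw : ∀ a, w a ∈ polyF1 F f ((k : ℤ) - 1))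
    (horth : ∀ r ∈ RTf F f, ipV f.1 w r = 0) :
    ipV f.1 (tanV F f ((curl σ).mulVec (cvec (F.nf f)))) w = 0 := by
  obtain ⟨η, hη, hb, hz⟩ := exists_rotFM F hk hf hw horth
  obtain ⟨γ, -, hγ⟩ := exists_comp_curl F f
  have h := hr.ipV_rotFM F hf hη hb
  have h1 : tanV F f ((curl σ).mulVec (cvec (F.nf f))) = γ • rotFM F f (tanM F f σ) := by
    funext a
    rw [tanV_mulVec, hγ, Pi.smul_apply, MvPolynomial.smul_eq_C_mul]
    rfl
  rw [h1, (isIP_ipV hf (face_nonempty f)).smul_left, ipV_congr hf (fun _ _ _ => rfl)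
    (fun i => zeroOn_sub_iff.mp (hz i)), h, mul_zero]

/-- As for the tangential part, with `exists_rotF`. Symmetry is needed to exchange the
normal-tangential components with the tangential-normal ones. -/
theorem RestSigma.face_nn_curl (hk : 7 ≤ k) (hr : RestSigma F k K σ) (hs : σ.IsSymm) {f : Face T}
    (hf : f.1 ⊆ K.1) {p : Poly} (hp : p ∈ polyF1 F f ((k : ℤ) - 1)) (horth : ipS f.1 p 1 = 0) :
    ipS f.1 (comp (F.nf f) (curl σ) (F.nf f)) p = 0 := by
  obtain ⟨w, hb, hz⟩ := exists_rotF F hk hf hp horth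
  obtain ⟨γ, -, hγ⟩ := exists_comp_curl F f
  have h := hr.ipS_rotF F hf hb
  have h1 : comp (F.nf f) (curl σ) (F.nf f) =
      γ • rotF F f (tanV F f (σ.mulVec (cvec (F.nf f)))) := by
    rw [hγ, MvPolynomial.smul_eq_C_mul]
    congr 2
    funext j
    rw [tanV_mulVec, comp_symm _ _ hs]
  rw [h1, ipS_smul_left, ipS_congr K hf (fun _ _ => rfl) (zeroOn_sub_iff.mp hz), h, mul_zero]

/-- The divergence term is zero, and the projection term is zero by the orthogonality to curls of
bubbles. -/
theorem RestSigma.cell_curl (hk : 4 ≤ k) (hr : RestSigma F k K σ)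
    (η : Matrix (Fin 3) (Fin 3) Poly) : harmDiv F k K (curl σ) η = 0 := by
  have h := isIP_ipM (ι := Fin 3) (subset_refl K.1) (cell_nonempty K)
  rw [harmDiv, ip_proj_of_orthogonal h, div_curl,
    (isIP_ipV subset_rfl (cell_nonempty K)).zero_left, add_zero]
  rintro _ ⟨η, hη, rfl⟩
  exact hr.ipM_curl F hk hη

/-- The curl maps the kernel of the remaining degrees of freedom to the corresponding kernel. -/
theorem RestSigma.restV (hk : 7 ≤ k) (hr : RestSigma F k K σ) (hs : σ.IsSymm) :
    RestV F k K (curl σ) where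
  vertex := hr.vertex_curl F
  face_nt _ hf _ hw horth := hr.face_nt_curl F hk hf hw horth
  face_nn _ hf _ hp horth := hr.face_nn_curl F hk hs hf hp horth
  cell η _ := hr.cell_curl F (by omega) η

end curlRest

/-! ## Characterization of the bubbles for `H(div)` -/

section bubDivChar

variable (F : Frame T) {K : Cell T} {k : ℕ}

/-- The gradient of a barycentric coordinate. -/
noncomputable def gradLam (K : Cell T) (m : K.1) : Fin 3 → ℝ :=
  fun a => slope K (EuclideanSpace.single a 1) m

theorem slope_eq_sum (K : Cell T) (w : E3) (m : K.1) : slope K w m = ∑ a, gradLam K m a * w a := by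
  have h : w = ∑ a, w a • EuclideanSpace.single a (1 : ℝ) := by
    ext b
    simp [Fin.sum_univ_three]
    fin_cases b <;> simp
  conv_lhs => rw [h]
  simp only [Fin.sum_univ_three, slope_add, slope_smul, gradLam]
  ring

theorem sum_gradLam (K : Cell T) (a : Fin 3) : ∑ m, gradLam K m a = 0 := sum_slope K _

theorem sum_gradLam_mul (K : Cell T) (a b : Fin 3) :
    ∑ m, gradLam K m a * m.1 b = if b = a then 1 else 0 := by
  have h := congrArg (fun w : E3 => w b) (sum_slope_smul K (EuclideanSpace.single a 1))
  simpa [gradLam, PiLp.single_apply] using h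

theorem exists_nf_eq (m : K.1) : ∃ h : ℝ, h ≠ 0 ∧ ∀ a, F.nf (opp K m) a = h * gradLam K m a := by
  obtain ⟨h, h0, hsl⟩ := exists_height F K m
  refine ⟨h, h0, fun a => ?_⟩
  rw [gradLam, hsl, EuclideanSpace.inner_single_right]
  simp

/-- The matrix `∇λₘ xᵢᵀ`. -/
noncomputable def gradDyad (K : Cell T) (m i : K.1) : Matrix (Fin 3) (Fin 3) ℝ :=
  Matrix.vecMulVec (gradLam K m) fun b => i.1 b

theorem sum_gradDyad (K : Cell T) (i : K.1) : ∑ m, gradDyad K m i = 0 := by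
  ext a b
  simp only [Matrix.sum_apply, gradDyad, Matrix.vecMulVec_apply, ← Finset.sum_mul, sum_gradLam,
    zero_mul, Matrix.zero_apply]

/-- The identity matrix is `∑ ∇λₘ xₘᵀ`, inserted here on both sides of `M`. -/
theorem eq_sum_gradDyad (K : Cell T) (M : Matrix (Fin 3) (Fin 3) ℝ) :
    M = ∑ m, ∑ l, (∑ c, ∑ d, m.1 c * M c d * gradLam K l d) • gradDyad K m l := by
  ext a b
  simp only [Matrix.sum_apply, Matrix.smul_apply, gradDyad, Matrix.vecMulVec_apply, smul_eq_mul]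
  have h1 : ∀ m l : K.1, (∑ c, ∑ d, m.1 c * M c d * gradLam K l d) *
      (gradLam K m a * l.1 b) =
      ∑ c, ∑ d, (gradLam K m a * m.1 c) * (M c d * (gradLam K l d * l.1 b)) := by
    intro m l
    simp only [Finset.sum_mul]
    exact Finset.sum_congr rfl fun c _ => Finset.sum_congr rfl fun d _ => by ring
  simp only [h1]
  have h2 : ∀ m : K.1, ∑ l : K.1, ∑ c, ∑ d, (gradLam K m a * m.1 c) *
      (M c d * (gradLam K l d * l.1 b)) = ∑ c, (gradLam K m a * m.1 c) * M c b := by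
    intro m
    rw [Finset.sum_comm]
    refine Finset.sum_congr rfl fun c _ => ?_
    rw [Finset.sum_comm]
    simp only [← Finset.mul_sum, sum_gradLam_mul]
    simp
  simp only [h2]
  rw [Finset.sum_comm]
  simp only [← Finset.sum_mul, sum_gradLam_mul]
  simp

theorem trace_gradDyad (K : Cell T) (m l : K.1) :
    (gradDyad K m l).trace = (if m = l then 1 else 0) - ev (lam K m) 0 := by
  classical
  have h1 := slope_eq_sum K l.1 m
  have h2 : (gradDyad K m l).trace = slope K l.1 m := by
    rw [h1]; rfl
  have h3 : ev (lam K m) l.1 = slope K l.1 m + ev (lam K m) 0 := by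
    have := ev_lam_add K m 0 l.1
    rw [zero_add] at this
    linarith
  rw [h2, eq_sub_iff_add_eq, ← h3, ev_lam_vertex]

/-- A space of matrices that contains the dyads of a normal of a face and a tangent of an edge of
that face, for the edges of a simplex, contains all traceless matrices that annihilate the normals
of the faces which contain the simplex. -/
theorem mem_of_dyads {G : Submodule ℝ (Matrix (Fin 3) (Fin 3) ℝ)} {S : Finset K.1}
    (hS : 2 ≤ S.card)
    (hG : ∀ m i j, i ∈ S → j ∈ S → m ≠ i → m ≠ j → i ≠ j →
      gradDyad K m i - gradDyad K m j ∈ G) {M : Matrix (Fin 3) (Fin 3) ℝ} (ht : M.trace = 0)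
    (h0 : ∀ l, l ∉ S → ∀ c, ∑ d, M c d * gradLam K l d = 0) : M ∈ G := by
  classical
  set A : K.1 → K.1 → ℝ := fun m l => ∑ c, ∑ d, m.1 c * M c d * gradLam K l d with hA
  have hM : M = ∑ m, ∑ l, A m l • gradDyad K m l := eq_sum_gradDyad K M
  have hA0 : ∀ m l, l ∉ S → A m l = 0 := by
    intro m l hl
    simp only [hA, mul_assoc, ← Finset.mul_sum, h0 l hl, mul_zero, Finset.sum_const_zero]
  have hAsum : ∀ m, ∑ l, A m l = 0 := by
    intro m
    simp only [hA]
    rw [Finset.sum_comm]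
    refine Finset.sum_eq_zero fun c _ => ?_
    rw [Finset.sum_comm]
    refine Finset.sum_eq_zero fun d _ => ?_
    rw [← Finset.mul_sum, sum_gradLam, mul_zero]
  have hAtr : ∑ l, A l l = 0 := by
    have h1 := ht
    rw [hM, Matrix.trace_sum] at h1
    simp only [Matrix.trace_sum, Matrix.trace_smul, trace_gradDyad, smul_eq_mul, mul_sub,
      Finset.sum_sub_distrib, ← Finset.sum_mul, hAsum, zero_mul, sub_zero, mul_ite, mul_one,
      mul_zero, Finset.sum_ite_eq, Finset.mem_univ, if_true] at h1
    exact h1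
  -- A reference vertex for each `m`. Dyads with the same `m` are compared with the one at its
  -- reference vertex.
  have hs : ∀ m, ∃ s ∈ S, s ≠ m := fun m => by
    obtain ⟨x, hx, hxm⟩ := Finset.exists_mem_ne (by omega : 1 < S.card) m
    exact ⟨x, hx, hxm⟩
  choose s hsS hsm using hs
  set d : K.1 → Matrix (Fin 3) (Fin 3) ℝ := fun m => gradDyad K m (s m) with hd
  have hoff : ∀ m l, l ∈ S → m ≠ l → gradDyad K m l - d m ∈ G := by
    intro m l hl hml
    by_cases h : l = s m
    · rw [hd, h, sub_self]; exact G.zero_mem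
    · exact hG m l (s m) hl (hsS m) hml (hsm m).symm h
  -- The diagonal dyads are not given as differences; they are expressed by the off-diagonal ones
  -- through `∑ ∇λₘ = 0`.
  have hdiag : ∀ l, l ∈ S → gradDyad K l l - d l + ∑ m, d m ∈ G := by
    intro l hl
    have h1 : gradDyad K l l - d l + ∑ m, d m =
        -∑ m ∈ Finset.univ.erase l, (gradDyad K m l - d m) := by
      have h2 := sum_gradDyad K l
      rw [← Finset.add_sum_erase _ _ (Finset.mem_univ l)] at h2
      rw [← Finset.add_sum_erase _ d (Finset.mem_univ l), Finset.sum_sub_distrib,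
        eq_neg_of_add_eq_zero_left h2]
      abel
    rw [h1]
    exact G.neg_mem (G.sum_mem fun m hm => hoff m l hl (Finset.ne_of_mem_erase hm))
  -- The row sums of the coefficients vanish and so does their trace, hence the reference terms can
  -- be inserted without changing the sum.
  have hfin : M = ∑ m, ∑ l, A m l •
      (gradDyad K m l - d m + if m = l then ∑ m, d m else 0) := by
    simp only [smul_add, smul_sub, Finset.sum_add_distrib, Finset.sum_sub_distrib,
      ← Finset.sum_smul, hAsum, zero_smul, sub_zero, smul_ite, smul_zero,
      Finset.sum_ite_eq, Finset.mem_univ, if_true, hAtr, add_zero]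
    exact hM
  rw [hfin]
  refine G.sum_mem fun m _ => G.sum_mem fun l _ => ?_
  by_cases hl : l ∈ S
  · refine G.smul_mem _ ?_
    split_ifs with h
    · subst h; exact hdiag m hl
    · rw [add_zero]; exact hoff m l hl h
  · rw [hA0 m l hl, zero_smul]; exact G.zero_mem

/-- The normal components of a matrix field vanish on the faces of `K`. -/
def NormalZero (F : Frame T) (K : Cell T) (v : Matrix (Fin 3) (Fin 3) Poly) : Prop :=
  ∀ i : K.1, ∀ a, ZeroOn K (opp K i).1 (comp a v (F.nf (opp K i)))

/-- Each Bernstein coefficient is a traceless matrix that kills the normals of the faces on which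
its monomial survives. By `mem_of_dyads` it is a combination of dyads of a face normal and an edge
vector between two vertices with positive exponents, and each such term is a generator. -/
theorem mem_bubDiv (hk : 3 ≤ k) {v : Matrix (Fin 3) (Fin 3) Poly} (ht : v.trace = 0)
    (hd : ∀ i j, Deg ((k : ℤ) - 1) (v i j)) (hv : ∀ x ∈ K.1, ∀ i j, VanishOrd x 2 (v i j))
    (hn : NormalZero F K v) : v ∈ bubDiv F k K := by
  classical
  choose c hc using fun i j => exists_bern K (d := k - 1) (p := v i j) (by
    have := hd i j
    rwa [Nat.cast_sub (by omega), Nat.cast_one])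
  have hvm : v = Matrix.of fun i j => bern K (k - 1) (c i j) := by
    ext1 i j; exact hc i j
  have hsum : v = ∑ α ∈ idx Finset.univ (k - 1),
      bmon K (k - 1) α • (Matrix.of fun i j => c i j α).map MvPolynomial.C := by
    ext1 i j
    rw [hc, bern_eq_sum_bmon, Matrix.sum_apply]
    refine Finset.sum_congr rfl fun α _ => ?_
    rw [Matrix.smul_apply, Matrix.map_apply, Matrix.of_apply, MvPolynomial.smul_eq_C_mul,
      smul_eq_mul, mul_comm]
  rw [hsum]
  refine Submodule.sum_mem _ fun α hα => ?_
  rw [mem_idx_univ] at hα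
  by_cases hall : ∀ i j, c i j α = 0
  · have : (Matrix.of fun i j => c i j α).map (MvPolynomial.C : ℝ →+* Poly) = 0 := by
      ext1 i j; simp [hall]
    rw [this, smul_zero]
    exact Submodule.zero_mem _
  push Not at hall
  obtain ⟨i₀, j₀, hij⟩ := hall
  -- The double zeros at the vertices exclude the larger exponents in degree `k - 1`. This also
  -- makes at least two exponents positive.
  have hbd : ∀ p, α p + 3 ≤ k := by
    intro p
    by_contra h
    refine hij (coeff_eq_zero_of_vanishOrd K p (m := 2) ?_ α hα (by omega))
    rw [← hc]
    exact hv p.1 p.2 _ _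
  let G : Submodule ℝ (Matrix (Fin 3) (Fin 3) ℝ) :=
    { carrier := {M | bmon K (k - 1) α • M.map (MvPolynomial.C : ℝ →+* Poly) ∈ bubDiv F k K}
      zero_mem' := by
        have : (0 : Matrix (Fin 3) (Fin 3) ℝ).map (MvPolynomial.C : ℝ →+* Poly) = 0 := by
          ext1; simp
        rw [Set.mem_ofPred_eq, this, smul_zero]
        exact Submodule.zero_mem _
      add_mem' := by
        intro M N hM hN
        have : (M + N).map (MvPolynomial.C : ℝ →+* Poly) = M.map MvPolynomial.C +
            N.map MvPolynomial.C := by ext1; simp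
        rw [Set.mem_ofPred_eq, this, smul_add]
        exact Submodule.add_mem _ hM hN
      smul_mem' := by
        intro r M hM
        have : bmon K (k - 1) α • (r • M).map (MvPolynomial.C : ℝ →+* Poly) =
            r • (bmon K (k - 1) α • M.map (MvPolynomial.C : ℝ →+* Poly)) := by
          ext1 i j
          simp only [Matrix.smul_apply, Matrix.map_apply, smul_eq_mul, MvPolynomial.smul_eq_C_mul,
            MvPolynomial.C_mul]
          ring
        rw [Set.mem_ofPred_eq, this]
        exact Submodule.smul_mem _ _ hM }
  change (Matrix.of fun i j => c i j α) ∈ G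
  refine mem_of_dyads (S := Finset.univ.filter fun l => α l ≠ 0) ?_ ?_ ?_ ?_
  · by_contra hcard
    obtain ⟨p, hp⟩ : ∃ p, ∀ q, q ≠ p → α q = 0 := by
      have : Nonempty K.1 := (cell_nonempty K).coe_sort
      obtain ⟨p, hp⟩ := Finset.card_le_one_iff_subset_singleton.mp (by omega :
        (Finset.univ.filter fun l : K.1 => α l ≠ 0).card ≤ 1)
      refine ⟨p, fun q hq => ?_⟩
      by_contra h
      have := hp (Finset.mem_filter.mpr ⟨Finset.mem_univ q, h⟩)
      exact hq (Finset.mem_singleton.mp this)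
    have h1 := Finset.sum_eq_single (f := α) (s := Finset.univ) p (fun q _ hq => hp q hq) (by simp)
    have := hbd p
    omega
  · intro m i j hi hj hmi hmj hij
    rw [Finset.mem_filter] at hi hj
    obtain ⟨h, h0, hnf⟩ := exists_nf_eq F m
    have hmem := bmon_smul_mem_bubDiv F (by omega) hmi hmj hij (by omega : ∑ v, α v + 1 = k)
      (Nat.one_le_iff_ne_zero.mpr hi.2) (Nat.one_le_iff_ne_zero.mpr hj.2) hbd
    have h2 : cdyad (F.nf (opp K m)) (i.1 - j.1) =
        (h • (gradDyad K m i - gradDyad K m j)).map (MvPolynomial.C : ℝ →+* Poly) := by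
      ext1 a b
      simp only [cdyad, cvec, Matrix.vecMulVec_apply, gradDyad, Matrix.map_apply, hnf,
        Matrix.smul_apply, Matrix.sub_apply, smul_eq_mul, ← MvPolynomial.C_mul]
      congr 1
      rw [PiLp.sub_apply]; ring
    rw [h2] at hmem
    have h3 : h • (gradDyad K m i - gradDyad K m j) ∈ G := hmem
    rwa [G.smul_mem_iff h0] at h3
  · have h1 : bern K (k - 1) (∑ i, c i i) = bern K (k - 1) 0 := by
      rw [bern_sum, bern_zero, ← ht, Matrix.trace]
      exact Finset.sum_congr rfl fun i _ => (hc i i).symm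
    have := bern_injective K h1 hα
    rw [Finset.sum_apply] at this
    exact this
  · intro l hl a
    rw [Finset.mem_filter, not_and, not_not] at hl
    obtain ⟨h, h0, hnf⟩ := exists_nf_eq F l
    have h1 := hn l (EuclideanSpace.single a 1)
    rw [hvm, comp_bern, zeroOn_bern_opp] at h1
    have h2 := h1 α hα (hl (Finset.mem_univ l))
    simp only [quad, PiLp.single_apply, hnf] at h2
    rw [Finset.sum_eq_single a (fun b _ hb => by simp [hb]) (by simp)] at h2
    simp only [if_true, one_mul] at h2
    have h3 : h * ∑ d, c a d α * gradLam K l d = 0 := by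
      rw [← h2, Finset.mul_sum]
      exact Finset.sum_congr rfl fun d _ => by ring
    rw [mul_eq_zero, or_iff_right h0] at h3
    exact h3

/-! ## Properties of the bubbles for `H(curl)` -/

theorem bubCurl_induction {p : Matrix (Fin 3) (Fin 3) Poly → Prop}
    (h1 : ∀ (i : K.1) (q : Poly), Deg ((k : ℤ) - 3) q → VanishAt K.1 q →
      p ((bub K (opp K i).1 * q) • cdyad (F.nf (opp K i)) (F.nf (opp K i))))
    (h2 : ∀ Q : Matrix (Fin 3) (Fin 3) Poly, Q.IsSymm → (∀ a b, Deg ((k : ℤ) - 4) (Q a b)) →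
      p (bub K K.1 • Q)) (h0 : p 0) (hadd : ∀ σ τ, p σ → p τ → p (σ + τ))
    (hsmul : ∀ (r : ℝ) σ, p σ → p (r • σ)) {σ : Matrix (Fin 3) (Fin 3) Poly}
    (hσ : σ ∈ bubCurl F k K) : p σ := by
  induction hσ using Submodule.span_induction with
  | mem x hx =>
    rcases hx with ⟨i, q, hq, hv, rfl⟩ | ⟨Q, hQ, hd, rfl⟩
    exacts [h1 i q hq hv, h2 Q hQ hd]
  | zero => exact h0
  | add x y _ _ hx hy => exact hadd x y hx hy
  | smul r x _ hx => exact hsmul r x hx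

theorem cdyad_isSymm (n : E3) : (cdyad n n).IsSymm :=
  Matrix.IsSymm.ext fun i j => by
    simp only [cdyad, Matrix.vecMulVec_apply, mul_comm]

theorem isSymm_of_mem_bubCurl {σ : Matrix (Fin 3) (Fin 3) Poly} (hσ : σ ∈ bubCurl F k K) :
    σ.IsSymm :=
  bubCurl_induction F (fun _ _ _ _ => (cdyad_isSymm _).smul _) (fun _ hQ _ => hQ.smul _)
    Matrix.isSymm_zero (fun _ _ h h' => h.add h') (fun _ _ h => h.smul _) hσ

theorem deg_of_mem_bubCurl {σ : Matrix (Fin 3) (Fin 3) Poly} (hσ : σ ∈ bubCurl F k K) (i j : Fin 3) :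
    Deg (k : ℤ) (σ i j) := by
  refine bubCurl_induction F (p := fun σ => Deg (k : ℤ) (σ i j)) (fun l q hq _ => ?_)
    (fun Q _ hd => ?_) (deg_zero _) (fun _ _ h h' => h.add h') (fun r σ h => h.smul r) hσ
  · have hb := deg_bub K (opp_subset K l)
    rw [(opp K l).2.2] at hb
    have h := (hb.mul hq).mul ((deg_C (F.nf (opp K l) i)).mul (deg_C (F.nf (opp K l) j)))
    exact h.mono (by push_cast; linarith)
  · have hb := deg_bub K (subset_refl K.1)
    rw [K.2.2] at hb
    exact (hb.mul (hd i j)).mono (by push_cast; linarith)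

theorem vanishOrd_of_mem_bubCurl {σ : Matrix (Fin 3) (Fin 3) Poly} (hσ : σ ∈ bubCurl F k K)
    {x : E3} (hx : x ∈ K.1) (i j : Fin 3) : VanishOrd x 3 (σ i j) := by
  refine bubCurl_induction F (p := fun σ => VanishOrd x 3 (σ i j)) (fun l q _ hv => ?_)
    (fun Q _ hd => ?_) (vanishOrd_zero x 3) (fun _ _ h h' => h.add h') (fun r σ h => ?_) hσ
  · have hb := vanishOrd_bub (opp_subset K l) ⟨x, hx⟩
    rw [(opp K l).2.2] at hb
    have h1 : VanishOrd x 1 q := ⟨hv x hx, fun _ => trivial⟩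
    exact VanishOrd.mul (n := 0) (hb.mul h1) trivial
  · have hb := vanishOrd_bub (subset_refl K.1) ⟨x, hx⟩
    rw [K.2.2] at hb
    exact VanishOrd.mul (n := 0) hb trivial
  · rw [Matrix.smul_apply, MvPolynomial.smul_eq_C_mul]
    exact h.C_mul r

theorem tangentZero_of_mem_bubCurl {σ : Matrix (Fin 3) (Fin 3) Poly} (hσ : σ ∈ bubCurl F k K) :
    TangentZero K σ := by
  refine bubCurl_induction F (p := TangentZero K) (fun l q _ _ i t ht a => ?_)
    (fun Q _ _ i t _ a => ?_) (fun i t _ a => ?_) (fun σ τ h h' i t ht a => ?_)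
    (fun r σ h i t ht a => ?_) hσ
  · rw [comp_smul, comp_cdyad]
    by_cases h : i = l
    · subst h
      rw [(isTangent_opp_iff F).mp ht]
      simpa using zeroOn_zero
    · refine ZeroOn.mul_right (fun x hx => ?_) _
      rw [ev_mul, ev_bub_eq_zero (vertex_mem_opp.mpr h) (mem_planeOf_opp.mp hx), zero_mul]
  · rw [comp_smul]
    refine ZeroOn.mul_right (fun x hx => ?_) _
    exact ev_bub_eq_zero i.2 (mem_planeOf_opp.mp hx)
  · rw [show comp a 0 t = 0 by simp [comp]]
    exact zeroOn_zero
  · rw [comp_add]; exact (h i t ht a).add (h' i t ht a)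
  · have : comp a (r • σ) t = MvPolynomial.C r * comp a σ t := by
      rw [← comp_smul]
      congr 1
      ext1 i j
      simp [MvPolynomial.smul_eq_C_mul]
    rw [this]
    exact (h i t ht a).mul_left _

/-- The normal component of the curl involves only derivatives along the face of tangential
components. -/
theorem normalZero_curl {σ : Matrix (Fin 3) (Fin 3) Poly} (ht : TangentZero K σ) :
    NormalZero F K (curl σ) := by
  intro i a
  obtain ⟨γ, -, hγ⟩ := exists_comp_curl F (opp K i)
  rw [hγ]
  refine ZeroOn.mul_left ?_ _
  have key : ∀ j l, ZeroOn K (opp K i).1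
      (dir (F.tf (opp K i) l) (comp a σ (F.tf (opp K i) j))) := fun j l =>
    dir_vanish K (opp_subset K i) (opp_nonempty K i)
      (ht i _ (isTangent_tf F (opp_subset K i) j) a) (isTangent_tf F (opp_subset K i) l)
  exact (key 1 0).neg.add (key 0 1)

/-- This inclusion lets `harm_transfer` remove the projection term for the divergence. -/
theorem curl_mem_bubDiv (hk : 3 ≤ k) {σ : Matrix (Fin 3) (Fin 3) Poly} (hσ : σ ∈ bubCurl F k K) :
    curl σ ∈ bubDiv F k K :=
  mem_bubDiv F hk (trace_curl σ (isSymm_of_mem_bubCurl F hσ))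
    (fun i j => Deg.curl (deg_of_mem_bubCurl F hσ) i j)
    (fun _ hx _ _ => ((vanishOrd_of_mem_bubCurl F hσ hx _ _).2 _).sub
      ((vanishOrd_of_mem_bubCurl F hσ hx _ _).2 _))
    (normalZero_curl F (tangentZero_of_mem_bubCurl F hσ))

theorem isFinSub_curl_bubCurl : IsFinSub
    (curl '' (bubCurl F k K : Set (Matrix (Fin 3) (Fin 3) Poly))) :=
  ((isFinSub_matrix (isFinSub_deg_int K k)).subset (bubCurl F k K)
    fun _ hσ i j => deg_of_mem_bubCurl F hσ i j).image curlL

/-- The divergence maps the kernel of the remaining degrees of freedom to the corresponding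
kernel. -/
theorem RestV.restQ (hk : 7 ≤ k) {v : Matrix (Fin 3) (Fin 3) Poly} (hr : RestV F k K v) :
    RestQ k K (div v) where
  vertex x hx i := by
    rw [div, ev_sum]
    refine Finset.sum_eq_zero fun j _ => ?_
    have : VanishOrd x 2 (v i j) := vanishOrd_iff.mpr fun α hα => hr.vertex x hx α hα i j
    exact (this.2 j).1
  cell w hw horth := by
    obtain ⟨η, hη, rfl⟩ := exists_div F hk (fun i => (hw i).1) (fun i => (hw i).2) horth
    refine harm_transfer (isIP_ipM subset_rfl (cell_nonempty K))
      (isFinSub_curl_bubCurl F (k := k) (K := K)) (σ := v) (B := bubDiv F k K)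
      (b := fun η => ipV K.1 (div v) (div η)) (fun η hη => hr.cell η hη) ?_ ?_ η hη
    · rintro η hη _ ⟨p, hp, rfl⟩
      exact Submodule.sub_mem _ hη (curl_mem_bubDiv F (by omega) hp)
    · rintro η - _ ⟨p, -, rfl⟩
      simp only [div_sub, div_curl, sub_zero]

end bubDivChar

/-! ## Exactness of the bubble complex -/

section bubbleExact

variable (F : Frame T) {K : Cell T} {k : ℕ} {σ : Matrix (Fin 3) (Fin 3) Poly}

theorem dir_affComp (w v A : E3) (t : ℝ) :
    dir w (affComp v A t) = MvPolynomial.C (t * inner ℝ v w) := by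
  simp only [affComp, dir_C_mul, dir_add, dir_C, dir_X, Fin.sum_univ_three, inner_e3,
    MvPolynomial.C_mul, MvPolynomial.C_add]
  ring

/-- On a face, a symmetric matrix field whose tangential part is rotation-free agrees with a Hessian
in the tangential directions. -/
theorem exists_hess_face {f : Face T} (hf : f.1 ⊆ K.1) (hs : σ.IsSymm)
    (hd : ∀ i j, Deg (k : ℤ) (σ i j))
    (hrot : ∀ a, ZeroOn K f.1 (rotF F f fun j => comp a σ (F.tf f j))) :
    ∃ u, Deg ((k : ℤ) + 2) u ∧ ∀ t, IsTangent K f.1 t → ∀ a,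
      ZeroOn K f.1 (comp a (σ - hess u) t) := by
  obtain ⟨p, hp, hp'⟩ := exists_hessF F hf (tanM_isSymm F f hs) (fun i j => Deg.comp hd _ _)
    (fun i => hrot (F.tf f i))
  obtain ⟨a₀, ha₀⟩ := face_nonempty f
  obtain ⟨g, hg, hg'⟩ := exists_gradF F hf ha₀ (w := fun j => comp (F.nf f) σ (F.tf f j))
    (fun j => Deg.comp hd _ _) (hrot (F.nf f))
  have hn : inner ℝ (F.nf f) (F.nf f) = (1 : ℝ) := by
    rw [Frame.nf, real_inner_self_eq_norm_sq, OrthonormalBasis.norm_eq_one, one_pow]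
  -- The signed distance from the plane of the face: zero on the plane, with normal derivative one.
  set ℓ := affComp (F.nf f) (-a₀) 1 with hℓ
  have hℓ0 : ∀ x ∈ planeOf K f.1, ev ℓ x = 0 := fun x hx => by
    rw [hℓ, ev_affComp, one_smul, neg_add_eq_sub, inner_nf_of_mem F hf ha₀ hx]
  have hℓt : ∀ j, dir (F.tf f j) ℓ = 0 := fun j => by
    rw [hℓ, dir_affComp, inner_nf_tf, mul_zero, map_zero]
  have hℓn : dir (F.nf f) ℓ = 1 := by
    rw [hℓ, dir_affComp, hn, mul_one, map_one]
  -- The first summand produces the tangential-tangential part. The second one is invisible there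
  -- and produces the normal-tangential part through the normal derivative of `ℓ`.
  refine ⟨flat a₀ (F.nf f) p + ℓ * flat a₀ (F.nf f) g, (hp.flat _ _).add
    (((deg_affComp _ _ _).mul (hg.flat _ _)).mono (by linarith)), fun t ht a => ?_⟩
  have key : ∀ j b, ZeroOn K f.1
      (comp b (σ - hess (flat a₀ (F.nf f) p + ℓ * flat a₀ (F.nf f) g)) (F.tf f j)) := by
    intro j b
    refine zeroOn_of_frame (F.face f) (fun i => ?_) b
    rw [comp_sub, comp_hess, zeroOn_sub_iff]
    intro x hx
    have htt : ∀ i : Fin 2, ev (comp (F.tf f i) σ (F.tf f j)) x =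
        ev (dir (F.tf f i) (dir (F.tf f j) (flat a₀ (F.nf f) p + ℓ * flat a₀ (F.nf f) g))) x := by
      intro i
      simp only [dir_add, dir_mul, hℓt, zero_mul, zero_add, dir_tf_flat]
      rw [ev_add, ev_mul, hℓ0 x hx, zero_mul, add_zero, flat_eq_of_mem F hf ha₀ hx]
      exact (zeroOn_sub_iff.mp (hp' i j) x hx).symm
    have hnt : ev (comp (F.nf f) σ (F.tf f j)) x =
        ev (dir (F.nf f) (dir (F.tf f j) (flat a₀ (F.nf f) p + ℓ * flat a₀ (F.nf f) g))) x := by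
      have h1 := congrFun hg' j
      rw [gradF] at h1
      rw [dir_comm]
      simp only [dir_add, dir_mul, dir_nf_flat, hℓn, one_mul, mul_zero, add_zero, zero_add,
        dir_tf_flat, h1]
      rw [flat_eq_of_mem F hf ha₀ hx, flat_eq_of_mem F hf ha₀ hx]
    fin_cases i
    exacts [htt 0, htt 1, hnt]
  rw [tangent_eq F hf ht, comp_add_right, comp_smul_right, comp_smul_right]
  exact ((key 0 a).mul_left _).add ((key 1 a).mul_left _)

/-- The edge of `K` shared by the faces opposite to two vertices. -/
noncomputable def oppEdge (K : Cell T) (i j : K.1) : Finset E3 := facet (opp K i).1 j.1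

theorem vertex_mem_oppEdge {i j v : K.1} : v.1 ∈ oppEdge K i j ↔ v ≠ i ∧ v ≠ j := by
  rw [oppEdge, mem_facet, vertex_mem_opp, ne_eq, ← Subtype.ext_iff, and_comm]

theorem oppEdge_subset_left (i j : K.1) : oppEdge K i j ⊆ (opp K i).1 := facet_subset _ _

theorem oppEdge_comm (i j : K.1) : oppEdge K i j = oppEdge K j i := by
  ext x
  simp only [oppEdge, mem_facet, mem_opp]
  tauto

/-- Two polynomials whose Hessians agree with the same symmetric matrix field in the tangential
directions of two faces. -/
theorem edge_hess (hs : σ.IsSymm) {i j : K.1} {p q : Poly}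
    (hp : ∀ t, IsTangent K (opp K i).1 t → ∀ a, ZeroOn K (opp K i).1 (comp a (σ - hess p) t))
    (hq : ∀ t, IsTangent K (opp K j).1 t → ∀ a, ZeroOn K (opp K j).1 (comp a (σ - hess q) t))
    {s t : E3} (ht : IsTangent K (opp K i).1 t) (hst : IsTangent K (opp K j).1 s) :
    ZeroOn K (oppEdge K i j) (dir s (dir t (p - q))) := by
  have h1 := (hp t ht s).mono (oppEdge_subset_left i j)
  have h2 := (hq s hst t).mono (oppEdge_subset_left j i)
  rw [oppEdge_comm] at h2
  rw [comp_sub, comp_hess] at h1 h2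
  have h3 := h2.sub h1
  rw [comp_symm _ _ hs, dir_comm t s] at h3
  convert h3 using 1
  rw [dir_sub, dir_sub]
  ring

/-- The edge vector is tangential to both faces, so the gradient of `p - q` is constant along the
common edge. It therefore vanishes once it does at one vertex, and the same holds for the value. -/
theorem edge_vanish {i j : K.1} {p q : Poly}
    (hp : ∀ t, IsTangent K (opp K i).1 t → ∀ a, ZeroOn K (opp K i).1 (comp a (σ - hess p) t))
    (hq : ∀ t, IsTangent K (opp K j).1 t → ∀ a, ZeroOn K (opp K j).1 (comp a (σ - hess q) t))
    {m : K.1} (hmi : m ≠ i) (hmj : m ≠ j) (h0 : ev (p - q) m.1 = 0)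
    (h1 : ∀ a, ev (dir a (p - q)) m.1 = 0) :
    ZeroOn K (oppEdge K i j) (p - q) ∧ ∀ a, ZeroOn K (oppEdge K i j) (dir a (p - q)) := by
  have hsub : oppEdge K i j ⊆ K.1 := (oppEdge_subset_left i j).trans (opp_subset K i)
  have hm : m.1 ∈ oppEdge K i j := vertex_mem_oppEdge.mpr ⟨hmi, hmj⟩
  have key : ∀ a, ZeroOn K (oppEdge K i j) (dir a (p - q)) := by
    intro a
    refine vanish_of_dir K hsub hm (fun l hl => ?_) (h1 a)
    have ht := isTangent_sub (K := K) hl hm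
    have hti := ht.mono (oppEdge_subset_left i j)
    have htj := ht.mono (oppEdge_comm i j ▸ oppEdge_subset_left j i)
    have h2 := (hp _ hti a).mono (oppEdge_subset_left i j)
    have h3 := (hq _ htj a).mono (oppEdge_subset_left j i)
    rw [oppEdge_comm] at h3
    rw [comp_sub, comp_hess] at h2 h3
    have h4 := h3.sub h2
    rw [dir_comm, dir_sub, dir_sub]
    change ZeroOn K _ _
    convert h4 using 1
    ring
  exact ⟨vanish_of_dir K hsub hm (fun l _ => key _) h0, key⟩

/-- Coefficients whose entries at `i` and `j` are at most one encode the value, the gradient and one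
mixed second derivative on the common edge; the mixed derivative is prescribed by `σ` from both
faces. -/
theorem edge_coeff (hs : σ.IsSymm) {i j : K.1} (hij : i ≠ j) {d : ℕ} {c c' : (K.1 → ℕ) → ℝ}
    (hp : ∀ t, IsTangent K (opp K i).1 t → ∀ a,
      ZeroOn K (opp K i).1 (comp a (σ - hess (bern K (d + 2) c)) t))
    (hq : ∀ t, IsTangent K (opp K j).1 t → ∀ a,
      ZeroOn K (opp K j).1 (comp a (σ - hess (bern K (d + 2) c')) t))
    {m : K.1} (hmi : m ≠ i) (hmj : m ≠ j) (h0 : ev (bern K (d + 2) c - bern K (d + 2) c') m.1 = 0)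
    (h1 : ∀ a, ev (dir a (bern K (d + 2) c - bern K (d + 2) c')) m.1 = 0) {α : K.1 → ℕ}
    (hα : ∑ v, α v = d + 2) (hi : α i ≤ 1) (hj : α j ≤ 1) : c α = c' α := by
  obtain ⟨hv, hdv⟩ := edge_vanish hp hq hmi hmj h0 h1
  have hsub : oppEdge K i j ⊆ K.1 := (oppEdge_subset_left i j).trans (opp_subset K i)
  have hne : (oppEdge K i j).Nonempty := ⟨m.1, vertex_mem_oppEdge.mpr ⟨hmi, hmj⟩⟩
  have hmix := edge_hess hs hp hq (s := i.1 - m.1) (t := j.1 - m.1)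
    (isTangent_sub (vertex_mem_opp.mpr hij.symm) (vertex_mem_opp.mpr hmi))
    (isTangent_sub (vertex_mem_opp.mpr hij) (vertex_mem_opp.mpr hmj))
  rw [← bern_sub] at hv hmix
  simp only [← bern_sub] at hdv
  rw [← sub_eq_zero, ← Pi.sub_apply]
  have hout : ∀ {β : K.1 → ℕ}, β i = 0 → β j = 0 → ∀ v : K.1, v.1 ∉ oppEdge K i j → β v = 0 := by
    intro β h1 h2 v hv
    rw [vertex_mem_oppEdge, not_and_or, not_not, not_not] at hv
    rcases hv with rfl | rfl <;> assumption
  set D := c - c'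
  have e0 : ∀ β : K.1 → ℕ, ∑ v, β v = d + 2 → β i = 0 → β j = 0 → D β = 0 := fun β hβ h1 h2 =>
    (zeroOn_bern_iff K hsub hne).mp hv β hβ (hout h1 h2)
  have e1 : ∀ l β, ∑ v, β v = d + 1 → β i = 0 → β j = 0 → D (β + unit l) = 0 := by
    intro l β hβ h1 h2
    have h3 := hdv (l.1 - m.1)
    rw [dir_sub_bern, zeroOn_bern_iff K hsub hne] at h3
    have h4 := h3 β hβ (hout h1 h2)
    have h5 := e0 (β + unit m) (by rw [sum_add_unit, hβ]) (by
      rw [Pi.add_apply, h1, unit_of_ne hmi.symm]) (by rw [Pi.add_apply, h2, unit_of_ne hmj.symm])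
    rwa [h5, sub_zero] at h4
  have e2 : ∀ β, ∑ v, β v = d → β i = 0 → β j = 0 → D (β + unit i + unit j) = 0 := by
    intro β hβ h1 h2
    rw [dir_sub_bern, dir_sub_bern, zeroOn_bern_iff K hsub hne] at hmix
    have h3 := hmix β hβ (hout h1 h2)
    have hβm : ∑ v, (β + unit m) v = d + 1 := by rw [sum_add_unit, hβ]
    have hmi' : (β + unit m) i = 0 := by rw [Pi.add_apply, h1, unit_of_ne hmi.symm]
    have hmj' : (β + unit m) j = 0 := by rw [Pi.add_apply, h2, unit_of_ne hmj.symm]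
    rw [add_right_comm β (unit i) (unit m), e1 i _ hβm hmi' hmj', e1 j _ hβm hmi' hmj',
      e1 m _ hβm hmi' hmj'] at h3
    simpa using h3
  by_cases hi0 : α i = 0
  · by_cases hj0 : α j = 0
    · exact e0 α hα hi0 hj0
    · obtain ⟨β, rfl⟩ := exists_eq_add_unit hj0
      rw [Pi.add_apply, unit_self] at hj
      rw [Pi.add_apply, unit_of_ne hij] at hi0
      exact e1 j β (by rw [sum_add_unit] at hα; omega) hi0 (by omega)
  · obtain ⟨β, rfl⟩ := exists_eq_add_unit hi0
    rw [sum_add_unit] at hα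
    rw [Pi.add_apply, unit_self] at hi
    by_cases hj0 : β j = 0
    · exact e1 i β (by omega) (by omega) hj0
    · obtain ⟨γ, rfl⟩ := exists_eq_add_unit hj0
      rw [Pi.add_apply, unit_of_ne hij] at hi
      rw [Pi.add_apply, Pi.add_apply, unit_self, unit_of_ne hij.symm] at hj
      rw [sum_add_unit] at hα
      rw [add_right_comm]
      exact e2 γ (by omega) (by omega) (by omega)

/-- Potentials on the four faces can be glued. -/
theorem exists_hess_tangentZero (hs : σ.IsSymm) {u : K.1 → Poly}
    (hu : ∀ i, Deg ((k : ℤ) + 2) (u i))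
    (h : ∀ i t, IsTangent K (opp K i).1 t → ∀ a,
      ZeroOn K (opp K i).1 (comp a (σ - hess (u i)) t)) :
    ∃ w, Deg ((k : ℤ) + 2) w ∧ TangentZero K (σ - hess w) := by
  classical
  obtain ⟨i₀⟩ : Nonempty K.1 := (cell_nonempty K).coe_sort
  choose m hm hm' using exists_third K i₀
  -- The potentials are unique only up to affine functions. They are normalized to agree with the
  -- one of `i₀` to first order at a vertex of the edge shared with its face.
  set u' : K.1 → Poly := fun j => u j - taylor (m j).1 (u j - u i₀) with hu'
  have hu'0 : u' i₀ = u i₀ := by simp [hu', taylor]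
  have hcomp : ∀ i a t, comp a (σ - hess (u' i)) t = comp a (σ - hess (u i)) t := by
    intro i a t
    have h1 := dir_dir_of_deg_one (deg_taylor (m i).1 (u i - u i₀)) a t
    have h2 : dir a (dir t (u' i)) = dir a (dir t (u i)) := by
      simp only [hu']; rw [dir_sub, dir_sub, h1, sub_zero]
    rw [comp_sub, comp_sub, comp_hess, comp_hess, h2]
  have h' : ∀ i t, IsTangent K (opp K i).1 t → ∀ a,
      ZeroOn K (opp K i).1 (comp a (σ - hess (u' i)) t) := fun i t ht a => by
    rw [hcomp]; exact h i t ht a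
  have hdeg : ∀ i, Deg ((k + 2 : ℕ) : ℤ) (u' i) := fun i => by
    have h1 : Deg ((k : ℤ) + 2) (taylor (m i).1 (u i - u i₀)) := (deg_taylor _ _).mono (by omega)
    have h2 : Deg ((k : ℤ) + 2) (u i - taylor (m i).1 (u i - u i₀)) := (hu i).sub h1
    push_cast
    exact h2
  choose c hc using fun i => exists_bern K (hdeg i)
  have hbase : ∀ j, ev (u' j - u' i₀) (m j).1 = 0 ∧ ∀ a, ev (dir a (u' j - u' i₀)) (m j).1 = 0 := by
    intro j
    have : u' j - u' i₀ = (u j - u i₀) - taylor (m j).1 (u j - u i₀) := by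
      rw [hu'0]; simp only [hu']; ring
    rw [this]
    exact ⟨ev_sub_taylor _ _, fun a => ev_dir_sub_taylor _ _ a⟩
  have hjet0 : ∀ j p, j ≠ i₀ → p ≠ i₀ → p ≠ j →
      ev (u' j - u' i₀) p.1 = 0 ∧ ∀ a, ev (dir a (u' j - u' i₀)) p.1 = 0 := by
    intro j p hj hp hpj
    obtain ⟨h1, h2⟩ := edge_vanish (h' j) (h' i₀) (hm' j) (hm j) (hbase j).1 (hbase j).2
    have hpm := vertex_mem_planeOf (K := K) (vertex_mem_oppEdge.mpr ⟨hpj, hp⟩)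
    exact ⟨h1 _ hpm, fun a => h2 a _ hpm⟩
  have hjet : ∀ i j, i ≠ j → ∃ p : K.1, p ≠ i ∧ p ≠ j ∧ ev (u' i - u' j) p.1 = 0 ∧
      ∀ a, ev (dir a (u' i - u' j)) p.1 = 0 := by
    have hcard : Fintype.card K.1 = 4 := by rw [Fintype.card_coe, K.2.2]
    have hneg : ∀ {i j p : K.1}, (ev (u' i - u' j) p.1 = 0 ∧ ∀ a, ev (dir a (u' i - u' j)) p.1 = 0) →
        ev (u' j - u' i) p.1 = 0 ∧ ∀ a, ev (dir a (u' j - u' i)) p.1 = 0 := by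
      intro i j p hp
      simp only [ev_sub, dir_sub, sub_eq_zero] at hp ⊢
      exact ⟨hp.1.symm, fun a => (hp.2 a).symm⟩
    intro i j hij
    by_cases hi : i = i₀
    · subst hi
      exact ⟨m j, hm j, hm' j, hneg (hbase j)⟩
    by_cases hj : j = i₀
    · subst hj
      exact ⟨m i, hm' i, hm i, hbase i⟩
    -- This vertex lies on all three faces, so the two potentials are compared there through the one
    -- of `i₀`.
    obtain ⟨p, hp⟩ : ∃ p : K.1, p ∉ ({i₀, i, j} : Finset K.1) := by
      by_contra! hall
      have h1 := Finset.card_le_card (fun x _ => hall x : Finset.univ ⊆ ({i₀, i, j} : Finset K.1))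
      have h2 := Finset.card_le_three (a := i₀) (b := i) (c := j)
      rw [Finset.card_univ, hcard] at h1
      omega
    simp only [Finset.mem_insert, Finset.mem_singleton, not_or] at hp
    refine ⟨p, hp.2.1, hp.2.2, ?_⟩
    have h1 := hjet0 i p hi hp.1 hp.2.1
    have h2 := hneg (hjet0 j p hj hp.1 hp.2.2)
    simp only [ev_sub, dir_sub, sub_eq_zero] at h1 h2 ⊢
    exact ⟨h1.1.trans h2.1, fun a => (h1.2 a).trans (h2.2 a)⟩
  have hagree : ∀ i j α, ∑ v, α v = k + 2 → α i ≤ 1 → α j ≤ 1 → c i α = c j α := by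
    intro i j α hα hi hj
    by_cases hij : i = j
    · rw [hij]
    obtain ⟨p, hpi, hpj, h0, h1⟩ := hjet i j hij
    have h2 := h' i
    have h3 := h' j
    simp only [hc] at h0 h1 h2 h3
    exact edge_coeff hs hij h2 h3 hpi hpj h0 h1 hα hi hj
  -- A coefficient with an entry at most one at `i` is taken from the potential of the face `i`; by
  -- `hagree` the choice does not matter. The remaining coefficients are free and set to zero.
  set e : (K.1 → ℕ) → ℝ := fun α => if hα : ∃ i, α i ≤ 1 then c hα.choose α else 0 with he
  have hec : ∀ i α, ∑ v, α v = k + 2 → α i ≤ 1 → e α = c i α := by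
    intro i α hα hi
    have hex : ∃ i, α i ≤ 1 := ⟨i, hi⟩
    rw [he]
    simp only [dif_pos hex]
    exact hagree _ _ α hα hex.choose_spec hi
  refine ⟨bern K (k + 2) e, (deg_bern K _ _).mono (by push_cast; rfl), fun i t ht a => ?_⟩
  -- Entries at most one at `i` determine the value and all first derivatives on that face, and a
  -- further tangential derivative stays there.
  have h1 : ZeroOn K (opp K i).1 (dir a (dir t (bern K (k + 2) e - u' i))) := by
    rw [dir_comm, hc, ← bern_sub]
    refine dir_vanish K (opp_subset K i) (opp_nonempty K i) ?_ ht
    have : ZeroOn K (opp K i).1 (dir a (bern K (k + 1 + 1) (e - c i))) := by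
      rw [dir_bern, zeroOn_bern_opp]
      intro β hβ hβi
      refine Finset.sum_eq_zero fun q _ => ?_
      rw [Pi.sub_apply, hec i _ (by rw [sum_add_unit, hβ]), sub_self, mul_zero]
      rw [Pi.add_apply, hβi, zero_add]
      by_cases hq : i = q
      · subst hq; rw [unit_self]
      · rw [unit_of_ne hq]; omega
    exact this
  have h2 := (h' i t ht a).sub h1
  convert h2 using 1
  simp only [comp_sub, comp_hess, dir_sub]
  ring

end bubbleExact

/-- The converse of `coeff_eq_zero_of_vanishOrd`: a derivative lowers the degree by one and the
entry at `p` by at most one. -/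
theorem vanishOrd_of_coeff (K : Cell T) (p : K.1) : ∀ {m d : ℕ} {c : (K.1 → ℕ) → ℝ},
    (∀ α : K.1 → ℕ, ∑ v, α v = d → d < α p + m → c α = 0) → VanishOrd p.1 m (bern K d c)
  | 0, _, _, _ => trivial
  | m + 1, 0, c, h => by
    have : bern K 0 c = bern K 0 0 := bern_congr K fun α hα => h α hα (by omega)
    rw [this, bern_zero]
    exact vanishOrd_zero _ _
  | m + 1, d + 1, c, h => by
    refine ⟨ev_bern_eq_zero K (s := {p.1}) (fun α hα hα' => h α hα ?_) fun v hv => ?_, fun i => ?_⟩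
    · have : ∑ v, α v = α p := Finset.sum_eq_single p (fun v _ hv => hα' v fun hv' => hv (Subtype.ext (by simpa using hv'))) (by simp)
      omega
    · rw [ev_lam_vertex, if_neg]
      rintro rfl
      simp at hv
    · rw [← dir_single, dir_bern]
      refine vanishOrd_of_coeff K p fun β hβ hlt => Finset.sum_eq_zero fun v _ => ?_
      rw [h _ (by rw [sum_add_unit, hβ]) (by rw [Pi.add_apply]; omega), mul_zero]

/-- The derivatives of a matrix field that enter the curl, in two tangential directions of a face. -/
theorem exists_dir_comp_sub (F : Frame T) {K : Cell T} {f : Face T} (hf : f.1 ⊆ K.1) {s t : E3}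
    (hs : IsTangent K f.1 s) (ht : IsTangent K f.1 t) :
    ∃ r : ℝ, ∀ σ a, dir s (comp a σ t) - dir t (comp a σ s) =
      MvPolynomial.C r * comp a (curl σ) (F.nf f) := by
  obtain ⟨γ, hγ, h⟩ := exists_comp_curl F f
  refine ⟨(inner ℝ (F.tf f 1) s * inner ℝ (F.tf f 0) t -
    inner ℝ (F.tf f 0) s * inner ℝ (F.tf f 1) t) * γ⁻¹, fun σ a => ?_⟩
  have hc : ∀ w, IsTangent K f.1 w → comp a σ w =
      MvPolynomial.C (inner ℝ (F.tf f 0) w) * comp a σ (F.tf f 0) +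
      MvPolynomial.C (inner ℝ (F.tf f 1) w) * comp a σ (F.tf f 1) := fun w hw => by
    conv_lhs => rw [tangent_eq F hf hw]
    rw [comp_add_right, comp_smul_right, comp_smul_right]
  rw [hc t ht, hc s hs, h, ← mul_assoc, ← MvPolynomial.C_mul, inv_mul_cancel_right₀ hγ,
    dir_tangent F hf hs, dir_tangent F hf ht, rotF]
  simp only [dir_add, dir_C_mul, MvPolynomial.C_sub, MvPolynomial.C_mul]
  ring

/-- A field with vanishing tangential components whose curl vanishes to second order at the
vertices vanishes there to third order. -/
theorem TangentZero.vanishOrd (F : Frame T) {K : Cell T} {k : ℕ} (hk : 3 ≤ k)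
    {σ : Matrix (Fin 3) (Fin 3) Poly} (hs : σ.IsSymm) (hd : ∀ i j, Deg (k : ℤ) (σ i j))
    (ht : TangentZero K σ) (hc : ∀ x ∈ K.1, ∀ i j, VanishOrd x 2 (curl σ i j)) :
    ∀ x ∈ K.1, ∀ i j, VanishOrd x 3 (σ i j) := by
  classical
  obtain ⟨d, rfl⟩ : ∃ d, k = d + 2 + 1 := ⟨k - 3, by omega⟩
  choose c hσc using fun i j => exists_bern K (hd i j)
  have hσ : σ = Matrix.of fun i j => bern K (d + 2 + 1) (c i j) := by ext1 i j; exact hσc i j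
  set Q : (K.1 → ℕ) → Fin 3 → Fin 3 → ℝ := fun α i j => c i j α with hQ
  have hcomp : ∀ a b, comp a σ b = bern K (d + 2 + 1) fun α => quad a (Q α) b := fun a b => by
    rw [hσ, comp_bern]
  have hsymm : ∀ α, ∑ v, α v = d + 2 + 1 → ∀ a b, quad a (Q α) b = quad b (Q α) a :=
    fun α hα a b => bern_injective K (c := fun α => quad a (Q α) b)
      (c' := fun α => quad b (Q α) a) (by rw [← hcomp, ← hcomp, comp_symm _ _ hs]) hα
  have hT : ∀ α, ∑ v, α v = d + 2 + 1 → ∀ i, α i = 0 → ∀ t, IsTangent K (opp K i).1 t → ∀ a,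
      quad a (Q α) t = 0 := fun α hα i hi t hti a => by
    have := ht i t hti a
    rw [hcomp, zeroOn_bern_opp] at this
    exact this α hα hi
  have hZ : ∀ α, ∑ v, α v = d + 2 + 1 → ∀ i l, i ≠ l → α i = 0 → α l = 0 → ∀ a b,
      quad a (Q α) b = 0 := fun α hα i l hil hi hl a b => by
    obtain ⟨u, v, huv, hu, hv⟩ := exists_tangent_add K hil b
    rw [huv, quad_add_right, hT α hα i hi u hu, hT α hα l hl v hv, add_zero]
  have hcard : Fintype.card K.1 = 4 := by rw [Fintype.card_coe, K.2.2]
  -- Near the corner `j` a coefficient either has two zero entries and is covered by `hZ`, or has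
  -- one unit at each of two vertices `l`, `m` and none at `q`. Only the second kind needs the
  -- hypothesis on the curl.
  have core : ∀ j q l m : K.1, j ≠ q → j ≠ l → j ≠ m → q ≠ l → q ≠ m → l ≠ m →
      ∀ α, ∑ v, α v = d + 2 + 1 → α q = 0 → α l = 1 → α m = 1 → α j = d + 1 →
      ∀ a b, quad a (Q α) b = 0 := by
    intro j q l m hjq hjl hjm hql hqm hlm α hα hq hl hm hj
    have hs' : IsTangent K (opp K l).1 (m.1 - j.1) :=
      isTangent_sub (vertex_mem_opp.mpr hlm.symm) (vertex_mem_opp.mpr hjl)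
    have ht' : IsTangent K (opp K l).1 (q.1 - j.1) :=
      isTangent_sub (vertex_mem_opp.mpr hql) (vertex_mem_opp.mpr hjl)
    have htm : IsTangent K (opp K m).1 (q.1 - j.1) :=
      isTangent_sub (vertex_mem_opp.mpr hqm) (vertex_mem_opp.mpr hjm)
    -- On the face opposite to `l` the curl is a difference of two directional derivatives; of the
    -- four coefficients in it, all but the wanted one vanish by the tangential conditions.
    obtain ⟨r, hr⟩ := exists_dir_comp_sub F (opp_subset K l) hs' ht'
    have h1 : VanishOrd j.1 2 (dir (m.1 - j.1) (comp (q.1 - j.1) σ (q.1 - j.1)) -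
        dir (q.1 - j.1) (comp (q.1 - j.1) σ (m.1 - j.1))) := by
      rw [hr]
      exact (VanishOrd.comp (hc j.1 j.2) _ _).C_mul r
    rw [hcomp, hcomp, dir_sub_bern, dir_sub_bern, ← bern_sub] at h1
    obtain ⟨β, rfl⟩ := exists_eq_add_unit (v := m) (α := α) (by omega)
    rw [sum_add_unit] at hα
    rw [Pi.add_apply, unit_of_ne hqm, add_zero] at hq
    rw [Pi.add_apply, unit_of_ne hlm, add_zero] at hl
    rw [Pi.add_apply, unit_self] at hm
    rw [Pi.add_apply, unit_of_ne hjm, add_zero] at hj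
    have hm0 : β m = 0 := by omega
    have h2 := coeff_eq_zero_of_vanishOrd K j h1 β (by omega) (by omega)
    have hsum : ∀ v : K.1, ∑ w, (β + unit v) w = d + 2 + 1 := fun v => by
      rw [sum_add_unit]; omega
    simp only [Pi.sub_apply] at h2
    rw [hZ _ (hsum j) q m hqm (by rw [Pi.add_apply, unit_of_ne hjq.symm, hq])
        (by rw [Pi.add_apply, unit_of_ne hjm.symm, hm0]),
      hZ _ (hsum j) q m hqm (by rw [Pi.add_apply, unit_of_ne hjq.symm, hq])
        (by rw [Pi.add_apply, unit_of_ne hjm.symm, hm0]),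
      hsymm _ (hsum q), hT _ (hsum q) m (by rw [Pi.add_apply, unit_of_ne hqm.symm, hm0]) _ htm,
      sub_zero, sub_zero, sub_zero] at h2
    have hq0 : (β + unit m) q = 0 := by rw [Pi.add_apply, unit_of_ne hqm, hq]
    -- The coefficient matrix kills the tangents of the face opposite to `q`, so only its entry in
    -- the transversal direction `q - j` was open.
    have h3 : ∀ b, quad (q.1 - j.1) (Q (β + unit m)) b = 0 ∧ ∃ τ, IsTangent K (opp K q).1 τ ∧
        b = slope K b q • (q.1 - j.1) + τ := by
      intro b
      have hτ : IsTangent K (opp K q).1 (b - slope K b q • (q.1 - j.1)) := by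
        have h4 : slope K b q = slope K (b - slope K b q • (q.1 - j.1)) q +
            slope K (slope K b q • (q.1 - j.1)) q := by
          rw [← slope_add, sub_add_cancel]
        rw [slope_smul, slope_sub, if_pos rfl, if_neg hjq.symm] at h4
        rw [isTangent_opp]
        linarith
      refine ⟨?_, _, hτ, by abel⟩
      have hb : b = slope K b q • (q.1 - j.1) + (b - slope K b q • (q.1 - j.1)) := by abel
      rw [hb, quad_add_right, quad_smul_right, h2, hT _ (hsum m) q hq0 _ hτ, mul_zero, add_zero]
    intro a b
    obtain ⟨τ, hτ, hb⟩ := (h3 b).2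
    rw [hb, quad_add_right, quad_smul_right, hT _ (hsum m) q hq0 _ hτ, hsymm _ (hsum m),
      (h3 a).1, mul_zero, add_zero]
  intro x hx i₀ j₀
  rw [hσc]
  obtain ⟨j, rfl⟩ : ∃ j : K.1, j.1 = x := ⟨⟨x, hx⟩, rfl⟩
  refine vanishOrd_of_coeff K j fun α hα hlt => ?_
  obtain ⟨q, l, m, hjq, hjl, hjm, hql, hqm, hlm, hall⟩ := exists_three hcard j
  have hsum : α j + α q + α l + α m = d + 2 + 1 := by
    have : (Finset.univ : Finset K.1) = {j, q, l, m} := by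
      ext v; simpa using hall v
    rw [← hα, this, Finset.sum_insert (by simp [hjq, hjl, hjm]),
      Finset.sum_insert (by simp [hql, hqm]), Finset.sum_pair hlm]
    ring
  suffices h : ∀ a b, quad a (Q α) b = 0 by
    have := h (EuclideanSpace.single i₀ 1) (EuclideanSpace.single j₀ 1)
    rwa [quad_single] at this
  by_cases hq : α q = 0
  · by_cases hl : α l = 0
    · exact hZ α hα q l hql hq hl
    by_cases hm : α m = 0
    · exact hZ α hα q m hqm hq hm
    exact core j q l m hjq hjl hjm hql hqm hlm α hα hq (by omega) (by omega) (by omega)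
  by_cases hl : α l = 0
  · by_cases hm : α m = 0
    · exact hZ α hα l m hlm hl hm
    exact core j l q m hjl hjq hjm hql.symm hlm hqm α hα hl (by omega) (by omega) (by omega)
  · exact core j m q l hjm hjq hjl hqm.symm hlm.symm hql α hα (by omega) (by omega) (by omega)
      (by omega)

/-- The kernel of the divergence among the bubble functions consists of curls of bubble functions. -/
theorem exists_curl_bubble (F : Frame T) {K : Cell T} {k : ℕ} (hk : 4 ≤ k)
    {v : Matrix (Fin 3) (Fin 3) Poly} (ht : v.trace = 0) (hd : ∀ i j, Deg ((k : ℤ) - 1) (v i j))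
    (hv : ∀ x ∈ K.1, ∀ i j, VanishOrd x 2 (v i j)) (hn : NormalZero F K v) (h0 : div v = 0) :
    ∃ σ ∈ bubCurl F k K, curl σ = v := by
  obtain ⟨σ, hs, hσ, rfl⟩ := exists_curl hd ht h0
  have hσd : ∀ i j, Deg (k : ℤ) (σ i j) := fun i j => (hσ i j).mono (by omega)
  -- On each face the vanishing normal component of the curl says that the tangential part of the
  -- potential has no rotation.
  have hex := fun i => exists_hess_face F (opp_subset K i) hs hσd fun a => by
    obtain ⟨γ, hγ, h⟩ := exists_comp_curl F (opp K i)
    intro x hx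
    have := hn i a x hx
    rw [h, ev_mul, ev_C] at this
    exact (mul_eq_zero.mp this).resolve_left hγ
  choose u hu hu' using hex
  obtain ⟨w, hw, hw'⟩ := exists_hess_tangentZero hs hu hu'
  have hc : curl (σ - hess w) = curl σ := by rw [curl_sub, curl_hess, sub_zero]
  have hs' : (σ - hess w).IsSymm := hs.sub (hess_isSymm w)
  have hd' : ∀ i j, Deg (k : ℤ) ((σ - hess w) i j) := fun i j =>
    (hσd i j).sub ((Deg.hess hw i j).mono (by omega))
  exact ⟨σ - hess w, mem_bubCurl F hk hs' hd'
    (hw'.vanishOrd F (by omega) hs' hd' (by rwa [hc])) hw', hc⟩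

/-! ## Unisolvence of the `H(div)` and `L²` elements -/

section unisolvenceV

variable (F : Frame T) {k : ℕ} {K : Cell T}

theorem ipV_rt {s : Finset E3} (hs : s ⊆ K.1) (hne : s.Nonempty) {w : Fin 3 → Poly}
    (h : ∀ j, ipV s w (rtBasis j) = 0) : ∀ r ∈ RT, ipV s w r = 0 := by
  rintro _ ⟨A, t, rfl⟩
  have hip := isIP_ipV (ι := Fin 3) hs hne
  have hr : (fun i => MvPolynomial.C (A i) + MvPolynomial.C t * MvPolynomial.X i : Fin 3 → Poly) =
      A 0 • rtBasis 1 + (A 1 • rtBasis 2 + (A 2 • rtBasis 3 + t • rtBasis 0)) := by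
    funext i
    have h0 : rtBasis 0 i = MvPolynomial.X i := rfl
    have h1 : ∀ j : Fin 3, rtBasis j.succ i =
      MvPolynomial.C ((EuclideanSpace.single j (1 : ℝ) : E3) i) := fun _ => rfl
    have e1 := h1 0
    have e2 := h1 1
    have e3 := h1 2
    simp only [Pi.add_apply, Pi.smul_apply, MvPolynomial.smul_eq_C_mul]
    rw [h0, show (1 : Fin 4) = Fin.succ 0 from rfl, show (2 : Fin 4) = Fin.succ 1 from rfl,
      show (3 : Fin 4) = Fin.succ 2 from rfl, e1, e2, e3]
    fin_cases i <;> simp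
  rw [hr]
  simp only [hip.add_right, hip.smul_right, h, mul_zero, add_zero]

/-- Parseval's identity in the frame of the face, without the normal term. -/
theorem ipV_eq_tanV {f : Face T} (hf : f.1 ⊆ K.1) {w r : Fin 3 → Poly}
    (h : ∀ x ∈ planeOf K f.1, ∑ i, F.nf f i * ev (r i) x = 0) :
    ipV f.1 w r = ipV f.1 (tanV F f w) (tanV F f r) := by
  have hS : ∀ {ι : Type} [Fintype ι] (a b : ι → Poly), ipV f.1 a b = ipS f.1 (∑ i, a i * b i) 1 :=
    fun a b => by
      rw [ipS_sum_left K hf (face_nonempty f), ipV]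
      exact Finset.sum_congr rfl fun i _ => ipS_eq _ _ _
  rw [hS, hS]
  refine ipS_congr K hf (fun x hx => ?_) fun _ _ => rfl
  have h1 := (F.face f).sum_inner_mul_inner (WithLp.toLp 2 fun i => ev (w i) x : E3)
    (WithLp.toLp 2 fun i => ev (r i) x)
  have h2 := h x hx
  simp only [Fin.sum_univ_three, inner_e3] at h1 h2
  simp only [tanV, Fin.sum_univ_three, Fin.sum_univ_two, ev_add, ev_mul, ev_C]
  simp only [Frame.nf] at h2
  rw [h2] at h1
  simp only [Frame.tf, Fin.castSucc_zero, Fin.castSucc_one]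
  linear_combination -h1

theorem RestV.vanishOrd {v : Matrix (Fin 3) (Fin 3) Poly} (hr : RestV F k K v) {x : E3}
    (hx : x ∈ K.1) (i j : Fin 3) : VanishOrd x 2 (v i j) :=
  vanishOrd_iff.mpr fun α hα => hr.vertex x hx α (by omega) i j

theorem RestV.comp_mem_polyF1 {v : Matrix (Fin 3) (Fin 3) Poly} (hr : RestV F k K v)
    (hd : ∀ i j, Deg ((k : ℤ) - 1) (v i j)) {f : Face T} (hf : f.1 ⊆ K.1) (a b : E3) :
    comp a v b ∈ polyF1 F f ((k : ℤ) - 1) := by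
  have h : ∀ x ∈ f.1, VanishOrd x 2 (comp a v b) := fun x hx =>
    VanishOrd.comp (hr.vanishOrd F (hf hx)) a b
  exact ⟨Deg.comp hd a b, fun x hx => (h x hx).1, fun c x hx => ((h x hx).dir (F.tf f c)).1⟩

/-- The moments against spatial `RT` fields supply both missing orthogonalities: fields tangential
to the face give `RT(f)`, and the constant normal field gives the mean of the normal part. Each part
can then be tested with itself. -/
theorem RestV.zeroOn_face {v : Matrix (Fin 3) (Fin 3) Poly} (hr : RestV F k K v)
    (hd : ∀ i j, Deg ((k : ℤ) - 1) (v i j)) {f : Face T} (hf : f.1 ⊆ K.1)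
    (h0 : ∀ j, dofV F f v j = 0) (a : E3) : ZeroOn K f.1 (comp a v (F.nf f)) := by
  have hne := face_nonempty f
  set w := v.mulVec (cvec (F.nf f)) with hw
  have hrt : ∀ r ∈ RT, ipV f.1 w r = 0 := ipV_rt hf hne h0
  have ht : ∀ r ∈ RTf F f, ipV f.1 (tanV F f w) r = 0 := by
    rintro _ ⟨_, ⟨A, t, rfl⟩, rfl⟩
    obtain ⟨a₀, ha₀⟩ := hne
    -- The normal part of `A + t x` is this constant on the plane of the face; subtracting it leaves
    -- a tangential field with the same tangential part.
    set c : ℝ := inner ℝ (F.nf f) (A + t • a₀) with hc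
    have h1 := hrt _ ⟨A - c • F.nf f, t, rfl⟩
    rw [ipV_eq_tanV F hf] at h1
    · rw [← h1]
      congr 1
      funext b
      have h2 := inner_nf_tf F f b
      rw [inner_e3] at h2
      have h3 := congrArg (MvPolynomial.C (σ := Fin 3)) h2
      simp only [map_add, map_mul, map_zero] at h3
      simp only [tanV, Fin.sum_univ_three, PiLp.sub_apply, PiLp.smul_apply, smul_eq_mul, map_sub,
        map_mul]
      linear_combination MvPolynomial.C c * h3
    · intro x hx
      have h2 := inner_nf_of_mem F hf ha₀ hx
      have h3 : inner ℝ (F.nf f) (F.nf f) = (1 : ℝ) := by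
        rw [Frame.nf, real_inner_self_eq_norm_sq, OrthonormalBasis.norm_eq_one, one_pow]
      have h4 : ∑ i, F.nf f i * ev (MvPolynomial.C ((A - c • F.nf f) i) +
          MvPolynomial.C t * MvPolynomial.X i) x =
          inner ℝ (F.nf f) (A - c • F.nf f + t • x) := by
        simp [inner_e3, Fin.sum_univ_three]
      rw [h4]
      rw [inner_sub_right] at h2
      rw [inner_add_right, real_inner_smul_right] at hc
      rw [inner_add_right, inner_sub_right, real_inner_smul_right, real_inner_smul_right, h3]
      linear_combination t * h2 - hc
  have hmem : ∀ b, tanV F f w b ∈ polyF1 F f ((k : ℤ) - 1) := fun b => by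
    rw [hw, tanV_mulVec]; exact hr.comp_mem_polyF1 F hd hf _ _
  have htan := (ipV_self_eq_zero hf hne).mp (hr.face_nt f hf _ hmem ht)
  have hn1 : ipS f.1 (comp (F.nf f) v (F.nf f)) 1 = 0 := by
    have h1 := hrt (cvec (F.nf f)) ⟨F.nf f, 0, by funext i; simp [cvec]⟩
    rw [← h1, comp_eq, ipS_sum_left K hf hne, ipV]
    refine Finset.sum_congr rfl fun i _ => ?_
    rw [← ipS_eq f.1 (MvPolynomial.C (F.nf f i)), ipS_comm]; rfl
  have hnn := ev_eq_zero_of_ipS_self K hf hne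
    (hr.face_nn f hf _ (hr.comp_mem_polyF1 F hd hf _ _) hn1)
  have htan' : ∀ b, ZeroOn K f.1 (comp (F.tf f b) v (F.nf f)) := fun b x hx => by
    rw [← tanV_mulVec]; exact htan b x hx
  refine zeroOn_of_frame (F.face f) (fun i => ?_) a
  fin_cases i
  exacts [htan' 0, htan' 1, hnn]

/-- The field is a bubble and may be tested with itself. Its divergence is then zero, so by
`exists_curl_bubble` it lies in the space onto which its projection vanishes. -/
theorem RestV.eq_zero (hk : 7 ≤ k) {v : Matrix (Fin 3) (Fin 3) Poly} (hr : RestV F k K v)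
    (ht : v.trace = 0) (hd : ∀ i j, Deg ((k : ℤ) - 1) (v i j))
    (h0 : ∀ f : Face T, f.1 ⊆ K.1 → ∀ j, dofV F f v j = 0) : v = 0 := by
  have hne := cell_nonempty K
  have hip := isIP_ipM (ι := Fin 3) (subset_refl K.1) hne
  have hv : ∀ x ∈ K.1, ∀ i j, VanishOrd x 2 (v i j) := fun x hx => hr.vanishOrd F hx
  have hn : NormalZero F K v := fun i a =>
    hr.zeroOn_face F hd (opp_subset K i) (h0 _ (opp_subset K i)) a
  have h2 := hr.cell v (mem_bubDiv F (by omega) ht hd hv hn)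
  have h3 := ip_self_eq_zero_of_harm hip (isFinSub_curl_bubCurl F)
    ((isIP_ipV (subset_refl K.1) hne).nonneg _) h2 (fun h0 => by
      have hdiv : div v = 0 := by
        funext i
        exact zeroOn_cell.mp ((ipV_self_eq_zero (subset_refl K.1) hne).mp h0 i)
      obtain ⟨σ, hσ, hσv⟩ := exists_curl_bubble F (by omega) ht hd hv hn hdiv
      exact ⟨v, ⟨σ, hσ, hσv⟩, by rw [sub_self, hip.zero_left]⟩)
  ext1 i j
  exact zeroOn_cell.mp ((ipM_self_eq_zero (subset_refl K.1) hne).mp h3 i j)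

theorem RestQ.eq_zero {q : Fin 3 → Poly} (hr : RestQ k K q) (hd : ∀ i, Deg ((k : ℤ) - 2) (q i))
    (h0 : ∀ j, dofQ K q j = 0) : q = 0 := by
  have hne := cell_nonempty K
  have h := hr.cell q (fun i => ⟨hd i, fun x hx => hr.vertex x hx i⟩)
    (ipV_rt (subset_refl K.1) hne h0)
  funext i
  exact zeroOn_cell.mp ((ipV_self_eq_zero (subset_refl K.1) hne).mp h i)

end unisolvenceV

/-! ## The remaining degrees of freedom depend linearly on the function -/

section linear

theorem IsIP.lin {V : Type} [AddCommGroup V] [Module ℝ V] {ip : V → V → ℝ} (h : IsIP ip) (c : ℝ)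
    {u v z : V} (hu : ip u z = 0) (hv : ip v z = 0) : ip (c • u + v) z = 0 := by
  rw [h.add_left, h.smul_left, hu, hv, mul_zero, add_zero]

/-- The chosen projections are linear only modulo null vectors. Inside the form the projection of
the first argument can be dropped, and then linearity is plain. -/
theorem harm_lin {V V' : Type} [AddCommGroup V] [Module ℝ V] [AddCommGroup V'] [Module ℝ V']
    {ip : V → V → ℝ} {ip' : V' → V' → ℝ} (h : IsIP ip) (h' : IsIP ip') {W : Set V}
    (hW : IsFinSub W) (c : ℝ) {u v z : V} {u' v' z' : V'}
    (hu : ip (proj ip W u) (proj ip W z) + ip' u' z' = 0)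
    (hv : ip (proj ip W v) (proj ip W z) + ip' v' z' = 0) :
    ip (proj ip W (c • u + v)) (proj ip W z) + ip' (c • u' + v') z' = 0 := by
  rw [ip_proj_proj h hW] at hu hv ⊢
  rw [h.add_left, h.smul_left, h'.add_left, h'.smul_left]
  linear_combination c * hu + hv

theorem dAlpha_lin (α : Fin 3 → ℕ) (c : ℝ) (p q : Poly) :
    dAlpha α (c • p + q) = c • dAlpha α p + dAlpha α q := by
  have h : ∀ (i : Fin 3) n (p q : Poly),
      (pd i)^[n] (c • p + q) = c • (pd i)^[n] p + (pd i)^[n] q := by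
    intro i n
    induction n with
    | zero => exact fun _ _ => rfl
    | succ n ih => intro p q; simp only [Function.iterate_succ_apply, pd_add, pd_smul, ih]
  simp only [dAlpha, h]

theorem dir_lin (w : E3) (c : ℝ) (p q : Poly) : dir w (c • p + q) = c • dir w p + dir w q := by
  rw [dir_add, dir_smul]

theorem ev_lin {x : E3} (c : ℝ) {p q : Poly} (hp : ev p x = 0) (hq : ev q x = 0) :
    ev (c • p + q) x = 0 := by
  rw [MvPolynomial.smul_eq_C_mul, ev_add, ev_mul, hp, hq, mul_zero, add_zero]

variable (F : Frame T) {k : ℕ} {K : Cell T}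

theorem comp_lin (a b : E3) (c : ℝ) (σ τ : Matrix (Fin 3) (Fin 3) Poly) :
    comp a (c • σ + τ) b = c • comp a σ b + comp a τ b := by
  have h : c • σ = (MvPolynomial.C c : Poly) • σ := by
    ext1 i j; exact MvPolynomial.smul_eq_C_mul _ _
  rw [comp_add, h, comp_smul, MvPolynomial.smul_eq_C_mul]

theorem rotF_lin (f : Face T) (c : ℝ) (v w : Fin 2 → Poly) :
    rotF F f (c • v + w) = c • rotF F f v + rotF F f w := by
  simp only [rotF, Pi.add_apply, Pi.smul_apply, dir_lin, smul_add, smul_neg]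
  ring

theorem tanV_lin (f : Face T) (n : E3) (c : ℝ) (σ τ : Matrix (Fin 3) (Fin 3) Poly) :
    tanV F f ((c • σ + τ).mulVec (cvec n)) =
      c • tanV F f (σ.mulVec (cvec n)) + tanV F f (τ.mulVec (cvec n)) := by
  funext a
  rw [Pi.add_apply, Pi.smul_apply, tanV_mulVec, tanV_mulVec, tanV_mulVec, comp_lin]

theorem RestU.lin (c : ℝ) {u v : Poly} (hu : RestU F k K u) (hv : RestU F k K v) :
    RestU F k K (c • u + v) where
  vertex x hx α h2 h4 := by
    rw [dAlpha_lin]; exact ev_lin c (hu.vertex x hx α h2 h4) (hv.vertex x hx α h2 h4)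
  edge_tt e he p hp := by
    rw [dir_lin, dir_lin]
    exact (isIP_ipS he (edge_nonempty e)).lin c (hu.edge_tt e he p hp) (hv.edge_tt e he p hp)
  edge_nt e he j p hp := by
    rw [dir_lin, dir_lin]
    exact (isIP_ipS he (edge_nonempty e)).lin c (hu.edge_nt e he j p hp) (hv.edge_nt e he j p hp)
  edge_nn e he j j' p hp := by
    rw [dir_lin, dir_lin]
    exact (isIP_ipS he (edge_nonempty e)).lin c (hu.edge_nn e he j j' p hp)
      (hv.edge_nn e he j j' p hp)
  face_hess f hf p hp := by
    have : hessF F f (c • u + v) = c • hessF F f u + hessF F f v := by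
      ext1 a b
      simp only [hessF, Matrix.of_apply, Matrix.add_apply, Matrix.smul_apply, dir_lin]
    rw [this]
    exact (isIP_ipM hf (face_nonempty f)).lin c (hu.face_hess f hf p hp) (hv.face_hess f hf p hp)
  face_grad f hf p hp := by
    have : ∀ u v, gradF F f (c • u + v) = c • gradF F f u + gradF F f v := fun u v => by
      funext a; exact dir_lin _ _ _ _
    rw [dir_lin, this]
    exact (isIP_ipV hf (face_nonempty f)).lin c (hu.face_grad f hf p hp) (hv.face_grad f hf p hp)
  cell p hp := by
    rw [hess_add, hess_smul]
    exact (isIP_ipM subset_rfl (cell_nonempty K)).lin c (hu.cell p hp) (hv.cell p hp)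

theorem RestSigma.lin (c : ℝ) {σ τ : Matrix (Fin 3) (Fin 3) Poly} (hσ : RestSigma F k K σ)
    (hτ : RestSigma F k K τ) : RestSigma F k K (c • σ + τ) where
  vertex x hx α h i j := by
    rw [Matrix.add_apply, Matrix.smul_apply, dAlpha_lin]
    exact ev_lin c (hσ.vertex x hx α h i j) (hτ.vertex x hx α h i j)
  edge_tt e he p hp hq := by
    rw [comp_lin]
    exact (isIP_ipS he (edge_nonempty e)).lin c (hσ.edge_tt e he p hp hq) (hτ.edge_tt e he p hp hq)
  edge_nt e he j p hp hq := by
    rw [comp_lin]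
    exact (isIP_ipS he (edge_nonempty e)).lin c (hσ.edge_nt e he j p hp hq)
      (hτ.edge_nt e he j p hp hq)
  edge_nn e he j j' p hp := by
    rw [comp_lin]
    exact (isIP_ipS he (edge_nonempty e)).lin c (hσ.edge_nn e he j j' p hp)
      (hτ.edge_nn e he j j' p hp)
  face_tt f hf η hη hη' := by
    have h1 : tanM F f (c • σ + τ) = c • tanM F f σ + tanM F f τ := by
      ext1 a b; exact comp_lin _ _ _ _ _
    have h2 : rotFM F f (c • tanM F f σ + tanM F f τ) =
        c • rotFM F f (tanM F f σ) + rotFM F f (tanM F f τ) := by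
      funext a; exact rotF_lin F f c _ _
    rw [h1, harmFM, h2]
    exact harm_lin (isIP_ipM hf (face_nonempty f)) (isIP_ipV hf (face_nonempty f))
      (isFinSub_hessF F f _) c (hσ.face_tt f hf η hη hη') (hτ.face_tt f hf η hη hη')
  face_nt f hf w hw := by
    rw [tanV_lin, harmFV, rotF_lin]
    exact harm_lin (isIP_ipV hf (face_nonempty f)) (isIP_ipS hf (face_nonempty f))
      (isFinSub_gradF F f _) c (hσ.face_nt f hf w hw) (hτ.face_nt f hf w hw)
  cell η hη := by
    rw [harmCurl, curl_add, curl_smul]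
    exact harm_lin (isIP_ipM subset_rfl (cell_nonempty K)) (isIP_ipM subset_rfl (cell_nonempty K))
      (isFinSub_hess _) c (hσ.cell η hη) (hτ.cell η hη)

theorem RestV.lin (c : ℝ) {v w : Matrix (Fin 3) (Fin 3) Poly} (hv : RestV F k K v)
    (hw : RestV F k K w) : RestV F k K (c • v + w) where
  vertex x hx α h i j := by
    rw [Matrix.add_apply, Matrix.smul_apply, dAlpha_lin]
    exact ev_lin c (hv.vertex x hx α h i j) (hw.vertex x hx α h i j)
  face_nt f hf p hp h := by
    rw [tanV_lin]
    exact (isIP_ipV hf (face_nonempty f)).lin c (hv.face_nt f hf p hp h) (hw.face_nt f hf p hp h)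
  face_nn f hf p hp h := by
    rw [comp_lin]
    exact (isIP_ipS hf (face_nonempty f)).lin c (hv.face_nn f hf p hp h) (hw.face_nn f hf p hp h)
  cell η hη := by
    rw [harmDiv, div_add, div_smul]
    exact harm_lin (isIP_ipM subset_rfl (cell_nonempty K)) (isIP_ipV subset_rfl (cell_nonempty K))
      (isFinSub_curl_bubCurl F) c (hv.cell η hη) (hw.cell η hη)

theorem RestQ.lin (c : ℝ) {q r : Fin 3 → Poly} (hq : RestQ k K q) (hr : RestQ k K r) :
    RestQ k K (c • q + r) where
  vertex x hx i := ev_lin c (hq.vertex x hx i) (hr.vertex x hx i)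
  cell w hw h := (isIP_ipV subset_rfl (cell_nonempty K)).lin c (hq.cell w hw h) (hr.cell w hw h)

/-- Every degree of freedom outside of the first set contains at least two derivatives. -/
theorem restU_of_deg_one {p : Poly} (hp : Deg 1 p) : RestU F k K p where
  vertex x _ α h2 _ := by
    have hex : ∀ α : Fin 3 → ℕ, 1 ≤ ∑ i, α i → ∃ (β : Fin 3 → ℕ) (i : Fin 3),
        α = β + Pi.single i 1 := by
      intro α h
      obtain ⟨i, hi⟩ : ∃ i, α i ≠ 0 := by
        by_contra! h0
        simp [h0] at h
      refine ⟨α - Pi.single i 1, i, ?_⟩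
      ext j
      by_cases hj : j = i
      · subst hj; simp; omega
      · simp [hj]
    obtain ⟨β, i, rfl⟩ := hex α (by omega)
    obtain ⟨γ, j, rfl⟩ := hex β (by
      simp only [Pi.add_apply, Finset.sum_add_distrib, Finset.sum_pi_single', Finset.mem_univ,
        if_true] at h2
      omega)
    rw [← dAlpha_pd, ← dAlpha_pd]
    have : pd j (pd i p) = 0 := congrFun₂ (hess_eq_zero_of_deg hp) j i
    rw [this]
    exact vanishOrd_iff.mp (vanishOrd_zero x (∑ i, γ i + 1)) γ (by omega)
  edge_tt e he _ _ := by
    rw [dir_dir_of_deg_one hp]; exact (isIP_ipS he (edge_nonempty e)).zero_left _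
  edge_nt e he _ _ _ := by
    rw [dir_dir_of_deg_one hp]; exact (isIP_ipS he (edge_nonempty e)).zero_left _
  edge_nn e he _ _ _ _ := by
    rw [dir_dir_of_deg_one hp]; exact (isIP_ipS he (edge_nonempty e)).zero_left _
  face_hess f hf _ _ := by
    have : hessF F f p = 0 := by ext1 a b; exact dir_dir_of_deg_one hp _ _
    rw [this]; exact (isIP_ipM hf (face_nonempty f)).zero_left _
  face_grad f hf _ _ := by
    have : gradF F f (dir (F.nf f) p) = 0 := by funext a; exact dir_dir_of_deg_one hp _ _
    rw [this]; exact (isIP_ipV hf (face_nonempty f)).zero_left _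
  cell _ _ := by
    rw [hess_eq_zero_of_deg hp]; exact (isIP_ipM subset_rfl (cell_nonempty K)).zero_left _

end linear

/-! ## Spans of dual basis functions -/

section span

open Classical in
/-- The span of the functions dual to single-valued degrees of freedom, if these are unisolvent for
the local spaces `R K`. -/
theorem mem_spanOf_iff {ι C X : Type} [Finite ι] [AddCommGroup X] [Module ℝ X]
    {R : C → Submodule ℝ X} {dof : ι → X →ₗ[ℝ] Fin 4 → ℝ} {inc : ι → C → Prop}
    (huni : ∀ K, ∀ x ∈ R K, (∀ i, inc i K → dof i x = 0) → x = 0) {φ : ι → Fin 4 → C → X}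
    (hφ : ∀ i j K, φ i j K ∈ R K)
    (dual : ∀ i j i' j' K, inc i' K → dof i' (φ i j K) j' = if i' = i ∧ j' = j then 1 else 0)
    {u : C → X} : u ∈ spanOf φ ↔
      (∀ K, u K ∈ R K) ∧ ∀ i K L, inc i K → inc i L → dof i (u K) = dof i (u L) := by
  constructor
  · intro h
    induction h using Submodule.span_induction with
    | mem x hx =>
      obtain ⟨i, j, rfl⟩ := hx
      refine ⟨hφ i j, fun i' K L hK hL => ?_⟩
      funext j'
      rw [dual _ _ _ _ _ hK, dual _ _ _ _ _ hL]
    | zero => exact ⟨fun K => (R K).zero_mem, fun _ _ _ _ _ => rfl⟩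
    | add x y _ _ hx hy =>
      exact ⟨fun K => (R K).add_mem (hx.1 K) (hy.1 K), fun i K L hK hL => by
        rw [Pi.add_apply, Pi.add_apply, map_add, map_add, hx.2 i K L hK hL, hy.2 i K L hK hL]⟩
    | smul c x _ hx =>
      exact ⟨fun K => (R K).smul_mem c (hx.1 K), fun i K L hK hL => by
        rw [Pi.smul_apply, Pi.smul_apply, map_smul, map_smul, hx.2 i K L hK hL]⟩
  · rintro ⟨hR, hu⟩
    have := Fintype.ofFinite ι
    -- The common values are the coefficients of the expansion; an index that meets no cell receives
    -- zero.
    have hc : ∀ i, ∃ c : Fin 4 → ℝ, ∀ K, inc i K → dof i (u K) = c := fun i => by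
      by_cases h : ∃ K, inc i K
      · exact ⟨dof i (u h.choose), fun K hK => hu i _ _ hK h.choose_spec⟩
      · exact ⟨0, fun K hK => absurd ⟨K, hK⟩ h⟩
    choose c hc using hc
    have hsum : u = ∑ i, ∑ j, c i j • φ i j := by
      funext K
      rw [← sub_eq_zero]
      simp only [Finset.sum_apply, Pi.smul_apply]
      -- On each cell the difference lies in the local space, and duality makes its degrees of
      -- freedom zero, so unisolvence applies.
      refine huni K _ ((R K).sub_mem (hR K) (Submodule.sum_mem _ fun i _ =>
        Submodule.sum_mem _ fun j _ => (R K).smul_mem _ (hφ i j K))) fun i hi => ?_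
      funext j
      simp only [map_sub, map_sum, map_smul, Pi.sub_apply, Finset.sum_apply, Pi.smul_apply,
        dual _ _ _ _ _ hi, hc i K hi, smul_eq_mul, mul_ite, mul_one, mul_zero, Pi.zero_apply]
      rw [Finset.sum_eq_single i, Finset.sum_eq_single j]
      · simp
      · intro j' _ hj'
        rw [if_neg fun h => hj' h.2.symm]
      · simp
      · intro i' _ hi'
        exact Finset.sum_eq_zero fun j' _ => if_neg fun h => hi' h.1.symm
      · simp
    rw [hsum]
    exact Submodule.sum_mem _ fun i _ => Submodule.sum_mem _ fun j _ =>
      Submodule.smul_mem _ _ (Submodule.subset_span ⟨i, j, rfl⟩)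

/-- A nonempty set closed under the operations `c • u + v` is a submodule. -/
def submoduleOfLin {X : Type} [AddCommGroup X] [Module ℝ X] (p : X → Prop) (h0 : p 0)
    (h : ∀ (c : ℝ) u v, p u → p v → p (c • u + v)) : Submodule ℝ X where
  carrier := {u | p u}
  zero_mem' := h0
  add_mem' {u v} hu hv := by simpa using h 1 u v hu hv
  smul_mem' c u hu := by simpa using h c u 0 hu h0

variable (F : Frame T) {k : ℕ} (K : Cell T)

theorem Deg.lin {d : ℤ} (c : ℝ) {p q : Poly} (hp : Deg d p) (hq : Deg d q) : Deg d (c • p + q) :=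
  (hp.smul c).add hq

theorem deg_hess {u : Poly} (hu : Deg ((k : ℤ) + 2) u) (i j : Fin 3) :
    Deg (k : ℤ) (hess u i j) := (hu.hess i j).mono (by omega)

/-- The zero field is the Hessian of zero; the next two elements obtain theirs by applying the curl
and the divergence. -/
theorem restSigma_zero : RestSigma F k K 0 := by
  have h := (restU_of_deg_one F (k := k) (K := K) (deg_zero 1)).restSigma F
  rwa [hess_eq_zero_of_deg (deg_zero 1)] at h

theorem restV_zero (hk : 7 ≤ k) : RestV F k K 0 := by
  have h := (restSigma_zero F K).restV F hk (Matrix.isSymm_zero)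
  have h0 : curl (0 : Matrix (Fin 3) (Fin 3) Poly) = 0 := map_zero curlL
  rwa [h0] at h

theorem restQ_zero (F : Frame T) (hk : 7 ≤ k) : RestQ k K 0 := by
  have h := (restV_zero F K hk).restQ F hk
  have h0 : div (0 : Matrix (Fin 3) (Fin 3) Poly) = 0 := map_zero divL
  rwa [h0] at h

/-- The local space for `U_h`. -/
noncomputable def localU : Submodule ℝ Poly :=
  submoduleOfLin (fun u => RestU F k K u ∧ Deg ((k : ℤ) + 2) u)
    ⟨restU_of_deg_one F (deg_zero 1), deg_zero _⟩
    fun c _ _ hu hv => ⟨hu.1.lin F c hv.1, hu.2.lin c hv.2⟩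

/-- The local space for `Σ_h`. -/
noncomputable def localSigma : Submodule ℝ (Matrix (Fin 3) (Fin 3) Poly) :=
  submoduleOfLin (fun σ => RestSigma F k K σ ∧ σ.IsSymm ∧ ∀ i j, Deg (k : ℤ) (σ i j))
    ⟨restSigma_zero F K, Matrix.isSymm_zero, fun _ _ => deg_zero _⟩
    fun c _ _ hu hv => ⟨hu.1.lin F c hv.1, (hu.2.1.smul c).add hv.2.1,
      fun i j => (hu.2.2 i j).lin c (hv.2.2 i j)⟩

/-- The local space for `V_h`. -/
noncomputable def localV (hk : 7 ≤ k) : Submodule ℝ (Matrix (Fin 3) (Fin 3) Poly) :=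
  submoduleOfLin (fun v => RestV F k K v ∧ v.trace = 0 ∧ ∀ i j, Deg ((k : ℤ) - 1) (v i j))
    ⟨restV_zero F K hk, Matrix.trace_zero _ _, fun _ _ => deg_zero _⟩
    fun c _ _ hu hv => ⟨hu.1.lin F c hv.1, by
      rw [Matrix.trace_add, Matrix.trace_smul, hu.2.1, hv.2.1, smul_zero, add_zero],
      fun i j => (hu.2.2 i j).lin c (hv.2.2 i j)⟩

/-- The local space for `Q_h`. -/
noncomputable def localQ (F : Frame T) (hk : 7 ≤ k) : Submodule ℝ (Fin 3 → Poly) :=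
  submoduleOfLin (fun q => RestQ k K q ∧ ∀ i, Deg ((k : ℤ) - 2) (q i))
    ⟨restQ_zero K F hk, fun _ => deg_zero _⟩
    fun c _ _ hu hv => ⟨hu.1.lin c hv.1, fun i => (hu.2 i).lin c (hv.2 i)⟩

/-- The first degrees of freedom of `U_h` as a linear map. -/
noncomputable def dofUL (x : Vertex T) : Poly →ₗ[ℝ] Fin 4 → ℝ where
  toFun := dofU x
  map_add' u v := by
    funext j
    refine Fin.cases ?_ (fun i => ?_) j
    · exact ev_add _ _ _
    · simp [dofU]
  map_smul' c u := by
    funext j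
    refine Fin.cases ?_ (fun i => ?_) j
    · simp [dofU, MvPolynomial.smul_eq_C_mul]
    · simp [dofU, MvPolynomial.smul_eq_C_mul]

variable {K}

/-- Moments of `σ n` on a simplex of `K`, as a linear map. -/
noncomputable def momentL {s : Finset E3} (hs : s ⊆ K.1) (hne : s.Nonempty) (n : E3) :
    Matrix (Fin 3) (Fin 3) Poly →ₗ[ℝ] Fin 4 → ℝ where
  toFun σ j := ipV s (σ.mulVec (cvec n)) (rtBasis j)
  map_add' σ τ := by
    funext j
    rw [Matrix.add_mulVec]
    exact (isIP_ipV hs hne).add_left _ _ _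
  map_smul' c σ := by
    funext j
    rw [Matrix.smul_mulVec]
    exact (isIP_ipV hs hne).smul_left _ _ _

/-- The first degrees of freedom of `Q_h` as a linear map. -/
noncomputable def dofQL (K : Cell T) : (Fin 3 → Poly) →ₗ[ℝ] Fin 4 → ℝ where
  toFun := dofQ K
  map_add' _ _ := funext fun _ => (isIP_ipV subset_rfl (cell_nonempty K)).add_left _ _ _
  map_smul' _ _ := funext fun _ => (isIP_ipV subset_rfl (cell_nonempty K)).smul_left _ _ _

end span

/-! ## The spans of the dual basis functions -/

section dual

variable {Ω : Set E3} {F : Frame T} {k : ℕ}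

theorem mem_span_basisU (hT : IsTriangulation Ω T) (hk : 7 ≤ k) {φ : Vertex T → Fin 4 → PwS T}
    (hφ : IsBasisU Ω F k φ) {u : PwS T} : u ∈ spanOf φ ↔
      (∀ K, RestU F k K (u K) ∧ Deg ((k : ℤ) + 2) (u K)) ∧
        ∀ x : Vertex T, ∀ K L : Cell T, x.1 ∈ K.1 → x.1 ∈ L.1 → dofU x (u K) = dofU x (u L) := by
  have : Finite (Vertex T) :=
    (Set.Finite.preimage Finset.singleton_injective.injOn hT.finite).to_subtype
  exact mem_spanOf_iff (R := fun K => localU F K) (dof := dofUL) (inc := fun x K => x.1 ∈ K.1)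
    (fun K u hu h => hu.1.eq_zero F hk hu.2 fun x hx => h x hx)
    (fun x j K => ⟨hφ.rest x j K, (hφ.mem x j).deg K⟩)
    (fun x j y i K hy => (hφ.dual x j y i K hy).trans (by congr))

theorem mem_span_basisSigma (hT : IsTriangulation Ω T) (hk : 7 ≤ k) {φ : Edge T → Fin 4 → PwM T}
    (hφ : IsBasisSigma Ω F k φ) {σ : PwM T} : σ ∈ spanOf φ ↔
      (∀ K, RestSigma F k K (σ K) ∧ (σ K).IsSymm ∧ ∀ i j, Deg (k : ℤ) (σ K i j)) ∧
        ∀ e : Edge T, ∀ K L : Cell T, e.1 ⊆ K.1 → e.1 ⊆ L.1 →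
          dofSigma F e (σ K) = dofSigma F e (σ L) := by
  have : Finite (Edge T) := (hT.finite.subset fun _ h => h.1).to_subtype
  -- Linearity of the edge moments is known for edges of a cell, so one such cell is selected; the
  -- functional itself does not depend on it.
  have hex : ∀ e : Edge T, ∃ K : Cell T, e.1 ⊆ K.1 := fun e => by
    obtain ⟨K, hK, he, hc⟩ := hT.pure e.1 e.2.1
    exact ⟨⟨K, hK, hc⟩, he⟩
  choose c hc using hex
  exact mem_spanOf_iff (R := fun K => localSigma F K)
    (dof := fun e => momentL (hc e) (edge_nonempty e) (F.te e)) (inc := fun e K => e.1 ⊆ K.1)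
    (fun K σ hσ h => hσ.1.eq_zero F (by omega) hσ.2.1 hσ.2.2 fun e he j => congrFun (h e he) j)
    (fun e j K => ⟨hφ.rest e j K, (hφ.mem e j).symm K, (hφ.mem e j).deg K⟩)
    (fun e j e' i K he => (hφ.dual e j e' i K he).trans (by congr))

theorem mem_span_basisV (hT : IsTriangulation Ω T) (hk : 7 ≤ k) {φ : Face T → Fin 4 → PwM T}
    (hφ : IsBasisV Ω F k φ) {v : PwM T} : v ∈ spanOf φ ↔
      (∀ K, RestV F k K (v K) ∧ (v K).trace = 0 ∧ ∀ i j, Deg ((k : ℤ) - 1) (v K i j)) ∧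
        ∀ f : Face T, ∀ K L : Cell T, f.1 ⊆ K.1 → f.1 ⊆ L.1 →
          dofV F f (v K) = dofV F f (v L) := by
  have : Finite (Face T) := (hT.finite.subset fun _ h => h.1).to_subtype
  have hex : ∀ f : Face T, ∃ K : Cell T, f.1 ⊆ K.1 := fun f => by
    obtain ⟨K, hK, hf, hc⟩ := hT.pure f.1 f.2.1
    exact ⟨⟨K, hK, hc⟩, hf⟩
  choose c hc using hex
  exact mem_spanOf_iff (R := fun K => localV F K hk)
    (dof := fun f => momentL (hc f) (face_nonempty f) (F.nf f)) (inc := fun f K => f.1 ⊆ K.1)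
    (fun K v hv h => hv.1.eq_zero F hk hv.2.1 hv.2.2 fun f hf j => congrFun (h f hf) j)
    (fun f j K => ⟨hφ.rest f j K, (hφ.mem f j).traceless K, (hφ.mem f j).deg K⟩)
    (fun f j f' i K hf => (hφ.dual f j f' i K hf).trans (by congr))

theorem mem_span_basisQ (F : Frame T) (hT : IsTriangulation Ω T) (hk : 7 ≤ k)
    {φ : Cell T → Fin 4 → PwV T} (hφ : IsBasisQ k φ) {q : PwV T}
    (hq : ∀ K, RestQ k K (q K) ∧ ∀ i, Deg ((k : ℤ) - 2) (q K i)) : q ∈ spanOf φ := by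
  have : Finite (Cell T) := (hT.finite.subset fun _ h => h.1).to_subtype
  exact (mem_spanOf_iff (R := fun K => localQ K F hk) (dof := dofQL) (inc := fun K L => K = L)
    (fun K q hq h => hq.1.eq_zero hq.2 fun j => congrFun (h K rfl) j)
    (fun K j L => ⟨hφ.rest K j L, (hφ.mem K j).deg L⟩)
    (fun K j L i M hM => by subst hM; exact (hφ.dual K j L i).trans (by congr))).mpr
    ⟨hq, fun _ _ _ hK hL => by rw [← hK, ← hL]⟩

/-- For two cells at a common edge, the difference of the polynomials has zero vertex degrees of
freedom on that edge, and `dofSigma_hess` applies to it as one polynomial. -/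
theorem pwHess_mem (hT : IsTriangulation Ω T) (hk : 7 ≤ k) {φ : Vertex T → Fin 4 → PwS T}
    {ψ : Edge T → Fin 4 → PwM T} (hφ : IsBasisU Ω F k φ) (hψ : IsBasisSigma Ω F k ψ) {u : PwS T}
    (hu : u ∈ spanOf φ) : pwHess u ∈ spanOf ψ := by
  obtain ⟨hR, hd⟩ := (mem_span_basisU hT hk hφ).mp hu
  refine (mem_span_basisSigma hT hk hψ).mpr ⟨fun K => ⟨(hR K).1.restSigma F, hess_isSymm _,
    deg_hess (hR K).2⟩, fun e K L hK hL => ?_⟩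
  change momentL hK (edge_nonempty e) (F.te e) _ = momentL hK (edge_nonempty e) (F.te e) _
  rw [← sub_eq_zero, ← map_sub, pwHess, pwHess, ← hess_sub]
  funext j
  refine dofSigma_hess F hK (fun x hx => ?_) j
  change dofUL x _ = 0
  rw [map_sub, sub_eq_zero]
  exact hd x K L (hK hx) (hL hx)

/-- Stokes' theorem is applied to the difference of the two polynomial fields at a common face,
whose edge moments vanish. -/
theorem pwCurl_mem (hT : IsTriangulation Ω T) (hk : 7 ≤ k) {φ : Edge T → Fin 4 → PwM T}
    {ψ : Face T → Fin 4 → PwM T} (hφ : IsBasisSigma Ω F k φ) (hψ : IsBasisV Ω F k ψ) {σ : PwM T}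
    (hσ : σ ∈ spanOf φ) : pwCurl σ ∈ spanOf ψ := by
  obtain ⟨hR, hd⟩ := (mem_span_basisSigma hT hk hφ).mp hσ
  refine (mem_span_basisV hT hk hψ).mpr ⟨fun K => ⟨(hR K).1.restV F hk (hR K).2.1,
    trace_curl _ (hR K).2.1, Deg.curl (hR K).2.2⟩, fun f K L hK hL => ?_⟩
  change momentL hK (face_nonempty f) (F.nf f) _ = momentL hK (face_nonempty f) (F.nf f) _
  rw [← sub_eq_zero, ← map_sub, pwCurl, pwCurl, ← curl_sub]
  funext j
  refine dofV_curl F hK ((hR K).2.1.sub (hR L).2.1) j fun e he => ?_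
  change momentL (he.trans hK) (edge_nonempty e) (F.te e) _ j = 0
  rw [map_sub, Pi.sub_apply, sub_eq_zero]
  exact congrFun (hd e K L (he.trans hK) (he.trans hL)) j

theorem pwDiv_mem (hT : IsTriangulation Ω T) (hk : 7 ≤ k) {φ : Face T → Fin 4 → PwM T}
    {ψ : Cell T → Fin 4 → PwV T} (hφ : IsBasisV Ω F k φ) (hψ : IsBasisQ k ψ) {v : PwM T}
    (hv : v ∈ spanOf φ) : pwDiv v ∈ spanOf ψ := by
  obtain ⟨hR, -⟩ := (mem_span_basisV hT hk hφ).mp hv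
  refine mem_span_basisQ F hT hk hψ fun K => ⟨(hR K).1.restQ F hk, fun i => ?_⟩
  exact Deg.sum fun j _ => (((hR K).2.2 i j).pd j).mono (by omega)

end dual

end GradGrad

theorem mainTheorem5 (Ω : Set GradGrad.E3) (hΩ : ContractibleSpace Ω)
    (T : Geometry.SimplicialComplex ℝ GradGrad.E3) (hT : GradGrad.IsTriangulation Ω T)
    (F : GradGrad.Frame T) (k : ℕ) (hk : 7 ≤ k)
    (φx : GradGrad.Vertex T → Fin 4 → GradGrad.PwS T)
    (φe : GradGrad.Edge T → Fin 4 → GradGrad.PwM T)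
    (φf : GradGrad.Face T → Fin 4 → GradGrad.PwM T)
    (φK : GradGrad.Cell T → Fin 4 → GradGrad.PwV T)
    (hx : GradGrad.IsBasisU Ω F k φx) (he : GradGrad.IsBasisSigma Ω F k φe)
    (hf : GradGrad.IsBasisV Ω F k φf) (hK : GradGrad.IsBasisQ k φK) :
    -- the four maps of the sequence are well defined
    (∀ p : GradGrad.Poly, GradGrad.Deg 1 p →
      (fun _ => p : GradGrad.PwS T) ∈ GradGrad.spanOf φx) ∧
    (∀ u ∈ GradGrad.spanOf φx, GradGrad.pwHess u ∈ GradGrad.spanOf φe) ∧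
    (∀ σ ∈ GradGrad.spanOf φe, GradGrad.pwCurl σ ∈ GradGrad.spanOf φf) ∧
    (∀ v ∈ GradGrad.spanOf φf, GradGrad.pwDiv v ∈ GradGrad.spanOf φK) ∧
    -- the composition of two successive maps is zero
    (∀ p : GradGrad.Poly, GradGrad.Deg 1 p → GradGrad.pwHess (fun _ => p : GradGrad.PwS T) = 0) ∧
    (∀ u ∈ GradGrad.spanOf φx, GradGrad.pwCurl (GradGrad.pwHess u) = 0) ∧
    (∀ σ ∈ GradGrad.spanOf φe, GradGrad.pwDiv (GradGrad.pwCurl σ) = 0) := by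
  refine ⟨fun p hp => (GradGrad.mem_span_basisU hT hk hx).mpr
      ⟨fun K => ⟨GradGrad.restU_of_deg_one F hp, hp.mono (by omega)⟩, fun _ _ _ _ _ => rfl⟩,
    fun u hu => GradGrad.pwHess_mem hT hk hx he hu, fun σ hσ => GradGrad.pwCurl_mem hT hk he hf hσ,
    fun v hv => GradGrad.pwDiv_mem hT hk hf hK hv,
    fun p hp => funext fun _ => GradGrad.hess_eq_zero_of_deg hp,
    fun u _ => funext fun _ => GradGrad.curl_hess _, fun σ hσ => funext fun K => ?_⟩
  exact GradGrad.div_curl _
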